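/- **Setting.** Let $K$ be a nonarchimedean local field with ring of integers $\mathcal O$, maximal ideal $\mathfrak p$, normalized absolute value $|\cdot|$, and let $e$ be an additive character of $K$ trivial on $\mathcal O$ but not on $\mathfrak p^{-1}$. Additive Haar measures on matrix spaces give integral matrices volume $1$, and on every $\mathrm{GL}_d(K)$ we use $d^\times X=|\det X|^{-d}dX$; $\mathrm{Vol}$ is the volume for it. Let $n=a+b$, $a=n_1+\dots+n_t$, $b=n_{t+1}+\dots+n_{m}$. Let $P_a\subset \mathrm{GL}_a$, $P_b\subset\mathrm{GL}_b$, $P_{a,b}\subset \mathrm{GL}_n$ be the standard upper block triangular parabolic subgroups attached to these partitions, and $P_w=\{\begin{pmatrix}A&B\\0&D\end{pmatrix}: A\in P_a, D\in P_b^{\mathrm{op}}\}$. For a standard parabolic $P_\bullet$ (or its opposite, or $P_w$) with block diagonal Levi $L_\bullet$, let $I_{\bullet,r}$ be the group of integral invertible matrices which modulo $\mathfrak p^r$ lie in the unipotent radical, and $I^0_{\bullet,r}=L_\bullet(\mathcal O)I_{\bullet,r}$ ($I^0_{a,r}, I^0_{b,r},I^0_{a,b,r},I_{w,r},\dots$).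 $\operatorname{Ind}$ is normalized parabolic induction and $\vee$ the smooth contragredient. **Representations.** Let $\sigma_j$ be irreducible admissible representations of $\mathrm{GL}_{n_j}(K)$, $\sigma_a=\boxtimes_{j\le t}\sigma_j$, $\sigma_b=\boxtimes_{j>t}\sigma_j$. Let $\pi_a$, $\pi_b$, $\pi_w$ be irreducible quotients of $\operatorname{Ind}_{P_a}\sigma_a$, $\operatorname{Ind}_{P_b^{\mathrm{op}}}\sigma_b$ and $\operatorname{Ind}_{P_{a,b}}(\pi_a\boxtimes\pi_b)$ respectively. Their contragredients are embedded in $\operatorname{Ind}_{P_a}\sigma_a^\vee$, $\operatorname{Ind}_{P_b^{\mathrm{op}}}\sigma_b^\vee$, $\operatorname{Ind}_{P_{a,b}}(\pi_a^\vee\boxtimes\pi_b^\vee)$ by duality, through the pairings $\int (\varphi(k),\varphi^\vee(k))\,d^\times k$ over $\mathrm{GL}_a(\mathcal O)$, $\mathrm{GL}_b(\mathcal O)$, $\mathrm{GL}_n(\mathcal O)$. **Types and level.** Let $\chi_1,\chi_2$ be characters of $K^\times$, composed with $\det$ on $\mathrm{GL}_d(K)$. Let $\tau_j$ be irreducible finite-dimensional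 representations of $\mathrm{GL}_{n_j}(\mathcal O)$ with equivariant embeddings $\tau_j\hookrightarrow\sigma_j$, $\tau_j^\vee\hookrightarrow\sigma_j^\vee$ compatible with the pairings, and let $\phi_j,\phi_j^\vee$ be vectors in their images with $\langle\phi_j,\phi_j^\vee\rangle=1$. Put $\tau_a=\boxtimes_{j\le t}\tau_j$, $\tau_b=\boxtimes_{j>t}\tau_j$, $\tau_w=\tau_a\boxtimes\tau_b$, $\phi_a^0=\otimes_{j\le t}\phi_j$, $\phi_b^0=\otimes_{j>t}\phi_j$, and similarly $\phi_a^{\vee,0},\phi_b^{\vee,0}$. Let $c_a,c_b\ge1$ be integers such that $\chi_1$ is trivial on $1+\mathfrak p^{c_a}$ and the $\tau_j$, $j\le t$, are trivial on matrices $\equiv1$ mod $\mathfrak p^{c_a}$, and such that $\chi_2$ and the $\tau_j$, $j>t$, have the same property for $\mathfrak p^{c_b}$. Let $r\ge c_a+c_b$. The representations $\tau_\bullet$, $\tau_\bullet^\vee$ are extended to the groups $I^0_{\bullet,r}$ and ${}^tI^0_{\bullet,r}$, trivially on $I_{\bullet,r}$ and ${}^tI_{\bullet,r}$. **Test vectors.**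 Let $\varphi_a\in\operatorname{Ind}_{P_a}\sigma_a$, $\varphi_b\in\operatorname{Ind}_{P_b^{\mathrm{op}}}\sigma_b$, $\varphi_w\in\operatorname{Ind}_{P_w}(\sigma_a\boxtimes\sigma_b)$ be the functions fixed by, respectively, $I_{a,r}$, ${}^tI_{b,r}$, $I_{w,r}$, supported on $P_aI_{a,r}$, $P_b^{\mathrm{op}}\,{}^tI_{b,r}$, $P_wI_{w,r}$, and equal there to $\gamma\mapsto\tau_a(\gamma)\phi^0_a$, $\tau_b(\gamma)\phi_b^0$, $\tau_w(\gamma)(\phi_a^0\otimes\phi_b^0)$ on $I^0_{a,r}$, ${}^tI^0_{b,r}$, $I^0_{w,r}$. Let $\phi_a,\phi_b,\phi_w$ be their images in $\pi_a,\pi_b,\pi_w$ (for $\varphi_w$ via $\operatorname{Ind}_{P_w}(\sigma_a\boxtimes\sigma_b)\to\operatorname{Ind}_{P_{a,b}}(\pi_a\boxtimes\pi_b)\to\pi_w$). Assume given $\phi_a^\vee\in\pi_a^\vee$, $\phi_b^\vee\in\pi_b^\vee$, $\phi_w^\vee\in\pi_w^\vee$, fixed by ${}^tI_{a,r}$, $I_{b,r}$,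 ${}^tI_{w,r}$, whose images in the induced representations have support containing $P_a{}^tI_{a,r}$, $P_b^{\mathrm{op}}I_{b,r}$, $P_w{}^tI_{w,r}$ and equal $\gamma\mapsto\tau_a^\vee(\gamma)\phi_a^{\vee,0}$, $\tau_b^\vee(\gamma)\phi_b^{\vee,0}$, $\tau_w^\vee(\gamma)(\phi_a^\vee\otimes\phi_b^\vee)$ on ${}^tI^0_{a,r}$, $I^0_{b,r}$, ${}^tI^0_{w,r}$ (in the last formula $\tau_w^\vee(ku)$, $k\in L_w(\mathcal O)$, $u\in{}^tI_{w,r}$, acts as $(\pi_a^\vee\boxtimes\pi_b^\vee)(k)$). **Schwartz functions.** Put $\mathfrak X^{(1)}={}^tI^0_{a,r}I^0_{a,r}$, $\mathfrak X^{(4)}={}^tI^0_{b,r}I^0_{b,r}$. Let $\mu'_a,\mu'_b$ be supported on these sets with $\mu_a'(\gamma_1\gamma_2)=(\tau_a(\gamma_1^{-1})\phi_a^0,\tau_a^\vee(\gamma_2)\phi_a^{\vee,0})$ and $\mu_b'(\gamma_1\gamma_2)=(\tau_b(\gamma_2)\phi_b^0,\tau_b^\vee(\gamma_1^{-1})\phi_b^{\vee,0})$.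 Put $\mu_a=\chi_2^{-1}\mu_a'$, $\mu_b=\chi_1\mu_b'$, $\nu_\bullet=\chi_1^{-1}\chi_2\mu_\bullet$ for $\bullet=a,b$. Let $\mathfrak X_w$ be the set of $\begin{pmatrix}A&B\\C&D\end{pmatrix}$ with $A\in\mathfrak X^{(1)}$, $D\in\mathfrak X^{(4)}$ and $B,C$ integral, and let $\mu_w,\nu_w$ be supported on $\mathfrak X_w$ with values $\mu_a(A)\mu_b(D)$, $\nu_a(A)\nu_b(D)$. Let $\mathfrak G_w\subset\mathrm{GL}_n(\mathcal O)$ be the subgroup of matrices whose entries below the $n_j\times n_j$ diagonal blocks and in the upper right $a\times b$ block are in $\mathfrak p^r$. Let $\Phi_1=\mu_w\mathbf 1_{\mathfrak G_w}$, $\Phi_2(x)=\int_{M_n(K)}\nu_w(-y)e(\operatorname{tr}(yx))dy$, $\Phi^{(1)}(A)=\int_{\mathfrak X^{(1)}}\nu_a(-\alpha)e(\operatorname{tr}(\alpha A))d\alpha$, $\Phi^{(4)}(D)=\int_{\mathfrak X^{(4)}}\nu_b(-\delta)e(\operatorname{tr}(\delta D))d\delta$. For $\varepsilon\in\{1,-1\}$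 put $$\Phi_w(X_1,X_2)=\frac{(\dim\tau_w)^2}{\mathrm{Vol}(\mathfrak G_w)}\Phi_1(\varepsilon X_1)\Phi_2(X_2).$$ **Zeta integral.** Let $S$ be the permutation matrix exchanging the second and fourth of the column blocks of sizes $a,b,a,b$. For $s\in\mathbb C$ let $$Z_w=\int_{\mathrm{GL}_n(K)}\chi_2(\det g)|\det g|^{\frac n2+s}\Big(\int_{\mathrm{GL}_n(K)}\Phi_w((Xg,X)S)\,\chi_1^{-1}\chi_2(\det X)|\det X|^{n+2s}d^\times X\Big)\langle\pi_w(g)\phi_w,\phi_w^\vee\rangle\, d^\times g,$$ $$\mathcal I_a=\int_{I^0_{a,r}}\int_{\mathrm{GL}_a(K)}\mu_a(A_1)\chi_2(A_1)\chi_1^{-1}(A_2)\Phi^{(1)}(A_2)|\det A_2|^{s+\frac a2}\langle\pi_a(A_1)\phi_a,\pi_a^\vee(A_2)\phi_a^\vee\rangle\, d^\times A_2\,d^\times A_1,$$ $$\mathcal I_b=\int_{I^0_{b,r}}\int_{\mathrm{GL}_b(K)}\mu_b(D_2)\chi_2(D_1)\chi_1^{-1}(D_2)\Phi^{(4)}(D_1)|\det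 D_1|^{s+\frac b2}\langle\pi_b(D_1)\phi_b,\pi_b^\vee(D_2)\phi_b^\vee\rangle\, d^\times D_1\,d^\times D_2.$$ **Claim.** There is a real $s_0$ such that $Z_w$, $\mathcal I_a$, $\mathcal I_b$ converge absolutely (as double integrals) whenever $\operatorname{Re}(s)>s_0$; and for every $s$ at which $Z_w$ converges absolutely, $$Z_w=\mu_a(\varepsilon 1_a)\,\mu_b(\varepsilon 1_b)\cdot\frac{(\dim\tau_w)^2\,\mathrm{Vol}(I^0_{a,b,r})}{\mathrm{Vol}(I^0_{a,r})\,\mathrm{Vol}(I^0_{b,r})}\cdot\mathcal I_a\cdot\mathcal I_b ,$$ where the first factor is $1$ for $\varepsilon=1$ and a sign for $\varepsilon=-1$. -/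

import Mathlib

open MeasureTheory
open scoped TensorProduct Matrix

noncomputable section

/-- Matrices carry the product sigma-algebra of their entries. -/
instance Matrix.instMeasurableSpaceEntries {ι κ K : Type*} [MeasurableSpace K] :
    MeasurableSpace (Matrix ι κ K) :=
  inferInstanceAs (MeasurableSpace (ι → κ → K))

namespace LocalZeta

/-! ### Smooth representations and normalized parabolic induction -/

section Representations

variable {G : Type*} [Group G] [TopologicalSpace G]
variable {V : Type*} [AddCommGroup V] [Module ℂ V]

/-- Every vector has an open stabilizer. -/
def IsSmooth (ρ : Representation ℂ G V) : Prop :=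
  ∀ v : V, ∃ U : OpenSubgroup G, ∀ u ∈ U, ρ u v = v

/-- Smooth, and the vectors fixed by any open subgroup form a finite-dimensional space. -/
def IsAdmissible (ρ : Representation ℂ G V) : Prop :=
  IsSmooth ρ ∧ ∀ U : OpenSubgroup G,
    FiniteDimensional ℂ (Representation.invariants (ρ.comp (U : Subgroup G).subtype))

/-- The smooth vectors of the full linear dual. -/
def smoothDual (ρ : Representation ℂ G V) : Submodule ℂ (Module.Dual ℂ V) where
  carrier := {l | ∃ U : OpenSubgroup G, ∀ u ∈ U, ρ.dual u l = l}
  zero_mem' := ⟨⊤, fun u _ => map_zero _⟩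
  add_mem' := by
    rintro x y ⟨U, hU⟩ ⟨U', hU'⟩
    refine ⟨U ⊓ U', fun u hu => ?_⟩
    rw [map_add, hU u hu.1, hU' u hu.2]
  smul_mem' := by
    rintro c x ⟨U, hU⟩
    exact ⟨U, fun u hu => by rw [map_smul, hU u hu]⟩

theorem exists_conj [IsTopologicalGroup G] (U : OpenSubgroup G) (g : G) :
    ∃ U' : OpenSubgroup G, ∀ u ∈ U', g⁻¹ * u * g ∈ U := by
  refine ⟨U.comap (MulAut.conj g⁻¹).toMonoidHom ?_, fun u hu => ?_⟩
  · change Continuous fun u : G => g⁻¹ * u * (g⁻¹)⁻¹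
    fun_prop
  · have h : g⁻¹ * u * (g⁻¹)⁻¹ ∈ U := hu
    simpa using h

theorem dual_mem_smoothDual [IsTopologicalGroup G] (ρ : Representation ℂ G V) (g : G) :
    ∀ l ∈ smoothDual ρ, ρ.dual g l ∈ smoothDual ρ := by
  rintro l ⟨U, hU⟩
  obtain ⟨U', hU'⟩ := exists_conj U g
  refine ⟨U', fun u hu => ?_⟩
  have h := hU _ (hU' u hu)
  have e : u * g = g * (g⁻¹ * u * g) := by group
  rw [← Module.End.mul_apply, ← map_mul, e, map_mul, Module.End.mul_apply, h]

/-- The contragredient representation. -/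
def contragredient [IsTopologicalGroup G] (ρ : Representation ℂ G V) :
    Representation ℂ G (smoothDual ρ) where
  toFun g := (ρ.dual g).restrict (dual_mem_smoothDual ρ g)
  map_one' := by
    ext l v
    change l.1 (ρ 1⁻¹ v) = l.1 v
    simp
  map_mul' g h := by
    ext l v
    change l.1 (ρ (g * h)⁻¹ v) = l.1 (ρ h⁻¹ (ρ g⁻¹ v))
    simp

/-- The data entering normalized induction from a parabolic subgroup `P = L N` of `G`: the
embedding of the Levi factor `L`, the unipotent radical `N` and the modulus character of `P`
on `L`. -/
structure ParabolicDatum (L G : Type*) [Group L] [Group G] where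
  levi : L →* G
  unip : Set G
  modulus : L → ℝ

variable {L : Type*} [Group L]

/-- The subgroup `P = L N`, as a set. -/
def ParabolicDatum.carrier (D : ParabolicDatum L G) : Set G :=
  {g | ∃ l : L, ∃ u ∈ D.unip, g = D.levi l * u}

/-- The space of normalized induction: right-smooth functions `f : G → V` such that
`f (l u g) = δ_P(l) ^ (1/2) σ(l) f(g)` for `l ∈ L`, `u ∈ N`. -/
def inducedSpace (D : ParabolicDatum L G) (σ : Representation ℂ L V) : Submodule ℂ (G → V) where
  carrier := {f | (∀ l g, f (D.levi l * g) = ((Real.sqrt (D.modulus l) : ℝ) : ℂ) • σ l (f g)) ∧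
    (∀ u ∈ D.unip, ∀ g, f (u * g) = f g) ∧
    ∃ U : OpenSubgroup G, ∀ u ∈ U, ∀ g, f (g * u) = f g}
  zero_mem' := ⟨by simp, by simp, ⊤, by simp⟩
  add_mem' := by
    rintro x y ⟨h1, h2, U, hU⟩ ⟨h1', h2', U', hU'⟩
    refine ⟨fun l g => ?_, fun u hu g => ?_, U ⊓ U', fun u hu g => ?_⟩
    · simp [h1, h1']
    · simp [h2 u hu, h2' u hu]
    · simp [hU u hu.1, hU' u hu.2]
  smul_mem' := by
    rintro c x ⟨h1, h2, U, hU⟩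
    refine ⟨fun l g => ?_, fun u hu g => ?_, U, fun u hu g => ?_⟩
    · simp [h1, smul_comm c]
    · simp [h2 u hu]
    · simp [hU u hu]

/-- Right translation by `g` on functions on `G`. -/
def rightTranslate (V : Type*) [AddCommGroup V] [Module ℂ V] (g : G) : (G → V) →ₗ[ℂ] (G → V) where
  toFun f x := f (x * g)
  map_add' _ _ := rfl
  map_smul' _ _ := rfl

theorem rightTranslate_mem [IsTopologicalGroup G] (D : ParabolicDatum L G)
    (σ : Representation ℂ L V) (g : G) :
    ∀ f ∈ inducedSpace D σ, rightTranslate V g f ∈ inducedSpace D σ := by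
  rintro f ⟨h1, h2, U, hU⟩
  obtain ⟨U', hU'⟩ := exists_conj U g
  refine ⟨fun l x => ?_, fun u hu x => ?_, U', fun u hu x => ?_⟩
  · simp [rightTranslate, mul_assoc, h1]
  · simp [rightTranslate, mul_assoc, h2 u hu]
  · have h := hU _ (hU' u hu) (x * g)
    have e : x * g * (g⁻¹ * u * g) = x * u * g := by group
    rw [e] at h
    exact h

/-- Normalized parabolic induction, with `G` acting by right translation. -/
def normalizedInd [IsTopologicalGroup G] (D : ParabolicDatum L G) (σ : Representation ℂ L V) :
    Representation ℂ G (inducedSpace D σ) where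
  toFun g := (rightTranslate V g).restrict (rightTranslate_mem D σ g)
  map_one' := by ext; simp [rightTranslate]
  map_mul' g h := by ext; simp [rightTranslate, mul_assoc]

/-- `f` is the function in the induced representation that is fixed by `I`, is supported on
`P I`, and satisfies `f (k i) = σ(k) v₀` for `k` in the compact subgroup `KL` of `L`, `i ∈ I`. -/
structure IsTestVector [IsTopologicalGroup G] (D : ParabolicDatum L G) (σ : Representation ℂ L V)
    (KL : Subgroup L) (I : Set G) (v₀ : V) (f : inducedSpace D σ) : Prop where
  fixed : ∀ i ∈ I, normalizedInd D σ i f = f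
  support : Function.support f.1 = {g | ∃ p ∈ D.carrier, ∃ i ∈ I, g = p * i}
  value : ∀ k ∈ KL, ∀ i ∈ I, f.1 (D.levi k * i) = σ k v₀

/-- Let `q` be a quotient map from the induced representation of `σ` onto `π`, and let `B` be a
pairing between the spaces of `σ` and of its contragredient `σ'`.  The functional `l` on `π`
corresponds to the function `f'` in the induced representation of `σ'` under the embedding dual
to `q`, that is `⟨q f, l⟩ = ∫_{K₀} B (f k) (f' k) dk` for all `f`. -/
def IsDualImage [IsTopologicalGroup G] [MeasurableSpace G] (D : ParabolicDatum L G)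
    (σ : Representation ℂ L V) {V' : Type*} [AddCommGroup V'] [Module ℂ V']
    (σ' : Representation ℂ L V') (B : V → V' → ℂ) (μ : Measure G) (K₀ : Subgroup G)
    {E : Type*} [AddCommGroup E] [Module ℂ E] {π : Representation ℂ G E}
    (q : (normalizedInd D σ).IntertwiningMap π) (l : smoothDual π) (f' : inducedSpace D σ') :
    Prop :=
  ∀ f : inducedSpace D σ, l.1 (q f) = ∫ k in (K₀ : Set G), B (f.1 k) (f'.1 k) ∂μ

/-- The requirements on the test vector `l` in the contragredient of `π`, with image `f'`. -/
structure IsDualTestVector [IsTopologicalGroup G] (D : ParabolicDatum L G)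
    {V' : Type*} [AddCommGroup V'] [Module ℂ V'] (σ' : Representation ℂ L V')
    (KL : Subgroup L) (P I : Set G) (v₀ : V') {E : Type*} [AddCommGroup E] [Module ℂ E]
    {π : Representation ℂ G E} (l : smoothDual π) (f' : inducedSpace D σ') : Prop where
  fixed : ∀ i ∈ I, contragredient π i l = l
  support : {g | ∃ p ∈ P, ∃ i ∈ I, g = p * i} ⊆ Function.support f'.1
  value : ∀ k ∈ KL, ∀ i ∈ I, f'.1 (D.levi k * i) = σ' k v₀

end Representations

section TensorProducts

/-- The external tensor product of a finite family of representations. -/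
def extTensor {t : ℕ} {H : Fin t → Type*} [∀ j, Group (H j)] {V : Fin t → Type*}
    [∀ j, AddCommGroup (V j)] [∀ j, Module ℂ (V j)] (σ : ∀ j, Representation ℂ (H j) (V j)) :
    Representation ℂ (∀ j, H j) (⨂[ℂ] j, V j) where
  toFun l := PiTensorProduct.map fun j => σ j (l j)
  map_one' := by
    simp only [Pi.one_apply, map_one]
    exact PiTensorProduct.map_one
  map_mul' l l' := by
    simp only [Pi.mul_apply, map_mul]
    exact PiTensorProduct.map_mul _ _

/-- The external tensor product of two representations. -/
def extTensor₂ {H₁ H₂ V₁ V₂ : Type*} [Group H₁] [Group H₂] [AddCommGroup V₁] [Module ℂ V₁]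
    [AddCommGroup V₂] [Module ℂ V₂] (ρ₁ : Representation ℂ H₁ V₁) (ρ₂ : Representation ℂ H₂ V₂) :
    Representation ℂ (H₁ × H₂) (V₁ ⊗[ℂ] V₂) :=
  Representation.tprod (ρ₁.comp (MonoidHom.fst H₁ H₂)) (ρ₂.comp (MonoidHom.snd H₁ H₂))

/-- The product of the tautological pairings between `σ j` and its contragredient. -/
def piPairing {t : ℕ} {H : Fin t → Type*} [∀ j, Group (H j)] [∀ j, TopologicalSpace (H j)]
    {V : Fin t → Type*} [∀ j, AddCommGroup (V j)] [∀ j, Module ℂ (V j)]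
    (σ : ∀ j, Representation ℂ (H j) (V j)) (x : ⨂[ℂ] j, V j) (y : ⨂[ℂ] j, smoothDual (σ j)) : ℂ :=
  PiTensorProduct.dualDistrib (PiTensorProduct.map (fun j => (smoothDual (σ j)).subtype) y) x

/-- The product of the two tautological pairings. -/
def pairing₂ {H₁ H₂ V₁ V₂ : Type*} [Group H₁] [Group H₂] [TopologicalSpace H₁]
    [TopologicalSpace H₂] [AddCommGroup V₁] [Module ℂ V₁] [AddCommGroup V₂] [Module ℂ V₂]
    (ρ₁ : Representation ℂ H₁ V₁) (ρ₂ : Representation ℂ H₂ V₂)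
    (x : V₁ ⊗[ℂ] V₂) (y : smoothDual ρ₁ ⊗[ℂ] smoothDual ρ₂) : ℂ :=
  TensorProduct.dualDistrib ℂ V₁ V₂
    (TensorProduct.map (smoothDual ρ₁).subtype (smoothDual ρ₂).subtype y) x

end TensorProducts

/-! ### Local fields, integral matrices, Haar measures -/

section LocalField

variable (K : Type*) [NontriviallyNormedField K]

/-- The ring of integers. -/
abbrev integers [IsUltrametricDist K] : ValuationSubring K :=
  (NormedField.valuation (K := K)).valuationSubring

/-- The number of elements of the residue field. -/
def residueCard [IsUltrametricDist K] : ℕ := Nat.card (IsLocalRing.ResidueField (integers K))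

/-- A nonarchimedean local field with its normalized absolute value: a uniformizer has absolute
value `1 / q`, where `q` is the number of elements of the residue field. -/
class IsNormalizedLocalField : Prop extends IsUltrametricDist K, ProperSpace K where
  norm_uniformizer : ∀ ϖ : integers K, Irreducible ϖ → ‖(ϖ : K)‖ = ((residueCard K : ℕ) : ℝ)⁻¹

variable [IsNormalizedLocalField K]

/-- The fractional ideal `𝔭 ^ r`. -/
def pPow (r : ℤ) : Set K := {x | ‖x‖ ≤ (residueCard K : ℝ) ^ (-r)}

/-- The Haar measure on `K` that gives the ring of integers volume one. -/
def haarK [MeasurableSpace K] [BorelSpace K] : Measure K :=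
  Measure.addHaarMeasure
    ⟨⟨Metric.closedBall 0 1, isCompact_closedBall 0 1⟩,
      ⟨0, Metric.ball_subset_interior_closedBall (Metric.mem_ball_self one_pos)⟩⟩

/-- The additive Haar measure on matrices that gives integral matrices volume one. -/
def haarMatrix (ι κ : Type*) [Fintype ι] [Fintype κ] [MeasurableSpace K] [BorelSpace K] :
    Measure (Matrix ι κ K) :=
  (Measure.pi fun _ : ι => Measure.pi fun _ : κ => haarK K : Measure (ι → κ → K))

/-- The Haar measure `d^× X = |det X| ^ (-d) dX` on `GL_d(K)`. -/
def haarGL (ι : Type*) [Fintype ι] [DecidableEq ι] [MeasurableSpace K] [BorelSpace K] :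
    Measure (GL ι K) :=
  Measure.comap (fun g : GL ι K => g.val)
    ((haarMatrix K ι ι).withDensity
      fun X => ENNReal.ofReal ((‖X.det‖ ^ Fintype.card ι)⁻¹))

/-- `GL_d` of the ring of integers. -/
def intGL (ι : Type*) [Fintype ι] [DecidableEq ι] : Subgroup (GL ι K) :=
  (Matrix.GeneralLinearGroup.map (n := ι) (integers K).subtype).range

/-- The additive character `e` has conductor the ring of integers. -/
def IsUnramifiedAddChar (e : AddChar K Circle) : Prop :=
  (∀ x ∈ pPow K 0, e x = 1) ∧ ∃ x ∈ pPow K (-1), e x ≠ 1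

/-- The multiplicative character `χ` (extended by zero to `K`) is trivial on `1 + 𝔭 ^ c`. -/
def IsTrivialOnUnits (χ : MulChar K ℂ) (c : ℕ) : Prop :=
  ∀ x : K, x - 1 ∈ pPow K c → χ x = 1

end LocalField

/-! ### Block parabolic subgroups and Iwahori subgroups -/

section Blocks

variable {K : Type*} [NontriviallyNormedField K] {t : ℕ}

/-- Row and column indices of matrices cut into blocks of sizes `n 0, n 1, …`. -/
abbrev BlockIdx (n : Fin t → ℕ) : Type := Σ j : Fin t, Fin (n j)

/-- Block diagonal embedding of `∏ j, GL_{n j}`. -/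
def blockLevi (n : Fin t → ℕ) :
    (∀ j, GL (Fin (n j)) K) →* GL (BlockIdx n) K :=
  (Units.map (Matrix.blockDiagonal'RingHom (fun j => Fin (n j)) K).toMonoidHom).comp
    (MulEquiv.piUnits (M := fun j => Matrix (Fin (n j)) (Fin (n j)) K)).symm.toMonoidHom

open Classical in
/-- The block parabolic subgroup of matrices whose `(i, j)` block vanishes unless `i = j` or
`R i j`.  With `R = (· < ·)` this is the standard (upper triangular) parabolic subgroup attached
to `n`, and with `R = (· > ·)` it is the opposite one. -/
def blockParabolic (n : Fin t → ℕ) (R : Fin t → Fin t → Prop) :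
    ParabolicDatum (∀ j, GL (Fin (n j)) K) (GL (BlockIdx n) K) where
  levi := blockLevi n
  unip := {u | ∀ x y : BlockIdx n, ¬ R x.1 y.1 → u.val x y = (1 : Matrix _ _ K) x y}
  modulus l := ∏ k, ‖(l k).val.det‖ ^
    ((∑ j, if R k j then (n j : ℤ) else 0) - ∑ i, if R i k then (n i : ℤ) else 0)

variable {a b : Type*} [Fintype a] [DecidableEq a] [Fintype b] [DecidableEq b]

/-- The embedding `(A, D) ↦ diag(A, D)`. -/
def diagEmb : GL a K × GL b K →* GL (a ⊕ b) K where
  toFun p :=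
    { val := Matrix.fromBlocks p.1.val 0 0 p.2.val
      inv := Matrix.fromBlocks (p.1⁻¹).val 0 0
        (p.2⁻¹).val
      val_inv := by
        simp only [Matrix.fromBlocks_multiply, Units.mul_inv, Matrix.zero_mul,
          Matrix.mul_zero, add_zero, zero_add, Matrix.fromBlocks_one]
      inv_val := by
        simp only [Matrix.fromBlocks_multiply, Units.inv_mul, Matrix.zero_mul,
          Matrix.mul_zero, add_zero, zero_add, Matrix.fromBlocks_one] }
  map_one' := by ext1; simp
  map_mul' p p' := by ext1; simp [Matrix.fromBlocks_multiply]

/-- The standard parabolic subgroup `P_{a,b}` of `GL_{a+b}`. -/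
def maxParabolic : ParabolicDatum (GL a K × GL b K) (GL (a ⊕ b) K) where
  levi := diagEmb
  unip := {u | ∃ B : Matrix a b K, u.val = Matrix.fromBlocks 1 B 0 1}
  modulus p := ‖p.1.val.det‖ ^ (Fintype.card b : ℤ) *
    ‖p.2.val.det‖ ^ (-(Fintype.card a : ℤ))

/-- The parabolic subgroup `P_w` of block matrices `(A B; 0 D)` with `A` in the standard parabolic
subgroup attached to `nA` and `D` in the opposite of the one attached to `nB`. -/
def mixedParabolic {s : ℕ} (nA : Fin t → ℕ) (nB : Fin s → ℕ) :
    ParabolicDatum ((∀ j, GL (Fin (nA j)) K) × (∀ j, GL (Fin (nB j)) K))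
      (GL (BlockIdx nA ⊕ BlockIdx nB) K) where
  levi := diagEmb.comp ((blockLevi nA).prodMap (blockLevi nB))
  unip := {u | ∃ uA ∈ (blockParabolic (K := K) nA (· < ·)).unip,
    ∃ uB ∈ (blockParabolic (K := K) nB (· > ·)).unip, ∃ B : Matrix (BlockIdx nA) (BlockIdx nB) K,
      u.val = Matrix.fromBlocks uA.val B 0 uB.val}
  modulus l := (blockParabolic nA (· < ·)).modulus l.1 * (blockParabolic nB (· > ·)).modulus l.2 *
    maxParabolic.modulus (blockLevi nA l.1, blockLevi nB l.2)

variable [IsNormalizedLocalField K]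

/-- `∏ j, GL_{n j}` of the ring of integers. -/
def intLevi (n : Fin t → ℕ) : Subgroup (∀ j, GL (Fin (n j)) K) :=
  Subgroup.pi Set.univ fun j => intGL K (Fin (n j))

/-- The pro-`p` Iwahori subgroup of level `r`: integral invertible matrices which modulo `𝔭 ^ r`
lie in the unipotent radical of `blockParabolic n R`.  Transposition exchanges `R = (· < ·)`
and `R = (· > ·)`. -/
def iwahori (n : Fin t → ℕ) (R : Fin t → Fin t → Prop) (r : ℕ) : Set (GL (BlockIdx n) K) :=
  {g | g ∈ intGL K (BlockIdx n) ∧ ∀ x y : BlockIdx n, ¬ R x.1 y.1 →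
    g.val x y - (1 : Matrix _ _ K) x y ∈ pPow K r}

/-- The Iwahori subgroup of level `r`: the product of the integral Levi subgroup and the pro-`p`
Iwahori subgroup. -/
def iwahori₀ (n : Fin t → ℕ) (R : Fin t → Fin t → Prop) (r : ℕ) : Set (GL (BlockIdx n) K) :=
  {g | ∃ k ∈ intLevi n, ∃ u ∈ iwahori n R r, g = blockLevi n k * u}

variable {s : ℕ} (nA : Fin t → ℕ) (nB : Fin s → ℕ) (r : ℕ)

/-- The pro-`p` Iwahori subgroup `I_{w,r}` attached to `mixedParabolic nA nB`. -/
def iwahoriW : Set (GL (BlockIdx nA ⊕ BlockIdx nB) K) :=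
  {g | g ∈ intGL K (BlockIdx nA ⊕ BlockIdx nB) ∧
    (∀ x y : BlockIdx nA, ¬ x.1 < y.1 →
      g.val (Sum.inl x) (Sum.inl y) - (1 : Matrix _ _ K) x y ∈ pPow K r) ∧
    (∀ x y : BlockIdx nB, ¬ x.1 > y.1 →
      g.val (Sum.inr x) (Sum.inr y) - (1 : Matrix _ _ K) x y ∈ pPow K r) ∧
    ∀ x y, g.val (Sum.inr x) (Sum.inl y) ∈ pPow K r}

/-- The transpose of `I_{w,r}`. -/
def iwahoriWT : Set (GL (BlockIdx nA ⊕ BlockIdx nB) K) :=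
  {g | ∃ h ∈ iwahoriW (K := K) nA nB r, g.val = h.valᵀ}

/-- The Iwahori subgroup `I^0_{a,b,r}` of level `r` of the parabolic subgroup `P_{a,b}`. -/
def iwahoriAB : Set (GL (BlockIdx nA ⊕ BlockIdx nB) K) :=
  {g | g ∈ intGL K (BlockIdx nA ⊕ BlockIdx nB) ∧
    ∀ x y, g.val (Sum.inr x) (Sum.inl y) ∈ pPow K r}

/-- The group `𝔊_w` of integral invertible matrices whose terms below the diagonal blocks of sizes
`nA, nB`, and whose upper right `a × b` block, are in `𝔭 ^ r`. -/
def groupG : Set (GL (BlockIdx nA ⊕ BlockIdx nB) K) :=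
  {g | g ∈ intGL K (BlockIdx nA ⊕ BlockIdx nB) ∧
    (∀ x y : BlockIdx nA, y.1 < x.1 → g.val (Sum.inl x) (Sum.inl y) ∈ pPow K r) ∧
    (∀ x y : BlockIdx nB, y.1 < x.1 → g.val (Sum.inr x) (Sum.inr y) ∈ pPow K r) ∧
    (∀ x y, g.val (Sum.inr x) (Sum.inl y) ∈ pPow K r) ∧
    ∀ x y, g.val (Sum.inl x) (Sum.inr y) ∈ pPow K r}

/-- The set `𝔛 = ᵗI^0_r · I^0_r` of matrices. -/
def frakX (n : Fin t → ℕ) (r : ℕ) : Set (Matrix (BlockIdx n) (BlockIdx n) K) :=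
  {X | ∃ g₁ ∈ iwahori₀ (K := K) n (· > ·) r, ∃ g₂ ∈ iwahori₀ (K := K) n (· < ·) r,
    X = (g₁ * g₂).val}

/-- The set `𝔛_w` of matrices `(A B; C D)` with `A ∈ 𝔛^(1)`, `D ∈ 𝔛^(4)` and `B`, `C` integral. -/
def frakXW : Set (Matrix (BlockIdx nA ⊕ BlockIdx nB) (BlockIdx nA ⊕ BlockIdx nB) K) :=
  {X | X.toBlocks₁₁ ∈ frakX nA r ∧ X.toBlocks₂₂ ∈ frakX nB r ∧
    (∀ x y, X.toBlocks₁₂ x y ∈ pPow K 0) ∧ ∀ x y, X.toBlocks₂₁ x y ∈ pPow K 0}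

end Blocks

/-! ### Types and their vectors -/

section Types

variable {K : Type*} [NontriviallyNormedField K] [IsNormalizedLocalField K]

/-- An irreducible representation `τ` of `GL_m(𝒪)` on the finite-dimensional space `W`, trivial
on the matrices congruent to `1` modulo `𝔭 ^ c`, with embeddings of `τ` in `σ` and of its
dual in the contragredient of `σ` that are compatible with the pairings, and vectors
`φ`, `φt` in their images with `⟨φ, φt⟩ = 1`. -/
structure TypeVectors {m : ℕ} {V : Type*} [AddCommGroup V] [Module ℂ V]
    (σ : Representation ℂ (GL (Fin m) K) V) (c : ℕ)
    (W : Type*) [AddCommGroup W] [Module ℂ W] where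
  τ : Representation ℂ (intGL K (Fin m)) W
  finiteDimensional : FiniteDimensional ℂ W
  irreducible : τ.IsIrreducible
  trivial : ∀ k : intGL K (Fin m),
    (∀ x y, k.1.val x y - (1 : Matrix _ _ K) x y ∈ pPow K c) → τ k = 1
  α : W →ₗ[ℂ] V
  α_injective : Function.Injective α
  α_equivariant : ∀ (k : intGL K (Fin m)) w, α (τ k w) = σ k (α w)
  αt : Module.Dual ℂ W →ₗ[ℂ] smoothDual σ
  αt_injective : Function.Injective αt
  αt_equivariant : ∀ (k : intGL K (Fin m)) l, αt (τ.dual k l) = contragredient σ k (αt l)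
  compatible : ∀ l w, (αt l).1 (α w) = l w
  φ : V
  φ_mem : φ ∈ LinearMap.range α
  φt : smoothDual σ
  φt_mem : φt ∈ LinearMap.range αt
  pairing_eq_one : φt.1 φ = 1

variable {t : ℕ} {n : Fin t → ℕ} {V : Fin t → Type*} [∀ j, AddCommGroup (V j)]
  [∀ j, Module ℂ (V j)] {σ : ∀ j, Representation ℂ (GL (Fin (n j)) K) (V j)} {c : ℕ}
  {W : Fin t → Type*} [∀ j, AddCommGroup (W j)] [∀ j, Module ℂ (W j)]

/-- The vector `⨂ j, φ_j`. -/
def vec₀ (T : ∀ j, TypeVectors (σ j) c (W j)) : ⨂[ℂ] j, V j :=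
  PiTensorProduct.tprod ℂ fun j => (T j).φ

/-- The vector `⨂ j, φt_j`. -/
def dualVec₀ (T : ∀ j, TypeVectors (σ j) c (W j)) : ⨂[ℂ] j, smoothDual (σ j) :=
  PiTensorProduct.tprod ℂ fun j => (T j).φt

open Classical in
/-- The function on matrices supported on `𝔛 = ᵗI^0_r · I^0_r` whose value at
`X = (k₁ u₁) (k₂ u₂)` is `F k₁ k₂`, where `k₁`, `k₂` are in the integral Levi subgroup and
`u₁ ∈ ᵗI_r`, `u₂ ∈ I_r`.  For the functions `F` below the value does not depend on the
decomposition chosen. -/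
def extendToX (n : Fin t → ℕ) (r : ℕ)
    (F : (∀ j, GL (Fin (n j)) K) → (∀ j, GL (Fin (n j)) K) → ℂ)
    (X : Matrix (BlockIdx n) (BlockIdx n) K) : ℂ :=
  if h : ∃ d : ((∀ j, GL (Fin (n j)) K) × GL (BlockIdx n) K) ×
      ((∀ j, GL (Fin (n j)) K) × GL (BlockIdx n) K),
      d.1.1 ∈ intLevi n ∧ d.1.2 ∈ iwahori n (· > ·) r ∧
      d.2.1 ∈ intLevi n ∧ d.2.2 ∈ iwahori n (· < ·) r ∧
      X = ((blockLevi n d.1.1 * d.1.2) * (blockLevi n d.2.1 * d.2.2)).val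
  then F h.choose.1.1 h.choose.2.1 else 0

/-- The extended matrix coefficient `μ'_a`: `γ₁ γ₂ ↦ (τ(γ₁⁻¹) φ⁰, τt(γ₂) φt⁰)`. -/
def muA' (T : ∀ j, TypeVectors (σ j) c (W j)) (r : ℕ) :
    Matrix (BlockIdx n) (BlockIdx n) K → ℂ :=
  extendToX n r fun k₁ k₂ =>
    piPairing σ (extTensor σ k₁⁻¹ (vec₀ T))
      (extTensor (fun j => contragredient (σ j)) k₂ (dualVec₀ T))

/-- The extended matrix coefficient `μ'_b`: `γ₁ γ₂ ↦ (τ(γ₂) φ⁰, τt(γ₁⁻¹) φt⁰)`. -/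
def muB' (T : ∀ j, TypeVectors (σ j) c (W j)) (r : ℕ) :
    Matrix (BlockIdx n) (BlockIdx n) K → ℂ :=
  extendToX n r fun k₁ k₂ =>
    piPairing σ (extTensor σ k₂ (vec₀ T))
      (extTensor (fun j => contragredient (σ j)) k₁⁻¹ (dualVec₀ T))

/-- `μ_a = χ₂⁻¹ μ'_a`. -/
def muA (χ₂ : MulChar K ℂ) (T : ∀ j, TypeVectors (σ j) c (W j)) (r : ℕ)
    (X : Matrix (BlockIdx n) (BlockIdx n) K) : ℂ :=
  χ₂⁻¹ X.det * muA' T r X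

/-- `μ_b = χ₁ μ'_b`. -/
def muB (χ₁ : MulChar K ℂ) (T : ∀ j, TypeVectors (σ j) c (W j)) (r : ℕ)
    (X : Matrix (BlockIdx n) (BlockIdx n) K) : ℂ :=
  χ₁ X.det * muB' T r X

end Types

/-! ### Schwartz functions -/

section Schwartz

variable {K : Type*} [NontriviallyNormedField K] [IsNormalizedLocalField K]
  {t s : ℕ} {nA : Fin t → ℕ} {nB : Fin s → ℕ}

/-- The twist `ν = χ₁⁻¹ χ₂ μ`. -/
def twist (χ₁ χ₂ : MulChar K ℂ) {ι : Type*} [Fintype ι] [DecidableEq ι] (μ : Matrix ι ι K → ℂ)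
    (X : Matrix ι ι K) : ℂ :=
  χ₁⁻¹ X.det * χ₂ X.det * μ X

open Classical in
/-- The function supported on `𝔛_w` with value `f(A) g(D)` at `(A B; C D) ∈ 𝔛_w`. -/
def blockExtend (r : ℕ) (f : Matrix (BlockIdx nA) (BlockIdx nA) K → ℂ)
    (g : Matrix (BlockIdx nB) (BlockIdx nB) K → ℂ)
    (X : Matrix (BlockIdx nA ⊕ BlockIdx nB) (BlockIdx nA ⊕ BlockIdx nB) K) : ℂ :=
  if X ∈ frakXW nA nB r then f X.toBlocks₁₁ * g X.toBlocks₂₂ else 0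

open Classical in
/-- `Φ_{1,w}`: the restriction of `μ_w` to `𝔊_w`, extended by zero. -/
def Phi₁ (r : ℕ) (μa : Matrix (BlockIdx nA) (BlockIdx nA) K → ℂ)
    (μb : Matrix (BlockIdx nB) (BlockIdx nB) K → ℂ)
    (X : Matrix (BlockIdx nA ⊕ BlockIdx nB) (BlockIdx nA ⊕ BlockIdx nB) K) : ℂ :=
  if ∃ g ∈ groupG (K := K) nA nB r, g.val = X then blockExtend r μa μb X else 0

variable [MeasurableSpace K] [BorelSpace K]

/-- The Fourier transform `x ↦ ∫ ν(-y) e(tr(y x)) dy`. -/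
def fourier (e : AddChar K Circle) {ι : Type*} [Fintype ι] (ν : Matrix ι ι K → ℂ)
    (x : Matrix ι ι K) : ℂ :=
  ∫ y, ν (-y) * (e (y * x).trace : ℂ) ∂(haarMatrix K ι ι)

/-- `Φ_{2,w}`: the Fourier transform of `ν_w`, where `ν_w (A B; C D) = ν_a(A) ν_b(D)` on `𝔛_w`. -/
def Phi₂ (e : AddChar K Circle) (χ₁ χ₂ : MulChar K ℂ) (r : ℕ)
    (μa : Matrix (BlockIdx nA) (BlockIdx nA) K → ℂ)
    (μb : Matrix (BlockIdx nB) (BlockIdx nB) K → ℂ) :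
    Matrix (BlockIdx nA ⊕ BlockIdx nB) (BlockIdx nA ⊕ BlockIdx nB) K → ℂ :=
  fourier e (blockExtend r (twist χ₁ χ₂ μa) (twist χ₁ χ₂ μb))

/-- `Φ^{(1)}`, respectively `Φ^{(4)}`: the integral of `ν(-α) e(tr(α A))` over `α ∈ 𝔛`. -/
def PhiDiag {n : Fin t → ℕ} (e : AddChar K Circle) (χ₁ χ₂ : MulChar K ℂ) (r : ℕ)
    (μ : Matrix (BlockIdx n) (BlockIdx n) K → ℂ) (A : Matrix (BlockIdx n) (BlockIdx n) K) : ℂ :=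
  ∫ α in frakX n r, twist χ₁ χ₂ μ (-α) * (e (α * A).trace : ℂ) ∂(haarMatrix K _ _)

/-- The Schwartz function `Φ_w(X₁, X₂) = (dim τ)² / Vol(𝔊_w) · Φ_{1,w}(ε X₁) Φ_{2,w}(X₂)` on
`n × 2n` matrices, where `ε` is a sign. -/
def PhiW (ε : ℤˣ) (e : AddChar K Circle) (χ₁ χ₂ : MulChar K ℂ) (r dimτ : ℕ)
    (μa : Matrix (BlockIdx nA) (BlockIdx nA) K → ℂ)
    (μb : Matrix (BlockIdx nB) (BlockIdx nB) K → ℂ)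
    (X : Matrix (BlockIdx nA ⊕ BlockIdx nB)
      ((BlockIdx nA ⊕ BlockIdx nB) ⊕ (BlockIdx nA ⊕ BlockIdx nB)) K) : ℂ :=
  (dimτ : ℂ) ^ 2 / ((haarGL K _).real (groupG (K := K) nA nB r) : ℂ) *
    Phi₁ r μa μb ((ε : ℤ) • X.toCols₁) * Phi₂ e χ₁ χ₂ r μa μb X.toCols₂

end Schwartz

/-! ### The zeta integrals -/

section Zeta

variable {K : Type*} [NontriviallyNormedField K]

/-- The permutation matrix `S_w`, which exchanges the second and the fourth block of columns for
the decomposition `2 n = a + b + a + b`. -/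
def swapMatrix (K : Type*) [NontriviallyNormedField K] (a b : Type*) [DecidableEq a]
    [DecidableEq b] : Matrix ((a ⊕ b) ⊕ (a ⊕ b)) ((a ⊕ b) ⊕ (a ⊕ b)) K :=
  Matrix.fromBlocks (Matrix.fromBlocks 1 0 0 0) (Matrix.fromBlocks 0 0 0 1)
    (Matrix.fromBlocks 0 0 0 1) (Matrix.fromBlocks 1 0 0 0)

variable {a b : Type*} [Fintype a] [DecidableEq a] [Fintype b] [DecidableEq b]

/-- `|det g| ^ z`. -/
def absDet {ι : Type*} [Fintype ι] [DecidableEq ι] (g : GL ι K) (z : ℂ) : ℂ :=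
  ((‖g.val.det‖ : ℝ) : ℂ) ^ z

/-- The integrand of the section `f⁺` at `(u, 1)`:
`Φ((X u, X) S) χ₁⁻¹ χ₂(det X) |det X| ^ (n + 2 s)`. -/
def sectionIntegrand (χ₁ χ₂ : MulChar K ℂ) (Φ : Matrix (a ⊕ b) ((a ⊕ b) ⊕ (a ⊕ b)) K → ℂ) (s : ℂ)
    (u X : GL (a ⊕ b) K) : ℂ :=
  Φ (Matrix.fromCols (X * u).val X.val *
      swapMatrix K a b) *
    (χ₁⁻¹ X.val.det * χ₂ X.val.det) *
    absDet X (Fintype.card (a ⊕ b) + 2 * s)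

/-- The factor `χ₂(det u) |det u| ^ (n / 2 + s)`. -/
def sectionFactor (χ₂ : MulChar K ℂ) (s : ℂ) (u : GL (a ⊕ b) K) : ℂ :=
  χ₂ u.val.det * absDet u (Fintype.card (a ⊕ b) / 2 + s)

variable [IsNormalizedLocalField K] [MeasurableSpace K] [BorelSpace K]

/-- The local Siegel-Weil section `u ↦ f⁺_{w,s}(u, 1)`. -/
def sectionPlus (χ₁ χ₂ : MulChar K ℂ) (Φ : Matrix (a ⊕ b) ((a ⊕ b) ⊕ (a ⊕ b)) K → ℂ) (s : ℂ)
    (u : GL (a ⊕ b) K) : ℂ :=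
  sectionFactor χ₂ s u * ∫ X, sectionIntegrand χ₁ χ₂ Φ s u X ∂(haarGL K (a ⊕ b))

/-- The zeta integral `Z_w = ∫ f⁺_{w,s}(g, 1) ⟨π(g) φ, φt⟩ d^× g`, where `coeff` is the matrix
coefficient `g ↦ ⟨π(g) φ, φt⟩`. -/
def zetaIntegral (χ₁ χ₂ : MulChar K ℂ) (Φ : Matrix (a ⊕ b) ((a ⊕ b) ⊕ (a ⊕ b)) K → ℂ)
    (coeff : GL (a ⊕ b) K → ℂ) (s : ℂ) : ℂ :=
  ∫ g, sectionPlus χ₁ χ₂ Φ s g * coeff g ∂(haarGL K (a ⊕ b))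

/-- Absolute convergence of the double integral (over `g` and `X`) that defines `Z_w`. -/
def ZetaConverges (χ₁ χ₂ : MulChar K ℂ) (Φ : Matrix (a ⊕ b) ((a ⊕ b) ⊕ (a ⊕ b)) K → ℂ)
    (coeff : GL (a ⊕ b) K → ℂ) (s : ℂ) : Prop :=
  Integrable (fun p : GL (a ⊕ b) K × GL (a ⊕ b) K =>
      sectionFactor χ₂ s p.1 * sectionIntegrand χ₁ χ₂ Φ s p.1 p.2 * coeff p.1)
    ((haarGL K (a ⊕ b)).prod (haarGL K (a ⊕ b)))

/-- The integrand of `𝓘_a`, where `coeff A₁ A₂ = ⟨π_a(A₁) φ_a, πt_a(A₂) φt_a⟩`. -/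
def integrandA (χ₁ χ₂ : MulChar K ℂ) (μa Φ : Matrix a a K → ℂ) (coeff : GL a K → GL a K → ℂ)
    (s : ℂ) (A₁ A₂ : GL a K) : ℂ :=
  μa A₁.val * χ₂ A₁.val.det * χ₁⁻¹ A₂.val.det *
    Φ A₂.val * absDet A₂ (s + Fintype.card a / 2) * coeff A₁ A₂

/-- The integrand of `𝓘_b`, where `coeff D₁ D₂ = ⟨π_b(D₁) φ_b, πt_b(D₂) φt_b⟩`. -/
def integrandB (χ₁ χ₂ : MulChar K ℂ) (μb Φ : Matrix b b K → ℂ) (coeff : GL b K → GL b K → ℂ)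
    (s : ℂ) (D₂ D₁ : GL b K) : ℂ :=
  μb D₂.val * χ₂ D₁.val.det * χ₁⁻¹ D₂.val.det *
    Φ D₁.val * absDet D₁ (s + Fintype.card b / 2) * coeff D₁ D₂

/-- `∫_{X ∈ I} ∫_{Y ∈ GL} F X Y d^× Y d^× X`. -/
def iteratedIntegral (I : Set (GL a K)) (F : GL a K → GL a K → ℂ) : ℂ :=
  ∫ X in I, ∫ Y, F X Y ∂(haarGL K a) ∂(haarGL K a)

/-- Absolute convergence of the double integral `∫_{X ∈ I} ∫_{Y ∈ GL} F X Y d^× Y d^× X`. -/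
def IteratedConverges (I : Set (GL a K)) (F : GL a K → GL a K → ℂ) : Prop :=
  Integrable (fun p : GL a K × GL a K => F p.1 p.2)
    (((haarGL K a).restrict I).prod (haarGL K a))

end Zeta

/-! ### Passage from `P_w` to `P_{a,b}` -/

section Transitivity

variable {K : Type*} [NontriviallyNormedField K] {t s : ℕ} {nA : Fin t → ℕ} {nB : Fin s → ℕ}
  {VA VB PA PB : Type*} [AddCommGroup VA] [Module ℂ VA] [AddCommGroup VB] [Module ℂ VB]
  [AddCommGroup PA] [Module ℂ PA] [AddCommGroup PB] [Module ℂ PB]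

/-- Evaluation at `h` on an induced representation. -/
def evalAt {L G : Type*} [Group L] [Group G] [TopologicalSpace G] {V : Type*} [AddCommGroup V]
    [Module ℂ V] (D : ParabolicDatum L G) (σ : Representation ℂ L V) (h : G) :
    inducedSpace D σ →ₗ[ℂ] V :=
  (LinearMap.proj h).comp (inducedSpace D σ).subtype

/-- `F` is the image of `f` under the map
`Ind_{P_w} (σ_a ⊠ σ_b) ≃ Ind_{P_{a,b}} (Ind σ_a ⊠ Ind σ_b) → Ind_{P_{a,b}} (π_a ⊠ π_b)`
that is induced by the quotient maps `qA`, `qB`.  The first isomorphism sends `f` to the function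
whose value at `g` is `h ↦ δ(h) ^ (-1/2) f(h g)`, `h ∈ GL_a × GL_b`, with `δ` the modulus
character of `P_{a,b}`. -/
def IsTransitImage {σA : Representation ℂ (∀ j, GL (Fin (nA j)) K) VA}
    {σB : Representation ℂ (∀ j, GL (Fin (nB j)) K) VB}
    {πA : Representation ℂ (GL (BlockIdx nA) K) PA} {πB : Representation ℂ (GL (BlockIdx nB) K) PB}
    (qA : (normalizedInd (blockParabolic nA (· < ·)) σA).IntertwiningMap πA)
    (qB : (normalizedInd (blockParabolic nB (· > ·)) σB).IntertwiningMap πB)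
    (f : inducedSpace (mixedParabolic nA nB) (extTensor₂ σA σB))
    (F : inducedSpace (maxParabolic (K := K)) (extTensor₂ πA πB)) : Prop :=
  ∀ g : GL (BlockIdx nA ⊕ BlockIdx nB) K,
    ∃ T : inducedSpace (blockParabolic nA (· < ·)) σA ⊗[ℂ]
        inducedSpace (blockParabolic nB (· > ·)) σB,
      (∀ hA hB, TensorProduct.map (evalAt _ σA hA) (evalAt _ σB hB) T =
        (((Real.sqrt (maxParabolic.modulus (hA, hB)))⁻¹ : ℝ) : ℂ) • f.1 (diagEmb (hA, hB) * g)) ∧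
      F.1 g = TensorProduct.map qA.toLinearMap qB.toLinearMap T

end Transitivity

end LocalZeta

end

open LocalZeta

set_option linter.unusedSectionVars false
set_option linter.unusedVariables false

noncomputable section
namespace LocalZeta

/-! ### Norms and uniformizers of a normalized local field. -/

section FieldBasics

variable {K : Type*} [NontriviallyNormedField K] [IsNormalizedLocalField K]

/-! The substitution Z = X g and left invariance of Haar measure turn Z_w into an integral over
pairs (X, Z) (`section_eq_zetaKernel`, `zetaConverges_iff`). The permutation S hands the left block
column of Z and the right block column of X to Φ₁, and the two remaining block columns to Φ₂. The
support of Φ₁ then forces the upper left block of Z and the lower right block of X to be invertible.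
So X and Z lie in two opposite big cells: X is upper unipotent times diag(A₂, D₂) times lower
unipotent, and Z is lower unipotent times diag(A₁, D₁) times upper unipotent. On each cell the Haar
measure is a product measure times explicit powers of determinants (`CellChart.restrict_eq_map`).

In these coordinates Φ_w splits (`PhiW_swap`). Φ₁ puts A₁ and D₂ in Iwahori groups and two of the
off-diagonal blocks in 𝔭^r; its sign factor comes out because -1 acts on each type by a scalar. By
`fourier_blockExtend`, Φ₂ is the product of the transforms of ν_a and ν_b and of indicators of
integral blocks. Those transforms are invariant under integral translations, so they do not see the
shears of the cell coordinates, and they are supported on 𝔭^(-c_a) and 𝔭^(-c_b).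

The matrix coefficient is evaluated at X⁻¹ Z. Because r ≥ c_a + c_b, the unipotent factors, once
exchanged and moved past the Levi elements, are absorbed by the invariance of φ_w under I_w and of
its dual vector under ᵗI_w (`coeff_cells`). What is left is the Levi element m = diag(A₂⁻¹ A₁, D₂⁻¹
D₁). There `coeffW_diagEmb` computes the coefficient as an integral over GL_n(𝒪). With δ the modulus
of P_{a,b}, the integrand is δ(m)^(1/2) times the product of the coefficients of π_a and π_b on a
set of volume δ(m)⁻¹ Vol(I⁰_{a,b,r}), and zero elsewhere. This rests on `IsTransitImage.apply_one`,
which identifies the value at 1 of the image of φ_w. All powers of determinants combine to those of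
𝓘_a and 𝓘_b (`cpow_cells`), so the integrand is a product (`zetaKernel_cells`), and the volumes of
the off-diagonal blocks cancel against those inside Vol(𝔊_w) (`haarGL_real_groupG`).

Convergence for large Re(s) comes from polynomial growth of matrix coefficients. For the σ_j,
`norm_coeff_diagPow_le` gives an exponential bound along the torus by averaging inside a
finite-dimensional space of fixed vectors, and the Cartan decomposition spreads it over the group
(`hasGrowth_coeff`). `hasGrowth_induced` passes the bound on to π_a and π_b. The Fourier transforms
have bounded support, so a high power of |det| dominates (`exists_iteratedConverges`), and the
product structure yields convergence of Z_w. Conversely, where only Z_w is known to converge, each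
factor is integrable unless the constant is zero or some factor vanishes almost everywhere, and in
those cases both sides of the formula are zero (`mul_integral_mul_integral_eq`). -/

theorem norm_add_le_of_le {x y : K} {c : ℝ} (hx : ‖x‖ ≤ c) (hy : ‖y‖ ≤ c) : ‖x + y‖ ≤ c :=
  (IsUltrametricDist.norm_add_le_max x y).trans (max_le hx hy)

theorem norm_sum_le_of_le {ι : Type*} (s : Finset ι) {f : ι → K} {c : ℝ} (hc : 0 ≤ c)
    (h : ∀ i ∈ s, ‖f i‖ ≤ c) : ‖∑ i ∈ s, f i‖ ≤ c :=
  IsUltrametricDist.norm_sum_le_of_forall_le_of_nonneg hc h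

theorem mem_integers_iff {x : K} : x ∈ integers K ↔ ‖x‖ ≤ 1 := by
  simp [integers, Valuation.mem_valuationSubring_iff, NormedField.valuation_apply,
    ← NNReal.coe_le_coe]

-- The open unit ball is closed, hence compact, so the norm attains a maximum on it. A maximizer is
-- irreducible, because a product of two nonunits has strictly smaller norm; the normalization of
-- the absolute value then gives its exact size.
variable (K) in
theorem exists_uniformizer : ∃ ϖ : K, ‖ϖ‖ = ((residueCard K : ℕ) : ℝ)⁻¹ ∧ 0 < ‖ϖ‖ ∧ ‖ϖ‖ < 1 ∧
    ∀ x : K, ‖x‖ < 1 → ‖x‖ ≤ ‖ϖ‖ := by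
  obtain ⟨y, hy0, hy1⟩ := NormedField.exists_norm_lt_one K
  have hcomp : IsCompact (Metric.ball (0 : K) 1) :=
    (isCompact_closedBall (0 : K) 1).of_isClosed_subset (IsUltrametricDist.isClosed_ball 0 1)
      Metric.ball_subset_closedBall
  obtain ⟨ϖ, hϖ, hmax⟩ := hcomp.exists_isMaxOn ⟨y, by simpa using hy1⟩ continuous_norm.continuousOn
  have hlt : ‖ϖ‖ < 1 := by simpa using hϖ
  have hmax' : ∀ x : K, ‖x‖ < 1 → ‖x‖ ≤ ‖ϖ‖ := fun x hx => hmax (by simpa using hx)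
  have hpos : 0 < ‖ϖ‖ := hy0.trans_le (hmax' y hy1)
  refine ⟨ϖ, ?_, hpos, hlt, hmax'⟩
  have hunit : ∀ x : integers K, ¬ IsUnit x → ‖(x : K)‖ < 1 := by
    intro x hx
    refine lt_of_le_of_ne (mem_integers_iff.1 x.2) fun h => hx ?_
    have hx0 : (x : K) ≠ 0 := by
      rw [← norm_pos_iff, h]; exact one_pos
    refine IsUnit.of_mul_eq_one ⟨(x : K)⁻¹, mem_integers_iff.2 (by rw [norm_inv, h, inv_one])⟩ ?_
    ext
    simp [hx0]
  have hirr : Irreducible (⟨ϖ, mem_integers_iff.2 hlt.le⟩ : integers K) := by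
    constructor
    · rintro ⟨u, hu⟩
      have h1 := congrArg (fun z : integers K => ‖(z : K)‖) u.mul_inv
      simp only [hu] at h1
      have h2 := mem_integers_iff.1 (u⁻¹ : (integers K)ˣ).1.2
      have h3 : ‖ϖ‖ * ‖((u⁻¹ : (integers K)ˣ).1 : K)‖ = 1 := by simpa using h1
      nlinarith [norm_nonneg ϖ]
    · intro a b hab
      by_contra! hcon
      have h1 : ϖ = (a : K) * b := congrArg Subtype.val hab
      have ha := hmax' _ (hunit a hcon.1)
      have hb := hunit b hcon.2
      have h2 : ‖ϖ‖ = ‖(a : K)‖ * ‖(b : K)‖ := by rw [← norm_mul, ← h1]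
      have hb' := norm_nonneg (b : K)
      nlinarith
  exact IsNormalizedLocalField.norm_uniformizer _ hirr

variable (K) in
theorem one_lt_residueCard : (1 : ℝ) < residueCard K := by
  obtain ⟨ϖ, h, h0, h1, -⟩ := exists_uniformizer K
  rw [h] at h0 h1
  exact (inv_lt_one₀ (inv_pos.1 h0)).1 h1

/-- A power of `ϖ` scales `x` to a norm in the interval (‖ϖ‖, 1], and by maximality of `ϖ` no norm
lies strictly between the two ends. -/
theorem exists_norm_eq_zpow {x : K} (hx : x ≠ 0) {ϖ : K} (h0 : 0 < ‖ϖ‖) (h1 : ‖ϖ‖ < 1)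
    (hmax : ∀ x : K, ‖x‖ < 1 → ‖x‖ ≤ ‖ϖ‖) : ∃ k : ℤ, ‖x‖ = ‖ϖ‖ ^ k := by
  obtain ⟨k, hk1, hk2⟩ := exists_mem_Ioc_zpow (norm_pos_iff.2 hx) ((one_lt_inv₀ h0).2 h1)
  refine ⟨-(k + 1), ?_⟩
  have hϖ : ϖ ≠ 0 := norm_pos_iff.1 h0
  rw [inv_zpow', ← norm_zpow] at hk1 hk2
  have hp : 0 < ‖ϖ ^ (-(k + 1))‖ := norm_pos_iff.2 (zpow_ne_zero _ hϖ)
  rw [← norm_zpow]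
  by_contra hne
  have h2 : ‖x * (ϖ ^ (-(k + 1)))⁻¹‖ < 1 := by
    rw [norm_mul, norm_inv, ← div_eq_mul_inv, div_lt_one hp]
    exact lt_of_le_of_ne hk2 hne
  have h3 := hmax _ h2
  rw [norm_mul, norm_inv, ← div_eq_mul_inv, div_le_iff₀ hp, ← norm_mul, ← zpow_one_add₀ hϖ] at h3
  have : (1 + -(k + 1) : ℤ) = -k := by ring
  rw [this] at h3
  exact absurd h3 (not_le.2 hk1)

theorem mem_pPow_iff {r : ℤ} {x : K} : x ∈ pPow K r ↔ ‖x‖ ≤ (residueCard K : ℝ) ^ (-r) := Iff.rfl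

end FieldBasics

/-! ### Entrywise bounds, determinants and integral invertible matrices. -/

section MatLe

variable {K : Type*} [NontriviallyNormedField K] [IsNormalizedLocalField K]
variable {ι κ μ : Type*}

/-- All entries have norm at most `c`. -/
def MatLe (c : ℝ) (M : Matrix ι κ K) : Prop := ∀ i j, ‖M i j‖ ≤ c

theorem MatLe.mono {c d : ℝ} {M : Matrix ι κ K} (h : MatLe c M) (hcd : c ≤ d) : MatLe d M :=
  fun i j => (h i j).trans hcd

theorem MatLe.add {c : ℝ} {M N : Matrix ι κ K} (h : MatLe c M) (h' : MatLe c N) :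
    MatLe c (M + N) := fun i j => norm_add_le_of_le (h i j) (h' i j)

theorem MatLe.neg {c : ℝ} {M : Matrix ι κ K} (h : MatLe c M) : MatLe c (-M) :=
  fun i j => by simpa using h i j

theorem MatLe.sub {c : ℝ} {M N : Matrix ι κ K} (h : MatLe c M) (h' : MatLe c N) :
    MatLe c (M - N) := by rw [sub_eq_add_neg]; exact h.add h'.neg

theorem MatLe.zero {c : ℝ} (hc : 0 ≤ c) : MatLe c (0 : Matrix ι κ K) := fun i j => by simpa using hc

theorem MatLe.one [DecidableEq ι] : MatLe 1 (1 : Matrix ι ι K) := fun i j => by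
  rw [Matrix.one_apply]; split_ifs <;> simp

theorem MatLe.mul [Fintype κ] {c d : ℝ} (hc : 0 ≤ c) (hd : 0 ≤ d) {M : Matrix ι κ K}
    {N : Matrix κ μ K} (h : MatLe c M) (h' : MatLe d N) : MatLe (c * d) (M * N) := fun i j => by
  rw [Matrix.mul_apply]
  refine norm_sum_le_of_le _ (by positivity) fun k _ => ?_
  rw [norm_mul]
  exact mul_le_mul (h i k) (h' k j) (norm_nonneg _) hc

theorem MatLe.mul_left [Fintype κ] {c : ℝ} (hc : 0 ≤ c) {M : Matrix ι κ K}
    {N : Matrix κ μ K} (h : MatLe 1 M) (h' : MatLe c N) : MatLe c (M * N) := by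
  simpa using MatLe.mul zero_le_one hc h h'

theorem MatLe.mul_right [Fintype κ] {c : ℝ} (hc : 0 ≤ c) {M : Matrix ι κ K}
    {N : Matrix κ μ K} (h : MatLe c M) (h' : MatLe 1 N) : MatLe c (M * N) := by
  simpa using MatLe.mul hc zero_le_one h h'

theorem MatLe.transpose {c : ℝ} {M : Matrix ι κ K} (h : MatLe c M) : MatLe c Mᵀ :=
  fun i j => h j i

theorem MatLe.submatrix {ι' κ' : Type*} {c : ℝ} {M : Matrix ι κ K} (h : MatLe c M) (f : ι' → ι)
    (g : κ' → κ) : MatLe c (M.submatrix f g) := fun i j => h _ _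

theorem MatLe.fromBlocks {ι' κ' : Type*} {c : ℝ} {A : Matrix ι κ K} {B : Matrix ι κ' K}
    {C : Matrix ι' κ K} {D : Matrix ι' κ' K} (hA : MatLe c A) (hB : MatLe c B) (hC : MatLe c C)
    (hD : MatLe c D) : MatLe c (Matrix.fromBlocks A B C D) := by
  rintro (i | i) (j | j)
  · exact hA i j
  · exact hB i j
  · exact hC i j
  · exact hD i j

theorem matLe_fromBlocks_iff {ι' κ' : Type*} {c : ℝ} {A : Matrix ι κ K} {B : Matrix ι κ' K}
    {C : Matrix ι' κ K} {D : Matrix ι' κ' K} :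
    MatLe c (Matrix.fromBlocks A B C D) ↔ MatLe c A ∧ MatLe c B ∧ MatLe c C ∧ MatLe c D :=
  ⟨fun h => ⟨fun i j => h (Sum.inl i) (Sum.inl j), fun i j => h (Sum.inl i) (Sum.inr j),
    fun i j => h (Sum.inr i) (Sum.inl j), fun i j => h (Sum.inr i) (Sum.inr j)⟩,
    fun h => h.1.fromBlocks h.2.1 h.2.2.1 h.2.2.2⟩

theorem MatLe.sub_one_of_sub_one {c : ℝ} [DecidableEq ι] {M : Matrix ι ι K} (hc : c ≤ 1)
    (h : MatLe c (M - 1)) : MatLe 1 M := by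
  have := (h.mono hc).add MatLe.one
  simpa using this

variable [Fintype ι] [DecidableEq ι]

theorem norm_prod_sub_prod_le {s : Finset κ} {f g : κ → K} {c : ℝ} (hc : 0 ≤ c)
    (hf : ∀ i ∈ s, ‖f i‖ ≤ 1) (hg : ∀ i ∈ s, ‖g i‖ ≤ 1) (h : ∀ i ∈ s, ‖f i - g i‖ ≤ c) :
    ‖∏ i ∈ s, f i - ∏ i ∈ s, g i‖ ≤ c := by
  classical
  induction s using Finset.induction_on with
  | empty => simpa using hc
  | insert a s ha ih =>
    rw [Finset.prod_insert ha, Finset.prod_insert ha]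
    have e : f a * ∏ i ∈ s, f i - g a * ∏ i ∈ s, g i =
        f a * (∏ i ∈ s, f i - ∏ i ∈ s, g i) + (f a - g a) * ∏ i ∈ s, g i := by ring
    rw [e]
    have h1 := ih (fun i hi => hf i (Finset.mem_insert_of_mem hi))
      (fun i hi => hg i (Finset.mem_insert_of_mem hi)) fun i hi => h i (Finset.mem_insert_of_mem hi)
    have h2 : ‖∏ i ∈ s, g i‖ ≤ 1 := by
      rw [norm_prod]
      exact Finset.prod_le_one (fun _ _ => norm_nonneg _)
        fun i hi => hg i (Finset.mem_insert_of_mem hi)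
    refine norm_add_le_of_le ?_ ?_
    · rw [norm_mul]
      exact (mul_le_mul (hf a (Finset.mem_insert_self _ _)) h1 (norm_nonneg _) zero_le_one).trans
        (by simp)
    · rw [norm_mul]
      exact (mul_le_mul (h a (Finset.mem_insert_self _ _)) h2 (norm_nonneg _) hc).trans (by simp)

theorem norm_det_sub_det_le {c : ℝ} (hc : 0 ≤ c) {M N : Matrix ι ι K} (hM : MatLe 1 M)
    (hN : MatLe 1 N) (h : MatLe c (M - N)) : ‖M.det - N.det‖ ≤ c := by
  rw [Matrix.det_apply', Matrix.det_apply', ← Finset.sum_sub_distrib]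
  refine norm_sum_le_of_le _ hc fun σ _ => ?_
  rw [← mul_sub, norm_mul]
  have h1 : ‖((Equiv.Perm.sign σ : ℤ) : K)‖ = 1 := by
    rcases Int.units_eq_one_or (Equiv.Perm.sign σ) with h | h <;> simp [h]
  rw [h1, one_mul]
  exact norm_prod_sub_prod_le hc (fun i _ => hM _ _) (fun i _ => hN _ _) fun i _ => h _ _

theorem MatLe.norm_det_le {c : ℝ} (hc : 0 ≤ c) {M : Matrix ι ι K} (h : MatLe c M) :
    ‖M.det‖ ≤ c ^ Fintype.card ι := by
  rw [Matrix.det_apply']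
  refine norm_sum_le_of_le _ (by positivity) fun σ _ => ?_
  have h1 : ‖((Equiv.Perm.sign σ : ℤ) : K)‖ = 1 := by
    rcases Int.units_eq_one_or (Equiv.Perm.sign σ) with h | h <;> simp [h]
  rw [norm_mul, h1, one_mul, norm_prod]
  refine (Finset.prod_le_prod (fun _ _ => norm_nonneg _) fun i _ => h (σ i) i).trans ?_
  simp

theorem MatLe.adjugate {c : ℝ} (hc : 1 ≤ c) {M : Matrix ι ι K} (h : MatLe c M) :
    MatLe (c ^ Fintype.card ι) M.adjugate := fun i j => by
  rw [Matrix.adjugate_apply]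
  refine MatLe.norm_det_le (zero_le_one.trans hc) fun k l => ?_
  rw [Matrix.updateRow_apply]
  split_ifs
  · rw [Pi.single_apply]; split_ifs <;> simp [hc, zero_le_one.trans hc]
  · exact h _ _

/-- The determinant differs from 1 by less than 1, and the ultrametric inequality then forces
equality of norms. -/
theorem norm_det_eq_one {c : ℝ} (hc0 : 0 ≤ c) (hc : c < 1) {M : Matrix ι ι K}
    (h : MatLe c (M - 1)) : ‖M.det‖ = 1 := by
  have h1 := norm_det_sub_det_le hc0 (h.sub_one_of_sub_one hc.le) MatLe.one h
  rw [Matrix.det_one] at h1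
  have h2 : ‖(1 : K)‖ = 1 := norm_one
  have := IsUltrametricDist.norm_add_eq_max_of_norm_ne_norm (x := M.det - 1) (y := 1)
    (by rw [h2]; exact (h1.trans_lt hc).ne)
  rw [sub_add_cancel, h2] at this
  rw [this, max_eq_right (h1.trans hc.le)]

theorem norm_det_pos (g : GL ι K) : 0 < ‖g.val.det‖ :=
  norm_pos_iff.2 (Matrix.GeneralLinearGroup.det_ne_zero g)

theorem val_inv_eq_smul_adjugate (g : GL ι K) : (g⁻¹).val = (g.val.det)⁻¹ • g.val.adjugate := by
  rw [Matrix.coe_units_inv, Matrix.inv_def, Ring.inverse_eq_inv']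

theorem matLe_inv_of_det {g : GL ι K} {c : ℝ} (hc : 1 ≤ c) (h : MatLe c g.val) :
    MatLe (c ^ Fintype.card ι * ‖g.val.det‖⁻¹) (g⁻¹).val := fun i j => by
  rw [val_inv_eq_smul_adjugate, Matrix.smul_apply, smul_eq_mul, norm_mul, norm_inv, mul_comm]
  exact mul_le_mul_of_nonneg_right (h.adjugate hc i j) (by positivity)

/-- The inverse is the adjugate divided by the determinant, so a determinant of norm one already
makes the inverse integral. -/
theorem mem_intGL_iff_det {g : GL ι K} : g ∈ intGL K ι ↔ MatLe 1 g.val ∧ ‖g.val.det‖ = 1 := by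
  constructor
  · rintro ⟨k, rfl⟩
    have h1 : ∀ k : GL ι (integers K),
        MatLe 1 (Matrix.GeneralLinearGroup.map (n := ι) (integers K).subtype k).val :=
      fun k i j => mem_integers_iff.1 (k.val i j).2
    have h2 : ∀ k : GL ι (integers K),
        ‖(Matrix.GeneralLinearGroup.map (n := ι) (integers K).subtype k).val.det‖ ≤ 1 :=
      fun k => by simpa using (h1 k).norm_det_le zero_le_one
    refine ⟨h1 k, le_antisymm (h2 k) ?_⟩
    have h3 := h2 k⁻¹
    set G := Matrix.GeneralLinearGroup.map (n := ι) (integers K).subtype k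
    have h4 : G.val.det * (G⁻¹).val.det = 1 := by
      rw [← Matrix.det_mul, ← Units.val_mul, mul_inv_cancel, Units.val_one, Matrix.det_one]
    rw [map_inv] at h3
    have h5 : ‖G.val.det‖ * ‖(G⁻¹).val.det‖ = 1 := by rw [← norm_mul, h4, norm_one]
    nlinarith [norm_nonneg G.val.det]
  · rintro ⟨h, hd⟩
    have h' : MatLe 1 (g⁻¹).val := by simpa [hd] using matLe_inv_of_det le_rfl h
    have inj : Function.Injective (fun M : Matrix ι ι (integers K) => M.map Subtype.val) :=
      fun M N hMN => by
        ext i j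
        exact congrFun (congrFun hMN i) j
    have hmul : ∀ M N : Matrix ι ι (integers K),
        (M * N).map Subtype.val = M.map Subtype.val * (N.map Subtype.val : Matrix ι ι K) :=
      fun M N => Matrix.map_mul (f := (integers K).subtype)
    have hone : (1 : Matrix ι ι (integers K)).map Subtype.val = (1 : Matrix ι ι K) := by
      ext i j; simp [Matrix.one_apply]; split_ifs <;> simp
    refine ⟨⟨fun i j => ⟨g.val i j, mem_integers_iff.2 (h i j)⟩,
      fun i j => ⟨(g⁻¹).val i j, mem_integers_iff.2 (h' i j)⟩, ?_, ?_⟩, ?_⟩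
    · apply inj
      exact (hmul _ _).trans (g.mul_inv.trans hone.symm)
    · apply inj
      exact (hmul _ _).trans (g.inv_mul.trans hone.symm)
    · ext i j
      rfl

theorem mem_intGL_iff {g : GL ι K} : g ∈ intGL K ι ↔ MatLe 1 g.val ∧ MatLe 1 (g⁻¹).val := by
  constructor
  · intro h
    exact ⟨(mem_intGL_iff_det.1 h).1, (mem_intGL_iff_det.1 (inv_mem h)).1⟩
  · rintro ⟨h, h'⟩
    refine mem_intGL_iff_det.2 ⟨h, ?_⟩
    have h1 : ‖g.val.det‖ ≤ 1 := by simpa using h.norm_det_le zero_le_one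
    have h2 : ‖(g⁻¹).val.det‖ ≤ 1 := by simpa using h'.norm_det_le zero_le_one
    have h4 : g.val.det * (g⁻¹).val.det = 1 := by
      rw [← Matrix.det_mul, ← Units.val_mul, mul_inv_cancel, Units.val_one, Matrix.det_one]
    have h5 : ‖g.val.det‖ * ‖(g⁻¹).val.det‖ = 1 := by rw [← norm_mul, h4, norm_one]
    nlinarith [norm_nonneg g.val.det]

/-- The invertible matrix with a given nonzero determinant. -/
def glOfDet (M : Matrix ι ι K) (h : M.det ≠ 0) : GL ι K :=
  Matrix.GeneralLinearGroup.mkOfDetNeZero M h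

@[simp] theorem glOfDet_val (M : Matrix ι ι K) (h : M.det ≠ 0) : (glOfDet M h).val = M := rfl

/-- The source of the group elements in the factorizations below: blocks are built as matrices close
to 1 and promoted to the group by this lemma. -/
theorem exists_gl_of_sub_one {c : ℝ} (hc0 : 0 ≤ c) (hc : c < 1) {M : Matrix ι ι K}
    (h : MatLe c (M - 1)) : ∃ g : GL ι K, g.val = M ∧ g ∈ intGL K ι := by
  have hd := norm_det_eq_one hc0 hc h
  refine ⟨glOfDet M (norm_pos_iff.1 (by rw [hd]; exact one_pos)), rfl, mem_intGL_iff_det.2 ?_⟩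
  exact ⟨h.sub_one_of_sub_one hc.le, hd⟩

/-- The congruence subgroup of integral invertible matrices at distance at most `c` from `1`. -/
def congrGL (K : Type*) [NontriviallyNormedField K] [IsNormalizedLocalField K]
    (ι : Type*) [Fintype ι] [DecidableEq ι] {c : ℝ} (hc : 0 ≤ c) : Subgroup (GL ι K) where
  carrier := {g | g ∈ intGL K ι ∧ MatLe c (g.val - 1)}
  one_mem' := ⟨one_mem _, by simpa using MatLe.zero hc⟩
  mul_mem' := by
    rintro g h ⟨hg, hg'⟩ ⟨hh, hh'⟩
    refine ⟨mul_mem hg hh, ?_⟩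
    have e : (g * h).val - 1 = (g.val - 1) * h.val + (h.val - 1) := by
      rw [Units.val_mul]; noncomm_ring
    rw [e]
    exact (hg'.mul_right hc (mem_intGL_iff.1 hh).1).add hh'
  inv_mem' := by
    rintro g ⟨hg, hg'⟩
    refine ⟨inv_mem hg, ?_⟩
    have e : (g⁻¹).val - 1 = -((g⁻¹).val * (g.val - 1)) := by
      rw [mul_sub, ← Units.val_mul]; simp
    rw [e]
    exact (MatLe.mul_left hc (mem_intGL_iff.1 hg).2 hg').neg

theorem mem_congrGL {c : ℝ} (hc : 0 ≤ c) {g : GL ι K} :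
    g ∈ congrGL K ι hc ↔ g ∈ intGL K ι ∧ MatLe c (g.val - 1) := Iff.rfl

theorem mem_congrGL_of_lt {c : ℝ} (hc : 0 ≤ c) (hc1 : c < 1) {g : GL ι K}
    (h : MatLe c (g.val - 1)) : g ∈ congrGL K ι hc :=
  ⟨mem_intGL_iff_det.2 ⟨h.sub_one_of_sub_one hc1.le, norm_det_eq_one hc hc1 h⟩, h⟩

theorem conj_mem_congrGL {c : ℝ} (hc : 0 ≤ c) {g k : GL ι K} (hg : g ∈ congrGL K ι hc)
    (hk : k ∈ intGL K ι) : k * g * k⁻¹ ∈ congrGL K ι hc := by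
  refine ⟨mul_mem (mul_mem hk hg.1) (inv_mem hk), ?_⟩
  have e : (k * g * k⁻¹).val - 1 = k.val * (g.val - 1) * (k⁻¹).val := by
    rw [mul_sub, sub_mul, mul_one, ← Units.val_mul, ← Units.val_mul, ← Units.val_mul]; simp
  rw [e]
  exact (MatLe.mul_left hc (mem_intGL_iff.1 hk).1 hg.2).mul_right hc (mem_intGL_iff.1 hk).2

end MatLe

end LocalZeta
end

noncomputable section
namespace LocalZeta

/-! ### Compact and open subgroups of GL_d(K). -/

section Topology

/-- `F` is locally constant, hence continuous for the discrete topology on `X`, and a compact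
discrete set is finite. This replaces every sum over cosets. -/
theorem finite_image_of_right_invariant {G X : Type*} [Group G] [TopologicalSpace G]
    [IsTopologicalGroup G] {C : Set G} (hC : IsCompact C) (F : G → X) (U : OpenSubgroup G)
    (h : ∀ u ∈ U, ∀ g, F (g * u) = F g) : (F '' C).Finite := by
  let _ : TopologicalSpace X := ⊥
  have : DiscreteTopology X := ⟨rfl⟩
  have hloc : IsLocallyConstant F := by
    rw [IsLocallyConstant.iff_exists_open]
    intro x
    refine ⟨(fun y => x⁻¹ * y) ⁻¹' (U : Set G), U.isOpen.preimage (by fun_prop),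
      by simp, fun y hy => ?_⟩
    have := h _ hy x
    simpa using this
  exact isCompact_iff_finite.1 (hC.image hloc.continuous)

variable {K : Type*} [NontriviallyNormedField K] [IsNormalizedLocalField K]
variable {ι κ : Type*} [Fintype ι] [DecidableEq ι] [Fintype κ] [DecidableEq κ]

/-- The topology of units records the inverse as well; this adds nothing here, since inversion is
continuous on invertible matrices by the adjugate formula. -/
theorem isEmbedding_val_gl : Topology.IsEmbedding (Units.val : GL ι K → Matrix ι ι K) := by
  refine Units.isEmbedding_val_mk' (f := fun M => M⁻¹) ?_ fun u => (Matrix.coe_units_inv u).symm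
  intro M hM
  have hd : M.det ≠ 0 := ((Matrix.isUnit_iff_isUnit_det M).1 hM).ne_zero
  refine ContinuousAt.continuousWithinAt ?_
  have e : (fun M : Matrix ι ι K => M⁻¹) = fun M => (M.det)⁻¹ • M.adjugate := by
    funext M; rw [Matrix.inv_def, Ring.inverse_eq_inv']
  rw [e]
  have h1 : Continuous fun M : Matrix ι ι K => M.det := continuous_id.matrix_det
  have h2 : Continuous fun M : Matrix ι ι K => M.adjugate := continuous_id.matrix_adjugate
  exact (h1.continuousAt.inv₀ hd).smul h2.continuousAt

theorem isClosed_matLe (c : ℝ) : IsClosed {M : Matrix ι κ K | MatLe c M} := by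
  have e : {M : Matrix ι κ K | MatLe c M} = ⋂ i, ⋂ j, {M | ‖M i j‖ ≤ c} := by
    ext; simp [MatLe]
  rw [e]
  refine isClosed_iInter fun i => isClosed_iInter fun j => isClosed_le ?_ continuous_const
  exact (continuous_id.matrix_elem i j).norm

theorem setOf_entries_eq_pi (c : ι → ℝ) :
    (Set.pi Set.univ fun i : ι => Set.pi Set.univ fun _ : κ => Metric.closedBall (0 : K) (c i)) =
      {M : ι → κ → K | ∀ i j, ‖M i j‖ ≤ c i} := by
  ext M
  simp [Set.mem_pi]

theorem isCompact_matLe (c : ℝ) : IsCompact {M : Matrix ι κ K | MatLe c M} := by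
  have h : IsCompact (Set.pi Set.univ fun _ : ι => Set.pi Set.univ fun _ : κ =>
      Metric.closedBall (0 : K) c) :=
    isCompact_univ_pi fun _ => isCompact_univ_pi fun _ => isCompact_closedBall 0 c
  rw [setOf_entries_eq_pi fun _ : ι => c] at h
  exact h

theorem isOpen_matLe {c : ℝ} (hc : 0 < c) : IsOpen {M : Matrix ι κ K | MatLe c M} := by
  have h : IsOpen (Set.pi Set.univ fun _ : ι => Set.pi Set.univ fun _ : κ =>
      Metric.closedBall (0 : K) c) :=
    isOpen_set_pi Set.finite_univ fun _ _ => isOpen_set_pi Set.finite_univ fun _ _ =>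
      IsUltrametricDist.isOpen_closedBall 0 hc.ne'
  rw [setOf_entries_eq_pi fun _ : ι => c] at h
  exact h

/-- The multiplicative monoid of integral matrices. -/
def integralMatrices (K : Type*) [NontriviallyNormedField K] [IsNormalizedLocalField K]
    (ι : Type*) [Fintype ι] [DecidableEq ι] : Submonoid (Matrix ι ι K) where
  carrier := {M | MatLe 1 M}
  one_mem' := MatLe.one
  mul_mem' h h' := MatLe.mul_left zero_le_one h h'

/-- It is the group of units of the compact monoid of integral matrices. -/
theorem isCompact_intGL : IsCompact (intGL K ι : Set (GL ι K)) := by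
  have : (intGL K ι : Set (GL ι K)) = (integralMatrices K ι).units := by
    ext g
    rw [SetLike.mem_coe, mem_intGL_iff, SetLike.mem_coe, Submonoid.mem_units_iff]
    rfl
  rw [this]
  exact Submonoid.units_isCompact (isCompact_matLe 1)

theorem isOpen_intGL : IsOpen (intGL K ι : Set (GL ι K)) := by
  have : (intGL K ι : Set (GL ι K)) =
      Units.val ⁻¹' {M | MatLe 1 M} ∩ (fun g : GL ι K => (g⁻¹).val) ⁻¹' {M | MatLe 1 M} := by
    ext g
    rw [SetLike.mem_coe, mem_intGL_iff]
    rfl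
  rw [this]
  exact ((isOpen_matLe one_pos).preimage Units.continuous_val).inter
    ((isOpen_matLe one_pos).preimage (Units.continuous_val.comp continuous_inv))

theorem isOpen_congrGL {c : ℝ} (hc : 0 < c) : IsOpen (congrGL K ι hc.le : Set (GL ι K)) := by
  have : (congrGL K ι hc.le : Set (GL ι K)) =
      (intGL K ι : Set (GL ι K)) ∩ (fun g : GL ι K => g.val - 1) ⁻¹' {M | MatLe c M} := rfl
  rw [this]
  exact isOpen_intGL.inter ((isOpen_matLe hc).preimage (Units.continuous_val.sub continuous_const))

/-- The congruence subgroups as open subgroups. -/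
def openCongrGL (K : Type*) [NontriviallyNormedField K] [IsNormalizedLocalField K]
    (ι : Type*) [Fintype ι] [DecidableEq ι] {c : ℝ} (hc : 0 < c) : OpenSubgroup (GL ι K) :=
  ⟨congrGL K ι hc.le, isOpen_congrGL hc⟩

theorem isCompact_congrGL {c : ℝ} (hc : 0 < c) : IsCompact (congrGL K ι hc.le : Set (GL ι K)) :=
  isCompact_intGL.of_isClosed_subset (openCongrGL K ι hc).isClosed fun _ h => h.1

theorem exists_matLe_nhds {U : Set (Matrix ι κ K)} {M : Matrix ι κ K} (hU : U ∈ nhds M) :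
    ∃ c : ℝ, 0 < c ∧ ∀ N, MatLe c (N - M) → N ∈ U := by
  have key : ∀ (V : Set (ι → κ → K)) (A : ι → κ → K), V ∈ nhds A →
      ∃ c : ℝ, 0 < c ∧ ∀ B : ι → κ → K, (∀ i j, ‖B i j - A i j‖ ≤ c) → B ∈ V := by
    intro V A hV
    obtain ⟨δ, hδ, h⟩ := Metric.mem_nhds_iff.1 hV
    refine ⟨δ / 2, by positivity, fun B hB => h ?_⟩
    rw [Metric.mem_ball]
    refine lt_of_le_of_lt ?_ (half_lt_self hδ)
    refine (dist_pi_le_iff (by positivity)).2 fun i => (dist_pi_le_iff (by positivity)).2 fun j => ?_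
    rw [dist_eq_norm]
    exact hB i j
  exact key U M hU

theorem exists_congrGL_le (U : OpenSubgroup (GL ι K)) :
    ∃ c : ℝ, ∃ hc : 0 < c, c < 1 ∧ congrGL K ι hc.le ≤ U.toSubgroup := by
  have h1 : (U : Set (GL ι K)) ∈ nhds 1 := U.mem_nhds_one
  rw [isEmbedding_val_gl.nhds_eq_comap, Filter.mem_comap] at h1
  obtain ⟨S, hS, hSU⟩ := h1
  obtain ⟨c, hc, h⟩ := exists_matLe_nhds hS
  -- The cap 1/2 only keeps the radius below one, the range in which the LDU factorization holds.
  refine ⟨min c (1 / 2), by positivity, by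
    exact (min_le_right _ _).trans_lt (by norm_num), fun g hg => hSU (h _ ?_)⟩
  exact hg.2.mono (min_le_left _ _)

instance : SecondCountableTopology (Matrix ι κ K) :=
  inferInstanceAs (SecondCountableTopology (ι → κ → K))

instance : LocallyCompactSpace (Matrix ι κ K) :=
  inferInstanceAs (LocallyCompactSpace (ι → κ → K))

instance : SecondCountableTopology (GL ι K) := isEmbedding_val_gl.secondCountableTopology

end Topology

/-! ### Haar measures on matrices and on GL_d(K). -/

section Measure

variable {K : Type*} [NontriviallyNormedField K] [IsNormalizedLocalField K]
  [MeasurableSpace K] [BorelSpace K]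
variable {ι κ : Type*} [Fintype ι] [Fintype κ]

instance : BorelSpace (Matrix ι κ K) := inferInstanceAs (BorelSpace (ι → κ → K))

variable (K) in
instance isAddHaarMeasure_haarK : (haarK K).IsAddHaarMeasure := inferInstanceAs (Measure.addHaarMeasure _).IsAddHaarMeasure

instance : SigmaFinite (haarK K) := inferInstance

instance : (haarMatrix K ι κ).IsAddHaarMeasure :=
  inferInstanceAs (Measure.pi fun _ : ι => Measure.pi fun _ : κ => haarK K).IsAddHaarMeasure

instance : SigmaFinite (haarMatrix K ι κ) :=
  inferInstanceAs (SigmaFinite (Measure.pi fun _ : ι => Measure.pi fun _ : κ => haarK K))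

variable [DecidableEq ι] [DecidableEq κ]

instance : BorelSpace (GL ι K) :=
  ⟨calc (Units.instMeasurableSpace : MeasurableSpace (Matrix ι ι K)ˣ) =
        MeasurableSpace.comap Units.val (borel (Matrix ι ι K)) := by
          rw [← BorelSpace.measurable_eq]; rfl
    _ = @borel _ (TopologicalSpace.induced Units.val inferInstance) := borel_comap.symm
    _ = borel (GL ι K) := by rw [← isEmbedding_val_gl.eq_induced]⟩

theorem measurable_matrix_det : Measurable fun M : Matrix ι ι K => M.det :=
  (continuous_id.matrix_det : Continuous fun M : Matrix ι ι K => M.det).measurable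

theorem measurableEmbedding_val : MeasurableEmbedding (Units.val : GL ι K → Matrix ι ι K) := by
  refine isEmbedding_val_gl.measurableEmbedding ?_
  have : Set.range (Units.val : GL ι K → Matrix ι ι K) = {M | M.det ≠ 0} := by
    ext M
    exact ⟨by rintro ⟨g, rfl⟩; exact Matrix.GeneralLinearGroup.det_ne_zero g,
      fun h => ⟨glOfDet M h, rfl⟩⟩
  rw [this]
  exact (measurable_matrix_det (measurableSet_singleton 0)).compl

theorem range_val : Set.range (Units.val : GL ι K → Matrix ι ι K) = {M | M.det ≠ 0} := by
  ext M
  exact ⟨by rintro ⟨g, rfl⟩; exact Matrix.GeneralLinearGroup.det_ne_zero g,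
    fun h => ⟨glOfDet M h, rfl⟩⟩

variable (K ι) in
/-- The density `|det X| ^ (-d)` of the multiplicative Haar measure. -/
def glDensity (M : Matrix ι ι K) : ENNReal := ENNReal.ofReal ((‖M.det‖ ^ Fintype.card ι)⁻¹)

theorem measurable_glDensity : Measurable (glDensity K ι) :=
  ((measurable_matrix_det.norm.pow_const _).inv).ennreal_ofReal

theorem map_val_haarGL : (haarGL K ι).map Units.val =
    ((haarMatrix K ι ι).withDensity (glDensity K ι)).restrict {M | M.det ≠ 0} := by
  rw [haarGL, measurableEmbedding_val.map_comap, range_val]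
  rfl

instance : SigmaFinite ((haarMatrix K ι ι).withDensity (glDensity K ι)) :=
  SigmaFinite.withDensity_of_ne_top (by
    filter_upwards with M; exact ENNReal.ofReal_ne_top)

instance : SigmaFinite (haarGL K ι) := by
  have h : SigmaFinite ((haarGL K ι).map Units.val) := by
    rw [map_val_haarGL]; infer_instance
  exact SigmaFinite.of_map _ measurableEmbedding_val.measurable.aemeasurable h

/-- Requiring `F` to vanish on singular matrices makes it unnecessary to know whether they form a
null set. -/
theorem lintegral_haarGL (f : GL ι K → ENNReal) (F : Matrix ι ι K → ENNReal)
    (hf : ∀ g : GL ι K, F g.val = f g) (hF : ∀ M : Matrix ι ι K, M.det = 0 → F M = 0)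
    (hm : Measurable F) :
    ∫⁻ g, f g ∂(haarGL K ι) = ∫⁻ M, glDensity K ι M * F M ∂(haarMatrix K ι ι) := by
  have h1 : ∫⁻ g, f g ∂(haarGL K ι) = ∫⁻ M, F M ∂((haarGL K ι).map Units.val) := by
    rw [measurableEmbedding_val.lintegral_map]
    simp_rw [hf]
  rw [h1, map_val_haarGL, setLIntegral_eq_of_support_subset,
    lintegral_withDensity_eq_lintegral_mul _ measurable_glDensity hm]
  · rfl
  · intro M hM hM0
    exact hM (hF M hM0)

theorem haarK_closedBall_one : haarK K (Metric.closedBall 0 1) = 1 :=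
  Measure.addHaarMeasure_self (K₀ := ⟨⟨Metric.closedBall 0 1, isCompact_closedBall 0 1⟩,
      ⟨0, Metric.ball_subset_interior_closedBall (Metric.mem_ball_self one_pos)⟩⟩)

theorem haarMatrix_matLe (c : ι → ℝ) :
    haarMatrix K ι κ {M | ∀ i j, ‖M i j‖ ≤ c i} =
      ∏ i, haarK K (Metric.closedBall 0 (c i)) ^ Fintype.card κ := by
  have h : (Measure.pi fun _ : ι => Measure.pi fun _ : κ => haarK K)
      (Set.pi Set.univ fun i : ι => Set.pi Set.univ fun _ : κ => Metric.closedBall (0 : K) (c i)) =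
      ∏ i, haarK K (Metric.closedBall 0 (c i)) ^ Fintype.card κ := by
    simp [Measure.pi_pi]
  rw [setOf_entries_eq_pi c] at h
  exact h

theorem haarMatrix_matLe_one : haarMatrix K ι κ {M | MatLe 1 M} = 1 := by
  refine (haarMatrix_matLe (K := K) (κ := κ) (fun _ : ι => (1 : ℝ))).trans ?_
  simp [haarK_closedBall_one]

end Measure

end LocalZeta
end

noncomputable section
namespace LocalZeta

/-! ### Block LDU factorization near 1 and the Cartan decomposition. -/

section Factorizations

variable {K : Type*} [NontriviallyNormedField K] [IsNormalizedLocalField K]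

theorem submatrix_symm_mul {ι ι' : Type*} [Fintype ι] [Fintype ι'] (e : ι' ≃ ι)
    (M N : Matrix ι' ι' K) :
    (M * N).submatrix e.symm e.symm = M.submatrix e.symm e.symm * N.submatrix e.symm e.symm :=
  (Matrix.submatrix_mul_equiv M N e.symm e.symm e.symm).symm

theorem matLe_unit_block_sub_one {ι ι' : Type*} [DecidableEq ι] [DecidableEq ι'] {c : ℝ}
    (e : ι' ≃ ι) {M : Matrix ι' ι' K} (h : MatLe c (M - 1)) :
    MatLe c (M.submatrix e.symm e.symm - 1) := by
  have : M.submatrix e.symm e.symm - 1 = (M - 1).submatrix e.symm e.symm := by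
    rw [Matrix.submatrix_sub, Pi.sub_apply, Pi.sub_apply, Matrix.submatrix_one_equiv]
  rw [this]
  exact h.submatrix _ _

theorem matLe_fromBlocks_sub_one {ι ι' : Type*} [DecidableEq ι] [DecidableEq ι'] {c : ℝ}
    {A : Matrix ι ι K} {B : Matrix ι ι' K} {C : Matrix ι' ι K} {D : Matrix ι' ι' K}
    (hA : MatLe c (A - 1)) (hB : MatLe c B) (hC : MatLe c C) (hD : MatLe c (D - 1)) :
    MatLe c (Matrix.fromBlocks A B C D - 1) := by
  have : Matrix.fromBlocks A B C D - 1 = Matrix.fromBlocks (A - 1) B C (D - 1) := by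
    rw [← Matrix.fromBlocks_one, sub_eq_add_neg, Matrix.fromBlocks_neg, Matrix.fromBlocks_add]
    simp [sub_eq_add_neg]
  rw [this]
  exact hA.fromBlocks hB hC hD

/-- Block factorization into lower unipotent, block diagonal and upper unipotent matrices of a
matrix that is congruent to `1`. -/
theorem exists_ldu {c : ℝ} (hc0 : 0 ≤ c) (hc : c < 1) {α : Type*} [LinearOrder α] (n : ℕ) :
    ∀ {ι : Type*} [Fintype ι] [DecidableEq ι], Fintype.card ι = n →
    ∀ (b : ι → α) (M : Matrix ι ι K), MatLe c (M - 1) →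
    ∃ L D U : Matrix ι ι K, M = L * D * U ∧
      (∀ i j, ¬ b i > b j → L i j = (1 : Matrix ι ι K) i j) ∧ (∀ i j, b i ≠ b j → D i j = 0) ∧
      (∀ i j, ¬ b i < b j → U i j = (1 : Matrix ι ι K) i j) ∧
      MatLe c (L - 1) ∧ MatLe c (D - 1) ∧ MatLe c (U - 1) := by
  induction n using Nat.strong_induction_on with
  | _ n ih =>
  intro ι _ _ hn b M hM
  classical
  rcases isEmpty_or_nonempty ι with hι | hι
  · exact ⟨1, 1, 1, Subsingleton.elim _ _, fun i => isEmptyElim i, fun i => isEmptyElim i,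
      fun i => isEmptyElim i, fun i => isEmptyElim i, fun i => isEmptyElim i, fun i => isEmptyElim i⟩
  -- Induction on the size: split off the block where `b` is minimal and eliminate with it.
  obtain ⟨i₀, hi₀⟩ := Finite.exists_min b
  let p : ι → Prop := fun i => b i = b i₀
  let e : {i // p i} ⊕ {i // ¬ p i} ≃ ι := Equiv.sumCompl p
  have hMe : MatLe c (M.submatrix e e - 1) := matLe_unit_block_sub_one e.symm hM
  set A := (M.submatrix e e).toBlocks₁₁ with hA
  set B := (M.submatrix e e).toBlocks₁₂ with hB
  set C := (M.submatrix e e).toBlocks₂₁ with hC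
  set D := (M.submatrix e e).toBlocks₂₂ with hD
  have hblocks : M.submatrix e e = Matrix.fromBlocks A B C D :=
    (Matrix.fromBlocks_toBlocks _).symm
  have hA1 : MatLe c (A - 1) := fun i j => by
    have := hMe (Sum.inl i) (Sum.inl j)
    simpa [A, Matrix.toBlocks₁₁, Matrix.one_apply] using this
  have hD1 : MatLe c (D - 1) := fun i j => by
    have := hMe (Sum.inr i) (Sum.inr j)
    simpa [D, Matrix.toBlocks₂₂, Matrix.one_apply] using this
  have hB1 : MatLe c B := fun i j => by
    have := hMe (Sum.inl i) (Sum.inr j)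
    simpa [B, Matrix.toBlocks₁₂, Matrix.one_apply] using this
  have hC1 : MatLe c C := fun i j => by
    have := hMe (Sum.inr i) (Sum.inl j)
    simpa [C, Matrix.toBlocks₂₁, Matrix.one_apply] using this
  obtain ⟨g, hg, hgi⟩ := exists_gl_of_sub_one hc0 hc hA1
  have hginv := (mem_intGL_iff.1 hgi).2
  have hAg : A * (g⁻¹).val = 1 := by rw [← hg, ← Units.val_mul, mul_inv_cancel, Units.val_one]
  have hgA : (g⁻¹).val * A = 1 := by rw [← hg, ← Units.val_mul, inv_mul_cancel, Units.val_one]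
  -- The Schur complement is again congruent to 1, so the induction hypothesis applies to it.
  have hS : MatLe c (D - C * (g⁻¹).val * B - 1) := by
    have : D - C * (g⁻¹).val * B - 1 = (D - 1) - C * (g⁻¹).val * B := by abel
    rw [this]
    exact hD1.sub ((hC1.mul_right hc0 hginv).mul_right hc0 (hB1.mono hc.le))
  have hcard : Fintype.card {i // ¬ p i} < n := by
    rw [← hn]
    exact Fintype.card_subtype_lt (x := i₀) (fun h => h rfl)
  obtain ⟨L', D', U', hLDU, hL', hD', hU', hL1, hD1', hU1⟩ :=
    ih _ hcard rfl (fun i : {i // ¬ p i} => b i) _ hS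
  have hbl : ∀ i : {i // p i}, b i = b i₀ := fun i => i.2
  have hbr : ∀ i : {i // ¬ p i}, b i₀ < b i := fun i => lt_of_le_of_ne (hi₀ i) fun h => i.2 h.symm
  refine ⟨(Matrix.fromBlocks 1 0 (C * (g⁻¹).val) L').submatrix e.symm e.symm,
    (Matrix.fromBlocks A 0 0 D').submatrix e.symm e.symm,
    (Matrix.fromBlocks 1 ((g⁻¹).val * B) 0 U').submatrix e.symm e.symm, ?_, ?_, ?_, ?_, ?_, ?_, ?_⟩
  · rw [← submatrix_symm_mul, ← submatrix_symm_mul, Matrix.fromBlocks_multiply,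
      Matrix.fromBlocks_multiply]
    have h1 : C * (g⁻¹).val * A = C := by rw [Matrix.mul_assoc, hgA, Matrix.mul_one]
    have h2 : A * ((g⁻¹).val * B) = B := by rw [← Matrix.mul_assoc, hAg, Matrix.one_mul]
    simp only [Matrix.one_mul, Matrix.zero_mul, Matrix.mul_zero, add_zero, zero_add, Matrix.mul_one,
      h1, h2]
    rw [← hLDU, ← Matrix.mul_assoc]
    have h3 : C * (g⁻¹).val * B + (D - C * (g⁻¹).val * B) = D := by abel
    rw [h3, ← hblocks, Matrix.submatrix_submatrix]
    simp
  · intro i j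
    obtain ⟨i, rfl⟩ := e.surjective i
    obtain ⟨j, rfl⟩ := e.surjective j
    rw [Matrix.submatrix_apply, e.symm_apply_apply, e.symm_apply_apply,
      ← Matrix.submatrix_apply (1 : Matrix ι ι K) e e, Matrix.submatrix_one_equiv]
    rcases i with i | i <;> rcases j with j | j <;> intro h
    · simp [Matrix.one_apply]
    · simp
    · exact absurd (show b i > b j by rw [hbl j]; exact hbr i) h
    · simpa [Matrix.one_apply] using hL' i j h
  · intro i j
    obtain ⟨i, rfl⟩ := e.surjective i
    obtain ⟨j, rfl⟩ := e.surjective j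
    rw [Matrix.submatrix_apply, e.symm_apply_apply, e.symm_apply_apply]
    rcases i with i | i <;> rcases j with j | j <;> intro h
    · exact absurd ((hbl i).trans (hbl j).symm) h
    · simp
    · simp
    · simpa using hD' i j h
  · intro i j
    obtain ⟨i, rfl⟩ := e.surjective i
    obtain ⟨j, rfl⟩ := e.surjective j
    rw [Matrix.submatrix_apply, e.symm_apply_apply, e.symm_apply_apply,
      ← Matrix.submatrix_apply (1 : Matrix ι ι K) e e, Matrix.submatrix_one_equiv]
    rcases i with i | i <;> rcases j with j | j <;> intro h
    · simp [Matrix.one_apply]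
    · exact absurd (show b i < b j by rw [hbl i]; exact hbr j) h
    · simp
    · simpa [Matrix.one_apply] using hU' i j h
  · refine matLe_unit_block_sub_one e (matLe_fromBlocks_sub_one ?_ (MatLe.zero hc0)
      (hC1.mul_right hc0 hginv) hL1)
    simpa using MatLe.zero hc0
  · exact matLe_unit_block_sub_one e (matLe_fromBlocks_sub_one hA1 (MatLe.zero hc0)
      (MatLe.zero hc0) hD1')
  · refine matLe_unit_block_sub_one e (matLe_fromBlocks_sub_one ?_
      (MatLe.mul_left hc0 hginv hB1) (MatLe.zero hc0) hU1)
    simpa using MatLe.zero hc0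

/-- Every matrix is diagonal up to integral invertible matrices on both sides. -/
theorem exists_integral_diagonal (n : ℕ) :
    ∀ {ι : Type*} [Fintype ι] [DecidableEq ι], Fintype.card ι = n → ∀ M : Matrix ι ι K,
    ∃ (k₁ k₂ : Matrix ι ι K) (d : ι → K), M = k₁ * Matrix.diagonal d * k₂ ∧
      MatLe 1 k₁ ∧ ‖k₁.det‖ = 1 ∧ MatLe 1 k₂ ∧ ‖k₂.det‖ = 1 := by
  induction n using Nat.strong_induction_on with
  | _ n ih =>
  intro ι _ _ hn M
  classical
  by_cases hM : M = 0
  · exact ⟨1, 1, 0, by simp [hM], MatLe.one, by simp, MatLe.one, by simp⟩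
  have hne : Nonempty (ι × ι) := by
    by_contra h
    rw [not_nonempty_iff] at h
    exact hM (by ext i j; exact h.elim (i, j))
  -- Pivoting on an entry of maximal norm keeps the elimination integral; the transposition `σ`
  -- brings the pivot to the diagonal.
  obtain ⟨⟨i₀, j₀⟩, hmax⟩ := Finite.exists_max fun x : ι × ι => ‖M x.1 x.2‖
  simp only [Prod.forall] at hmax
  set x := M i₀ j₀ with hx
  have hx0 : x ≠ 0 := by
    intro h
    apply hM
    ext i j
    have := hmax i j
    rw [h, norm_zero] at this
    simpa using this
  let σ := Equiv.swap i₀ j₀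
  let p : ι → Prop := fun i => i = i₀
  let e : {i // p i} ⊕ {i // ¬ p i} ≃ ι := Equiv.sumCompl p
  let N : Matrix ι ι K := M.submatrix id σ
  have hN : ∀ i j, ‖N i j‖ ≤ ‖x‖ := fun i j => hmax _ _
  set B := (N.submatrix e e).toBlocks₁₂ with hB
  set C := (N.submatrix e e).toBlocks₂₁ with hC
  set D := (N.submatrix e e).toBlocks₂₂ with hD
  have hA : (N.submatrix e e).toBlocks₁₁ = Matrix.diagonal fun _ => x := by
    ext ⟨i, hi⟩ ⟨j, hj⟩
    have hi' : i = i₀ := hi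
    have hj' : j = i₀ := hj
    simp [Matrix.toBlocks₁₁, N, e, σ, x, hi', hj']
  have hblocks : N.submatrix e e = Matrix.fromBlocks (Matrix.diagonal fun _ => x) B C D := by
    rw [← hA]; exact (Matrix.fromBlocks_toBlocks _).symm
  have hB1 : MatLe 1 (x⁻¹ • B) := fun i j => by
    rw [Matrix.smul_apply, smul_eq_mul, norm_mul, norm_inv, inv_mul_le_iff₀ (norm_pos_iff.2 hx0),
      mul_one]
    exact hN _ _
  have hC1 : MatLe 1 (x⁻¹ • C) := fun i j => by
    rw [Matrix.smul_apply, smul_eq_mul, norm_mul, norm_inv, inv_mul_le_iff₀ (norm_pos_iff.2 hx0),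
      mul_one]
    exact hN _ _
  have hcard : Fintype.card {i // ¬ p i} < n := by
    rw [← hn]
    exact Fintype.card_subtype_lt (x := i₀) (fun h => h rfl)
  obtain ⟨k₁, k₂, d, hkd, hk₁, hk₁', hk₂, hk₂'⟩ :=
    ih _ hcard rfl (D - x⁻¹ • (C * B))
  refine ⟨(Matrix.fromBlocks 1 0 (x⁻¹ • C) k₁).submatrix e.symm e.symm,
    ((Matrix.fromBlocks 1 (x⁻¹ • B) 0 k₂).submatrix e.symm e.symm).submatrix id σ,
    Sum.elim (fun _ => x) d ∘ e.symm, ?_, ?_, ?_, ?_, ?_⟩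
  · have h1 : (Matrix.fromBlocks 1 0 (x⁻¹ • C) k₁ *
        Matrix.diagonal (Sum.elim (fun _ => x) d) *
        Matrix.fromBlocks 1 (x⁻¹ • B) 0 k₂).submatrix e.symm e.symm = N := by
      rw [← Matrix.fromBlocks_diagonal, Matrix.fromBlocks_multiply, Matrix.fromBlocks_multiply]
      have hd : (Matrix.diagonal fun _ : {i // p i} => x) = x • 1 := by
        rw [Matrix.smul_one_eq_diagonal]
      simp only [hd, Matrix.one_mul, Matrix.zero_mul, Matrix.mul_zero, add_zero, zero_add,
        Matrix.mul_one, Matrix.smul_mul, Matrix.mul_smul, smul_smul, mul_inv_cancel₀ hx0,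
        inv_mul_cancel₀ hx0, one_smul]
      rw [← hkd, add_sub_cancel, ← hd, ← hblocks, Matrix.submatrix_submatrix]
      simp
    have h2 : M = N.submatrix id σ := by
      ext i j; simp [N, σ]
    rw [h2, ← h1, submatrix_symm_mul, submatrix_symm_mul]
    have h3 : Matrix.diagonal (Sum.elim (fun _ => x) d ∘ e.symm) =
        (Matrix.diagonal (Sum.elim (fun _ => x) d)).submatrix e.symm e.symm :=
      (Matrix.submatrix_diagonal_equiv _ _).symm
    rw [h3]
    ext i j
    simp [Matrix.mul_apply, Matrix.submatrix_apply]
  · exact (MatLe.one.fromBlocks (MatLe.zero zero_le_one) hC1 hk₁).submatrix _ _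
  · rw [Matrix.det_submatrix_equiv_self, Matrix.det_fromBlocks_zero₁₂]
    simpa using hk₁'
  · exact ((MatLe.one.fromBlocks hB1 (MatLe.zero zero_le_one) hk₂).submatrix _ _).submatrix _ _
  · rw [Matrix.det_permute', norm_mul, Matrix.det_submatrix_equiv_self,
      Matrix.det_fromBlocks_zero₂₁]
    have h1 : ‖((Equiv.Perm.sign σ : ℤ) : K)‖ = 1 := by
      rcases Int.units_eq_one_or (Equiv.Perm.sign σ) with h | h <;> simp [h]
    simpa [h1] using hk₂'

variable {ι : Type*} [Fintype ι] [DecidableEq ι]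

/-- The invertible diagonal matrix with entries `ϖ ^ m i`. -/
def diagPow (ϖ : Kˣ) (m : ι → ℤ) : GL ι K :=
  ⟨Matrix.diagonal fun i => (ϖ : K) ^ m i, Matrix.diagonal fun i => (ϖ : K) ^ (-m i),
    by simp only [Matrix.diagonal_mul_diagonal, ← zpow_add₀ ϖ.ne_zero]; simp,
    by simp only [Matrix.diagonal_mul_diagonal, ← zpow_add₀ ϖ.ne_zero]; simp⟩

theorem diagPow_val (ϖ : Kˣ) (m : ι → ℤ) :
    (diagPow ϖ m).val = Matrix.diagonal fun i => (ϖ : K) ^ m i := rfl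

theorem diagPow_inv_val (ϖ : Kˣ) (m : ι → ℤ) :
    ((diagPow ϖ m)⁻¹).val = Matrix.diagonal fun i => (ϖ : K) ^ (-m i) := rfl

theorem diagPow_add (ϖ : Kˣ) (m m' : ι → ℤ) :
    diagPow ϖ (m + m') = diagPow ϖ m * diagPow ϖ m' := by
  ext1
  simp [diagPow_val, Matrix.diagonal_mul_diagonal, zpow_add₀ ϖ.ne_zero]

/-- Cartan decomposition. -/
theorem exists_cartan {ϖ : Kˣ} (h1 : ‖(ϖ : K)‖ < 1)
    (hmax : ∀ x : K, ‖x‖ < 1 → ‖x‖ ≤ ‖(ϖ : K)‖) (g : GL ι K) :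
    ∃ k₁ ∈ intGL K ι, ∃ k₂ ∈ intGL K ι, ∃ m : ι → ℤ, g = k₁ * diagPow ϖ m * k₂ := by
  obtain ⟨k₁, k₂, d, hg, hk₁, hk₁', hk₂, hk₂'⟩ := exists_integral_diagonal _ rfl g.val
  have hdet : g.val.det ≠ 0 := Matrix.GeneralLinearGroup.det_ne_zero g
  have hd : ∀ i, d i ≠ 0 := by
    intro i hi
    apply hdet
    rw [hg, Matrix.det_mul, Matrix.det_mul, Matrix.det_diagonal,
      Finset.prod_eq_zero (Finset.mem_univ i) hi]
    simp
  have hϖ : 0 < ‖(ϖ : K)‖ := norm_pos_iff.2 ϖ.ne_zero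
  -- Each diagonal entry is a power of `ϖ` times a unit, and the units are absorbed into the left
  -- integral factor.
  choose m hm using fun i => exists_norm_eq_zpow (hd i) hϖ h1 hmax
  have hu : ∀ i, ‖d i * (ϖ : K) ^ (-m i)‖ = 1 := fun i => by
    rw [norm_mul, hm, norm_zpow, ← zpow_add₀ hϖ.ne']
    simp
  have ne1 : k₁.det ≠ 0 := norm_pos_iff.1 (by rw [hk₁']; exact one_pos)
  have ne2 : k₂.det ≠ 0 := norm_pos_iff.1 (by rw [hk₂']; exact one_pos)
  have hdu : ‖(Matrix.diagonal fun i => d i * (ϖ : K) ^ (-m i)).det‖ = 1 := by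
    rw [Matrix.det_diagonal, norm_prod]
    exact Finset.prod_eq_one fun i _ => hu i
  have hdu' : MatLe 1 (Matrix.diagonal fun i => d i * (ϖ : K) ^ (-m i)) := fun i j => by
    rw [Matrix.diagonal_apply]
    split_ifs
    · exact (hu i).le
    · simp
  refine ⟨glOfDet k₁ ne1 * glOfDet (Matrix.diagonal fun i => d i * (ϖ : K) ^ (-m i))
    (norm_pos_iff.1 (by rw [hdu]; exact one_pos)), mul_mem (mem_intGL_iff_det.2 ⟨hk₁, hk₁'⟩)
    (mem_intGL_iff_det.2 ⟨hdu', hdu⟩), glOfDet k₂ ne2, mem_intGL_iff_det.2 ⟨hk₂, hk₂'⟩, m, ?_⟩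
  ext1
  simp only [Units.val_mul, glOfDet_val, diagPow_val]
  rw [hg, Matrix.mul_assoc k₁ (Matrix.diagonal fun i => d i * (ϖ : K) ^ (-m i)),
    Matrix.diagonal_mul_diagonal]
  congr 3
  ext1 i
  rw [mul_assoc, ← zpow_add₀ ϖ.ne_zero]
  simp

end Factorizations

end LocalZeta
end

noncomputable section
namespace LocalZeta

/-! ### Scaling of Haar measure under matrix multiplication. -/

section Modulus

/-- Uniqueness of Haar measure gives proportionality, and one set of `ν`-measure 1 reads off the
constant. -/
theorem map_continuousAddEquiv_eq_smul {G H : Type*} [AddGroup G] [TopologicalSpace G]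
    [IsTopologicalAddGroup G] [MeasurableSpace G] [BorelSpace G] [AddGroup H] [TopologicalSpace H]
    [IsTopologicalAddGroup H] [MeasurableSpace H] [BorelSpace H] [LocallyCompactSpace H]
    [SecondCountableTopology H] (μ : Measure G) [μ.IsAddHaarMeasure] (ν : Measure H)
    [ν.IsAddHaarMeasure] (φ : G ≃ₜ+ H) {S : Set H} (hS : MeasurableSet S) (hν : ν S = 1) :
    μ.map φ = μ (φ ⁻¹' S) • ν := by
  have h1 : (μ.map φ).IsAddHaarMeasure := φ.isAddHaarMeasure_map μ
  have h2 := Measure.isAddLeftInvariant_eq_smul (μ.map φ) ν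
  have h3 := congrArg (fun m : Measure H => m S) h2
  simp only [Measure.smul_apply, hν] at h3
  have hc : Measurable φ := φ.continuous.measurable
  rw [Measure.map_apply hc hS] at h3
  rw [h3]
  refine h2.trans ?_
  generalize (μ.map φ).addHaarScalarFactor ν = c
  rw [smul_assoc, one_smul]

variable {K : Type*} [NontriviallyNormedField K] [IsNormalizedLocalField K]
  [MeasurableSpace K] [BorelSpace K]

theorem residue_eq_zero_iff_norm {x : integers K} :
    IsLocalRing.residue (integers K) x = 0 ↔ ‖(x : K)‖ < 1 := by
  rw [IsLocalRing.residue_eq_zero_iff, IsLocalRing.mem_maximalIdeal, mem_nonunits_iff]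
  constructor
  · intro hx
    refine lt_of_le_of_ne (mem_integers_iff.1 x.2) fun h => hx ?_
    have hx0 : (x : K) ≠ 0 := by
      rw [← norm_pos_iff, h]; exact one_pos
    refine IsUnit.of_mul_eq_one ⟨(x : K)⁻¹, mem_integers_iff.2 (by rw [norm_inv, h, inv_one])⟩ ?_
    ext
    simp [hx0]
  · rintro hx ⟨u, rfl⟩
    have h1 : (u.1 : K) * ((u⁻¹ : (integers K)ˣ).1 : K) = 1 := congrArg Subtype.val u.mul_inv
    have h2 := mem_integers_iff.1 (u⁻¹ : (integers K)ˣ).1.2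
    have h3 : ‖(u.1 : K)‖ * ‖((u⁻¹ : (integers K)ˣ).1 : K)‖ = 1 := by
      rw [← norm_mul, h1, norm_one]
    nlinarith [norm_nonneg (u.1 : K)]

/-- The unit ball is a disjoint union of translates of the maximal ideal, one for each residue
class, so its measure 1 is shared equally among them. -/
theorem haarK_uniformizer {ϖ : K} (hϖ : ‖ϖ‖ = ((residueCard K : ℕ) : ℝ)⁻¹) (h1 : ‖ϖ‖ < 1)
    (hmax : ∀ x : K, ‖x‖ < 1 → ‖x‖ ≤ ‖ϖ‖) :
    haarK K (Metric.closedBall 0 ‖ϖ‖) = ENNReal.ofReal ‖ϖ‖ := by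
  let R := IsLocalRing.ResidueField (integers K)
  have hq := one_lt_residueCard K
  have hq0 : residueCard K ≠ 0 := by
    intro h; rw [h] at hq; norm_num at hq
  have hfin : Finite R := Nat.finite_of_card_ne_zero hq0
  have := Fintype.ofFinite R
  obtain ⟨s, hs⟩ := (IsLocalRing.residue_surjective (R := integers K)).hasRightInverse
  have hunion : Metric.closedBall (0 : K) 1 =
      ⋃ r : R, (fun x => -(s r : K) + x) ⁻¹' Metric.closedBall 0 ‖ϖ‖ := by
    ext x
    simp only [mem_closedBall_zero_iff, Set.mem_iUnion, Set.mem_preimage]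
    constructor
    · intro hx
      refine ⟨IsLocalRing.residue _ ⟨x, mem_integers_iff.2 hx⟩, hmax _ ?_⟩
      refine (residue_eq_zero_iff_norm (x := -s _ + ⟨x, mem_integers_iff.2 hx⟩)).1 ?_
      rw [map_add, map_neg, hs]
      simp
    · rintro ⟨r, hr⟩
      have : x = s r + (-(s r : K) + x) := by ring
      rw [this]
      exact norm_add_le_of_le (mem_integers_iff.1 (s r).2) (hr.trans h1.le)
  have hdisj : Pairwise (Function.onFun Disjoint
      fun r : R => (fun x => -(s r : K) + x) ⁻¹' Metric.closedBall 0 ‖ϖ‖) := by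
    intro r r' hrr
    refine Set.disjoint_left.2 fun x hx hx' => hrr ?_
    simp only [mem_closedBall_zero_iff, Set.mem_preimage] at hx hx'
    have h2 : ‖((s r - s r' : integers K) : K)‖ < 1 := by
      have : ((s r - s r' : integers K) : K) = (-(s r' : K) + x) - (-(s r : K) + x) := by
        push_cast; ring
      rw [this]
      refine lt_of_le_of_lt ?_ h1
      rw [sub_eq_add_neg]
      exact norm_add_le_of_le hx' (by rwa [norm_neg])
    rw [← residue_eq_zero_iff_norm, map_sub, hs, hs, sub_eq_zero] at h2
    exact h2
  have hm : haarK K (Metric.closedBall 0 1) = residueCard K * haarK K (Metric.closedBall 0 ‖ϖ‖) := by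
    rw [hunion, measure_iUnion hdisj fun r =>
      (measurable_const_add _) Metric.isClosed_closedBall.measurableSet]
    simp only [measure_preimage_add]
    rw [tsum_fintype, Finset.sum_const, Finset.card_univ, nsmul_eq_mul, residueCard,
      Nat.card_eq_fintype_card]
  rw [haarK_closedBall_one] at hm
  rw [hϖ, ENNReal.ofReal_inv_of_pos (by positivity), ENNReal.ofReal_natCast]
  rw [← hϖ]
  exact ENNReal.eq_inv_of_mul_eq_one_left (by rw [mul_comm]; exact hm.symm)

/-- Multiplication by a nonzero scalar as a homeomorphic automorphism of the additive group. -/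
def mulEquivK (y : Kˣ) : K ≃ₜ+ K where
  toFun x := y * x
  invFun x := (y⁻¹ : Kˣ) * x
  left_inv x := by simp
  right_inv x := by simp
  map_add' _ _ := mul_add _ _ _
  continuous_toFun := by fun_prop
  continuous_invFun := by fun_prop

theorem haarK_closedBall_mul (y : Kˣ) (c : ℝ) :
    haarK K (Metric.closedBall 0 (‖(y : K)‖⁻¹ * c)) =
      haarK K (Metric.closedBall 0 ‖(y : K)‖⁻¹) * haarK K (Metric.closedBall 0 c) := by
  have h := map_continuousAddEquiv_eq_smul (haarK K) (haarK K) (mulEquivK y)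
    Metric.isClosed_closedBall.measurableSet haarK_closedBall_one
  have hpre : ∀ d : ℝ, mulEquivK y ⁻¹' Metric.closedBall 0 d =
      Metric.closedBall 0 (‖(y : K)‖⁻¹ * d) := by
    intro d
    ext x
    have hy : 0 < ‖(y : K)‖ := norm_pos_iff.2 y.ne_zero
    simp only [Set.mem_preimage, mem_closedBall_zero_iff]
    change ‖(y : K) * x‖ ≤ d ↔ _
    rw [norm_mul, le_inv_mul_iff₀ hy]
  have h2 := congrArg (fun m : Measure K => m (Metric.closedBall 0 c)) h
  simp only [Measure.smul_apply, smul_eq_mul] at h2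
  have hc : Measurable (mulEquivK y) := (mulEquivK y).continuous.measurable
  rw [Measure.map_apply hc
    Metric.isClosed_closedBall.measurableSet, hpre, hpre, mul_one] at h2
  exact h2

theorem haarK_closedBall_zpow {ϖ : Kˣ} (hϖ : ‖(ϖ : K)‖ = ((residueCard K : ℕ) : ℝ)⁻¹)
    (h1 : ‖(ϖ : K)‖ < 1) (hmax : ∀ x : K, ‖x‖ < 1 → ‖x‖ ≤ ‖(ϖ : K)‖) (m : ℤ) :
    haarK K (Metric.closedBall 0 (‖(ϖ : K)‖ ^ m)) = ENNReal.ofReal (‖(ϖ : K)‖ ^ m) := by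
  have h0 : 0 < ‖(ϖ : K)‖ := norm_pos_iff.2 ϖ.ne_zero
  have hu := haarK_uniformizer hϖ h1 hmax
  have up : ∀ c : ℝ, haarK K (Metric.closedBall 0 (‖(ϖ : K)‖ * c)) =
      ENNReal.ofReal ‖(ϖ : K)‖ * haarK K (Metric.closedBall 0 c) := fun c => by
    have := haarK_closedBall_mul ϖ⁻¹ c
    simp only [Units.val_inv_eq_inv_val, norm_inv, inv_inv] at this
    rw [this, hu]
  have ne0 : ENNReal.ofReal ‖(ϖ : K)‖ ≠ 0 := by simp
  induction m using Int.induction_on with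
  | zero => simpa using haarK_closedBall_one
  | succ n ih => rw [zpow_add_one₀ h0.ne', mul_comm, up, ih, ENNReal.ofReal_mul h0.le]
  | pred n ih =>
    have h2 := up (‖(ϖ : K)‖ ^ (-(n : ℤ) - 1))
    have h3 : ‖(ϖ : K)‖ * ‖(ϖ : K)‖ ^ (-(n : ℤ) - 1) = ‖(ϖ : K)‖ ^ (-(n : ℤ)) := by
      rw [mul_comm, ← zpow_add_one₀ h0.ne']; congr 1; ring
    rw [h3, ih, ← h3, ENNReal.ofReal_mul h0.le] at h2
    exact ((ENNReal.mul_right_inj ne0 ENNReal.ofReal_ne_top).1 h2).symm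

variable {ι κ : Type*} [Fintype ι] [Fintype κ] [DecidableEq ι] [DecidableEq κ]

theorem measurableSet_matLe (c : ℝ) : MeasurableSet {M : Matrix ι κ K | MatLe c M} :=
  (isClosed_matLe c).measurableSet

/-- Left multiplication by an invertible matrix. -/
def mulLeftEquiv (κ : Type*) [Fintype κ] (g : GL ι K) : Matrix ι κ K ≃ₜ+ Matrix ι κ K where
  toFun M := g.val * M
  invFun M := (g⁻¹).val * M
  left_inv M := by beta_reduce; rw [← Matrix.mul_assoc, ← Units.val_mul]; simp
  right_inv M := by beta_reduce; rw [← Matrix.mul_assoc, ← Units.val_mul]; simp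
  map_add' _ _ := Matrix.mul_add _ _ _
  continuous_toFun := by fun_prop
  continuous_invFun := by fun_prop

/-- Transposition. -/
def transposeEquiv (K : Type*) [NontriviallyNormedField K] (ι κ : Type*) :
    Matrix ι κ K ≃ₜ+ Matrix κ ι K where
  toFun M := Mᵀ
  invFun M := Mᵀ
  left_inv M := Matrix.transpose_transpose M
  right_inv M := Matrix.transpose_transpose M
  map_add' _ _ := Matrix.transpose_add _ _
  continuous_toFun := continuous_id.matrix_transpose
  continuous_invFun := continuous_id.matrix_transpose

/-- Transposition preserves the integral matrices, so the constant of proportionality is 1. -/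
theorem map_transpose_haarMatrix :
    (haarMatrix K ι κ).map Matrix.transpose = haarMatrix K κ ι := by
  have h := map_continuousAddEquiv_eq_smul (haarMatrix K ι κ) (haarMatrix K κ ι)
    (transposeEquiv K ι κ) (measurableSet_matLe 1) haarMatrix_matLe_one
  have h2 : transposeEquiv K ι κ ⁻¹' {M | MatLe 1 M} = {M | MatLe 1 M} := by
    ext M
    exact ⟨fun h => h.transpose, fun h => h.transpose⟩
  rw [h2, haarMatrix_matLe_one, one_smul] at h
  exact h

/-- Both sides are multiplicative in `g`, so the Cartan decomposition leaves two cases. Integral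
invertible matrices preserve the lattice of integral matrices; for powers of a uniformizer on the
diagonal, the preimage of that lattice is a product of balls of known volume. -/
theorem map_mul_left_haarMatrix (g : GL ι K) :
    (haarMatrix K ι κ).map (fun M => g.val * M) =
      ENNReal.ofReal ((‖g.val.det‖ ^ Fintype.card κ)⁻¹) • haarMatrix K ι κ := by
  have hmeas : ∀ g : GL ι K, Measurable fun M : Matrix ι κ K => g.val * M :=
    fun g => (mulLeftEquiv κ g).continuous.measurable
  have hmap : ∀ g : GL ι K, (haarMatrix K ι κ).map (fun M => g.val * M) =
      haarMatrix K ι κ {M | MatLe 1 (g.val * M)} • haarMatrix K ι κ := fun g =>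
    map_continuousAddEquiv_eq_smul (haarMatrix K ι κ) (haarMatrix K ι κ)
      (mulLeftEquiv κ g) (measurableSet_matLe 1) haarMatrix_matLe_one
  have hmul : ∀ g h : GL ι K,
      (haarMatrix K ι κ).map (fun M => g.val * M) =
        ENNReal.ofReal ((‖g.val.det‖ ^ Fintype.card κ)⁻¹) • haarMatrix K ι κ →
      (haarMatrix K ι κ).map (fun M => h.val * M) =
        ENNReal.ofReal ((‖h.val.det‖ ^ Fintype.card κ)⁻¹) • haarMatrix K ι κ →
      (haarMatrix K ι κ).map (fun M => (g * h).val * M) =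
        ENNReal.ofReal ((‖(g * h).val.det‖ ^ Fintype.card κ)⁻¹) • haarMatrix K ι κ := by
    intro g h hg hh
    have e : (fun M : Matrix ι κ K => (g * h).val * M) =
        (fun M => g.val * M) ∘ fun M => h.val * M := by
      funext M; simp [Matrix.mul_assoc]
    rw [e, ← Measure.map_map (hmeas g) (hmeas h), hh, Measure.map_smul, hg, smul_smul,
      ← ENNReal.ofReal_mul (by positivity), ← mul_inv, ← mul_pow, ← norm_mul, ← Matrix.det_mul,
      ← Units.val_mul, Units.val_mul, Units.val_mul, Matrix.det_mul, Matrix.det_mul, mul_comm]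
  have hint : ∀ k ∈ intGL K ι, (haarMatrix K ι κ).map (fun M => k.val * M) =
      ENNReal.ofReal ((‖k.val.det‖ ^ Fintype.card κ)⁻¹) • haarMatrix K ι κ := by
    intro k hk
    have : {M : Matrix ι κ K | MatLe 1 (k.val * M)} = {M | MatLe 1 M} := by
      ext M
      refine ⟨fun h => ?_, fun h => MatLe.mul_left zero_le_one (mem_intGL_iff.1 hk).1 h⟩
      have h2 := MatLe.mul_left zero_le_one (mem_intGL_iff.1 hk).2 h
      rwa [← Matrix.mul_assoc, ← Units.val_mul, inv_mul_cancel, Units.val_one,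
        Matrix.one_mul] at h2
    rw [hmap, this, haarMatrix_matLe_one, (mem_intGL_iff_det.1 hk).2]
    simp
  obtain ⟨ϖ, hϖ, h0, h1, hmax⟩ := exists_uniformizer K
  obtain ⟨ϖ, rfl⟩ : ∃ u : Kˣ, (u : K) = ϖ := ⟨Units.mk0 ϖ (norm_pos_iff.1 h0), rfl⟩
  obtain ⟨k₁, hk₁, k₂, hk₂, m, rfl⟩ := exists_cartan h1 hmax g
  refine hmul _ _ (hmul _ _ (hint k₁ hk₁) ?_) (hint k₂ hk₂)
  have hset : {M : Matrix ι κ K | MatLe 1 ((diagPow ϖ m).val * M)} =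
      {M | ∀ i j, ‖M i j‖ ≤ ‖(ϖ : K)‖ ^ (-m i)} := by
    ext M
    refine forall_congr' fun i => forall_congr' fun j => ?_
    rw [diagPow_val, Matrix.diagonal_mul, norm_mul, norm_zpow, zpow_neg,
      ← one_div, le_div_iff₀' (zpow_pos h0 _)]
  rw [hmap, hset, haarMatrix_matLe]
  congr 1
  simp_rw [haarK_closedBall_zpow hϖ h1 hmax]
  rw [diagPow_val, Matrix.det_diagonal, norm_prod, ← Finset.prod_pow, ← Finset.prod_inv_distrib,
    ENNReal.ofReal_prod_of_nonneg (fun i _ => by positivity)]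
  refine Finset.prod_congr rfl fun i _ => ?_
  rw [norm_zpow, zpow_neg, ← ENNReal.ofReal_pow (by positivity), inv_pow]

theorem map_mul_right_haarMatrix (g : GL ι K) :
    (haarMatrix K κ ι).map (fun M => M * g.val) =
      ENNReal.ofReal ((‖g.val.det‖ ^ Fintype.card κ)⁻¹) • haarMatrix K κ ι := by
  let g' : GL ι K := glOfDet g.valᵀ (by
    rw [Matrix.det_transpose]; exact Matrix.GeneralLinearGroup.det_ne_zero g)
  have e : (fun M : Matrix κ ι K => M * g.val) =
      Matrix.transpose ∘ (fun M => g'.val * M) ∘ Matrix.transpose := by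
    funext M; simp [g']
  have m1 : Measurable (Matrix.transpose : Matrix κ ι K → Matrix ι κ K) :=
    (transposeEquiv K κ ι).continuous.measurable
  have m2 : Measurable (Matrix.transpose : Matrix ι κ K → Matrix κ ι K) :=
    (transposeEquiv K ι κ).continuous.measurable
  have m3 : Measurable fun M : Matrix ι κ K => g'.val * M :=
    (mulLeftEquiv κ g').continuous.measurable
  rw [e, ← Measure.map_map m2 (m3.comp m1), ← Measure.map_map m3 m1, map_transpose_haarMatrix,
    map_mul_left_haarMatrix, Measure.map_smul, map_transpose_haarMatrix]
  simp [g']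

theorem haarGL_apply (s : Set (GL ι K)) (hs : MeasurableSet s) :
    haarGL K ι s = ∫⁻ M in Units.val '' s, glDensity K ι M ∂(haarMatrix K ι ι) := by
  rw [haarGL, measurableEmbedding_val.comap_apply, withDensity_apply]
  · rfl
  · exact measurableEmbedding_val.measurableSet_image.2 hs

/-- The density absorbs exactly the factor by which left multiplication scales the additive measure
on square matrices. -/
instance : (haarGL K ι).IsMulLeftInvariant := by
  refine ⟨fun g => Measure.ext fun s hs => ?_⟩
  have hg : Measurable fun h : GL ι K => g * h := measurable_const_mul g
  rw [Measure.map_apply hg hs, haarGL_apply _ (hg hs), haarGL_apply _ hs]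
  have hs' : MeasurableSet (Units.val '' s : Set (Matrix ι ι K)) :=
    measurableEmbedding_val.measurableSet_image.2 hs
  have hpre : (Units.val '' ((fun h => g * h) ⁻¹' s) : Set (Matrix ι ι K)) =
      (fun M => g.val * M) ⁻¹' (Units.val '' s) := by
    ext M
    constructor
    · rintro ⟨h, hh, rfl⟩
      exact ⟨g * h, hh, by simp⟩
    · rintro ⟨h, hh, hM⟩
      refine ⟨g⁻¹ * h, by simpa using hh, ?_⟩
      rw [Units.val_mul, hM, ← Matrix.mul_assoc, ← Units.val_mul]
      simp
  have hm : Measurable fun M : Matrix ι ι K => g.val * M :=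
    (mulLeftEquiv ι g).continuous.measurable
  have hd := norm_det_pos g
  have hdens : ∀ M : Matrix ι ι K, glDensity K ι M =
      ENNReal.ofReal (‖g.val.det‖ ^ Fintype.card ι) * glDensity K ι (g.val * M) := by
    intro M
    rw [glDensity, glDensity, ← ENNReal.ofReal_mul (by positivity), Matrix.det_mul, norm_mul,
      mul_pow, mul_inv, mul_inv_cancel_left₀ (by positivity)]
  rw [hpre, lintegral_congr hdens,
    lintegral_const_mul (f := fun M => glDensity K ι (g.val * M)) _ (measurable_glDensity.comp hm),
    ← setLIntegral_map hs' measurable_glDensity hm, map_mul_left_haarMatrix,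
    Measure.restrict_smul, lintegral_smul_measure, smul_eq_mul, ← mul_assoc,
    ← ENNReal.ofReal_mul (by positivity), mul_inv_cancel₀ (by positivity), ENNReal.ofReal_one,
    one_mul]

end Modulus

end LocalZeta
end

noncomputable section
namespace LocalZeta

/-! ### Permuting the factors of product measures. -/

section Rearrangement

variable {α β γ δ : Type*} [MeasurableSpace α] [MeasurableSpace β] [MeasurableSpace γ]
  [MeasurableSpace δ] (μ : Measure α) (ν : Measure β) (ρ : Measure γ) (τ : Measure δ)
  [SigmaFinite μ] [SigmaFinite ν] [SigmaFinite ρ] [SigmaFinite τ]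

/-- `((x, y), z) ↦ ((x, z), y)` -/
def prodRightCommEquiv (α β γ : Type*) [MeasurableSpace α] [MeasurableSpace β]
    [MeasurableSpace γ] : (α × β) × γ ≃ᵐ (α × γ) × β where
  toFun p := ((p.1.1, p.2), p.1.2)
  invFun p := ((p.1.1, p.2), p.1.2)
  left_inv _ := rfl
  right_inv _ := rfl
  measurable_toFun := by simp only [Equiv.coe_fn_mk]; fun_prop
  measurable_invFun := by simp only [Equiv.coe_fn_symm_mk]; fun_prop

theorem measurePreserving_prodRightComm :
    MeasurePreserving (prodRightCommEquiv α β γ) ((μ.prod ν).prod ρ) ((μ.prod ρ).prod ν) :=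
  ((measurePreserving_prodAssoc μ ρ ν).symm _).comp
    (((MeasurePreserving.id μ).prod Measure.measurePreserving_swap).comp
      (measurePreserving_prodAssoc μ ν ρ))

/-- `((x, y), (z, w)) ↦ ((x, z), (y, w))` -/
def prodProdCommEquiv (α β γ δ : Type*) [MeasurableSpace α] [MeasurableSpace β]
    [MeasurableSpace γ] [MeasurableSpace δ] : (α × β) × (γ × δ) ≃ᵐ (α × γ) × (β × δ) where
  toFun p := ((p.1.1, p.2.1), (p.1.2, p.2.2))
  invFun p := ((p.1.1, p.2.1), (p.1.2, p.2.2))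
  left_inv _ := rfl
  right_inv _ := rfl
  measurable_toFun := by simp only [Equiv.coe_fn_mk]; fun_prop
  measurable_invFun := by simp only [Equiv.coe_fn_symm_mk]; fun_prop

theorem measurePreserving_prodProdComm :
    MeasurePreserving (prodProdCommEquiv α β γ δ) ((μ.prod ν).prod (ρ.prod τ))
      ((μ.prod ρ).prod (ν.prod τ)) :=
  (measurePreserving_prodAssoc (μ.prod ρ) ν τ).comp
    (((measurePreserving_prodRightComm μ ν ρ).prod (MeasurePreserving.id τ)).comp
      ((measurePreserving_prodAssoc (μ.prod ν) ρ τ).symm _))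

end Rearrangement

/-! ### Haar measure in the coordinates of a big cell. -/

section Cells

variable {K : Type*} [NontriviallyNormedField K] [IsNormalizedLocalField K]
  [MeasurableSpace K] [BorelSpace K]
variable {a b : Type*} [Fintype a] [Fintype b] [DecidableEq a] [DecidableEq b]

/-- In positive size this is the convention that the inverse of zero is zero; in size zero the
determinant is 1 and the hypothesis fails. -/
theorem glDensity_eq_zero {M : Matrix a a K} (h : M.det = 0) : glDensity K a M = 0 := by
  rcases isEmpty_or_nonempty a with ha | ha
  · simp at h
  · simp [glDensity, h]

/-- The density vanishes on singular matrices, so the restriction to invertible ones may be dropped.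
-/
theorem map_val_haarGL' : (haarGL K a).map Units.val =
    (haarMatrix K a a).withDensity (glDensity K a) := by
  rw [map_val_haarGL]
  refine Measure.restrict_eq_self_of_ae_mem ?_
  have h0 : MeasurableSet {M : Matrix a a K | M.det = 0} :=
    measurable_matrix_det (measurableSet_singleton 0)
  rw [ae_iff]
  have : {M : Matrix a a K | ¬ M ∈ {M : Matrix a a K | M.det ≠ 0}} = {M | M.det = 0} := by
    ext M; simp
  rw [this, withDensity_apply _ h0, setLIntegral_congr_fun h0 (fun M hM => glDensity_eq_zero hM)]
  simp

variable (K a b) in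
/-- Coordinates on a big cell, at the level of matrices. -/
abbrev CellMat : Type _ := (Matrix a a K × Matrix b b K) × (Matrix a b K × Matrix b a K)

variable (K a b) in
/-- Coordinates on a big cell. -/
abbrev CellGL : Type _ := (GL a K × GL b K) × (Matrix a b K × Matrix b a K)

variable (K a b) in
/-- The additive measure in the coordinates of a cell. -/
def cellMatMeasure : Measure (CellMat K a b) :=
  ((haarMatrix K a a).prod (haarMatrix K b b)).prod ((haarMatrix K a b).prod (haarMatrix K b a))

variable (K a b) in
/-- The product of the Haar measures in the coordinates of a cell. -/
def cellMeasure : Measure (CellGL K a b) :=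
  ((haarGL K a).prod (haarGL K b)).prod ((haarMatrix K a b).prod (haarMatrix K b a))

instance : SigmaFinite (cellMeasure K a b) := by unfold cellMeasure; infer_instance

/-- The density of the Haar measure in the coordinates of a cell. -/
def cellDensity (p : CellGL K a b) : NNReal :=
  (‖p.1.1.val.det‖₊ ^ Fintype.card b)⁻¹ * (‖p.1.2.val.det‖₊ ^ Fintype.card a)⁻¹

theorem measurable_gl_det : Measurable fun g : GL a K => g.val.det :=
  measurable_matrix_det.comp measurableEmbedding_val.measurable

theorem measurable_cellDensity : Measurable (cellDensity (K := K) (a := a) (b := b)) := by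
  have h1 : Measurable fun p : CellGL K a b => p.1.1.val.det :=
    measurable_gl_det.comp (measurable_fst.comp measurable_fst)
  have h2 : Measurable fun p : CellGL K a b => p.1.2.val.det :=
    measurable_gl_det.comp (measurable_snd.comp measurable_fst)
  exact ((h1.nnnorm.pow_const _).inv).mul ((h2.nnnorm.pow_const _).inv)

/-- Assembling a block matrix. -/
def blocksEquiv (K : Type*) [NontriviallyNormedField K] (a b : Type*) :
    CellMat K a b ≃ₜ+ Matrix (a ⊕ b) (a ⊕ b) K where
  toFun q := Matrix.fromBlocks q.1.1 q.2.1 q.2.2 q.1.2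
  invFun M := ((M.toBlocks₁₁, M.toBlocks₂₂), (M.toBlocks₁₂, M.toBlocks₂₁))
  left_inv q := by simp
  right_inv M := by simp [Matrix.fromBlocks_toBlocks]
  map_add' q q' := by simp [Matrix.fromBlocks_add]
  continuous_toFun := by
    exact Continuous.matrix_fromBlocks (by fun_prop) (by fun_prop) (by fun_prop) (by fun_prop)
  continuous_invFun := by
    refine Continuous.prodMk (Continuous.prodMk ?_ ?_) (Continuous.prodMk ?_ ?_)
    · exact continuous_matrix fun i j => continuous_id.matrix_elem (Sum.inl i) (Sum.inl j)
    · exact continuous_matrix fun i j => continuous_id.matrix_elem (Sum.inr i) (Sum.inr j)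
    · exact continuous_matrix fun i j => continuous_id.matrix_elem (Sum.inl i) (Sum.inr j)
    · exact continuous_matrix fun i j => continuous_id.matrix_elem (Sum.inr i) (Sum.inl j)

@[simp] theorem blocksEquiv_apply (q : CellMat K a b) :
    blocksEquiv K a b q = Matrix.fromBlocks q.1.1 q.2.1 q.2.2 q.1.2 := rfl

theorem measurePreserving_blocks :
    MeasurePreserving (blocksEquiv K a b) (cellMatMeasure K a b)
      (haarMatrix K (a ⊕ b) (a ⊕ b)) := by
  have h1 : ((haarMatrix K a a).prod (haarMatrix K b b)).IsAddHaarMeasure := inferInstance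
  have h2 : ((haarMatrix K a b).prod (haarMatrix K b a)).IsAddHaarMeasure := inferInstance
  have : (cellMatMeasure K a b).IsAddHaarMeasure := Measure.prod.instIsAddHaarMeasure _ _
  have hS : blocksEquiv K a b ⁻¹' {M | MatLe 1 M} =
      ({M | MatLe 1 M} ×ˢ {M | MatLe 1 M}) ×ˢ ({M | MatLe 1 M} ×ˢ {M | MatLe 1 M}) := by
    ext ⟨⟨A, D⟩, B, C⟩
    refine matLe_fromBlocks_iff.trans ⟨fun h => ⟨⟨h.1, h.2.2.2⟩, h.2.1, h.2.2.1⟩, ?_⟩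
    rintro ⟨⟨h1, h2⟩, h3, h4⟩
    exact ⟨h1, h3, h4, h2⟩
  refine ⟨(blocksEquiv K a b).continuous.measurable, ?_⟩
  rw [map_continuousAddEquiv_eq_smul (cellMatMeasure K a b) (haarMatrix K (a ⊕ b) (a ⊕ b))
    (blocksEquiv K a b) (measurableSet_matLe 1) haarMatrix_matLe_one, hS, cellMatMeasure,
    Measure.prod_prod, Measure.prod_prod, Measure.prod_prod]
  simp [haarMatrix_matLe_one]

/-- Forgetting invertibility in the coordinates of a cell. -/
def cellVal : CellGL K a b → CellMat K a b :=
  Prod.map (Prod.map Units.val Units.val) id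

theorem measurableEmbedding_cellVal :
    MeasurableEmbedding (cellVal (K := K) (a := a) (b := b)) :=
  (measurableEmbedding_val.prodMap measurableEmbedding_val).prodMap MeasurableEmbedding.id

theorem map_cellVal : (cellMeasure K a b).map cellVal =
    (cellMatMeasure K a b).withDensity fun q => glDensity K a q.1.1 * glDensity K b q.1.2 := by
  have ma : Measurable (Units.val : GL a K → _) := measurableEmbedding_val.measurable
  have mb : Measurable (Units.val : GL b K → _) := measurableEmbedding_val.measurable
  have h1 : ((haarGL K a).prod (haarGL K b)).map (Prod.map Units.val Units.val) =
      ((haarMatrix K a a).prod (haarMatrix K b b)).withDensity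
        fun q => glDensity K a q.1 * glDensity K b q.2 := by
    rw [← Measure.map_prod_map _ _ ma mb, map_val_haarGL', map_val_haarGL',
      prod_withDensity measurable_glDensity measurable_glDensity]
  rw [cellMeasure, cellVal, ← Measure.map_prod_map _ _ (ma.prodMap mb) measurable_id, h1,
    Measure.map_id, prod_withDensity_left]
  · rfl
  · exact (measurable_glDensity.comp measurable_fst).mul (measurable_glDensity.comp measurable_snd)

/-- A big cell: a parametrization of part of `GL_{a+b}` with the Jacobian determinant `1` on
matrices. -/
structure CellChart (K : Type*) [NontriviallyNormedField K] [IsNormalizedLocalField K]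
    [MeasurableSpace K] [BorelSpace K] (a b : Type*) [Fintype a] [Fintype b] [DecidableEq a]
    [DecidableEq b] where
  shear : CellMat K a b ≃ᵐ CellMat K a b
  preserving : MeasurePreserving shear (cellMatMeasure K a b) (cellMatMeasure K a b)
  toGL : CellGL K a b → GL (a ⊕ b) K
  toGL_val : ∀ p, (toGL p).val = blocksEquiv K a b (shear (cellVal p))
  image : Set (Matrix (a ⊕ b) (a ⊕ b) K)
  measurableSet_image : MeasurableSet image
  mem_image : ∀ q, q.1.1.det ≠ 0 → q.1.2.det ≠ 0 → blocksEquiv K a b (shear q) ∈ image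
  det_eq : ∀ q, blocksEquiv K a b (shear q) ∈ image →
    (blocksEquiv K a b (shear q)).det = q.1.1.det * q.1.2.det

namespace CellChart

variable (c : CellChart K a b)

theorem measurableEmbedding : MeasurableEmbedding c.toGL := by
  have h1 : MeasurableEmbedding (Units.val ∘ c.toGL) := by
    have : Units.val ∘ c.toGL = blocksEquiv K a b ∘ c.shear ∘ cellVal := by
      funext p; exact c.toGL_val p
    rw [this]
    exact ((blocksEquiv K a b).toHomeomorph.measurableEmbedding.comp
      c.shear.measurableEmbedding).comp measurableEmbedding_cellVal
  refine ⟨fun p q h => h1.injective (congrArg Units.val h), ?_, fun s hs => ?_⟩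
  · exact measurableEmbedding_val.measurable_comp_iff.1 h1.measurable
  · have h2 := measurableEmbedding_val.measurable (h1.measurableSet_image.2 hs)
    rwa [Set.image_comp, Set.preimage_image_eq _ measurableEmbedding_val.injective] at h2

/-- The shear preserves the additive measure and the determinant is that of A times that of D. Hence
the density |det|^(-(a+b)) is the product of the densities |det A|^(-a) and |det D|^(-b) of the two
smaller groups with the remaining factor `cellDensity`. -/
theorem restrict_eq_map : (haarGL K (a ⊕ b)).restrict (Units.val ⁻¹' c.image) =
    ((cellMeasure K a b).withDensity fun p => (cellDensity p : ENNReal)).map c.toGL := by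
  ext s hs
  have hU : MeasurableSet (Units.val ⁻¹' c.image : Set (GL (a ⊕ b) K)) :=
    measurableEmbedding_val.measurable c.measurableSet_image
  have hs' : MeasurableSet (Units.val '' s : Set (Matrix (a ⊕ b) (a ⊕ b) K)) :=
    measurableEmbedding_val.measurableSet_image.2 hs
  have hpre := c.measurableEmbedding.measurable hs
  set T : Set (Matrix (a ⊕ b) (a ⊕ b) K) := Units.val '' s ∩ c.image with hT
  have hTm : MeasurableSet T := hs'.inter c.measurableSet_image
  have himg : (Units.val '' (s ∩ Units.val ⁻¹' c.image) : Set (Matrix (a ⊕ b) (a ⊕ b) K)) = T := by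
    rw [Set.image_inter_preimage]
  have mdet1 : Measurable fun q : CellMat K a b => q.1.1.det :=
    measurable_matrix_det.comp (measurable_fst.comp measurable_fst)
  have mdet2 : Measurable fun q : CellMat K a b => q.1.2.det :=
    measurable_matrix_det.comp (measurable_snd.comp measurable_fst)
  let ρ : CellMat K a b → ENNReal := fun q =>
    (((‖q.1.1.det‖₊ ^ Fintype.card b)⁻¹ * (‖q.1.2.det‖₊ ^ Fintype.card a)⁻¹ : NNReal) : ENNReal)
  have hρ : Measurable ρ :=
    (((mdet1.nnnorm.pow_const _).inv).mul ((mdet2.nnnorm.pow_const _).inv)).coe_nnreal_ennreal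
  let Q : CellMat K a b → ENNReal := fun q =>
    ρ q * (T.indicator 1 (blocksEquiv K a b (c.shear q)))
  have hblocks : Measurable fun q : CellMat K a b => blocksEquiv K a b (c.shear q) :=
    (blocksEquiv K a b).continuous.measurable.comp c.shear.measurable
  have hQ : Measurable Q := hρ.mul ((measurable_one.indicator hTm).comp hblocks)
  rw [Measure.restrict_apply hs, haarGL_apply _ (hs.inter hU), himg,
    Measure.map_apply c.measurableEmbedding.measurable hs,
    withDensity_apply _ hpre, ← lintegral_indicator hpre]
  have h1 : ∀ p, (c.toGL ⁻¹' s).indicator (fun p => (cellDensity p : ENNReal)) p =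
      Q (cellVal p) := by
    intro p
    have hmem : blocksEquiv K a b (c.shear (cellVal p)) ∈ T ↔ p ∈ c.toGL ⁻¹' s := by
      rw [← c.toGL_val, hT]
      constructor
      · rintro ⟨⟨g, hg, hgp⟩, -⟩
        rw [Units.ext_iff.2 hgp] at hg
        exact hg
      · intro hp
        refine ⟨⟨_, hp, rfl⟩, ?_⟩
        rw [c.toGL_val]
        exact c.mem_image _ (Matrix.GeneralLinearGroup.det_ne_zero p.1.1)
          (Matrix.GeneralLinearGroup.det_ne_zero p.1.2)
    by_cases hp : p ∈ c.toGL ⁻¹' s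
    · simp only [Q, Set.indicator_of_mem hp, Set.indicator_of_mem (hmem.2 hp), Pi.one_apply,
        mul_one]
      rfl
    · simp only [Q, Set.indicator_of_notMem hp, Set.indicator_of_notMem (hp ∘ hmem.1), mul_zero]
  simp_rw [h1]
  rw [← measurableEmbedding_cellVal.lintegral_map, map_cellVal,
    lintegral_withDensity_eq_lintegral_mul _ _ hQ]
  swap
  · exact (measurable_glDensity.comp (measurable_fst.comp measurable_fst)).mul
      (measurable_glDensity.comp (measurable_snd.comp measurable_fst))
  rw [← lintegral_indicator hTm, ← measurePreserving_blocks.lintegral_comp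
    (measurable_glDensity.indicator hTm), ← c.preserving.lintegral_comp]
  swap
  · exact (measurable_glDensity.indicator hTm).comp (blocksEquiv K a b).continuous.measurable
  refine lintegral_congr fun q => ?_
  simp only [Pi.mul_apply, Q]
  by_cases hq : blocksEquiv K a b (c.shear q) ∈ T
  · rw [Set.indicator_of_mem hq, Set.indicator_of_mem hq, glDensity, c.det_eq q hq.2, glDensity,
      glDensity, Pi.one_apply, mul_one]
    simp only [ρ]
    rw [← ENNReal.ofReal_coe_nnreal, ← ENNReal.ofReal_mul (by positivity),
      ← ENNReal.ofReal_mul (by positivity)]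
    congr 1
    push_cast
    simp only [norm_mul, mul_pow, Fintype.card_sum, pow_add, mul_inv]
    ring
  · rw [Set.indicator_of_notMem hq, Set.indicator_of_notMem hq, mul_zero, mul_zero]

end CellChart


end Cells

end LocalZeta
end

noncomputable section
namespace LocalZeta

/-! ### Block unipotent matrices and the two block factorizations. -/

section Unipotents

variable {K : Type*} [NontriviallyNormedField K]
variable {a b : Type*} [Fintype a] [Fintype b] [DecidableEq a] [DecidableEq b]

/-- The upper unipotent block matrix `(1 B; 0 1)`. -/
def upperU (B : Matrix a b K) : GL (a ⊕ b) K where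
  val := Matrix.fromBlocks 1 B 0 1
  inv := Matrix.fromBlocks 1 (-B) 0 1
  val_inv := by simp [Matrix.fromBlocks_multiply]
  inv_val := by simp [Matrix.fromBlocks_multiply]

/-- The lower unipotent block matrix `(1 0; C 1)`. -/
def lowerU (C : Matrix b a K) : GL (a ⊕ b) K where
  val := Matrix.fromBlocks 1 0 C 1
  inv := Matrix.fromBlocks 1 0 (-C) 1
  val_inv := by simp [Matrix.fromBlocks_multiply]
  inv_val := by simp [Matrix.fromBlocks_multiply]

theorem upperU_val (B : Matrix a b K) : (upperU B).val = Matrix.fromBlocks 1 B 0 1 := rfl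

theorem lowerU_val (C : Matrix b a K) : (lowerU C).val = Matrix.fromBlocks 1 0 C 1 := rfl

theorem upperU_inv (B : Matrix a b K) : (upperU B)⁻¹ = upperU (-B) := by
  ext1; rfl

theorem lowerU_inv (C : Matrix b a K) : (lowerU C)⁻¹ = lowerU (-C) := by
  ext1; rfl

theorem diagEmb_val (p : GL a K × GL b K) :
    (diagEmb p).val = Matrix.fromBlocks p.1.val 0 0 p.2.val := rfl

theorem gl_mul_inv_val (A : GL a K) : A.val * (A⁻¹).val = 1 := A.mul_inv

theorem gl_inv_mul_val (A : GL a K) : (A⁻¹).val * A.val = 1 := A.inv_mul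

theorem gl_mul_inv_cancel_left {κ : Type*} [Fintype κ] (A : GL a K) (M : Matrix a κ K) :
    A.val * ((A⁻¹).val * M) = M := by rw [← Matrix.mul_assoc, A.mul_inv, Matrix.one_mul]

theorem gl_inv_mul_cancel_left {κ : Type*} [Fintype κ] (A : GL a K) (M : Matrix a κ K) :
    (A⁻¹).val * (A.val * M) = M := by rw [← Matrix.mul_assoc, A.inv_mul, Matrix.one_mul]

theorem gl_mul_inv_cancel_right {κ : Type*} [Fintype κ] (A : GL a K) (M : Matrix κ a K) :
    M * A.val * (A⁻¹).val = M := by rw [Matrix.mul_assoc, A.mul_inv, Matrix.mul_one]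

theorem gl_inv_mul_cancel_right {κ : Type*} [Fintype κ] (A : GL a K) (M : Matrix κ a K) :
    M * (A⁻¹).val * A.val = M := by rw [Matrix.mul_assoc, A.inv_mul, Matrix.mul_one]

theorem lower_diag_upper_val (A : GL a K) (D : GL b K) (B : Matrix a b K) (C : Matrix b a K) :
    (lowerU (C * (A⁻¹).val) * diagEmb (A, D) * upperU ((A⁻¹).val * B)).val =
      Matrix.fromBlocks A.val B C (D.val + C * (A⁻¹).val * B) := by
  simp only [Units.val_mul, lowerU_val, diagEmb_val, upperU_val, Matrix.fromBlocks_multiply,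
    Matrix.one_mul, Matrix.zero_mul, Matrix.mul_zero, Matrix.mul_one, add_zero, zero_add,
    gl_inv_mul_cancel_right, gl_mul_inv_cancel_left]
  rw [← Matrix.mul_assoc, add_comm]

theorem upper_diag_lower_val (A : GL a K) (D : GL b K) (B : Matrix a b K) (C : Matrix b a K) :
    (upperU (B * (D⁻¹).val) * diagEmb (A, D) * lowerU ((D⁻¹).val * C)).val =
      Matrix.fromBlocks (A.val + B * (D⁻¹).val * C) B C D.val := by
  simp only [Units.val_mul, lowerU_val, diagEmb_val, upperU_val, Matrix.fromBlocks_multiply,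
    Matrix.one_mul, Matrix.zero_mul, Matrix.mul_zero, Matrix.mul_one, add_zero, zero_add,
    gl_inv_mul_cancel_right, gl_mul_inv_cancel_left]
  rw [← Matrix.mul_assoc]

end Unipotents

/-! ### The two big cells as charts. -/

section Charts

variable {K : Type*} [NontriviallyNormedField K] [IsNormalizedLocalField K]
  [MeasurableSpace K] [BorelSpace K]
variable {a b : Type*} [Fintype a] [Fintype b] [DecidableEq a] [DecidableEq b]

theorem measurable_matrix_inv : Measurable fun M : Matrix a a K => M⁻¹ := by
  have e : (fun M : Matrix a a K => M⁻¹) = fun M => (M.det)⁻¹ • M.adjugate := by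
    funext M; rw [Matrix.inv_def, Ring.inverse_eq_inv']
  rw [e]
  have h2 : Measurable fun M : Matrix a a K => M.adjugate :=
    (continuous_id.matrix_adjugate : Continuous fun M : Matrix a a K => M.adjugate).measurable
  exact measurable_matrix_det.inv.smul h2

theorem measurable_matrix_mul {X ι κ τ : Type*} [MeasurableSpace X] [Fintype ι] [Fintype κ]
    [Fintype τ] {f : X → Matrix ι κ K} {g : X → Matrix κ τ K} (hf : Measurable f)
    (hg : Measurable g) : Measurable fun x => f x * g x := by
  have h : Continuous fun p : Matrix ι κ K × Matrix κ τ K => p.1 * p.2 := by fun_prop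
  exact h.measurable.comp (hf.prodMk hg)

theorem measurePreserving_shear {X ι κ : Type*} [MeasurableSpace X] [Fintype ι] [Fintype κ]
    (μ : Measure X) [SigmaFinite μ] {f : X → Matrix ι κ K} (hf : Measurable f) :
    MeasurePreserving (fun p : X × Matrix ι κ K => (p.1, p.2 + f p.1))
      (μ.prod (haarMatrix K ι κ)) (μ.prod (haarMatrix K ι κ)) := by
  refine (MeasurePreserving.id μ).skew_product (g := fun x M => M + f x) ?_ ?_
  · exact measurable_snd.add (hf.comp measurable_fst)
  · exact Filter.Eventually.of_forall fun x => map_add_right_eq_self _ _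

theorem measurable_lowerCorrection :
    Measurable fun q : CellMat K a b => q.2.2 * q.1.1⁻¹ * q.2.1 :=
  measurable_matrix_mul (measurable_matrix_mul (measurable_snd.comp measurable_snd)
    (measurable_matrix_inv.comp (measurable_fst.comp measurable_fst)))
    (measurable_fst.comp measurable_snd)

theorem measurable_upperCorrection :
    Measurable fun q : CellMat K a b => q.2.1 * q.1.2⁻¹ * q.2.2 :=
  measurable_matrix_mul (measurable_matrix_mul (measurable_fst.comp measurable_snd)
    (measurable_matrix_inv.comp (measurable_snd.comp measurable_fst)))
    (measurable_snd.comp measurable_snd)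

/-- The translation of the lower right block by `C A⁻¹ B`. -/
def shearLower (K : Type*) [NontriviallyNormedField K] [IsNormalizedLocalField K]
    [MeasurableSpace K] [BorelSpace K] (a b : Type*) [Fintype a] [Fintype b] [DecidableEq a]
    [DecidableEq b] : CellMat K a b ≃ᵐ CellMat K a b where
  toFun q := ((q.1.1, q.1.2 + q.2.2 * q.1.1⁻¹ * q.2.1), q.2)
  invFun q := ((q.1.1, q.1.2 - q.2.2 * q.1.1⁻¹ * q.2.1), q.2)
  left_inv q := by simp
  right_inv q := by simp
  measurable_toFun := ((measurable_fst.comp measurable_fst).prodMk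
    ((measurable_snd.comp measurable_fst).add measurable_lowerCorrection)).prodMk measurable_snd
  measurable_invFun := ((measurable_fst.comp measurable_fst).prodMk
    ((measurable_snd.comp measurable_fst).sub measurable_lowerCorrection)).prodMk measurable_snd

/-- The translation of the upper left block by `B D⁻¹ C`. -/
def shearUpper (K : Type*) [NontriviallyNormedField K] [IsNormalizedLocalField K]
    [MeasurableSpace K] [BorelSpace K] (a b : Type*) [Fintype a] [Fintype b] [DecidableEq a]
    [DecidableEq b] : CellMat K a b ≃ᵐ CellMat K a b where
  toFun q := ((q.1.1 + q.2.1 * q.1.2⁻¹ * q.2.2, q.1.2), q.2)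
  invFun q := ((q.1.1 - q.2.1 * q.1.2⁻¹ * q.2.2, q.1.2), q.2)
  left_inv q := by simp
  right_inv q := by simp
  measurable_toFun := (((measurable_fst.comp measurable_fst).add
    measurable_upperCorrection).prodMk (measurable_snd.comp measurable_fst)).prodMk measurable_snd
  measurable_invFun := (((measurable_fst.comp measurable_fst).sub
    measurable_upperCorrection).prodMk (measurable_snd.comp measurable_fst)).prodMk measurable_snd

/-- With the lower right block moved to the last coordinate, the map is a translation of that
coordinate by a quantity depending only on the others. -/
theorem measurePreserving_shearLower :
    MeasurePreserving (shearLower K a b) (cellMatMeasure K a b) (cellMatMeasure K a b) := by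
  have h1 := measurePreserving_prodRightComm (haarMatrix K a a) (haarMatrix K b b)
    ((haarMatrix K a b).prod (haarMatrix K b a))
  have h2 := measurePreserving_shear (ι := b) (κ := b)
    ((haarMatrix K a a).prod ((haarMatrix K a b).prod (haarMatrix K b a)))
    (f := fun x => x.2.2 * x.1⁻¹ * x.2.1)
    (measurable_matrix_mul (measurable_matrix_mul (measurable_snd.comp measurable_snd)
      (measurable_matrix_inv.comp measurable_fst)) (measurable_fst.comp measurable_snd))
  exact (measurePreserving_prodRightComm _ _ _).comp (h2.comp h1)

theorem measurePreserving_shearUpper :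
    MeasurePreserving (shearUpper K a b) (cellMatMeasure K a b) (cellMatMeasure K a b) := by
  have h0 : MeasurePreserving
      (Prod.map Prod.swap id : CellMat K a b →
        (Matrix b b K × Matrix a a K) × (Matrix a b K × Matrix b a K)) (cellMatMeasure K a b) _ :=
    (Measure.measurePreserving_swap (μ := haarMatrix K a a) (ν := haarMatrix K b b)).prod
      (MeasurePreserving.id ((haarMatrix K a b).prod (haarMatrix K b a)))
  have h1 := measurePreserving_prodRightComm (haarMatrix K b b) (haarMatrix K a a)
    ((haarMatrix K a b).prod (haarMatrix K b a))
  have h2 := measurePreserving_shear (ι := a) (κ := a)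
    ((haarMatrix K b b).prod ((haarMatrix K a b).prod (haarMatrix K b a)))
    (f := fun x => x.2.1 * x.1⁻¹ * x.2.2)
    (measurable_matrix_mul (measurable_matrix_mul (measurable_fst.comp measurable_snd)
      (measurable_matrix_inv.comp measurable_fst)) (measurable_snd.comp measurable_snd))
  have h3 : MeasurePreserving
      (Prod.map Prod.swap id : (Matrix b b K × Matrix a a K) × (Matrix a b K × Matrix b a K) →
        CellMat K a b) _ (cellMatMeasure K a b) :=
    (Measure.measurePreserving_swap (μ := haarMatrix K b b) (ν := haarMatrix K a a)).prod
      (MeasurePreserving.id ((haarMatrix K a b).prod (haarMatrix K b a)))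
  exact h3.comp ((measurePreserving_prodRightComm _ _ _).comp (h2.comp (h1.comp h0)))

theorem measurable_toBlocks₁₁ :
    Measurable fun M : Matrix (a ⊕ b) (a ⊕ b) K => M.toBlocks₁₁ :=
  measurable_fst.comp (measurable_fst.comp (blocksEquiv K a b).symm.continuous.measurable)

theorem measurable_toBlocks₂₂ :
    Measurable fun M : Matrix (a ⊕ b) (a ⊕ b) K => M.toBlocks₂₂ :=
  measurable_snd.comp (measurable_fst.comp (blocksEquiv K a b).symm.continuous.measurable)

variable (K a b) in
/-- The cell of matrices whose upper left block is invertible. -/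
def lowerChart : CellChart K a b where
  shear := shearLower K a b
  preserving := measurePreserving_shearLower
  toGL p := lowerU (p.2.2 * (p.1.1⁻¹).val) * diagEmb p.1 * upperU ((p.1.1⁻¹).val * p.2.1)
  toGL_val p := by
    rw [lower_diag_upper_val, Matrix.coe_units_inv]
    rfl
  image := {M | M.toBlocks₁₁.det ≠ 0}
  measurableSet_image :=
    ((measurable_matrix_det.comp measurable_toBlocks₁₁) (measurableSet_singleton 0)).compl
  mem_image q h _ := h
  det_eq q h := by
    have : Invertible q.1.1 := Matrix.invertibleOfIsUnitDet _ (isUnit_iff_ne_zero.2 h)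
    change (Matrix.fromBlocks q.1.1 q.2.1 q.2.2 (q.1.2 + q.2.2 * q.1.1⁻¹ * q.2.1)).det = _
    rw [Matrix.det_fromBlocks₁₁, Matrix.invOf_eq_nonsing_inv, add_sub_cancel_right]

variable (K a b) in
/-- The cell of matrices whose lower right block is invertible. -/
def upperChart : CellChart K a b where
  shear := shearUpper K a b
  preserving := measurePreserving_shearUpper
  toGL p := upperU (p.2.1 * (p.1.2⁻¹).val) * diagEmb p.1 * lowerU ((p.1.2⁻¹).val * p.2.2)
  toGL_val p := by
    rw [upper_diag_lower_val, Matrix.coe_units_inv]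
    rfl
  image := {M | M.toBlocks₂₂.det ≠ 0}
  measurableSet_image :=
    ((measurable_matrix_det.comp measurable_toBlocks₂₂) (measurableSet_singleton 0)).compl
  mem_image q _ h := h
  det_eq q h := by
    have : Invertible q.1.2 := Matrix.invertibleOfIsUnitDet _ (isUnit_iff_ne_zero.2 h)
    change (Matrix.fromBlocks (q.1.1 + q.2.1 * q.1.2⁻¹ * q.2.2) q.2.1 q.2.2 q.1.2).det = _
    rw [Matrix.det_fromBlocks₂₂, Matrix.invOf_eq_nonsing_inv, add_sub_cancel_right, mul_comm]

end Charts

end LocalZeta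
end

noncomputable section
namespace LocalZeta

/-! ### The radii of the ideals 𝔭^r. -/

section Radius

variable (K : Type*) [NontriviallyNormedField K] [IsNormalizedLocalField K]

/-- The radius of `𝔭 ^ r`. -/
def rad (r : ℕ) : ℝ := (residueCard K : ℝ) ^ (-(r : ℤ))

theorem rad_pos (r : ℕ) : 0 < rad K r := zpow_pos (zero_lt_one.trans (one_lt_residueCard K)) _

theorem rad_zero : rad K 0 = 1 := by simp [rad]

theorem rad_anti {r s : ℕ} (h : r ≤ s) : rad K s ≤ rad K r :=
  zpow_le_zpow_right₀ (one_lt_residueCard K).le (by simpa using h)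

theorem rad_le_one (r : ℕ) : rad K r ≤ 1 := by
  rw [← rad_zero K]; exact rad_anti K (Nat.zero_le r)

theorem rad_lt_one {r : ℕ} (h : 1 ≤ r) : rad K r < 1 :=
  zpow_lt_one_of_neg₀ (one_lt_residueCard K) (by omega)

theorem rad_add (r s : ℕ) : rad K (r + s) = rad K r * rad K s := by
  rw [rad, rad, rad, ← zpow_add₀ (zero_lt_one.trans (one_lt_residueCard K)).ne']
  congr 1; push_cast; ring

variable {K}

theorem mem_pPow_iff_rad {r : ℕ} {x : K} : x ∈ pPow K r ↔ ‖x‖ ≤ rad K r := Iff.rfl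

theorem mem_pPow_zero_iff {x : K} : x ∈ pPow K 0 ↔ ‖x‖ ≤ 1 := by
  rw [mem_pPow_iff]; simp

end Radius

/-! ### LDU factorization of products of Iwahori elements. -/

section BlockLDU

variable {K : Type*} [NontriviallyNormedField K] [IsNormalizedLocalField K]
variable {t : ℕ} {n : Fin t → ℕ}

theorem blockLevi_val (l : ∀ j, GL (Fin (n j)) K) :
    (blockLevi n l).val = Matrix.blockDiagonal' fun j => (l j).val := rfl

theorem blockLevi_neg (l : ∀ j, GL (Fin (n j)) K) : blockLevi n (-l) = -blockLevi n l := by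
  ext1
  rw [Units.val_neg, blockLevi_val, blockLevi_val, ← Matrix.blockDiagonal'_neg]
  rfl

theorem blockLevi_injective : Function.Injective (blockLevi (K := K) n) := by
  intro l l' h
  have h1 := Matrix.blockDiagonal'_injective (congrArg Units.val h)
  funext j
  exact Units.ext (congrFun h1 j)

theorem mem_intLevi {l : ∀ j, GL (Fin (n j)) K} : l ∈ intLevi n ↔ ∀ j, l j ∈ intGL K _ := by
  simp [intLevi, Subgroup.mem_pi]

theorem matLe_blockDiagonal' {c : ℝ} (hc : 0 ≤ c) {D : ∀ j, Matrix (Fin (n j)) (Fin (n j)) K} :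
    MatLe c (Matrix.blockDiagonal' D) ↔ ∀ j, MatLe c (D j) := by
  constructor
  · intro h j x y
    simpa [Matrix.blockDiagonal'_apply_eq] using h ⟨j, x⟩ ⟨j, y⟩
  · rintro h ⟨i, x⟩ ⟨j, y⟩
    rcases eq_or_ne i j with rfl | hij
    · simpa [Matrix.blockDiagonal'_apply_eq] using h i x y
    · simpa [Matrix.blockDiagonal'_apply_ne _ _ _ hij] using hc

theorem blockLevi_mem_intGL {l : ∀ j, GL (Fin (n j)) K} :
    blockLevi n l ∈ intGL K (BlockIdx n) ↔ l ∈ intLevi n := by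
  rw [mem_intGL_iff, ← map_inv, blockLevi_val, blockLevi_val, matLe_blockDiagonal' zero_le_one,
    matLe_blockDiagonal' zero_le_one, mem_intLevi, ← forall_and]
  exact forall_congr' fun j => mem_intGL_iff.symm

/-- The matrix vanishes outside the blocks selected by `R`. -/
def IsStrict (R : Fin t → Fin t → Prop) (S : Matrix (BlockIdx n) (BlockIdx n) K) : Prop :=
  ∀ x y, ¬ R x.1 y.1 → S x y = 0

theorem mem_unip_iff {R : Fin t → Fin t → Prop} {u : GL (BlockIdx n) K} :
    u ∈ (blockParabolic n R).unip ↔ IsStrict R (u.val - 1) := by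
  refine forall_congr' fun x => forall_congr' fun y => imp_congr_right fun _ => ?_
  rw [Matrix.sub_apply, sub_eq_zero]

theorem IsStrict.blockDiagonal'_mul {R : Fin t → Fin t → Prop}
    {S : Matrix (BlockIdx n) (BlockIdx n) K} (h : IsStrict R S)
    (D : ∀ j, Matrix (Fin (n j)) (Fin (n j)) K) : IsStrict R (Matrix.blockDiagonal' D * S) := by
  intro x y hxy
  rw [Matrix.mul_apply]
  refine Finset.sum_eq_zero fun z _ => ?_
  rcases eq_or_ne x.1 z.1 with hz | hz
  · rw [h z y (hz ▸ hxy), mul_zero]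
  · rw [show x = ⟨x.1, x.2⟩ from rfl, show z = ⟨z.1, z.2⟩ from rfl,
      Matrix.blockDiagonal'_apply_ne _ _ _ hz, zero_mul]

theorem IsStrict.mul_blockDiagonal' {R : Fin t → Fin t → Prop}
    {S : Matrix (BlockIdx n) (BlockIdx n) K} (h : IsStrict R S)
    (D : ∀ j, Matrix (Fin (n j)) (Fin (n j)) K) : IsStrict R (S * Matrix.blockDiagonal' D) := by
  intro x y hxy
  rw [Matrix.mul_apply]
  refine Finset.sum_eq_zero fun z _ => ?_
  rcases eq_or_ne z.1 y.1 with hz | hz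
  · rw [h x z (hz ▸ hxy), zero_mul]
  · rw [show y = ⟨y.1, y.2⟩ from rfl, show z = ⟨z.1, z.2⟩ from rfl,
      Matrix.blockDiagonal'_apply_ne _ _ _ hz, mul_zero]

theorem IsStrict.mul {R : Fin t → Fin t → Prop} (hR : ∀ i j k, R i j → R j k → R i k)
    {S T : Matrix (BlockIdx n) (BlockIdx n) K} (hS : IsStrict R S) (hT : IsStrict R T) :
    IsStrict R (S * T) := by
  intro x y hxy
  rw [Matrix.mul_apply]
  refine Finset.sum_eq_zero fun z _ => ?_
  by_cases h : R x.1 z.1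
  · rw [hT z y fun h' => hxy (hR _ _ _ h h'), mul_zero]
  · rw [hS x z h, zero_mul]

theorem IsStrict.add {R : Fin t → Fin t → Prop}
    {S T : Matrix (BlockIdx n) (BlockIdx n) K} (hS : IsStrict R S) (hT : IsStrict R T) :
    IsStrict R (S + T) := fun x y h => by rw [Matrix.add_apply, hS x y h, hT x y h, add_zero]

theorem mul_mem_unip {R : Fin t → Fin t → Prop} (hR : ∀ i j k, R i j → R j k → R i k)
    {u v : GL (BlockIdx n) K} (hu : u ∈ (blockParabolic n R).unip)
    (hv : v ∈ (blockParabolic n R).unip) : u * v ∈ (blockParabolic n R).unip := by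
  rw [mem_unip_iff] at *
  have e : (u * v).val - 1 = (u.val - 1) * (v.val - 1) + ((u.val - 1) + (v.val - 1)) := by
    rw [Units.val_mul]; noncomm_ring
  rw [e]
  exact (hu.mul hR hv).add (hu.add hv)

theorem conj_mem_unip {R : Fin t → Fin t → Prop} {u : GL (BlockIdx n) K}
    (hu : u ∈ (blockParabolic n R).unip) (l : ∀ j, GL (Fin (n j)) K) :
    blockLevi n l * u * (blockLevi n l)⁻¹ ∈ (blockParabolic n R).unip := by
  rw [mem_unip_iff] at *
  have e : (blockLevi n l * u * (blockLevi n l)⁻¹).val - 1 =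
      (blockLevi n l).val * (u.val - 1) * (blockLevi n l⁻¹).val := by
    rw [mul_sub, sub_mul, mul_one, map_inv, ← Units.val_mul, ← Units.val_mul, ← Units.val_mul,
      mul_inv_cancel, Units.val_one]
  rw [e]
  exact (hu.blockDiagonal'_mul _).mul_blockDiagonal' _

/-- `X = L D U` with integral block unipotent matrices `L` (lower), `U` (upper) and block diagonal
part `D` given by `k`. -/
def HasLDU (n : Fin t → ℕ) (X : Matrix (BlockIdx n) (BlockIdx n) K)
    (k : ∀ j, GL (Fin (n j)) K) : Prop :=
  ∃ L U : GL (BlockIdx n) K, L ∈ intGL K _ ∧ U ∈ intGL K _ ∧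
    L ∈ (blockParabolic (K := K) n (· > ·)).unip ∧ U ∈ (blockParabolic (K := K) n (· < ·)).unip ∧
    X = (L * blockLevi n k * U).val

theorem gt_trans' : ∀ i j k : Fin t, i > j → j > k → i > k := fun _ _ _ h h' => gt_trans h h'

theorem lt_trans'' : ∀ i j k : Fin t, i < j → j < k → i < k := fun _ _ _ h h' => lt_trans h h'

/-- The element of the integral Levi subgroup is congruent to `1`. -/
def LeviCongr (n : Fin t → ℕ) (c : ℝ) (l : ∀ j, GL (Fin (n j)) K) : Prop :=
  l ∈ intLevi n ∧ MatLe c ((blockLevi n l).val - 1)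

theorem exists_ldu_of_mem_congrGL {c : ℝ} (hc0 : 0 ≤ c) (hc : c < 1) {g : GL (BlockIdx n) K}
    (hg : g ∈ congrGL K _ hc0) : ∃ (L U : GL (BlockIdx n) K) (l : ∀ j, GL (Fin (n j)) K),
    L ∈ intGL K _ ∧ U ∈ intGL K _ ∧
    L ∈ (blockParabolic (K := K) n (· > ·)).unip ∧ U ∈ (blockParabolic (K := K) n (· < ·)).unip ∧
    LeviCongr n c l ∧ g = L * blockLevi n l * U := by
  obtain ⟨L, D, U, hg', hL, hD, hU, hL1, hD1, hU1⟩ :=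
    exists_ldu hc0 hc _ rfl (fun x : BlockIdx n => x.1) g.val hg.2
  obtain ⟨L', rfl, hL'⟩ := exists_gl_of_sub_one hc0 hc hL1
  obtain ⟨U', rfl, hU'⟩ := exists_gl_of_sub_one hc0 hc hU1
  have hDb : D = Matrix.blockDiagonal' fun j => Matrix.of fun x y => D ⟨j, x⟩ ⟨j, y⟩ := by
    ext ⟨i, x⟩ ⟨j, y⟩
    rcases eq_or_ne i j with rfl | hij
    · simp [Matrix.blockDiagonal'_apply_eq]
    · rw [Matrix.blockDiagonal'_apply_ne _ _ _ hij]
      exact hD _ _ hij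
  have hDj : ∀ j, MatLe c ((Matrix.of fun x y => D ⟨j, x⟩ ⟨j, y⟩) - 1) := fun j x y => by
    have := hD1 ⟨j, x⟩ ⟨j, y⟩
    simpa [Matrix.one_apply] using this
  choose l hl hl' using fun j => exists_gl_of_sub_one hc0 hc (hDj j)
  have hlD : (blockLevi n l).val = D := by
    rw [blockLevi_val, hDb]
    congr 1
    funext j
    exact hl j
  refine ⟨L', U', l, hL', hU', ?_, ?_, ⟨mem_intLevi.2 hl', by rwa [hlD]⟩, ?_⟩
  · exact fun x y h => hL x y h
  · exact fun x y h => hU x y h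
  · ext1
    rw [Units.val_mul, Units.val_mul, hlD]
    exact hg'

/-- Overwriting the entries of `u` outside the blocks selected by `R` with those of the identity
changes it by elements of 𝔭^r only. The result is therefore still integral and invertible, and it is
exactly unipotent. -/
theorem exists_unip_mul_congr {R : Fin t → Fin t → Prop} {r : ℕ} (hr : 1 ≤ r)
    {u : GL (BlockIdx n) K} (hu : u ∈ iwahori n R r) :
    ∃ N : GL (BlockIdx n) K, N ∈ intGL K _ ∧ N ∈ (blockParabolic (K := K) n R).unip ∧
      N⁻¹ * u ∈ congrGL K _ (rad_pos K r).le ∧ u * N⁻¹ ∈ congrGL K _ (rad_pos K r).le := by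
  classical
  have h0 := (rad_pos K r).le
  let M : Matrix (BlockIdx n) (BlockIdx n) K :=
    Matrix.of fun x y => if R x.1 y.1 then u.val x y else (1 : Matrix _ _ K) x y
  have hM : MatLe (rad K r) (u.val - M) := fun x y => by
    by_cases h : R x.1 y.1
    · simpa [M, h] using h0
    · have h2 := mem_pPow_iff_rad.1 (hu.2 x y h)
      simp only [Matrix.sub_apply, M, Matrix.of_apply, if_neg h]
      exact h2
  have hu' := mem_intGL_iff.1 hu.1
  have h1 : MatLe (rad K r) ((u⁻¹).val * M - 1) := by
    have : (u⁻¹).val * M - 1 = -((u⁻¹).val * (u.val - M)) := by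
      rw [mul_sub, ← Units.val_mul]; simp
    rw [this]
    exact (MatLe.mul_left h0 hu'.2 hM).neg
  obtain ⟨g, hg, hgi⟩ := exists_gl_of_sub_one h0 (rad_lt_one K hr) h1
  have hN : (u * g).val = M := by
    rw [Units.val_mul, hg, ← Matrix.mul_assoc, ← Units.val_mul]; simp
  refine ⟨u * g, mul_mem hu.1 hgi, fun x y h => ?_, ?_, ?_⟩
  · rw [hN]; simp [M, h]
  · have hgc : g ∈ congrGL K _ h0 := ⟨hgi, by rwa [hg]⟩
    have : (u * g)⁻¹ * u = g⁻¹ := by group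
    rw [this]; exact inv_mem hgc
  · have hgc : g ∈ congrGL K _ h0 := ⟨hgi, by rwa [hg]⟩
    have : u * (u * g)⁻¹ = u * g⁻¹ * u⁻¹ := by group
    rw [this]; exact conj_mem_congrGL _ (inv_mem hgc) hu.1

theorem conj_blockLevi_mem {L : GL (BlockIdx n) K} {l : ∀ j, GL (Fin (n j)) K}
    (hl : l ∈ intLevi n) (hL : L ∈ intGL K _) :
    blockLevi n l * L * (blockLevi n l)⁻¹ ∈ intGL K _ :=
  mul_mem (mul_mem (blockLevi_mem_intGL.2 hl) hL) (inv_mem (blockLevi_mem_intGL.2 hl))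

/-- Each `uᵢ` is a true unipotent up to a factor congruent to 1. Those two factors are gathered in
the middle, where their product has its own LDU factorization; its diagonal part is the correction
`l`. -/
theorem hasLDU_of_iwahori {r : ℕ} (hr : 1 ≤ r) {k₁ k₂ : ∀ j, GL (Fin (n j)) K}
    {u₁ u₂ : GL (BlockIdx n) K} (hk₁ : k₁ ∈ intLevi n) (hu₁ : u₁ ∈ iwahori n (· > ·) r)
    (hk₂ : k₂ ∈ intLevi n) (hu₂ : u₂ ∈ iwahori n (· < ·) r) :
    ∃ l, LeviCongr n (rad K r) l ∧
      HasLDU n ((blockLevi n k₁ * u₁) * (blockLevi n k₂ * u₂)).val (k₁ * k₂ * l) := by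
  obtain ⟨N₁, hN₁, hN₁', hE₁, -⟩ := exists_unip_mul_congr hr hu₁
  obtain ⟨N₂, hN₂, hN₂', -, hE₂⟩ := exists_unip_mul_congr hr hu₂
  have hkk := blockLevi_mem_intGL.2 hk₂
  have hP : (blockLevi n k₂)⁻¹ * (N₁⁻¹ * u₁) * blockLevi n k₂ * (u₂ * N₂⁻¹) ∈
      congrGL K _ (rad_pos K r).le := by
    refine mul_mem ?_ hE₂
    have := conj_mem_congrGL _ hE₁ (inv_mem hkk)
    rwa [inv_inv] at this
  obtain ⟨L, U, l, hL, hU, hL', hU', hl, hP'⟩ :=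
    exists_ldu_of_mem_congrGL (rad_pos K r).le (rad_lt_one K hr) hP
  refine ⟨l, hl, blockLevi n k₁ * N₁ * (blockLevi n k₁)⁻¹ *
    (blockLevi n (k₁ * k₂) * L * (blockLevi n (k₁ * k₂))⁻¹), U * N₂,
    mul_mem (conj_blockLevi_mem hk₁ hN₁) (conj_blockLevi_mem (mul_mem hk₁ hk₂) hL),
    mul_mem hU hN₂, mul_mem_unip gt_trans' (conj_mem_unip hN₁' _) (conj_mem_unip hL' _),
    mul_mem_unip lt_trans'' hU' hN₂', congrArg Units.val ?_⟩
  have h1 : blockLevi n k₁ * u₁ * (blockLevi n k₂ * u₂) = blockLevi n k₁ * N₁ * blockLevi n k₂ *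
      ((blockLevi n k₂)⁻¹ * (N₁⁻¹ * u₁) * blockLevi n k₂ * (u₂ * N₂⁻¹)) * N₂ := by group
  rw [h1, hP']
  simp only [map_mul]
  group

/-- Writing X = P U with P = L diag(k), the sum is P (1 + P⁻¹ Y U⁻¹) U, and the middle factor is
congruent to 1, so it has an LDU factorization that merges with the outer ones. -/
theorem HasLDU.add {c : ℕ} (hc : 1 ≤ c) {X Y : Matrix (BlockIdx n) (BlockIdx n) K}
    {k : ∀ j, GL (Fin (n j)) K} (hk : k ∈ intLevi n) (h : HasLDU n X k) (hY : MatLe (rad K c) Y) :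
    ∃ l, LeviCongr n (rad K c) l ∧ HasLDU n (X + Y) (k * l) := by
  obtain ⟨L, U, hL, hU, hL', hU', rfl⟩ := h
  have h0 := (rad_pos K c).le
  have hLk : L * blockLevi n k ∈ intGL K _ := mul_mem hL (blockLevi_mem_intGL.2 hk)
  have h1 : MatLe (rad K c) (1 + ((L * blockLevi n k)⁻¹).val * Y * (U⁻¹).val - 1) := by
    rw [add_sub_cancel_left]
    exact (MatLe.mul_left h0 (mem_intGL_iff.1 hLk).2 hY).mul_right h0 (mem_intGL_iff.1 hU).2
  obtain ⟨g, hg, hgi⟩ := exists_gl_of_sub_one h0 (rad_lt_one K hc) h1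
  obtain ⟨L₀, U₀, l, hL₀, hU₀, hL₀', hU₀', hl, hg'⟩ :=
    exists_ldu_of_mem_congrGL h0 (rad_lt_one K hc) (g := g) ⟨hgi, by rwa [hg]⟩
  refine ⟨l, hl, L * (blockLevi n k * L₀ * (blockLevi n k)⁻¹), U₀ * U,
    mul_mem hL (conj_blockLevi_mem hk hL₀), mul_mem hU₀ hU,
    mul_mem_unip gt_trans' hL' (conj_mem_unip hL₀' _), mul_mem_unip lt_trans'' hU₀' hU', ?_⟩
  have h2 : L * (blockLevi n k * L₀ * (blockLevi n k)⁻¹) * blockLevi n (k * l) * (U₀ * U) =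
      L * blockLevi n k * g * U := by
    rw [hg', map_mul]; group
  have h3 : (L * blockLevi n k).val *
      (1 + ((L * blockLevi n k)⁻¹).val * Y * (U⁻¹).val) * U.val =
      (L * blockLevi n k).val * U.val + ((L * blockLevi n k).val * ((L * blockLevi n k)⁻¹).val) *
        Y * ((U⁻¹).val * U.val) := by noncomm_ring
  rw [h2, Units.val_mul (L * blockLevi n k * g) U, Units.val_mul (L * blockLevi n k) g, hg, h3,
    Units.mul_inv, Units.inv_mul, one_mul, mul_one, ← Units.val_mul]

theorem blockTriangular_of_mem_unip_lt {u : GL (BlockIdx n) K}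
    (hu : u ∈ (blockParabolic (K := K) n (· < ·)).unip) :
    u.val.BlockTriangular (fun x : BlockIdx n => x.1) := fun x y h => by
  rw [hu x y (not_lt.2 h.le), Matrix.one_apply_ne]
  rintro rfl; exact lt_irrefl _ h

theorem blockTriangular_of_mem_unip_gt {u : GL (BlockIdx n) K}
    (hu : u ∈ (blockParabolic (K := K) n (· > ·)).unip) :
    u.val.BlockTriangular (fun x : BlockIdx n => OrderDual.toDual x.1) := fun x y h => by
  have h' : x.1 < y.1 := h
  rw [hu x y (not_lt.2 h'.le), Matrix.one_apply_ne]
  rintro rfl; exact lt_irrefl _ h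

theorem blockTriangular_blockLevi {α : Type*} [LinearOrder α] (f : Fin t → α)
    (l : ∀ j, GL (Fin (n j)) K) :
    (blockLevi n l).val.BlockTriangular (fun x : BlockIdx n => f x.1) := by
  rintro ⟨i, x⟩ ⟨j, y⟩ h
  rw [blockLevi_val, Matrix.blockDiagonal'_apply_ne]
  rintro rfl; exact lt_irrefl _ h

theorem blockTriangular_gl_inv {α : Type*} [LinearOrder α] {f : BlockIdx n → α}
    {u : GL (BlockIdx n) K} (h : u.val.BlockTriangular f) : (u⁻¹).val.BlockTriangular f := by
  have : Invertible u.val := u.invertible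
  rw [Matrix.coe_units_inv]
  exact Matrix.blockTriangular_inv_of_blockTriangular h

theorem mul_apply_of_block_lt {P Q : Matrix (BlockIdx n) (BlockIdx n) K} {x y : BlockIdx n}
    (hxy : x.1 = y.1) (h : ∀ z : BlockIdx n, z.1 ≠ x.1 → P x z = 0 ∨ Q z y = 0) :
    (P * Q) x y = ∑ z : Fin (n x.1), P x ⟨x.1, z⟩ * Q ⟨x.1, z⟩ y := by
  rw [Matrix.mul_apply, Fintype.sum_sigma, Finset.sum_eq_single x.1]
  · intro j _ hj
    refine Finset.sum_eq_zero fun z _ => ?_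
    rcases h ⟨j, z⟩ hj with h | h <;> simp [h]
  · simp

/-- For two factorizations, L'⁻¹ L is block lower and block upper triangular, hence block diagonal,
hence 1 because L and L' are unipotent. The diagonal blocks of what remains are `k` and `k'`. -/
theorem HasLDU.unique {X : Matrix (BlockIdx n) (BlockIdx n) K} {k k' : ∀ j, GL (Fin (n j)) K}
    (h : HasLDU n X k) (h' : HasLDU n X k') : k = k' := by
  obtain ⟨L, U, -, -, hL, hU, rfl⟩ := h
  obtain ⟨L', U', -, -, hL', hU', hX⟩ := h'
  have hX' := Units.ext hX
  have hΔ : L'⁻¹ * L = blockLevi n k' * (U' * U⁻¹) * (blockLevi n k)⁻¹ := by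
    have h1 : L = L' * blockLevi n k' * U' * U⁻¹ * (blockLevi n k)⁻¹ :=
      eq_mul_inv_of_mul_eq (eq_mul_inv_of_mul_eq hX')
    rw [h1]; group
  have hlow : (L'⁻¹ * L).val.BlockTriangular (fun x : BlockIdx n => OrderDual.toDual x.1) :=
    (blockTriangular_gl_inv (blockTriangular_of_mem_unip_gt hL')).mul
      (blockTriangular_of_mem_unip_gt hL)
  have hup : (L'⁻¹ * L).val.BlockTriangular (fun x : BlockIdx n => x.1) := by
    rw [hΔ, ← map_inv]
    exact ((blockTriangular_blockLevi id k').mul ((blockTriangular_of_mem_unip_lt hU').mul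
      (blockTriangular_gl_inv (blockTriangular_of_mem_unip_lt hU)))).mul
      (blockTriangular_blockLevi id k⁻¹)
  have hdiag : ∀ x y : BlockIdx n, x.1 ≠ y.1 → (L'⁻¹ * L).val x y = 0 := by
    intro x y hxy
    rcases lt_or_gt_of_ne hxy with h | h
    · exact hlow h
    · exact hup h
  have hLL : L' * (L'⁻¹ * L) = L := by group
  have hone : L'⁻¹ * L = 1 := by
    refine Units.ext (Matrix.ext fun x y => ?_)
    rw [Units.val_one]
    rcases eq_or_ne x.1 y.1 with hxy | hxy
    · have h1 : (L' * (L'⁻¹ * L)).val x y = L.val x y := by rw [hLL]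
      rw [Units.val_mul L', mul_apply_of_block_lt hxy
        (fun z hz => Or.inr (hdiag z y (hxy ▸ hz)))] at h1
      rw [hL x y (by rw [hxy]; exact lt_irrefl _)] at h1
      rw [← h1, Finset.sum_eq_single x.2]
      · rw [hL' x ⟨x.1, x.2⟩ (lt_irrefl _)]; simp
      · intro z _ hz
        rw [hL' x ⟨x.1, z⟩ (lt_irrefl _), Matrix.one_apply_ne, zero_mul]
        intro h; apply hz
        obtain ⟨i, x⟩ := x
        simpa using (Sigma.mk.inj_iff.1 h).2.symm
      · simp
    · rw [hdiag x y hxy, Matrix.one_apply_ne]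
      rintro rfl; exact hxy rfl
  have hLL' : L = L' := (inv_mul_eq_one.1 hone).symm
  rw [hLL', mul_assoc, mul_assoc, mul_right_inj] at hX'
  apply blockLevi_injective
  refine Units.ext (Matrix.ext fun x y => ?_)
  rcases eq_or_ne x.1 y.1 with hxy | hxy
  · have key : ∀ (l : ∀ j, GL (Fin (n j)) K) (V : GL (BlockIdx n) K),
        V ∈ (blockParabolic (K := K) n (· < ·)).unip →
        (blockLevi n l * V).val x y = (blockLevi n l).val x y := by
      intro l V hV
      rw [Units.val_mul, mul_apply_of_block_lt hxy fun z hz => Or.inl ?_,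
        Finset.sum_congr rfl fun z _ => by rw [hV ⟨x.1, z⟩ y (by rw [hxy]; exact lt_irrefl _)]]
      · have h2 := mul_apply_of_block_lt (P := (blockLevi n l).val)
          (Q := (1 : Matrix (BlockIdx n) (BlockIdx n) K)) hxy fun z hz => Or.inl ?_
        · rw [← h2, Matrix.mul_one]
        · exact Matrix.blockDiagonal'_apply_ne _ _ _ hz.symm
      · exact Matrix.blockDiagonal'_apply_ne _ _ _ hz.symm
    rw [← key k U hU, ← key k' U' hU', hX']
  · rw [blockLevi_val, blockLevi_val]
    exact (Matrix.blockDiagonal'_apply_ne _ _ _ hxy).trans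
      (Matrix.blockDiagonal'_apply_ne _ _ _ hxy).symm

end BlockLDU

end LocalZeta
end

noncomputable section
namespace LocalZeta

/-! ### Functions on 𝔛 defined through the Levi part. -/

section ExtendToX

variable {K : Type*} [NontriviallyNormedField K] [IsNormalizedLocalField K]
variable {t : ℕ} {n : Fin t → ℕ}

theorem mem_iwahori_of_unip {R : Fin t → Fin t → Prop} {r : ℕ} {u : GL (BlockIdx n) K}
    (hu : u ∈ intGL K _) (hu' : u ∈ (blockParabolic (K := K) n R).unip) : u ∈ iwahori n R r := by
  refine ⟨hu, fun x y h => mem_pPow_iff_rad.2 ?_⟩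
  rw [hu' x y h, sub_self, norm_zero]
  exact (rad_pos K r).le

theorem HasLDU.exists_decomp {X : Matrix (BlockIdx n) (BlockIdx n) K}
    {k : ∀ j, GL (Fin (n j)) K} (hk : k ∈ intLevi n) (h : HasLDU n X k) (r : ℕ) :
    ∃ u₁ ∈ iwahori (K := K) n (· > ·) r, ∃ u₂ ∈ iwahori (K := K) n (· < ·) r,
      X = ((blockLevi n k * u₁) * (blockLevi n 1 * u₂)).val := by
  obtain ⟨L, U, hL, hU, hL', hU', rfl⟩ := h
  refine ⟨(blockLevi n k)⁻¹ * L * blockLevi n k, mem_iwahori_of_unip ?_ ?_, U,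
    mem_iwahori_of_unip hU hU', congrArg Units.val ?_⟩
  · have := conj_blockLevi_mem (inv_mem hk) hL
    rwa [map_inv, inv_inv] at this
  · have := conj_mem_unip hL' k⁻¹
    rwa [map_inv, inv_inv] at this
  · rw [map_one]; group

theorem LeviCongr.mono {c d : ℝ} {l : ∀ j, GL (Fin (n j)) K} (h : LeviCongr n c l) (hcd : c ≤ d) :
    LeviCongr n d l := ⟨h.1, h.2.mono hcd⟩

/-- Shows in particular that 𝔛 does not depend on the positive level `r`. -/
theorem mem_frakX_iff {r : ℕ} (hr : 1 ≤ r) {X : Matrix (BlockIdx n) (BlockIdx n) K} :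
    X ∈ frakX n r ↔ ∃ k ∈ intLevi n, HasLDU n X k := by
  constructor
  · rintro ⟨_, ⟨k₁, hk₁, u₁, hu₁, rfl⟩, _, ⟨k₂, hk₂, u₂, hu₂, rfl⟩, rfl⟩
    obtain ⟨l, hl, h⟩ := hasLDU_of_iwahori hr hk₁ hu₁ hk₂ hu₂
    exact ⟨_, mul_mem (mul_mem hk₁ hk₂) hl.1, h⟩
  · rintro ⟨k, hk, h⟩
    obtain ⟨u₁, hu₁, u₂, hu₂, hX⟩ := h.exists_decomp hk r
    exact ⟨_, ⟨k, hk, u₁, hu₁, rfl⟩, _, ⟨1, one_mem _, u₂, hu₂, rfl⟩, hX⟩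

theorem HasLDU.exists_intGL {X : Matrix (BlockIdx n) (BlockIdx n) K}
    {k : ∀ j, GL (Fin (n j)) K} (hk : k ∈ intLevi n) (h : HasLDU n X k) :
    ∃ g ∈ intGL K (BlockIdx n), g.val = X := by
  obtain ⟨L, U, hL, hU, -, -, rfl⟩ := h
  exact ⟨_, mul_mem (mul_mem hL (blockLevi_mem_intGL.2 hk)) hU, rfl⟩

theorem HasLDU.neg {X : Matrix (BlockIdx n) (BlockIdx n) K}
    {k : ∀ j, GL (Fin (n j)) K} (h : HasLDU n X k) : HasLDU n (-X) (-k) := by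
  obtain ⟨L, U, hL, hU, hL', hU', rfl⟩ := h
  refine ⟨L, U, hL, hU, hL', hU', ?_⟩
  rw [blockLevi_neg, mul_neg, neg_mul, Units.val_neg]

theorem neg_mem_intLevi {k : ∀ j, GL (Fin (n j)) K} (hk : k ∈ intLevi n) : -k ∈ intLevi n := by
  rw [mem_intLevi] at *
  intro j
  have h := mem_intGL_iff.1 (hk j)
  refine mem_intGL_iff.2 ⟨?_, ?_⟩
  · exact h.1.neg
  · rw [Pi.neg_apply, inv_neg]; exact h.2.neg

theorem exists_intGL_of_mem_frakX {r : ℕ} (hr : 1 ≤ r) {X : Matrix (BlockIdx n) (BlockIdx n) K}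
    (h : X ∈ frakX n r) : ∃ g ∈ intGL K (BlockIdx n), g.val = X := by
  obtain ⟨k, hk, h⟩ := (mem_frakX_iff hr).1 h
  exact h.exists_intGL hk

theorem matLe_of_mem_frakX {r : ℕ} (hr : 1 ≤ r) {X : Matrix (BlockIdx n) (BlockIdx n) K}
    (h : X ∈ frakX n r) : MatLe 1 X := by
  obtain ⟨g, hg, rfl⟩ := exists_intGL_of_mem_frakX hr h
  exact (mem_intGL_iff.1 hg).1

theorem neg_mem_frakX {r : ℕ} (hr : 1 ≤ r) {X : Matrix (BlockIdx n) (BlockIdx n) K}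
    (h : X ∈ frakX n r) : -X ∈ frakX n r := by
  rw [mem_frakX_iff hr] at *
  obtain ⟨k, hk, h⟩ := h
  exact ⟨-k, neg_mem_intLevi hk, h.neg⟩

theorem add_mem_frakX {r c : ℕ} (hr : 1 ≤ r) (hc : 1 ≤ c)
    {X Y : Matrix (BlockIdx n) (BlockIdx n) K} (h : X ∈ frakX n r) (hY : MatLe (rad K c) Y) :
    X + Y ∈ frakX n r := by
  rw [mem_frakX_iff hr] at *
  obtain ⟨k, hk, h⟩ := h
  obtain ⟨l, hl, h'⟩ := h.add hc hk hY
  exact ⟨_, mul_mem hk hl.1, h'⟩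

theorem add_mem_frakX_iff {r c : ℕ} (hr : 1 ≤ r) (hc : 1 ≤ c)
    {X Y : Matrix (BlockIdx n) (BlockIdx n) K} (hY : MatLe (rad K c) Y) :
    X + Y ∈ frakX n r ↔ X ∈ frakX n r := by
  refine ⟨fun h => ?_, fun h => add_mem_frakX hr hc h hY⟩
  have := add_mem_frakX hr hc h hY.neg
  rwa [add_neg_cancel_right] at this

/-- Makes the choice in `extendToX` harmless. By uniqueness of LDU, the chosen k₁ k₂ agrees with `k`
up to a Levi element congruent to 1 modulo 𝔭^r, which `f` ignores since c ≤ r. -/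
theorem extendToX_apply {r c : ℕ} (hr : 1 ≤ r) (hcr : c ≤ r) {f : (∀ j, GL (Fin (n j)) K) → ℂ}
    (hf : ∀ k l, k ∈ intLevi n → LeviCongr n (rad K c) l → f (k * l) = f k)
    {X : Matrix (BlockIdx n) (BlockIdx n) K} {k : ∀ j, GL (Fin (n j)) K} (hk : k ∈ intLevi n)
    (h : HasLDU n X k) : extendToX n r (fun k₁ k₂ => f (k₁ * k₂)) X = f k := by
  obtain ⟨u₁, hu₁, u₂, hu₂, hX⟩ := h.exists_decomp hk r
  have hex : ∃ d : ((∀ j, GL (Fin (n j)) K) × GL (BlockIdx n) K) ×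
      ((∀ j, GL (Fin (n j)) K) × GL (BlockIdx n) K),
      d.1.1 ∈ intLevi n ∧ d.1.2 ∈ iwahori n (· > ·) r ∧
      d.2.1 ∈ intLevi n ∧ d.2.2 ∈ iwahori n (· < ·) r ∧
      X = ((blockLevi n d.1.1 * d.1.2) * (blockLevi n d.2.1 * d.2.2)).val :=
    ⟨⟨⟨k, u₁⟩, ⟨1, u₂⟩⟩, hk, hu₁, one_mem _, hu₂, hX⟩
  rw [extendToX, dif_pos hex]
  obtain ⟨h1, h2, h3, h4, h5⟩ := hex.choose_spec
  obtain ⟨l, hl, h'⟩ := hasLDU_of_iwahori hr h1 h2 h3 h4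
  rw [← h5] at h'
  rw [h.unique h', hf _ _ (mul_mem h1 h3) (hl.mono (rad_anti K hcr))]

theorem extendToX_of_notMem {r : ℕ} {F : (∀ j, GL (Fin (n j)) K) → (∀ j, GL (Fin (n j)) K) → ℂ}
    {X : Matrix (BlockIdx n) (BlockIdx n) K} (h : X ∉ frakX n r) : extendToX n r F X = 0 := by
  rw [extendToX, dif_neg]
  rintro ⟨⟨⟨k₁, u₁⟩, ⟨k₂, u₂⟩⟩, h1, h2, h3, h4, h5⟩
  exact h ⟨_, ⟨k₁, h1, u₁, h2, rfl⟩, _, ⟨k₂, h3, u₂, h4, rfl⟩, h5⟩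

/-- Functions on matrices that vanish off `𝔛` and are invariant under translations by
`𝔭 ^ c`. -/
structure IsLevelFun (n : Fin t → ℕ) (r c : ℕ) (μ : Matrix (BlockIdx n) (BlockIdx n) K → ℂ) :
    Prop where
  eq_zero : ∀ X ∉ frakX n r, μ X = 0
  add : ∀ X Y, MatLe (rad K c) Y → μ (X + Y) = μ X

theorem isLevelFun_extendToX {r c : ℕ} (hr : 1 ≤ r) (hc : 1 ≤ c) (hcr : c ≤ r)
    {f : (∀ j, GL (Fin (n j)) K) → ℂ}
    (hf : ∀ k l, k ∈ intLevi n → LeviCongr n (rad K c) l → f (k * l) = f k) :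
    IsLevelFun n r c (extendToX (K := K) n r (fun k₁ k₂ => f (k₁ * k₂))) := by
  refine ⟨fun X h => extendToX_of_notMem h, fun X Y hY => ?_⟩
  by_cases hX : X ∈ frakX n r
  · obtain ⟨k, hk, h⟩ := (mem_frakX_iff hr).1 hX
    obtain ⟨l, hl, h'⟩ := h.add hc hk hY
    rw [extendToX_apply hr hcr hf hk h, extendToX_apply hr hcr hf (mul_mem hk hl.1) h', hf k l hk hl]
  · rw [extendToX_of_notMem hX, extendToX_of_notMem]
    rwa [add_mem_frakX_iff hr hc hY]

/-- Factoring out `g` leaves the determinant of a matrix congruent to 1 modulo 𝔭^c. -/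
theorem mulChar_det_add {χ : MulChar K ℂ} {c : ℕ} (hχ : IsTrivialOnUnits K χ c) {ι : Type*}
    [Fintype ι] [DecidableEq ι] {g : GL ι K} (hg : g ∈ intGL K ι) {Y : Matrix ι ι K}
    (hY : MatLe (rad K c) Y) : χ (g.val + Y).det = χ g.val.det := by
  have h0 := (rad_pos K c).le
  have h1 : g.val + Y = g.val * (1 + (g⁻¹).val * Y) := by
    rw [mul_add, mul_one, gl_mul_inv_cancel_left]
  have hE : MatLe (rad K c) ((g⁻¹).val * Y) := MatLe.mul_left h0 (mem_intGL_iff.1 hg).2 hY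
  rw [h1, Matrix.det_mul, map_mul, hχ (1 + (g⁻¹).val * Y).det, mul_one]
  rw [mem_pPow_iff_rad]
  have h2 := norm_det_sub_det_le h0 (M := 1 + (g⁻¹).val * Y) (N := 1)
    (MatLe.one.add (hE.mono (rad_le_one K c))) MatLe.one (by rwa [add_sub_cancel_left])
  rwa [Matrix.det_one] at h2

theorem isTrivialOnUnits_inv {χ : MulChar K ℂ} {c : ℕ} (hc : 1 ≤ c) (hχ : IsTrivialOnUnits K χ c) :
    IsTrivialOnUnits K χ⁻¹ c := by
  intro x hx
  have h1 := hχ x hx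
  have hx0 : IsUnit x := by
    by_contra h
    rw [MulChar.map_nonunit _ h] at h1
    exact zero_ne_one h1
  have h2 : χ⁻¹ x * χ x = 1 := by
    rw [← MulChar.mul_apply, inv_mul_cancel, MulChar.one_apply hx0]
  rwa [h1, mul_one] at h2

theorem IsTrivialOnUnits.mono {χ : MulChar K ℂ} {c d : ℕ} (h : IsTrivialOnUnits K χ c)
    (hcd : c ≤ d) : IsTrivialOnUnits K χ d :=
  fun x hx => h x ((mem_pPow_iff_rad.1 hx).trans (rad_anti K hcd))

theorem IsLevelFun.mono {r c d : ℕ} {μ : Matrix (BlockIdx n) (BlockIdx n) K → ℂ}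
    (h : IsLevelFun n r c μ) (hcd : c ≤ d) : IsLevelFun n r d μ :=
  ⟨h.eq_zero, fun X Y hY => h.add X Y (hY.mono (rad_anti K hcd))⟩

theorem IsLevelFun.mulChar {r c : ℕ} (hr : 1 ≤ r) (hc : 1 ≤ c)
    {μ : Matrix (BlockIdx n) (BlockIdx n) K → ℂ}
    (h : IsLevelFun n r c μ) {χ : MulChar K ℂ} (hχ : IsTrivialOnUnits K χ c) :
    IsLevelFun n r c fun X => χ X.det * μ X := by
  refine ⟨fun X hX => by simp only [h.eq_zero X hX, mul_zero], fun X Y hY => ?_⟩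
  by_cases hX : X ∈ frakX n r
  · obtain ⟨g, hg, rfl⟩ := exists_intGL_of_mem_frakX hr hX
    simp only [mulChar_det_add hχ hg hY, h.add _ Y hY]
  · have hX' : X + Y ∉ frakX n r := by rwa [add_mem_frakX_iff hr hc hY]
    simp only [h.eq_zero X hX, h.eq_zero _ hX', mul_zero]

end ExtendToX

/-! ### Matrix coefficients of types: level and behaviour under -1. -/

section Types

variable {K : Type*} [NontriviallyNormedField K] [IsNormalizedLocalField K]
variable {t : ℕ} {n : Fin t → ℕ} {V : Fin t → Type*} [∀ j, AddCommGroup (V j)]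
  [∀ j, Module ℂ (V j)] {σ : ∀ j, Representation ℂ (GL (Fin (n j)) K) (V j)} {c : ℕ}
  {W : Fin t → Type*} [∀ j, AddCommGroup (W j)] [∀ j, Module ℂ (W j)]

theorem piPairing_tprod (v : ∀ j, V j) (l : ∀ j, smoothDual (σ j)) :
    piPairing σ (PiTensorProduct.tprod ℂ v) (PiTensorProduct.tprod ℂ l) = ∏ j, (l j).1 (v j) := by
  rw [piPairing, PiTensorProduct.map_tprod, PiTensorProduct.dualDistrib_apply]
  rfl

theorem extTensor_tprod {H : Fin t → Type*} [∀ j, Group (H j)]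
    (σ : ∀ j, Representation ℂ (H j) (V j)) (l : ∀ j, H j) (v : ∀ j, V j) :
    extTensor σ l (PiTensorProduct.tprod ℂ v) = PiTensorProduct.tprod ℂ fun j => σ j (l j) (v j) :=
  PiTensorProduct.map_tprod _ _

/-- The matrix coefficient `k ↦ ∏ j, ⟨σ_j(k_j) φ_j, φt_j⟩`. -/
def typeCoeff (T : ∀ j, TypeVectors (σ j) c (W j)) (k : ∀ j, GL (Fin (n j)) K) : ℂ :=
  ∏ j, (T j).φt.1 (σ j (k j) (T j).φ)

/-- Moving k₂ to the other side of the pairing shows that the value depends on the product k₁ k₂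
alone, the form required by `extendToX_apply`. -/
theorem muA'_eq (T : ∀ j, TypeVectors (σ j) c (W j)) (r : ℕ) :
    muA' T r = extendToX n r fun k₁ k₂ => typeCoeff T (k₁ * k₂)⁻¹ := by
  unfold muA' typeCoeff
  congr 1
  funext k₁ k₂
  rw [vec₀, dualVec₀, extTensor_tprod, extTensor_tprod, piPairing_tprod]
  refine Finset.prod_congr rfl fun j _ => ?_
  change (T j).φt.1 (σ j (k₂ j)⁻¹ (σ j (k₁⁻¹ j) (T j).φ)) = _
  rw [← Module.End.mul_apply, ← map_mul, mul_inv_rev]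
  rfl

theorem muB'_eq (T : ∀ j, TypeVectors (σ j) c (W j)) (r : ℕ) :
    muB' T r = extendToX n r fun k₁ k₂ => typeCoeff T (k₁ * k₂) := by
  unfold muB' typeCoeff
  congr 1
  funext k₁ k₂
  rw [vec₀, dualVec₀, extTensor_tprod, extTensor_tprod, piPairing_tprod]
  refine Finset.prod_congr rfl fun j _ => ?_
  change (T j).φt.1 (σ j (k₁⁻¹ j)⁻¹ (σ j (k₂ j) (T j).φ)) = _
  rw [← Module.End.mul_apply, ← map_mul, Pi.inv_apply, inv_inv]
  rfl

namespace TypeVectors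

variable {m : ℕ} {V : Type*} [AddCommGroup V] [Module ℂ V]
  {σ : Representation ℂ (GL (Fin m) K) V} {W : Type*} [AddCommGroup W] [Module ℂ W]
  (T : TypeVectors σ c W)

theorem map_mem_range {k : GL (Fin m) K} (hk : k ∈ intGL K _) {v : V}
    (hv : v ∈ LinearMap.range T.α) : σ k v ∈ LinearMap.range T.α := by
  obtain ⟨w, rfl⟩ := hv
  exact ⟨T.τ ⟨k, hk⟩ w, T.α_equivariant ⟨k, hk⟩ w⟩

theorem apply_of_congr {k : GL (Fin m) K} (hk : k ∈ intGL K _)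
    (hk' : MatLe (rad K c) (k.val - 1)) {v : V} (hv : v ∈ LinearMap.range T.α) : σ k v = v := by
  obtain ⟨w, rfl⟩ := hv
  rw [← T.α_equivariant ⟨k, hk⟩ w, T.trivial ⟨k, hk⟩ fun x y => mem_pPow_iff_rad.2 (hk' x y)]
  rfl

theorem neg_one_mem_intGL {ι : Type*} [Fintype ι] [DecidableEq ι] : (-1 : GL ι K) ∈ intGL K ι := by
  refine mem_intGL_iff.2 ⟨?_, ?_⟩
  · rw [Units.val_neg]; exact MatLe.one.neg
  · rw [inv_neg, inv_one, Units.val_neg]; exact MatLe.one.neg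

/-- Since -1 is central in the integral group, its fixed vectors form a subrepresentation of `τ`,
which is zero or everything. In the first case the vectors w + τ(-1) w, being fixed, all vanish, so
-1 acts by the scalar -1. -/
theorem exists_neg_one_smul : ∃ z : ℂ, ∀ v ∈ LinearMap.range T.α, σ (-1) v = z • v := by
  let ω : intGL K (Fin m) := ⟨-1, neg_one_mem_intGL⟩
  have hω : ω * ω = 1 := Subtype.ext (by simp [ω])
  have hcomm : ∀ g : intGL K (Fin m), g * ω = ω * g := fun g => Subtype.ext (by simp [ω])
  suffices h : ∃ z : ℂ, ∀ w, T.τ ω w = z • w by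
    obtain ⟨z, hz⟩ := h
    refine ⟨z, ?_⟩
    rintro _ ⟨w, rfl⟩
    rw [← map_smul, ← hz, T.α_equivariant]
  let S : Subrepresentation T.τ :=
    { toSubmodule := LinearMap.ker (T.τ ω - 1)
      apply_mem_toSubmodule := fun g v hv => by
        rw [LinearMap.mem_ker, LinearMap.sub_apply, sub_eq_zero] at *
        rw [Module.End.one_apply] at *
        rw [← Module.End.mul_apply, ← map_mul, ← hcomm, map_mul, Module.End.mul_apply, hv] }
  have hirr := T.irreducible
  rcases hirr.eq_bot_or_eq_top S with h | h
  · refine ⟨-1, fun w => ?_⟩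
    have hw : T.τ ω w + w ∈ S.toSubmodule := by
      change T.τ ω w + w ∈ LinearMap.ker (T.τ ω - 1)
      rw [LinearMap.mem_ker, LinearMap.sub_apply, map_add, ← Module.End.mul_apply, ← map_mul, hω,
        map_one, Module.End.one_apply, Module.End.one_apply]
      abel
    rw [h] at hw
    have hw' : T.τ ω w + w = 0 := hw
    rw [neg_one_smul]
    exact eq_neg_of_add_eq_zero_left hw'
  · refine ⟨1, fun w => ?_⟩
    have hw : w ∈ S.toSubmodule := by rw [h]; trivial
    have hw' : (T.τ ω - 1) w = 0 := hw
    rw [one_smul]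
    exact sub_eq_zero.1 hw'

end TypeVectors

theorem leviCongr_apply {ρ : ℝ} {l : ∀ j, GL (Fin (n j)) K} (h : LeviCongr n ρ l) (j : Fin t) :
    MatLe ρ ((l j).val - 1) := fun x y => by
  have := h.2 ⟨j, x⟩ ⟨j, y⟩
  rw [Matrix.sub_apply, blockLevi_val, Matrix.blockDiagonal'_apply_eq] at this
  rw [Matrix.sub_apply]
  have h1 : (1 : Matrix (BlockIdx n) (BlockIdx n) K) ⟨j, x⟩ ⟨j, y⟩ = (1 : Matrix _ _ K) x y := by
    simp [Matrix.one_apply]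
  rwa [h1] at this

theorem leviCongr_inv {ρ : ℝ} (h0 : 0 ≤ ρ) {l : ∀ j, GL (Fin (n j)) K} (h : LeviCongr n ρ l) :
    LeviCongr n ρ l⁻¹ := by
  refine ⟨inv_mem h.1, ?_⟩
  rw [map_inv]
  exact ((mem_congrGL h0).1 (inv_mem ((mem_congrGL h0).2 ⟨blockLevi_mem_intGL.2 h.1, h.2⟩))).2

theorem typeCoeff_mul (T : ∀ j, TypeVectors (σ j) c (W j)) {k l : ∀ j, GL (Fin (n j)) K}
    (hl : LeviCongr n (rad K c) l) : typeCoeff T (k * l) = typeCoeff T k := by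
  refine Finset.prod_congr rfl fun j _ => ?_
  rw [Pi.mul_apply, map_mul, Module.End.mul_apply,
    (T j).apply_of_congr (mem_intLevi.1 hl.1 j) (leviCongr_apply hl j) (T j).φ_mem]

theorem typeCoeff_mul_left (T : ∀ j, TypeVectors (σ j) c (W j)) {k l : ∀ j, GL (Fin (n j)) K}
    (hk : k ∈ intLevi n) (hl : LeviCongr n (rad K c) l) : typeCoeff T (l * k) = typeCoeff T k := by
  refine Finset.prod_congr rfl fun j _ => ?_
  rw [Pi.mul_apply, map_mul, Module.End.mul_apply,
    (T j).apply_of_congr (mem_intLevi.1 hl.1 j) (leviCongr_apply hl j)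
      ((T j).map_mem_range (mem_intLevi.1 hk j) (T j).φ_mem)]

theorem typeCoeff_one (T : ∀ j, TypeVectors (σ j) c (W j)) : typeCoeff T 1 = 1 := by
  refine Finset.prod_eq_one fun j _ => ?_
  rw [Pi.one_apply, map_one, Module.End.one_apply, (T j).pairing_eq_one]

theorem typeCoeff_neg (T : ∀ j, TypeVectors (σ j) c (W j)) {k : ∀ j, GL (Fin (n j)) K}
    (hk : k ∈ intLevi n) : typeCoeff T (-k) = typeCoeff T (-1) * typeCoeff T k := by
  choose z hz using fun j => (T j).exists_neg_one_smul
  have key : ∀ k : ∀ j, GL (Fin (n j)) K, k ∈ intLevi n →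
      typeCoeff T (-k) = (∏ j, z j) * typeCoeff T k := by
    intro k hk
    rw [typeCoeff, typeCoeff, ← Finset.prod_mul_distrib]
    refine Finset.prod_congr rfl fun j _ => ?_
    rw [Pi.neg_apply, ← neg_one_mul, map_mul, Module.End.mul_apply,
      hz j _ ((T j).map_mem_range (mem_intLevi.1 hk j) (T j).φ_mem), map_smul, smul_eq_mul]
  rw [key k hk, key 1 (one_mem _), typeCoeff_one, mul_one]

/-- The function changes sign by a fixed factor under multiplication by a sign. -/
def IsSignEquivariant {ι : Type*} [Fintype ι] [DecidableEq ι] (μ : Matrix ι ι K → ℂ) : Prop :=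
  ∀ (ε : ℤˣ) X, μ ((ε : ℤ) • X) = μ ((ε : ℤ) • 1) * μ X

theorem hasLDU_one : HasLDU n (1 : Matrix (BlockIdx n) (BlockIdx n) K) 1 :=
  ⟨1, 1, one_mem _, one_mem _, fun _ _ _ => rfl, fun _ _ _ => rfl, by simp⟩

theorem isSignEquivariant_extendToX {r c : ℕ} (hr : 1 ≤ r) (hcr : c ≤ r)
    {f : (∀ j, GL (Fin (n j)) K) → ℂ}
    (hf : ∀ k l, k ∈ intLevi n → LeviCongr n (rad K c) l → f (k * l) = f k) (hf1 : f 1 = 1)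
    (hneg : ∀ k ∈ intLevi n, f (-k) = f (-1) * f k) :
    IsSignEquivariant (extendToX (K := K) n r (fun k₁ k₂ => f (k₁ * k₂))) := by
  intro ε X
  have h1 := extendToX_apply hr hcr hf (one_mem _) (hasLDU_one (K := K))
  rcases Int.units_eq_one_or ε with rfl | rfl
  · rw [Units.val_one, one_smul, one_smul, h1, hf1, one_mul]
  · have h2 := extendToX_apply hr hcr hf (neg_mem_intLevi (one_mem _)) (hasLDU_one (K := K)).neg
    rw [Units.val_neg, Units.val_one, neg_one_smul, neg_one_smul, h2]
    by_cases hX : X ∈ frakX n r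
    · obtain ⟨k, hk, h⟩ := (mem_frakX_iff hr).1 hX
      rw [extendToX_apply hr hcr hf hk h, extendToX_apply hr hcr hf (neg_mem_intLevi hk) h.neg,
        hneg k hk]
    · rw [extendToX_of_notMem hX, extendToX_of_notMem, mul_zero]
      intro h
      apply hX
      rw [← neg_neg X]
      exact neg_mem_frakX hr h

theorem IsSignEquivariant.mulChar {ι : Type*} [Fintype ι] [DecidableEq ι] {μ : Matrix ι ι K → ℂ}
    (h : IsSignEquivariant μ) (χ : MulChar K ℂ) : IsSignEquivariant fun X => χ X.det * μ X := by
  intro ε X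
  have : ((ε : ℤ) • X).det = ((ε : ℤ) • (1 : Matrix ι ι K)).det * X.det := by
    rw [← Matrix.det_mul, smul_mul_assoc, one_mul]
  simp only [this, h ε X, map_mul]
  ring

section

variable (T : ∀ j, TypeVectors (σ j) c (W j)) {r : ℕ}

theorem typeCoeff_inv_mul {k l : ∀ j, GL (Fin (n j)) K} (hk : k ∈ intLevi n)
    (hl : LeviCongr n (rad K c) l) : typeCoeff T (k * l)⁻¹ = typeCoeff T k⁻¹ := by
  rw [mul_inv_rev]
  exact typeCoeff_mul_left T (inv_mem hk) (leviCongr_inv (rad_pos K c).le hl)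

theorem isLevelFun_muA' (hc : 1 ≤ c) (hcr : c ≤ r) : IsLevelFun n r c (muA' T r) := by
  rw [muA'_eq]
  exact isLevelFun_extendToX (f := fun k => typeCoeff T k⁻¹) (hc.trans hcr) hc hcr
    fun k l hk hl => typeCoeff_inv_mul T hk hl

theorem isLevelFun_muB' (hc : 1 ≤ c) (hcr : c ≤ r) : IsLevelFun n r c (muB' T r) := by
  rw [muB'_eq]
  exact isLevelFun_extendToX (f := fun k => typeCoeff T k) (hc.trans hcr) hc hcr
    fun k l hk hl => typeCoeff_mul T hl

theorem isSignEquivariant_muA' (hc : 1 ≤ c) (hcr : c ≤ r) : IsSignEquivariant (muA' T r) := by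
  rw [muA'_eq]
  refine isSignEquivariant_extendToX (f := fun k => typeCoeff T k⁻¹) (hc.trans hcr) hcr
    (fun k l hk hl => typeCoeff_inv_mul T hk hl) (by rw [inv_one, typeCoeff_one]) fun k hk => ?_
  have h1 : (-k)⁻¹ = -k⁻¹ := funext fun j => inv_neg
  have h2 : (-1 : ∀ j, GL (Fin (n j)) K)⁻¹ = -1 := funext fun j => by
    rw [Pi.inv_apply, Pi.neg_apply, Pi.one_apply, inv_neg, inv_one]
  simp only [h1, h2]
  exact typeCoeff_neg T (inv_mem hk)

theorem isSignEquivariant_muB' (hc : 1 ≤ c) (hcr : c ≤ r) : IsSignEquivariant (muB' T r) := by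
  rw [muB'_eq]
  exact isSignEquivariant_extendToX (f := fun k => typeCoeff T k) (hc.trans hcr) hcr
    (fun k l hk hl => typeCoeff_mul T hl) (typeCoeff_one T) fun k hk => typeCoeff_neg T hk

/-- On 𝔛 the determinant is nonzero and χ₂ cancels its inverse. The twisted function thus involves
χ₁ and the types j ≤ t only, so its level is c_a, whatever the conductor of χ₂. -/
theorem twist_muA (χ₁ χ₂ : MulChar K ℂ) (hr : 1 ≤ r) :
    twist χ₁ χ₂ (muA χ₂ T r) = fun X => χ₁⁻¹ X.det * muA' T r X := by
  funext X
  rw [twist, muA]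
  by_cases hX : X ∈ frakX n r
  · obtain ⟨g, hg, rfl⟩ := exists_intGL_of_mem_frakX hr hX
    have h : χ₂ g.val.det * χ₂⁻¹ g.val.det = 1 := by
      rw [← MulChar.mul_apply, mul_inv_cancel, MulChar.one_apply]
      exact (norm_pos_iff.1 (norm_det_pos g)).isUnit
    linear_combination (χ₁⁻¹ g.val.det * muA' T r g.val) * h
  · rw [muA', extendToX_of_notMem hX]; simp

theorem twist_muB (χ₁ χ₂ : MulChar K ℂ) (hr : 1 ≤ r) :
    twist χ₁ χ₂ (muB χ₁ T r) = fun X => χ₂ X.det * muB' T r X := by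
  funext X
  rw [twist, muB]
  by_cases hX : X ∈ frakX n r
  · obtain ⟨g, hg, rfl⟩ := exists_intGL_of_mem_frakX hr hX
    have h : χ₁ g.val.det * χ₁⁻¹ g.val.det = 1 := by
      rw [← MulChar.mul_apply, mul_inv_cancel, MulChar.one_apply]
      exact (norm_pos_iff.1 (norm_det_pos g)).isUnit
    linear_combination (χ₂ g.val.det * muB' T r g.val) * h
  · rw [muB', extendToX_of_notMem hX]; simp

end

end Types

end LocalZeta
end

noncomputable section
namespace LocalZeta

/-! ### Orthogonality relations for the additive character. -/

section Fourier

variable {K : Type*} [NontriviallyNormedField K] [IsNormalizedLocalField K]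
  [MeasurableSpace K] [BorelSpace K]
variable {ι κ : Type*} [Fintype ι] [Fintype κ] {e : AddChar K Circle}

/-- Take y = x₀ / x with `x₀` in 𝔭⁻¹ where `e` is nontrivial. Norms are powers of q, so the strict
bound on ‖x‖ gains a full factor q, which pays for ‖x₀‖ ≤ q. -/
theorem exists_addChar_ne_one (he : IsUnramifiedAddChar K e) {c : ℕ} {x : K}
    (hx : (rad K c)⁻¹ < ‖x‖) : ∃ y : K, ‖y‖ ≤ rad K c ∧ e (y * x) ≠ 1 := by
  obtain ⟨x₀, hx₀, hne⟩ := he.2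
  obtain ⟨ϖ, hϖ, h0, h1, hmax⟩ := exists_uniformizer K
  have hq := one_lt_residueCard K
  have hq0 := zero_lt_one.trans hq
  have hxpos : 0 < ‖x‖ := (inv_pos.2 (rad_pos K c)).trans hx
  obtain ⟨k, hk⟩ := exists_norm_eq_zpow (norm_pos_iff.1 hxpos) h0 h1 hmax
  rw [hϖ, inv_zpow'] at hk
  rw [rad, zpow_neg, inv_inv, hk, zpow_lt_zpow_iff_right₀ hq] at hx
  refine ⟨x₀ * x⁻¹, ?_, by rwa [inv_mul_cancel_right₀ (norm_pos_iff.1 hxpos)]⟩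
  have h2 : ‖x₀‖ ≤ (residueCard K : ℝ) ^ (-(-1) : ℤ) := hx₀
  rw [norm_mul, norm_inv, hk, ← zpow_neg, rad]
  calc ‖x₀‖ * (residueCard K : ℝ) ^ (- -k)
      ≤ (residueCard K : ℝ) ^ (-(-1) : ℤ) * (residueCard K : ℝ) ^ (- -k) := by gcongr
    _ = (residueCard K : ℝ) ^ (1 + k) := by
        rw [← zpow_add₀ hq0.ne']; congr 1; ring
    _ ≤ _ := zpow_le_zpow_right₀ hq.le (by omega)

theorem addChar_trace_eq_one (he : IsUnramifiedAddChar K e) {Y : Matrix ι κ K}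
    {A : Matrix κ ι K} {c d : ℝ} (hc : 0 ≤ c) (hd : 0 ≤ d) (hY : MatLe c Y) (hA : MatLe d A)
    (hcd : c * d ≤ 1) : e (Y * A).trace = 1 :=
  he.1 _ (mem_pPow_zero_iff.2 (norm_sum_le_of_le _ zero_le_one fun i _ =>
    (hY.mul hc hd hA i i).trans hcd))

/-- An entry of `A` that is too large gives a matrix with one nonzero entry, translation by which
fixes `f` but multiplies the integral by a value of `e` other than 1. -/
theorem integral_mul_char_eq_zero (he : IsUnramifiedAddChar K e) {f : Matrix ι κ K → ℂ} {c : ℕ}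
    (hf : ∀ X Y, MatLe (rad K c) Y → f (X + Y) = f X) {A : Matrix κ ι K}
    (hA : ¬ MatLe (rad K c)⁻¹ A) :
    ∫ y, f y * (e (y * A).trace : ℂ) ∂(haarMatrix K ι κ) = 0 := by
  classical
  simp only [MatLe, not_forall, not_le] at hA
  obtain ⟨i, j, hij⟩ := hA
  obtain ⟨y, hy, hne⟩ := exists_addChar_ne_one he hij
  have hY : MatLe (rad K c) (Matrix.single j i y) := fun a b => by
    rw [Matrix.single_apply]
    split_ifs
    · exact hy
    · simpa using (rad_pos K c).le
  have htr : (Matrix.single j i y * A).trace = y * A i j := by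
    rw [Matrix.trace_single_mul]; rfl
  have h1 := integral_add_right_eq_self (μ := haarMatrix K ι κ)
    (fun y => f y * (e (y * A).trace : ℂ)) (Matrix.single j i y)
  have h2 : ∀ x, f (x + Matrix.single j i y) * (e ((x + Matrix.single j i y) * A).trace : ℂ) =
      (e (y * A i j) : ℂ) * (f x * (e (x * A).trace : ℂ)) := fun x => by
    rw [hf x _ hY, Matrix.add_mul, Matrix.trace_add, htr, AddChar.map_add_eq_mul, Circle.coe_mul]
    ring
  simp_rw [h2] at h1
  rw [integral_const_mul] at h1
  by_contra h
  apply hne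
  have h3 := mul_right_cancel₀ h (h1.trans (one_mul _).symm)
  exact Circle.ext h3

/-- The kernel of the Fourier transform on the integral matrices. -/
theorem integral_indicator_char (he : IsUnramifiedAddChar K e) (A : Matrix κ ι K) :
    ∫ y, ({y | MatLe 1 y} : Set (Matrix ι κ K)).indicator 1 y * (e (y * A).trace : ℂ)
      ∂(haarMatrix K ι κ) = ({A | MatLe 1 A} : Set (Matrix κ ι K)).indicator 1 A := by
  classical
  by_cases hA : MatLe 1 A
  · rw [Set.indicator_of_mem (show A ∈ {A | MatLe 1 A} from hA)]
    have : ∀ y, ({y | MatLe 1 y} : Set (Matrix ι κ K)).indicator 1 y * (e (y * A).trace : ℂ) =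
        ({y | MatLe 1 y} : Set (Matrix ι κ K)).indicator (1 : Matrix ι κ K → ℂ) y := by
      intro y
      by_cases hy : MatLe 1 y
      · rw [addChar_trace_eq_one he zero_le_one zero_le_one hy hA (by norm_num), Circle.coe_one,
          mul_one]
      · rw [Set.indicator_of_notMem (show y ∉ {y | MatLe 1 y} from hy), zero_mul]
    simp_rw [this]
    rw [integral_indicator (measurableSet_matLe 1)]
    simp only [Pi.one_apply]
    rw [setIntegral_const, Measure.real, haarMatrix_matLe_one]
    simp
  · rw [Set.indicator_of_notMem (show A ∉ {A | MatLe 1 A} from hA)]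
    refine integral_mul_char_eq_zero (c := 0) he (fun X Y hY => ?_) ?_
    · rw [rad_zero] at hY
      have : MatLe 1 (X + Y) ↔ MatLe 1 X :=
        ⟨fun h => by simpa using h.sub hY, fun h => h.add hY⟩
      by_cases hX : MatLe 1 X
      · rw [Set.indicator_of_mem (show X ∈ {y | MatLe 1 y} from hX),
          Set.indicator_of_mem (show X + Y ∈ {y | MatLe 1 y} from this.2 hX)]
        rfl
      · rw [Set.indicator_of_notMem (show X ∉ {y | MatLe 1 y} from hX),
          Set.indicator_of_notMem (show X + Y ∉ {y | MatLe 1 y} from fun h => hX (this.1 h))]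
    · rwa [rad_zero, inv_one]

end Fourier

/-! ### Fourier transforms of functions on 𝔛 and their block factorization. -/

section LevelFun

variable {K : Type*} [NontriviallyNormedField K] [IsNormalizedLocalField K]
  [MeasurableSpace K] [BorelSpace K] {e : AddChar K Circle}
variable {t s : ℕ} {n : Fin t → ℕ} {nA : Fin t → ℕ} {nB : Fin s → ℕ} {r c : ℕ}

theorem continuous_of_add_invariant {ι κ : Type*} [Fintype ι] [Fintype κ] {E : Type*}
    [TopologicalSpace E] {f : Matrix ι κ K → E} {ρ : ℝ} (hρ : 0 < ρ)
    (hf : ∀ X Y, MatLe ρ Y → f (X + Y) = f X) : Continuous f := by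
  classical
  refine continuous_iff_continuousAt.2 fun X => ?_
  have hU : {Y : Matrix ι κ K | MatLe ρ (Y - X)} ∈ nhds X := by
    refine ((isOpen_matLe hρ).preimage (continuous_sub_right X)).mem_nhds ?_
    simpa using MatLe.zero hρ.le
  refine (continuousAt_const (y := f X)).congr ?_
  filter_upwards [hU] with Y hY
  rw [← hf X (Y - X) hY, add_sub_cancel]

theorem IsLevelFun.continuous {μ : Matrix (BlockIdx n) (BlockIdx n) K → ℂ}
    (h : IsLevelFun n r c μ) : Continuous μ :=
  continuous_of_add_invariant (rad_pos K c) h.add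

theorem IsLevelFun.eq_zero_of_not_matLe {μ : Matrix (BlockIdx n) (BlockIdx n) K → ℂ}
    (h : IsLevelFun n r c μ) (hr : 1 ≤ r) {X} (hX : ¬ MatLe 1 X) : μ X = 0 :=
  h.eq_zero X fun h' => hX (matLe_of_mem_frakX hr h')

/-- The function is supported on integral matrices, where the character of an integral trace is 1.
This is what later removes the shear terms of the cell coordinates. -/
theorem fourier_add (he : IsUnramifiedAddChar K e) (hr : 1 ≤ r)
    {ν : Matrix (BlockIdx n) (BlockIdx n) K → ℂ} (h : IsLevelFun n r c ν)
    (A Y : Matrix (BlockIdx n) (BlockIdx n) K) (hY : MatLe 1 Y) :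
    fourier e ν (A + Y) = fourier e ν A := by
  refine integral_congr_ae (Filter.Eventually.of_forall fun y => ?_)
  by_cases hy : MatLe 1 y
  · simp only [Matrix.mul_add, Matrix.trace_add, AddChar.map_add_eq_mul,
      addChar_trace_eq_one he zero_le_one zero_le_one hy hY (by norm_num), mul_one]
  · have : ν (-y) = 0 := h.eq_zero_of_not_matLe hr fun h' => hy (by simpa using h'.neg)
    simp only [this, zero_mul]

theorem fourier_eq_zero (he : IsUnramifiedAddChar K e)
    {ν : Matrix (BlockIdx n) (BlockIdx n) K → ℂ} (h : IsLevelFun n r c ν)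
    {A : Matrix (BlockIdx n) (BlockIdx n) K} (hA : ¬ MatLe (rad K c)⁻¹ A) : fourier e ν A = 0 :=
  integral_mul_char_eq_zero (f := fun y => ν (-y)) he
    (fun X Y hY => by simp only [neg_add]; exact h.add _ _ hY.neg) hA

theorem continuous_fourier (he : IsUnramifiedAddChar K e) (hr : 1 ≤ r)
    {ν : Matrix (BlockIdx n) (BlockIdx n) K → ℂ} (h : IsLevelFun n r c ν) :
    Continuous (fourier e ν) :=
  continuous_of_add_invariant one_pos (fourier_add he hr h)

theorem norm_fourier_le {ι : Type*} [Fintype ι] (ν : Matrix ι ι K → ℂ) (A : Matrix ι ι K) :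
    ‖fourier e ν A‖ ≤ ∫ y, ‖ν (-y)‖ ∂(haarMatrix K ι ι) := by
  refine (norm_integral_le_integral_norm _).trans_eq ?_
  simp only [norm_mul, Circle.norm_coe, mul_one]

theorem PhiDiag_eq_fourier (hr : 1 ≤ r) (χ₁ χ₂ : MulChar K ℂ)
    {μ : Matrix (BlockIdx n) (BlockIdx n) K → ℂ} (h : IsLevelFun n r c (twist χ₁ χ₂ μ)) :
    PhiDiag e χ₁ χ₂ r μ = fourier e (twist χ₁ χ₂ μ) := by
  funext A
  refine setIntegral_eq_integral_of_forall_compl_eq_zero fun y hy => ?_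
  rw [h.eq_zero, zero_mul]
  intro hy'
  apply hy
  rw [← neg_neg y]
  exact neg_mem_frakX hr hy'

theorem trace_fromBlocks_mul {a b : Type*} [Fintype a] [Fintype b] (q : CellMat K a b)
    (A : Matrix a a K) (B : Matrix a b K) (C : Matrix b a K) (D : Matrix b b K) :
    (Matrix.fromBlocks q.1.1 q.2.1 q.2.2 q.1.2 * Matrix.fromBlocks A B C D).trace =
      ((q.1.1 * A).trace + (q.1.2 * D).trace) + ((q.2.1 * C).trace + (q.2.2 * B).trace) := by
  rw [Matrix.fromBlocks_multiply, Matrix.trace, Fintype.sum_sum_type]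
  simp only [Matrix.diag_apply, Matrix.fromBlocks_apply₁₁, Matrix.fromBlocks_apply₂₂,
    Matrix.add_apply, Finset.sum_add_distrib, Matrix.trace]
  ring

theorem blockExtend_neg (hr : 1 ≤ r)
    {νa : Matrix (BlockIdx nA) (BlockIdx nA) K → ℂ} (ha : ∀ X ∉ frakX nA r, νa X = 0)
    {νb : Matrix (BlockIdx nB) (BlockIdx nB) K → ℂ} (hb : ∀ X ∉ frakX nB r, νb X = 0)
    (q : CellMat K (BlockIdx nA) (BlockIdx nB)) :
    blockExtend r νa νb (-(Matrix.fromBlocks q.1.1 q.2.1 q.2.2 q.1.2)) =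
      (νa (-q.1.1) * νb (-q.1.2)) *
        (({y | MatLe 1 y} : Set (Matrix _ _ K)).indicator 1 q.2.1 *
          ({y | MatLe 1 y} : Set (Matrix _ _ K)).indicator 1 q.2.2) := by
  rw [Matrix.fromBlocks_neg, blockExtend, Matrix.toBlocks_fromBlocks₁₁,
    Matrix.toBlocks_fromBlocks₂₂]
  have h2 : (∀ x y, (-q.2.1) x y ∈ pPow K 0) ↔ MatLe 1 q.2.1 := by
    refine forall_congr' fun x => forall_congr' fun y => ?_
    rw [mem_pPow_zero_iff, Matrix.neg_apply, norm_neg]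
  have h3 : (∀ x y, (-q.2.2) x y ∈ pPow K 0) ↔ MatLe 1 q.2.2 := by
    refine forall_congr' fun x => forall_congr' fun y => ?_
    rw [mem_pPow_zero_iff, Matrix.neg_apply, norm_neg]
  have key : Matrix.fromBlocks (-q.1.1) (-q.2.1) (-q.2.2) (-q.1.2) ∈ frakXW nA nB r ↔
      -q.1.1 ∈ frakX nA r ∧ -q.1.2 ∈ frakX nB r ∧ MatLe 1 q.2.1 ∧ MatLe 1 q.2.2 := by
    rw [← h2, ← h3]
    rfl
  rw [key]
  by_cases c1 : -q.1.1 ∈ frakX nA r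
  swap
  · rw [if_neg (by tauto), ha _ c1]; ring
  by_cases c2 : -q.1.2 ∈ frakX nB r
  swap
  · rw [if_neg (by tauto), hb _ c2]; ring
  by_cases c3 : MatLe 1 q.2.1
  swap
  · rw [if_neg (by tauto), Set.indicator_of_notMem (show q.2.1 ∉ {y | MatLe 1 y} from c3)]; ring
  by_cases c4 : MatLe 1 q.2.2
  swap
  · rw [if_neg (by tauto), Set.indicator_of_notMem (show q.2.2 ∉ {y | MatLe 1 y} from c4)]; ring
  rw [if_pos ⟨c1, c2, c3, c4⟩, Set.indicator_of_mem (show q.2.1 ∈ {y | MatLe 1 y} from c3),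
    Set.indicator_of_mem (show q.2.2 ∈ {y | MatLe 1 y} from c4)]
  simp

/-- The trace form pairs diagonal blocks with each other and each off-diagonal block with the
opposite one. The off-diagonal integrals are transforms of the lattice of integral matrices, which
is self-dual. -/
theorem fourier_blockExtend (he : IsUnramifiedAddChar K e) (hr : 1 ≤ r)
    {νa : Matrix (BlockIdx nA) (BlockIdx nA) K → ℂ} (ha : ∀ X ∉ frakX nA r, νa X = 0)
    {νb : Matrix (BlockIdx nB) (BlockIdx nB) K → ℂ} (hb : ∀ X ∉ frakX nB r, νb X = 0)
    (A : Matrix (BlockIdx nA) (BlockIdx nA) K) (B : Matrix (BlockIdx nA) (BlockIdx nB) K)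
    (C : Matrix (BlockIdx nB) (BlockIdx nA) K) (D : Matrix (BlockIdx nB) (BlockIdx nB) K) :
    fourier e (blockExtend r νa νb) (Matrix.fromBlocks A B C D) =
      (fourier e νa A * fourier e νb D) *
        (({y | MatLe 1 y} : Set (Matrix _ _ K)).indicator 1 C *
          ({y | MatLe 1 y} : Set (Matrix _ _ K)).indicator 1 B) := by
  rw [fourier, ← (measurePreserving_blocks (K := K)).integral_comp
    (blocksEquiv K _ _).toHomeomorph.measurableEmbedding, cellMatMeasure]
  simp_rw [blocksEquiv_apply, blockExtend_neg hr ha hb, trace_fromBlocks_mul,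
    AddChar.map_add_eq_mul, Circle.coe_mul]
  have h : ∀ q : CellMat K (BlockIdx nA) (BlockIdx nB),
      (νa (-q.1.1) * νb (-q.1.2)) *
        (({y | MatLe 1 y} : Set (Matrix _ _ K)).indicator 1 q.2.1 *
          ({y | MatLe 1 y} : Set (Matrix _ _ K)).indicator 1 q.2.2) *
      (((e (q.1.1 * A).trace : ℂ) * (e (q.1.2 * D).trace : ℂ)) *
        ((e (q.2.1 * C).trace : ℂ) * (e (q.2.2 * B).trace : ℂ))) =
      ((νa (-q.1.1) * (e (q.1.1 * A).trace : ℂ)) * (νb (-q.1.2) * (e (q.1.2 * D).trace : ℂ))) *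
      ((({y | MatLe 1 y} : Set (Matrix _ _ K)).indicator 1 q.2.1 * (e (q.2.1 * C).trace : ℂ)) *
       (({y | MatLe 1 y} : Set (Matrix _ _ K)).indicator 1 q.2.2 * (e (q.2.2 * B).trace : ℂ))) :=
    fun q => by ring
  simp_rw [h]
  rw [integral_prod_mul (f := fun p : Matrix (BlockIdx nA) (BlockIdx nA) K ×
      Matrix (BlockIdx nB) (BlockIdx nB) K =>
      (νa (-p.1) * (e (p.1 * A).trace : ℂ)) * (νb (-p.2) * (e (p.2 * D).trace : ℂ)))
    (g := fun p : Matrix (BlockIdx nA) (BlockIdx nB) K × Matrix (BlockIdx nB) (BlockIdx nA) K =>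
      (({y | MatLe 1 y} : Set (Matrix _ _ K)).indicator 1 p.1 * (e (p.1 * C).trace : ℂ)) *
       (({y | MatLe 1 y} : Set (Matrix _ _ K)).indicator 1 p.2 * (e (p.2 * B).trace : ℂ))),
    integral_prod_mul (f := fun p : Matrix (BlockIdx nA) (BlockIdx nA) K =>
      (νa (-p) * (e (p * A).trace : ℂ))) (g := fun p : Matrix (BlockIdx nB) (BlockIdx nB) K =>
      (νb (-p) * (e (p * D).trace : ℂ))),
    integral_prod_mul (f := fun p : Matrix (BlockIdx nA) (BlockIdx nB) K =>
      (({y | MatLe 1 y} : Set (Matrix _ _ K)).indicator 1 p * (e (p * C).trace : ℂ)))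
      (g := fun p : Matrix (BlockIdx nB) (BlockIdx nA) K =>
      (({y | MatLe 1 y} : Set (Matrix _ _ K)).indicator 1 p * (e (p * B).trace : ℂ))),
    integral_indicator_char he, integral_indicator_char he]
  rfl

end LevelFun

end LocalZeta
end

noncomputable section
namespace LocalZeta

/-! ### Tensors are separated by evaluations. -/

section Tensor

variable {M N VA VB : Type*} [AddCommGroup M] [Module ℂ M] [AddCommGroup N] [Module ℂ N]
  [AddCommGroup VA] [Module ℂ VA] [AddCommGroup VB] [Module ℂ VB]

/-- Expand `T` along a basis of `N`. Its coefficients in `M` are tested by functionals composed with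
the `f i`; contracting the first factor with such a functional gives a vector of `N`, which all `g
j` kill. -/
theorem tensor_eq_zero_of_map_eq_zero {I J : Type*} (f : I → M →ₗ[ℂ] VA) (g : J → N →ₗ[ℂ] VB)
    (hf : ∀ m, (∀ i, f i m = 0) → m = 0) (hg : ∀ m, (∀ j, g j m = 0) → m = 0) {T : M ⊗[ℂ] N}
    (h : ∀ i j, TensorProduct.map (f i) (g j) T = 0) : T = 0 := by
  classical
  let 𝒞 := Module.Basis.ofVectorSpace ℂ N
  apply (TensorProduct.equivFinsuppOfBasisRight (M := M) 𝒞).injective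
  rw [map_zero]
  ext k
  rw [Finsupp.zero_apply]
  apply hf
  intro i
  rw [← Module.forall_dual_apply_eq_zero_iff ℂ]
  intro φ
  have hy : TensorProduct.lid ℂ N (TensorProduct.map (φ ∘ₗ f i) LinearMap.id T) = 0 := by
    apply hg
    intro j
    rw [← Module.forall_dual_apply_eq_zero_iff ℂ]
    intro ψ
    have e : ψ ∘ₗ g j ∘ₗ (TensorProduct.lid ℂ N).toLinearMap ∘ₗ
        TensorProduct.map (φ ∘ₗ f i) LinearMap.id =
        (TensorProduct.lid ℂ ℂ).toLinearMap ∘ₗ TensorProduct.map φ ψ ∘ₗ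
          TensorProduct.map (f i) (g j) := by
      ext x y; simp
    have := LinearMap.congr_fun e T
    simp only [LinearMap.comp_apply, h i j, map_zero] at this
    exact this
  have e : φ ∘ₗ f i ∘ₗ Finsupp.lapply k ∘ₗ
      (TensorProduct.equivFinsuppOfBasisRight (M := M) 𝒞).toLinearMap =
      𝒞.coord k ∘ₗ (TensorProduct.lid ℂ N).toLinearMap ∘ₗ
        TensorProduct.map (φ ∘ₗ f i) LinearMap.id := by
    ext x y
    simp [mul_comm]
  have := LinearMap.congr_fun e T
  simp only [LinearMap.comp_apply, LinearEquiv.coe_coe, hy, map_zero, Finsupp.lapply_apply] at this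
  exact this

end Tensor

/-! ### Integral matrices in two-by-two block form. -/

section Blocks

variable {K : Type*} [NontriviallyNormedField K] [IsNormalizedLocalField K]
variable {a b : Type*} [Fintype a] [DecidableEq a] [Fintype b] [DecidableEq b]

/-- Replacing the lower left block by zero moves the determinant by less than 1. So the product of
the determinants of the diagonal blocks has norm 1, while each has norm at most 1. -/
theorem norm_det_blocks_eq_one {g : GL (a ⊕ b) K} (hg : g ∈ intGL K (a ⊕ b)) {c : ℝ} (hc0 : 0 ≤ c)
    (hc : c < 1) (hC : MatLe c g.val.toBlocks₂₁) :
    ‖g.val.toBlocks₁₁.det‖ = 1 ∧ ‖g.val.toBlocks₂₂.det‖ = 1 := by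
  obtain ⟨h1, h2⟩ := mem_intGL_iff_det.1 hg
  have hA : MatLe 1 g.val.toBlocks₁₁ := fun i j => h1 _ _
  have hD : MatLe 1 g.val.toBlocks₂₂ := fun i j => h1 _ _
  have hB : MatLe 1 g.val.toBlocks₁₂ := fun i j => h1 _ _
  have hN : MatLe 1 (Matrix.fromBlocks g.val.toBlocks₁₁ g.val.toBlocks₁₂ 0 g.val.toBlocks₂₂) :=
    hA.fromBlocks hB (MatLe.zero zero_le_one) hD
  have hsub : MatLe c (g.val -
      Matrix.fromBlocks g.val.toBlocks₁₁ g.val.toBlocks₁₂ 0 g.val.toBlocks₂₂) := by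
    rintro (i | i) (j | j)
    · rw [Matrix.sub_apply, Matrix.fromBlocks_apply₁₁, Matrix.toBlocks₁₁, Matrix.of_apply, sub_self,
        norm_zero]
      exact hc0
    · rw [Matrix.sub_apply, Matrix.fromBlocks_apply₁₂, Matrix.toBlocks₁₂, Matrix.of_apply, sub_self,
        norm_zero]
      exact hc0
    · rw [Matrix.sub_apply, Matrix.fromBlocks_apply₂₁, Matrix.zero_apply, sub_zero]
      exact hC i j
    · rw [Matrix.sub_apply, Matrix.fromBlocks_apply₂₂, Matrix.toBlocks₂₂, Matrix.of_apply, sub_self,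
        norm_zero]
      exact hc0
  have h3 := norm_det_sub_det_le hc0 h1 hN hsub
  rw [Matrix.det_fromBlocks_zero₂₁] at h3
  have h4 : ‖g.val.toBlocks₁₁.det * g.val.toBlocks₂₂.det‖ = 1 := by
    by_contra hne
    have h5 : ‖g.val.toBlocks₁₁.det * g.val.toBlocks₂₂.det‖ ≤ 1 := by
      have := hN.norm_det_le zero_le_one
      rwa [Matrix.det_fromBlocks_zero₂₁, one_pow] at this
    have h6 : ‖g.val.det‖ ≤ max c ‖g.val.toBlocks₁₁.det * g.val.toBlocks₂₂.det‖ := by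
      have := IsUltrametricDist.norm_add_le_max
        (g.val.det - g.val.toBlocks₁₁.det * g.val.toBlocks₂₂.det)
        (g.val.toBlocks₁₁.det * g.val.toBlocks₂₂.det)
      rw [sub_add_cancel] at this
      exact this.trans (max_le_max_right _ h3)
    rw [h2] at h6
    exact absurd h6 (not_le.2 (max_lt hc (lt_of_le_of_ne h5 hne)))
  have h7 : ‖g.val.toBlocks₁₁.det‖ ≤ 1 := by simpa using hA.norm_det_le zero_le_one
  have h8 : ‖g.val.toBlocks₂₂.det‖ ≤ 1 := by simpa using hD.norm_det_le zero_le_one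
  rw [norm_mul] at h4
  constructor <;> nlinarith [norm_nonneg g.val.toBlocks₁₁.det, norm_nonneg g.val.toBlocks₂₂.det]

theorem gl_eq_of_fromBlocks {g : GL (a ⊕ b) K} : g.val =
    Matrix.fromBlocks g.val.toBlocks₁₁ g.val.toBlocks₁₂ g.val.toBlocks₂₁ g.val.toBlocks₂₂ :=
  (Matrix.fromBlocks_toBlocks _).symm

theorem diagEmb_mem_intGL {p : GL a K × GL b K} :
    diagEmb p ∈ intGL K (a ⊕ b) ↔ p.1 ∈ intGL K a ∧ p.2 ∈ intGL K b := by
  have h0 : ∀ q : GL a K × GL b K, MatLe 1 (diagEmb q).val ↔ MatLe 1 q.1.val ∧ MatLe 1 q.2.val :=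
    fun q => by
      rw [diagEmb_val, matLe_fromBlocks_iff]
      exact ⟨fun h => ⟨h.1, h.2.2.2⟩,
        fun h => ⟨h.1, MatLe.zero zero_le_one, MatLe.zero zero_le_one, h.2⟩⟩
  rw [mem_intGL_iff, mem_intGL_iff, mem_intGL_iff, ← map_inv, h0, h0]
  simp only [Prod.fst_inv, Prod.snd_inv]
  tauto

theorem upperU_mem_intGL {B : Matrix a b K} : upperU B ∈ intGL K (a ⊕ b) ↔ MatLe 1 B := by
  rw [mem_intGL_iff, upperU_inv, upperU_val, upperU_val, matLe_fromBlocks_iff,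
    matLe_fromBlocks_iff]
  exact ⟨fun h => h.1.2.1, fun h => ⟨⟨MatLe.one, h, MatLe.zero zero_le_one, MatLe.one⟩, MatLe.one,
    h.neg, MatLe.zero zero_le_one, MatLe.one⟩⟩

theorem lowerU_mem_intGL {C : Matrix b a K} : lowerU C ∈ intGL K (a ⊕ b) ↔ MatLe 1 C := by
  rw [mem_intGL_iff, lowerU_inv, lowerU_val, lowerU_val, matLe_fromBlocks_iff,
    matLe_fromBlocks_iff]
  exact ⟨fun h => h.1.2.2.1, fun h => ⟨⟨MatLe.one, MatLe.zero zero_le_one, h, MatLe.one⟩, MatLe.one,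
    MatLe.zero zero_le_one, h.neg, MatLe.one⟩⟩

end Blocks

/-! ### Values of test vectors on their support. -/

section TestVectors

variable {L G : Type*} [Group L] [Group G] [TopologicalSpace G] [IsTopologicalGroup G]
  {V : Type*} [AddCommGroup V] [Module ℂ V] {D : ParabolicDatum L G} {σ : Representation ℂ L V}
  {KL : Subgroup L} {I : Set G} {v₀ : V} {f : inducedSpace D σ}

theorem IsTestVector.apply_mul (h : IsTestVector D σ KL I v₀ f) {i : G} (hi : i ∈ I) (g : G) :
    f.1 (g * i) = f.1 g :=
  congrFun (congrArg Subtype.val (h.fixed i hi)) g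

theorem IsTestVector.apply_one (h : IsTestVector D σ KL I v₀ f) (hI : (1 : G) ∈ I) :
    f.1 1 = v₀ := by
  have := h.value 1 (one_mem _) 1 hI
  rwa [map_one, mul_one, map_one, Module.End.one_apply] at this

theorem inducedSpace.apply_levi_mul (f : inducedSpace D σ) (l : L) (g : G) :
    f.1 (D.levi l * g) = ((Real.sqrt (D.modulus l) : ℝ) : ℂ) • σ l (f.1 g) := f.2.1 l g

theorem inducedSpace.apply_unip_mul (f : inducedSpace D σ) {u : G} (hu : u ∈ D.unip) (g : G) :
    f.1 (u * g) = f.1 g := f.2.2.1 u hu g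

theorem IsTestVector.apply_of_mem (h : IsTestVector D σ KL I v₀ f) (hI : (1 : G) ∈ I) (l : L)
    {u i : G} (hu : u ∈ D.unip) (hi : i ∈ I) :
    f.1 (D.levi l * u * i) = ((Real.sqrt (D.modulus l) : ℝ) : ℂ) • σ l v₀ := by
  rw [h.apply_mul hi, inducedSpace.apply_levi_mul, ← mul_one u, inducedSpace.apply_unip_mul f hu,
    h.apply_one hI]

theorem IsTestVector.eq_zero (h : IsTestVector D σ KL I v₀ f) {g : G}
    (hg : ∀ p ∈ D.carrier, ∀ i ∈ I, g ≠ p * i) : f.1 g = 0 := by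
  by_contra hne
  have : g ∈ Function.support f.1 := hne
  rw [h.support] at this
  obtain ⟨p, hp, i, hi, e⟩ := this
  exact hg p hp i hi e

end TestVectors

/-! ### The image of φ_w in the representation induced from P_{a,b}. -/

section Transit

variable {K : Type*} [NontriviallyNormedField K] [IsNormalizedLocalField K]
  {t s : ℕ} {nA : Fin t → ℕ} {nB : Fin s → ℕ} {r : ℕ}
  {VA VB PA PB : Type*} [AddCommGroup VA] [Module ℂ VA] [AddCommGroup VB] [Module ℂ VB]
  [AddCommGroup PA] [Module ℂ PA] [AddCommGroup PB] [Module ℂ PB]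
  {σA : Representation ℂ (∀ j, GL (Fin (nA j)) K) VA}
  {σB : Representation ℂ (∀ j, GL (Fin (nB j)) K) VB}
  {πA : Representation ℂ (GL (BlockIdx nA) K) PA} {πB : Representation ℂ (GL (BlockIdx nB) K) PB}
  {qA : (normalizedInd (blockParabolic nA (· < ·)) σA).IntertwiningMap πA}
  {qB : (normalizedInd (blockParabolic nB (· > ·)) σB).IntertwiningMap πB}
  {fW : inducedSpace (mixedParabolic nA nB) (extTensor₂ σA σB)}
  {FW : inducedSpace (maxParabolic (K := K)) (extTensor₂ πA πB)}
  {KA : Subgroup (∀ j, GL (Fin (nA j)) K)} {KB : Subgroup (∀ j, GL (Fin (nB j)) K)}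
  {KW : Subgroup ((∀ j, GL (Fin (nA j)) K) × (∀ j, GL (Fin (nB j)) K))}
  {vA : VA} {vB : VB}
  {fA : inducedSpace (blockParabolic nA (· < ·)) σA}
  {fB : inducedSpace (blockParabolic nB (· > ·)) σB}

/-- The condition that characterizes the tensor whose image is the value at `g`. -/
def IsTransitAt (fW : inducedSpace (mixedParabolic nA nB) (extTensor₂ σA σB))
    (g : GL (BlockIdx nA ⊕ BlockIdx nB) K)
    (T : inducedSpace (blockParabolic nA (· < ·)) σA ⊗[ℂ]
        inducedSpace (blockParabolic nB (· > ·)) σB) : Prop :=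
  ∀ hA hB, TensorProduct.map (evalAt _ σA hA) (evalAt _ σB hB) T =
    (((Real.sqrt (maxParabolic.modulus (hA, hB)))⁻¹ : ℝ) : ℂ) • fW.1 (diagEmb (hA, hB) * g)

/-- Evaluations separate the tensor product of the two induced spaces. The tensor in
`IsTransitImage` is therefore unique, and exhibiting any tensor with the right evaluations computes
the value. -/
theorem IsTransitImage.apply_eq (h : IsTransitImage qA qB fW FW)
    {g : GL (BlockIdx nA ⊕ BlockIdx nB) K} {T} (hT : IsTransitAt fW g T) :
    FW.1 g = TensorProduct.map qA.toLinearMap qB.toLinearMap T := by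
  obtain ⟨T', hT', hF⟩ := h g
  have : T' - T = 0 := by
    refine tensor_eq_zero_of_map_eq_zero (fun hA => evalAt _ σA hA) (fun hB => evalAt _ σB hB)
      (fun f hf => Subtype.ext (funext hf)) (fun f hf => Subtype.ext (funext hf))
      fun hA hB => ?_
    rw [map_sub, hT' hA hB, hT hA hB, sub_self]
  rw [hF, sub_eq_zero.1 this]

theorem IsTransitImage.apply_eq_zero (h : IsTransitImage qA qB fW FW)
    {g : GL (BlockIdx nA ⊕ BlockIdx nB) K}
    (hg : ∀ hA hB, fW.1 (diagEmb (hA, hB) * g) = 0) : FW.1 g = 0 := by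
  rw [h.apply_eq (T := 0) fun hA hB => by rw [hg, map_zero, smul_zero], map_zero]

theorem IsTransitImage.apply_mul (h : IsTransitImage qA qB fW FW)
    {i : GL (BlockIdx nA ⊕ BlockIdx nB) K} (hi : ∀ x, fW.1 (x * i) = fW.1 x)
    (g : GL (BlockIdx nA ⊕ BlockIdx nB) K) : FW.1 (g * i) = FW.1 g := by
  obtain ⟨T, hT, hF⟩ := h g
  rw [hF]
  exact h.apply_eq fun hA hB => by rw [hT hA hB, ← mul_assoc, hi]

theorem one_mem_iwahori {R : Fin t → Fin t → Prop} : (1 : GL (BlockIdx nA) K) ∈ iwahori nA R r :=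
  mem_iwahori_of_unip (one_mem _) fun _ _ _ => rfl

theorem mem_iwahoriW_iff {g : GL (BlockIdx nA ⊕ BlockIdx nB) K} : g ∈ iwahoriW nA nB r ↔
    g ∈ intGL K (BlockIdx nA ⊕ BlockIdx nB) ∧
    (∀ x y : BlockIdx nA, ¬ x.1 < y.1 →
      ‖(g.val.toBlocks₁₁ - 1) x y‖ ≤ rad K r) ∧
    (∀ x y : BlockIdx nB, ¬ x.1 > y.1 →
      ‖(g.val.toBlocks₂₂ - 1) x y‖ ≤ rad K r) ∧
    MatLe (rad K r) g.val.toBlocks₂₁ := Iff.rfl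

theorem one_mem_iwahoriW : (1 : GL (BlockIdx nA ⊕ BlockIdx nB) K) ∈ iwahoriW nA nB r := by
  refine ⟨one_mem _, fun x y _ => ?_, fun x y _ => ?_, fun x y => ?_⟩ <;>
  rw [mem_pPow_iff_rad] <;>
  simp [Matrix.one_apply, (rad_pos K r).le]

theorem diagEmb_mem_iwahoriW {A : GL (BlockIdx nA) K} {D : GL (BlockIdx nB) K}
    (hA : A ∈ iwahori nA (· < ·) r) (hD : D ∈ iwahori nB (· > ·) r) :
    diagEmb (A, D) ∈ iwahoriW nA nB r := by
  refine ⟨diagEmb_mem_intGL.2 ⟨hA.1, hD.1⟩, hA.2, hD.2, fun x y => ?_⟩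
  rw [mem_pPow_iff_rad]
  change ‖(0 : K)‖ ≤ _
  simpa using (rad_pos K r).le

theorem exists_blocks_of_mem_iwahoriW (hr : 1 ≤ r) {i : GL (BlockIdx nA ⊕ BlockIdx nB) K}
    (hi : i ∈ iwahoriW nA nB r) : ∃ A ∈ iwahori (K := K) nA (· < ·) r,
      ∃ D ∈ iwahori (K := K) nB (· > ·) r, ∃ B C, MatLe 1 B ∧ MatLe (rad K r) C ∧
        i.val = Matrix.fromBlocks A.val B C D.val := by
  obtain ⟨h1, h2, h3, h4⟩ := mem_iwahoriW_iff.1 hi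
  have hd := norm_det_blocks_eq_one h1 (rad_pos K r).le (rad_lt_one K hr) h4
  have hint := (mem_intGL_iff.1 h1).1
  refine ⟨glOfDet i.val.toBlocks₁₁ (norm_pos_iff.1 (by rw [hd.1]; exact one_pos)),
    ⟨mem_intGL_iff_det.2 ⟨fun x y => hint _ _, hd.1⟩, h2⟩,
    glOfDet i.val.toBlocks₂₂ (norm_pos_iff.1 (by rw [hd.2]; exact one_pos)),
    ⟨mem_intGL_iff_det.2 ⟨fun x y => hint _ _, hd.2⟩, h3⟩,
    i.val.toBlocks₁₂, i.val.toBlocks₂₁, fun x y => hint _ _, h4, gl_eq_of_fromBlocks⟩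

theorem exists_blocks_of_mem_mixed {p : GL (BlockIdx nA ⊕ BlockIdx nB) K}
    (hp : p ∈ (mixedParabolic (K := K) nA nB).carrier) :
    ∃ A ∈ (blockParabolic (K := K) nA (· < ·)).carrier,
      ∃ D ∈ (blockParabolic (K := K) nB (· > ·)).carrier, ∃ B,
        p.val = Matrix.fromBlocks A.val B 0 D.val := by
  obtain ⟨l, u, ⟨uA, huA, uB, huB, B, hu⟩, rfl⟩ := hp
  refine ⟨blockLevi nA l.1 * uA, ⟨l.1, uA, huA, rfl⟩, blockLevi nB l.2 * uB, ⟨l.2, uB, huB, rfl⟩,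
    (blockLevi nA l.1).val * B, ?_⟩
  rw [Units.val_mul, hu]
  change Matrix.fromBlocks (blockLevi nA l.1).val 0 0 (blockLevi nB l.2).val * _ = _
  rw [Matrix.fromBlocks_multiply]
  simp

/-- Shape of the elements of the support of the test vector of the mixed parabolic subgroup. -/
theorem exists_of_mem_mixed_mul (hr : 1 ≤ r) {g : GL (BlockIdx nA ⊕ BlockIdx nB) K}
    {p i : GL (BlockIdx nA ⊕ BlockIdx nB) K}
    (hp : p ∈ (mixedParabolic (K := K) nA nB).carrier) (hi : i ∈ iwahoriW nA nB r)
    (hg : g = p * i) :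
    ∃ pA ∈ (blockParabolic (K := K) nA (· < ·)).carrier,
      ∃ pB ∈ (blockParabolic (K := K) nB (· > ·)).carrier,
      ∃ iA ∈ iwahori (K := K) nA (· < ·) r, ∃ iB ∈ iwahori (K := K) nB (· > ·) r,
      ∃ (B B' : Matrix (BlockIdx nA) (BlockIdx nB) K) (C : Matrix (BlockIdx nB) (BlockIdx nA) K),
        MatLe (rad K r) C ∧
        g.val = Matrix.fromBlocks (pA.val * iA.val + B * C) B' (pB.val * C) (pB * iB).val := by
  obtain ⟨pA, hpA, pB, hpB, B, hp⟩ := exists_blocks_of_mem_mixed hp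
  obtain ⟨iA, hiA, iB, hiB, B', C, -, hC, hi⟩ := exists_blocks_of_mem_iwahoriW hr hi
  refine ⟨pA, hpA, pB, hpB, iA, hiA, iB, hiB, B, pA.val * B' + B * iB.val, C, hC, ?_⟩
  rw [hg, Units.val_mul, hp, hi, Matrix.fromBlocks_multiply, Matrix.zero_mul, Matrix.zero_mul,
    zero_add, zero_add, Units.val_mul]

variable (hfW : IsTestVector (mixedParabolic nA nB) (extTensor₂ σA σB) KW (iwahoriW nA nB r)
  (vA ⊗ₜ[ℂ] vB) fW)
  (hfA : IsTestVector (blockParabolic nA (· < ·)) σA KA (iwahori nA (· < ·) r) vA fA)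
  (hfB : IsTestVector (blockParabolic nB (· > ·)) σB KB (iwahori nB (· > ·) r) vB fB)

include hfW in
theorem IsTransitImage.apply_mul_iwahoriW (h : IsTransitImage qA qB fW FW)
    {i : GL (BlockIdx nA ⊕ BlockIdx nB) K} (hi : i ∈ iwahoriW nA nB r)
    (g : GL (BlockIdx nA ⊕ BlockIdx nB) K) : FW.1 (g * i) = FW.1 g :=
  h.apply_mul (fun x => hfW.apply_mul hi x) g

include hfW in
/-- The image vanishes where the lower right block is singular or `D⁻¹ C` is not in `𝔭 ^ r`. -/
theorem IsTransitImage.exists_of_ne_zero (hr : 1 ≤ r) (h : IsTransitImage qA qB fW FW)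
    {g : GL (BlockIdx nA ⊕ BlockIdx nB) K} (hg : FW.1 g ≠ 0) :
    ∃ D : GL (BlockIdx nB) K, D.val = g.val.toBlocks₂₂ ∧
      MatLe (rad K r) ((D⁻¹).val * g.val.toBlocks₂₁) := by
  have h1 : ∃ hA hB, fW.1 (diagEmb (hA, hB) * g) ≠ 0 := by
    by_contra hne
    push Not at hne
    exact hg (h.apply_eq_zero hne)
  obtain ⟨hA, hB, h2⟩ := h1
  have h3 : ∃ p ∈ (mixedParabolic (K := K) nA nB).carrier, ∃ i ∈ iwahoriW nA nB r,
      diagEmb (hA, hB) * g = p * i := by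
    by_contra hne
    push Not at hne
    exact h2 (hfW.eq_zero hne)
  obtain ⟨p, hp, i, hi, e⟩ := h3
  obtain ⟨pA, -, pB, -, iA, -, iB, hiB, B, B', C, hC, hg'⟩ := exists_of_mem_mixed_mul hr hp hi e
  rw [Units.val_mul, diagEmb_val, gl_eq_of_fromBlocks (g := g), Matrix.fromBlocks_multiply] at hg'
  have e21 := (Matrix.ext_iff_blocks.1 hg').2.2.1
  have e22 := (Matrix.ext_iff_blocks.1 hg').2.2.2
  simp only [Matrix.toBlocks_fromBlocks₂₁, Matrix.toBlocks_fromBlocks₂₂, Matrix.zero_mul,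
    zero_add] at e21 e22
  refine ⟨hB⁻¹ * (pB * iB), ?_, ?_⟩
  · rw [Units.val_mul, ← e22, gl_inv_mul_cancel_left]
  · have : (hB⁻¹ * (pB * iB))⁻¹ = iB⁻¹ * (pB⁻¹ * hB) := by group
    rw [this, Units.val_mul, Units.val_mul, Matrix.mul_assoc, Matrix.mul_assoc, e21,
      gl_inv_mul_cancel_left]
    exact MatLe.mul_left (rad_pos K r).le (mem_intGL_iff.1 hiB.1).2 hC

theorem norm_det_unip_lt {u : GL (BlockIdx nA) K}
    (hu : u ∈ (blockParabolic (K := K) nA (· < ·)).unip) : u.val.det = 1 := by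
  rw [(blockTriangular_of_mem_unip_lt hu).det_fintype]
  refine Finset.prod_eq_one fun k _ => ?_
  have : u.val.toSquareBlock (fun x : BlockIdx nA => x.1) k = 1 := by
    refine Matrix.ext fun x y => ?_
    have hxy : ¬ (x.1.1 < y.1.1) := by rw [x.2, y.2]; exact lt_irrefl _
    have := hu x.1 y.1 hxy
    rw [Matrix.toSquareBlock_def, Matrix.of_apply, this, Matrix.one_apply, Matrix.one_apply]
    simp only [Subtype.ext_iff]
  rw [this, Matrix.det_one]

theorem norm_det_unip_gt {u : GL (BlockIdx nB) K}
    (hu : u ∈ (blockParabolic (K := K) nB (· > ·)).unip) : u.val.det = 1 := by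
  rw [(blockTriangular_of_mem_unip_gt hu).det_fintype]
  refine Finset.prod_eq_one fun k _ => ?_
  have : u.val.toSquareBlock (fun x : BlockIdx nB => OrderDual.toDual x.1) k = 1 := by
    refine Matrix.ext fun x y => ?_
    have hxy : ¬ (x.1.1 > y.1.1) := by
      have : x.1.1 = y.1.1 := (x.2 : OrderDual.toDual x.1.1 = k).trans y.2.symm
      rw [this]; exact lt_irrefl _
    have := hu x.1 y.1 hxy
    rw [Matrix.toSquareBlock_def, Matrix.of_apply, this, Matrix.one_apply, Matrix.one_apply]
    simp only [Subtype.ext_iff]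
  rw [this, Matrix.det_one]

theorem maxParabolic_modulus_eq {a b : Type*} [Fintype a] [DecidableEq a] [Fintype b]
    [DecidableEq b] {p q : GL a K × GL b K} (h1 : ‖p.1.val.det‖ = ‖q.1.val.det‖)
    (h2 : ‖p.2.val.det‖ = ‖q.2.val.det‖) :
    maxParabolic.modulus p = maxParabolic.modulus q := by
  simp only [maxParabolic, h1, h2]

theorem maxParabolic_modulus_pos {a b : Type*} [Fintype a] [DecidableEq a] [Fintype b]
    [DecidableEq b] (p : GL a K × GL b K) : 0 < maxParabolic.modulus p :=
  mul_pos (zpow_pos (norm_det_pos _) _) (zpow_pos (norm_det_pos _) _)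

theorem blockParabolic_modulus_pos (R : Fin t → Fin t → Prop) (l : ∀ j, GL (Fin (nA j)) K) :
    0 < (blockParabolic nA R).modulus l := by
  simp only [blockParabolic]
  exact Finset.prod_pos fun k _ => zpow_pos (norm_det_pos (l k)) _

-- The tensor `fA ⊗ fB` has the required evaluations at 1. A block diagonal matrix lies in P_w I_w
-- exactly when its blocks lie in the two smaller supports, and there the modulus of P_w is the
-- product of the moduli of P_a, P_b^op and P_{a,b}, so the square root of the last one cancels.
include hfW hfA hfB in
theorem IsTransitImage.apply_one (hr : 1 ≤ r) (h : IsTransitImage qA qB fW FW) :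
    FW.1 1 = qA fA ⊗ₜ[ℂ] qB fB := by
  refine (h.apply_eq (T := fA ⊗ₜ[ℂ] fB) fun hA hB => ?_).trans (TensorProduct.map_tmul _ _ _ _)
  rw [TensorProduct.map_tmul, mul_one]
  change fA.1 hA ⊗ₜ[ℂ] fB.1 hB = _
  by_cases hmem : (∃ p ∈ (blockParabolic (K := K) nA (· < ·)).carrier,
      ∃ i ∈ iwahori nA (· < ·) r, hA = p * i) ∧
      (∃ p ∈ (blockParabolic (K := K) nB (· > ·)).carrier,
      ∃ i ∈ iwahori nB (· > ·) r, hB = p * i)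
  · obtain ⟨⟨_, ⟨lA, uA, huA, rfl⟩, iA, hiA, rfl⟩, ⟨_, ⟨lB, uB, huB, rfl⟩, iB, hiB, rfl⟩⟩ := hmem
    have hu : diagEmb (uA, uB) ∈ (mixedParabolic (K := K) nA nB).unip :=
      ⟨uA, huA, uB, huB, 0, rfl⟩
    have e : diagEmb ((blockParabolic (K := K) nA (· < ·)).levi lA * uA * iA,
        (blockParabolic (K := K) nB (· > ·)).levi lB * uB * iB) =
        (mixedParabolic nA nB).levi (lA, lB) * diagEmb (uA, uB) * diagEmb (iA, iB) := by
      change _ = diagEmb (blockLevi nA lA, blockLevi nB lB) * _ * _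
      rw [← map_mul, ← map_mul]
      rfl
    rw [hfA.apply_of_mem one_mem_iwahori lA huA hiA, hfB.apply_of_mem one_mem_iwahori lB huB hiB,
      e, hfW.apply_of_mem one_mem_iwahoriW (lA, lB) hu (diagEmb_mem_iwahoriW hiA hiB)]
    have hmod : (mixedParabolic (K := K) nA nB).modulus (lA, lB) =
        (blockParabolic nA (· < ·)).modulus lA * (blockParabolic nB (· > ·)).modulus lB *
          maxParabolic.modulus (blockLevi nA lA, blockLevi nB lB) := rfl
    have hmax : maxParabolic.modulus ((blockParabolic (K := K) nA (· < ·)).levi lA * uA * iA,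
        (blockParabolic (K := K) nB (· > ·)).levi lB * uB * iB) =
        maxParabolic.modulus (blockLevi nA lA, blockLevi nB lB) := by
      refine maxParabolic_modulus_eq ?_ ?_
      · simp only [Units.val_mul, Matrix.det_mul, norm_mul, norm_det_unip_lt huA,
          (mem_intGL_iff_det.1 hiA.1).2, mul_one]
        rfl
      · simp only [Units.val_mul, Matrix.det_mul, norm_mul, norm_det_unip_gt huB,
          (mem_intGL_iff_det.1 hiB.1).2, mul_one]
        rfl
    have hσ : extTensor₂ σA σB (lA, lB) (vA ⊗ₜ[ℂ] vB) = σA lA vA ⊗ₜ[ℂ] σB lB vB := rfl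
    have hpos := maxParabolic_modulus_pos (blockLevi (K := K) nA lA, blockLevi nB lB)
    have hA0 := (blockParabolic_modulus_pos (nA := nA) (· < ·) lA).le
    have hB0 := (blockParabolic_modulus_pos (nA := nB) (· > ·) lB).le
    rw [hmax, hmod, hσ, Real.sqrt_mul (mul_nonneg hA0 hB0), Real.sqrt_mul hA0, smul_smul,
      TensorProduct.smul_tmul_smul]
    congr 1
    have hne : ((Real.sqrt (maxParabolic.modulus (blockLevi (K := K) nA lA, blockLevi nB lB)) : ℝ)
      : ℂ) ≠ 0 := Complex.ofReal_ne_zero.2 (Real.sqrt_pos.2 hpos).ne'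
    push_cast
    field_simp
  · have h0 : fW.1 (diagEmb (hA, hB)) = 0 := by
      refine hfW.eq_zero fun p hp i hi e => hmem ?_
      obtain ⟨pA, hpA, pB, hpB, iA, hiA, iB, hiB, B, B', C, hC, hg'⟩ :=
        exists_of_mem_mixed_mul hr hp hi e
      rw [diagEmb_val] at hg'
      obtain ⟨e11, -, e21, e22⟩ := Matrix.ext_iff_blocks.1 hg'
      simp only [Matrix.toBlocks_fromBlocks₁₁, Matrix.toBlocks_fromBlocks₂₁,
        Matrix.toBlocks_fromBlocks₂₂] at e11 e21 e22
      have hC0 : C = 0 := by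
        rw [← gl_inv_mul_cancel_left pB C, ← e21, Matrix.mul_zero]
      rw [hC0, Matrix.mul_zero, add_zero, ← Units.val_mul] at e11
      exact ⟨⟨pA, hpA, iA, hiA, Units.ext e11⟩, ⟨pB, hpB, iB, hiB, Units.ext e22⟩⟩
    rw [h0, smul_zero]
    rcases not_and_or.1 hmem with hm | hm
    · push Not at hm
      rw [hfA.eq_zero hm, TensorProduct.zero_tmul]
    · push Not at hm
      rw [hfB.eq_zero hm, TensorProduct.tmul_zero]

end Transit

end LocalZeta
end

noncomputable section
namespace LocalZeta

/-! ### Absorbing unipotent factors into the Iwahori subgroups. -/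

section IwahoriElements

variable {K : Type*} [NontriviallyNormedField K] [IsNormalizedLocalField K]
  {t s : ℕ} {nA : Fin t → ℕ} {nB : Fin s → ℕ} {r : ℕ}

theorem congrGL_subset_iwahori {n : Fin t → ℕ} {R : Fin t → Fin t → Prop} {g : GL (BlockIdx n) K}
    (h : g ∈ congrGL K _ (rad_pos K r).le) : g ∈ iwahori n R r :=
  ⟨h.1, fun x y _ => mem_pPow_iff_rad.2 (h.2 x y)⟩

theorem upperU_mem_iwahoriW {B : Matrix (BlockIdx nA) (BlockIdx nB) K} (hB : MatLe 1 B) :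
    upperU B ∈ iwahoriW nA nB r := by
  have h0 := (rad_pos K r).le
  refine mem_iwahoriW_iff.2 ⟨upperU_mem_intGL.2 hB, fun x y _ => ?_, fun x y _ => ?_, ?_⟩
  · rw [upperU_val, Matrix.toBlocks_fromBlocks₁₁, sub_self, Matrix.zero_apply, norm_zero]
    exact h0
  · rw [upperU_val, Matrix.toBlocks_fromBlocks₂₂, sub_self, Matrix.zero_apply, norm_zero]
    exact h0
  · rw [upperU_val, Matrix.toBlocks_fromBlocks₂₁]
    exact MatLe.zero h0

theorem lowerU_mem_iwahoriW {C : Matrix (BlockIdx nB) (BlockIdx nA) K} (hC : MatLe (rad K r) C) :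
    lowerU C ∈ iwahoriW nA nB r := by
  have h0 := (rad_pos K r).le
  refine mem_iwahoriW_iff.2 ⟨lowerU_mem_intGL.2 (hC.mono (rad_le_one K r)), fun x y _ => ?_,
    fun x y _ => ?_, ?_⟩
  · rw [lowerU_val, Matrix.toBlocks_fromBlocks₁₁, sub_self, Matrix.zero_apply, norm_zero]
    exact h0
  · rw [lowerU_val, Matrix.toBlocks_fromBlocks₂₂, sub_self, Matrix.zero_apply, norm_zero]
    exact h0
  · rw [lowerU_val, Matrix.toBlocks_fromBlocks₂₁]
    exact hC

theorem lowerU_mem_iwahoriWT {C : Matrix (BlockIdx nB) (BlockIdx nA) K} (hC : MatLe 1 C) :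
    lowerU C ∈ iwahoriWT nA nB r :=
  ⟨upperU Cᵀ, upperU_mem_iwahoriW hC.transpose, by
    rw [lowerU_val, upperU_val, Matrix.fromBlocks_transpose]; simp⟩

theorem diagEmb_mem_iwahoriWT (hr : 1 ≤ r) {D : GL (BlockIdx nB) K}
    (hD : D ∈ congrGL K _ (rad_pos K r).le) : diagEmb (1, D) ∈ iwahoriWT nA nB r := by
  have h1 : MatLe (rad K r) (D.valᵀ - 1) := by
    have := hD.2.transpose
    rwa [Matrix.transpose_sub, Matrix.transpose_one] at this
  obtain ⟨D', hD', hi⟩ := exists_gl_of_sub_one (rad_pos K r).le (rad_lt_one K hr) h1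
  refine ⟨diagEmb (1, D'), diagEmb_mem_iwahoriW one_mem_iwahori
    (congrGL_subset_iwahori ⟨hi, by rwa [hD']⟩), ?_⟩
  rw [diagEmb_val, diagEmb_val, Matrix.fromBlocks_transpose, hD']
  simp

/-- Interchanging the two unipotent factors near the identity. -/
theorem exists_upper_mul_lower (hr : 1 ≤ r) {a b : Type*} [Fintype a] [DecidableEq a] [Fintype b]
    [DecidableEq b] {B : Matrix a b K} {C : Matrix b a K} (hB : MatLe (rad K r) B)
    (hC : MatLe (rad K r) C) : ∃ (B' : Matrix a b K) (C' : Matrix b a K),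
      ∃ A ∈ congrGL K a (rad_pos K r).le, ∃ D ∈ congrGL K b (rad_pos K r).le,
      MatLe (rad K r) B' ∧ MatLe (rad K r) C' ∧
      upperU B * lowerU C = lowerU C' * diagEmb (A, D) * upperU B' := by
  have h0 := (rad_pos K r).le
  have hl := rad_lt_one K hr
  have h1 : MatLe (rad K r) (1 + B * C - 1) := by
    rw [add_sub_cancel_left]
    exact MatLe.mul_left h0 (hB.mono hl.le) hC
  obtain ⟨A, hA, hAi⟩ := exists_gl_of_sub_one h0 hl h1
  have hAc : A ∈ congrGL K a h0 := ⟨hAi, by rwa [hA]⟩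
  have h2 : MatLe (rad K r) (1 - C * (A⁻¹).val * B - 1) := by
    rw [sub_sub_cancel_left]
    exact (MatLe.mul_left h0 ((hC.mono hl.le).mul_right zero_le_one
      (mem_intGL_iff.1 hAi).2) hB).neg
  obtain ⟨D, hD, hDi⟩ := exists_gl_of_sub_one h0 hl h2
  refine ⟨(A⁻¹).val * B, C * (A⁻¹).val, A, hAc, D, ⟨hDi, by rwa [hD]⟩,
    MatLe.mul_left h0 (mem_intGL_iff.1 hAi).2 hB, hC.mul_right h0 (mem_intGL_iff.1 hAi).2, ?_⟩
  apply Units.ext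
  rw [lower_diag_upper_val, Units.val_mul, upperU_val, lowerU_val, Matrix.fromBlocks_multiply, hD,
    hA]
  simp

variable {E : Type*} {c : GL (BlockIdx nA ⊕ BlockIdx nB) K → E}

/-- Reduction of a coefficient on the product of two cells to the Levi subgroup. -/
theorem coeff_cells {cA cB : ℕ} (hcA : 1 ≤ cA) (hcr : cA + cB ≤ r)
    (hR : ∀ i ∈ iwahoriW nA nB r, ∀ g, c (g * i) = c g)
    (hL : ∀ i ∈ iwahoriWT nA nB r, ∀ g, c (i * g) = c g)
    {A₁ A₂ : GL (BlockIdx nA) K} {D₁ D₂ : GL (BlockIdx nB) K}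
    {β₁ β₂ : Matrix (BlockIdx nA) (BlockIdx nB) K} {γ₁ γ₂ : Matrix (BlockIdx nB) (BlockIdx nA) K}
    (hA₁ : A₁ ∈ intGL K _) (hD₂ : D₂ ∈ intGL K _) (hA₂ : MatLe (rad K cA)⁻¹ A₂.val)
    (hD₁ : MatLe (rad K cB)⁻¹ D₁.val) (hβ₁ : MatLe 1 β₁) (hγ₁ : MatLe (rad K r) γ₁)
    (hβ₂ : MatLe (rad K r) β₂) (hγ₂ : MatLe 1 γ₂) :
    c ((upperU β₂ * diagEmb (A₂, D₂) * lowerU γ₂)⁻¹ *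
      (lowerU γ₁ * diagEmb (A₁, D₁) * upperU β₁)) = c (diagEmb (A₂⁻¹ * A₁, D₂⁻¹ * D₁)) := by
  have hr : 1 ≤ r := by omega
  -- The middle of the product, an upper factor followed by a lower one, is in the wrong order. Both
  -- are 𝔭^r-small, so they can be exchanged at the cost of Levi factors congruent to 1.
  obtain ⟨B', C', a, ha, d, hd, hB', hC', e⟩ := exists_upper_mul_lower hr hβ₂.neg hγ₁
  have hrA := rad_pos K cA
  have hrB := rad_pos K cB
  have hr0 := rad_pos K r
  have hbA : rad K r * (rad K cA)⁻¹ ≤ 1 := by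
    rw [mul_inv_le_iff₀ hrA, one_mul]; exact rad_anti K (by omega)
  have hbB : rad K r * (rad K cB)⁻¹ ≤ 1 := by
    rw [mul_inv_le_iff₀ hrB, one_mul]; exact rad_anti K (by omega)
  have e1 : (upperU β₂ * diagEmb (A₂, D₂) * lowerU γ₂)⁻¹ *
      (lowerU γ₁ * diagEmb (A₁, D₁) * upperU β₁) =
      lowerU (-γ₂) * (diagEmb (A₂⁻¹, D₂⁻¹) * lowerU C' * (diagEmb (A₂⁻¹, D₂⁻¹))⁻¹) *
      diagEmb (1, D₂⁻¹ * d * D₂) * diagEmb (A₂⁻¹ * A₁, D₂⁻¹ * D₁) *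
      diagEmb (A₁⁻¹ * a * A₁, 1) * ((diagEmb (A₁, D₁))⁻¹ * upperU B' * diagEmb (A₁, D₁)) *
        upperU β₁ := by
    have e2 : diagEmb (A₂⁻¹, D₂⁻¹) = (diagEmb (A₂, D₂))⁻¹ := by rw [← map_inv]; rfl
    have e3 : diagEmb (1, D₂⁻¹ * d * D₂) * diagEmb (A₂⁻¹ * A₁, D₂⁻¹ * D₁) *
        diagEmb (A₁⁻¹ * a * A₁, 1) = (diagEmb (A₂, D₂))⁻¹ * diagEmb (a, d) * diagEmb (A₁, D₁) := by
      rw [← map_inv, ← map_mul, ← map_mul, ← map_mul, ← map_mul]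
      congr 1
      refine Prod.ext ?_ ?_
      · change 1 * (A₂⁻¹ * A₁) * (A₁⁻¹ * a * A₁) = A₂⁻¹ * a * A₁
        group
      · change D₂⁻¹ * d * D₂ * (D₂⁻¹ * D₁) * 1 = D₂⁻¹ * d * D₁
        group
    calc _ = (lowerU γ₂)⁻¹ * (diagEmb (A₂, D₂))⁻¹ * ((upperU β₂)⁻¹ * lowerU γ₁) *
          diagEmb (A₁, D₁) * upperU β₁ := by group
      _ = (lowerU (-γ₂)) * (diagEmb (A₂, D₂))⁻¹ * lowerU C' * diagEmb (a, d) * upperU B' *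
          diagEmb (A₁, D₁) * upperU β₁ := by rw [upperU_inv, lowerU_inv, e]; group
      _ = lowerU (-γ₂) * (diagEmb (A₂⁻¹, D₂⁻¹) * lowerU C' * (diagEmb (A₂⁻¹, D₂⁻¹))⁻¹) *
          ((diagEmb (A₂, D₂))⁻¹ * diagEmb (a, d) * diagEmb (A₁, D₁)) *
          ((diagEmb (A₁, D₁))⁻¹ * upperU B' * diagEmb (A₁, D₁)) * upperU β₁ := by
            rw [e2]; group
      _ = _ := by rw [← e3]; group
  have e4 : diagEmb (A₂⁻¹, D₂⁻¹) * lowerU C' * (diagEmb (A₂⁻¹, D₂⁻¹))⁻¹ =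
      lowerU ((D₂⁻¹).val * C' * A₂.val) := by
    apply Units.ext
    rw [← map_inv, Units.val_mul, Units.val_mul, diagEmb_val, diagEmb_val, lowerU_val, lowerU_val,
      Matrix.fromBlocks_multiply, Matrix.fromBlocks_multiply]
    simp
  have e5 : (diagEmb (A₁, D₁))⁻¹ * upperU B' * diagEmb (A₁, D₁) =
      upperU ((A₁⁻¹).val * B' * D₁.val) := by
    apply Units.ext
    rw [← map_inv, Units.val_mul, Units.val_mul, diagEmb_val, diagEmb_val, upperU_val, upperU_val,
      Matrix.fromBlocks_multiply, Matrix.fromBlocks_multiply]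
    simp
  -- Here the level is used: 𝔭^r absorbs the denominators 𝔭^(-c_a) of `A₂`, and in `i2` the
  -- denominators 𝔭^(-c_b) of `D₁`.
  have i1 : MatLe 1 ((D₂⁻¹).val * C' * A₂.val) :=
    ((MatLe.mul_left hr0.le (mem_intGL_iff.1 hD₂).2 hC').mul hr0.le (inv_pos.2 hrA).le hA₂).mono hbA
  have i2 : MatLe 1 ((A₁⁻¹).val * B' * D₁.val) :=
    ((MatLe.mul_left hr0.le (mem_intGL_iff.1 hA₁).2 hB').mul hr0.le (inv_pos.2 hrB).le hD₁).mono hbB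
  have i3 : D₂⁻¹ * d * D₂ ∈ congrGL K _ hr0.le := by
    have := conj_mem_congrGL hr0.le hd (inv_mem hD₂)
    rwa [inv_inv] at this
  have i4 : A₁⁻¹ * a * A₁ ∈ congrGL K _ hr0.le := by
    have := conj_mem_congrGL hr0.le ha (inv_mem hA₁)
    rwa [inv_inv] at this
  rw [e1, e4, e5, hR _ (upperU_mem_iwahoriW hβ₁), hR _ (upperU_mem_iwahoriW i2),
    hR _ (diagEmb_mem_iwahoriW (congrGL_subset_iwahori i4) one_mem_iwahori),
    mul_assoc, mul_assoc, hL _ (lowerU_mem_iwahoriWT hγ₂.neg), hL _ (lowerU_mem_iwahoriWT i1),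
    hL _ (diagEmb_mem_iwahoriWT hr i3)]

end IwahoriElements

end LocalZeta
end

noncomputable section
namespace LocalZeta

/-! ### Volumes of sets described in cell coordinates. -/

section CellVolumes

variable {K : Type*} [NontriviallyNormedField K] [IsNormalizedLocalField K]
  [MeasurableSpace K] [BorelSpace K]
variable {a b : Type*} [Fintype a] [Fintype b] [DecidableEq a] [DecidableEq b]

/-- Where both diagonal determinants have norm one, the density of the cell is 1. -/
theorem CellChart.haarGL_image_eq (c : CellChart K a b) {S : Set (CellGL K a b)}
    (hS : MeasurableSet S) (h1 : ∀ p ∈ S, ‖p.1.1.val.det‖ = 1) (h2 : ∀ p ∈ S, ‖p.1.2.val.det‖ = 1) :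
    haarGL K (a ⊕ b) (c.toGL '' S) = cellMeasure K a b S := by
  have hsub : c.toGL '' S ⊆ Units.val ⁻¹' c.image := by
    rintro _ ⟨p, -, rfl⟩
    change (c.toGL p).val ∈ c.image
    rw [c.toGL_val]
    exact c.mem_image _ (Matrix.GeneralLinearGroup.det_ne_zero p.1.1)
      (Matrix.GeneralLinearGroup.det_ne_zero p.1.2)
  have hm := c.measurableEmbedding.measurableSet_image.2 hS
  rw [← Measure.restrict_eq_self _ hsub, c.restrict_eq_map,
    Measure.map_apply c.measurableEmbedding.measurable hm,
    Set.preimage_image_eq _ c.measurableEmbedding.injective, withDensity_apply _ hS,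
    setLIntegral_congr_fun hS (g := fun _ => 1), setLIntegral_one]
  intro p hp
  have e1 : ‖p.1.1.val.det‖₊ = 1 := NNReal.eq (h1 p hp)
  have e2 : ‖p.1.2.val.det‖₊ = 1 := NNReal.eq (h2 p hp)
  simp [cellDensity, e1, e2]

theorem measurableSet_intGL : MeasurableSet (intGL K a : Set (GL a K)) :=
  isOpen_intGL.measurableSet

theorem measurable_val_gl : Measurable (Units.val : GL a K → Matrix a a K) :=
  measurableEmbedding_val.measurable

theorem measurable_inv_val_gl : Measurable fun g : GL a K => (g⁻¹).val := by
  simp_rw [Matrix.coe_units_inv]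
  exact measurable_matrix_inv.comp measurable_val_gl

/-- The integral elements with `D⁻¹ C ∈ m₂ M(c) m₁⁻¹`. -/
def twistedSet (c : ℝ) (m₁ : GL a K) (m₂ : GL b K) : Set (GL (a ⊕ b) K) :=
  {k | k ∈ intGL K (a ⊕ b) ∧ ∃ D : GL b K, D.val = k.val.toBlocks₂₂ ∧
    MatLe c ((m₂⁻¹).val * ((D⁻¹).val * k.val.toBlocks₂₁) * m₁.val)}

/-- The coordinates of `twistedSet`. -/
def twistedCell (c : ℝ) (m₁ : GL a K) (m₂ : GL b K) : Set (CellGL K a b) :=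
  {p | p.1.1 ∈ intGL K a ∧ p.1.2 ∈ intGL K b ∧ MatLe 1 p.2.1 ∧
    MatLe c ((m₂⁻¹).val * ((p.1.2⁻¹).val * p.2.2) * m₁.val)}

variable {c : ℝ} {m₁ : GL a K} {m₂ : GL b K}

theorem matLe_one_of_twisted (hm : ∀ γ : Matrix b a K, MatLe c γ → MatLe 1 (m₂.val * γ * (m₁⁻¹).val))
    {γ : Matrix b a K} (h : MatLe c ((m₂⁻¹).val * γ * m₁.val)) : MatLe 1 γ := by
  have := hm _ h
  rwa [Matrix.mul_assoc, Matrix.mul_assoc (_ * _), gl_mul_inv_val, Matrix.mul_one,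
    gl_mul_inv_cancel_left] at this

theorem toGL_upperChart_val (p : CellGL K a b) : ((upperChart K a b).toGL p).val =
    Matrix.fromBlocks (p.1.1.val + p.2.1 * (p.1.2⁻¹).val * p.2.2) p.2.1 p.2.2 p.1.2.val :=
  upper_diag_lower_val _ _ _ _

theorem toGL_upperChart (p : CellGL K a b) : (upperChart K a b).toGL p =
    upperU (p.2.1 * (p.1.2⁻¹).val) * diagEmb p.1 * lowerU ((p.1.2⁻¹).val * p.2.2) := rfl

theorem toGL_lowerChart_val (p : CellGL K a b) : ((lowerChart K a b).toGL p).val =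
    Matrix.fromBlocks p.1.1.val p.2.1 p.2.2 (p.1.2.val + p.2.2 * (p.1.1⁻¹).val * p.2.1) :=
  lower_diag_upper_val _ _ _ _

theorem toGL_lowerChart (p : CellGL K a b) : (lowerChart K a b).toGL p =
    lowerU (p.2.2 * (p.1.1⁻¹).val) * diagEmb p.1 * upperU ((p.1.1⁻¹).val * p.2.1) := rfl

/-- The hypothesis makes γ = D⁻¹ C integral. Multiplying on the right by the lower unipotent matrix
of -γ then stays in the integral group and clears the lower left block, so the remaining diagonal
blocks are integral and invertible. -/
theorem twistedSet_eq (hm : ∀ γ : Matrix b a K, MatLe c γ → MatLe 1 (m₂.val * γ * (m₁⁻¹).val)) :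
    twistedSet c m₁ m₂ = (upperChart K a b).toGL '' twistedCell c m₁ m₂ := by
  ext k
  constructor
  · rintro ⟨hk, D, hD, hc⟩
    have hγ := matLe_one_of_twisted hm hc
    have hkm := (mem_intGL_iff.1 hk).1
    have hB : MatLe 1 k.val.toBlocks₁₂ := fun i j => hkm _ _
    have hA0 : MatLe 1 k.val.toBlocks₁₁ := fun i j => hkm _ _
    set γ := (D⁻¹).val * k.val.toBlocks₂₁ with hγd
    have hDγ : D.val * γ = k.val.toBlocks₂₁ := gl_mul_inv_cancel_left _ _
    have h1 : k * lowerU (-γ) ∈ intGL K (a ⊕ b) := mul_mem hk (lowerU_mem_intGL.2 hγ.neg)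
    have h2 : (k * lowerU (-γ)).val = Matrix.fromBlocks
        (k.val.toBlocks₁₁ - k.val.toBlocks₁₂ * γ) k.val.toBlocks₁₂ 0 D.val := by
      rw [Units.val_mul, lowerU_val, gl_eq_of_fromBlocks (g := k), Matrix.fromBlocks_multiply,
        ← hD]
      simp [hDγ, sub_eq_add_neg]
    have h3 := norm_det_blocks_eq_one h1 le_rfl zero_lt_one (by
      rw [h2, Matrix.toBlocks_fromBlocks₂₁]; exact MatLe.zero le_rfl)
    rw [h2, Matrix.toBlocks_fromBlocks₁₁, Matrix.toBlocks_fromBlocks₂₂] at h3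
    have hDi : D ∈ intGL K b := mem_intGL_iff_det.2 ⟨by rw [hD]; exact fun i j => hkm _ _, h3.2⟩
    refine ⟨((glOfDet (k.val.toBlocks₁₁ - k.val.toBlocks₁₂ * γ)
      (norm_pos_iff.1 (by rw [h3.1]; exact one_pos)), D), (k.val.toBlocks₁₂, k.val.toBlocks₂₁)),
      ⟨mem_intGL_iff_det.2 ⟨hA0.sub (MatLe.mul_left zero_le_one hB hγ), h3.1⟩, hDi, hB, hc⟩, ?_⟩
    apply Units.ext
    rw [toGL_upperChart_val]
    simp only [glOfDet_val]
    rw [Matrix.mul_assoc, ← hγd, sub_add_cancel, hD, Matrix.fromBlocks_toBlocks]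
  · rintro ⟨⟨⟨A, D⟩, B, C⟩, ⟨hA, hD, hB, hC⟩, rfl⟩
    have hγ := matLe_one_of_twisted hm hC
    refine ⟨?_, D, ?_, ?_⟩
    · rw [toGL_upperChart]
      exact mul_mem (mul_mem (upperU_mem_intGL.2 (hB.mul_right zero_le_one (mem_intGL_iff.1 hD).2))
        (diagEmb_mem_intGL.2 ⟨hA, hD⟩)) (lowerU_mem_intGL.2 hγ)
    · rw [toGL_upperChart_val, Matrix.toBlocks_fromBlocks₂₂]
    · rw [toGL_upperChart_val, Matrix.toBlocks_fromBlocks₂₁]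
      exact hC

theorem measurableSet_twistedCell : MeasurableSet (twistedCell c m₁ m₂) := by
  have h1 : Measurable fun p : CellGL K a b => p.1.1 := measurable_fst.comp measurable_fst
  have h2 : Measurable fun p : CellGL K a b => p.1.2 := measurable_snd.comp measurable_fst
  have h3 : Measurable fun p : CellGL K a b => p.2.1 := measurable_fst.comp measurable_snd
  have h4 : Measurable fun p : CellGL K a b => p.2.2 := measurable_snd.comp measurable_snd
  have h5 : Measurable fun p : CellGL K a b =>
      (m₂⁻¹).val * ((p.1.2⁻¹).val * p.2.2) * m₁.val :=
    measurable_matrix_mul (measurable_matrix_mul measurable_const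
      (measurable_matrix_mul (measurable_inv_val_gl.comp h2) h4)) measurable_const
  exact (h1 measurableSet_intGL).inter ((h2 measurableSet_intGL).inter
    ((h3 (measurableSet_matLe 1)).inter (h5 (measurableSet_matLe c))))

theorem haarMatrix_twisted (D : GL b K) :
    haarMatrix K b a {C | MatLe c ((m₂⁻¹).val * ((D⁻¹).val * C) * m₁.val)} =
      ENNReal.ofReal (‖m₂.val.det‖ ^ Fintype.card a * (‖m₁.val.det‖ ^ Fintype.card b)⁻¹) *
      haarMatrix K b a {C | MatLe c ((D⁻¹).val * C)} := by
  have hs : MeasurableSet {C : Matrix b a K | MatLe c C} := measurableSet_matLe c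
  have hD := norm_det_pos D
  have h1 : ∀ g : GL b K, Measurable fun C : Matrix b a K => g.val * C := fun g =>
    measurable_matrix_mul measurable_const measurable_id
  have h2 : ∀ g : GL a K, Measurable fun C : Matrix b a K => C * g.val := fun g =>
    measurable_matrix_mul measurable_id measurable_const
  have hdet : ∀ g : GL b K, ‖(g⁻¹).val.det‖ = ‖g.val.det‖⁻¹ := fun g => by
    have := congrArg norm (congrArg Matrix.det (gl_inv_mul_val g))
    rw [Matrix.det_mul, norm_mul, Matrix.det_one, norm_one] at this
    exact eq_inv_of_mul_eq_one_left this
  have e1 : {C : Matrix b a K | MatLe c ((m₂⁻¹).val * ((D⁻¹).val * C) * m₁.val)} =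
      (fun C => (m₂⁻¹ * D⁻¹).val * C) ⁻¹' ((fun C => C * m₁.val) ⁻¹' {C | MatLe c C}) := by
    ext C
    change MatLe c _ ↔ MatLe c ((m₂⁻¹ * D⁻¹).val * C * m₁.val)
    rw [Units.val_mul, Matrix.mul_assoc (m₂⁻¹).val (D⁻¹).val C]
  rw [e1, ← Measure.map_apply (h1 _) (h2 _ hs), map_mul_left_haarMatrix, Measure.smul_apply,
    ← Measure.map_apply (h2 _) hs, map_mul_right_haarMatrix, Measure.smul_apply]
  have e2 : {C : Matrix b a K | MatLe c ((D⁻¹).val * C)} =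
      (fun C => (D⁻¹).val * C) ⁻¹' {C | MatLe c C} := rfl
  rw [e2, ← Measure.map_apply (h1 _) hs, map_mul_left_haarMatrix, Measure.smul_apply]
  simp only [smul_eq_mul]
  rw [← mul_assoc, ← mul_assoc, ← ENNReal.ofReal_mul (by positivity),
    ← ENNReal.ofReal_mul (by positivity)]
  congr 2
  rw [Units.val_mul, Matrix.det_mul, norm_mul, hdet, hdet]
  simp only [mul_inv, inv_inv, mul_pow, inv_pow]
  ring

theorem cellMeasure_twistedCell : cellMeasure K a b (twistedCell c m₁ m₂) =
    ENNReal.ofReal (‖m₂.val.det‖ ^ Fintype.card a * (‖m₁.val.det‖ ^ Fintype.card b)⁻¹) *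
      cellMeasure K a b (twistedCell c 1 1) := by
  rw [cellMeasure, Measure.prod_apply measurableSet_twistedCell,
    Measure.prod_apply measurableSet_twistedCell, ← lintegral_const_mul']
  swap
  · exact ENNReal.ofReal_ne_top
  refine lintegral_congr fun x => ?_
  by_cases hx : x.1 ∈ intGL K a ∧ x.2 ∈ intGL K b
  · have key : ∀ (m₁ : GL a K) (m₂ : GL b K), Prod.mk x ⁻¹' twistedCell c m₁ m₂ =
        {B : Matrix a b K | MatLe 1 B} ×ˢ
          {C : Matrix b a K | MatLe c ((m₂⁻¹).val * ((x.2⁻¹).val * C) * m₁.val)} := by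
      intro m₁ m₂
      ext q
      exact ⟨fun h => ⟨h.2.2.1, h.2.2.2⟩, fun h => ⟨hx.1, hx.2, h.1, h.2⟩⟩
    rw [key, key, Measure.prod_prod, Measure.prod_prod, haarMatrix_twisted]
    simp only [inv_one, Units.val_one, Matrix.one_mul, Matrix.mul_one]
    ring
  · have key : ∀ (m₁ : GL a K) (m₂ : GL b K), Prod.mk x ⁻¹' twistedCell c m₁ m₂ = ∅ := by
      intro m₁ m₂
      ext q
      exact ⟨fun h => hx ⟨h.1, h.2.1⟩, fun h => h.elim⟩
    rw [key, key]; simp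

/-- For fixed A, D, B the condition on C is a linear change of variable of the untwisted one. The
resulting factor is the inverse of the modulus of P_{a,b} at (m₁, m₂). -/
theorem haarGL_twistedSet (hc : c ≤ 1)
    (hm : ∀ γ : Matrix b a K, MatLe c γ → MatLe 1 (m₂.val * γ * (m₁⁻¹).val)) :
    haarGL K (a ⊕ b) (twistedSet c m₁ m₂) =
      ENNReal.ofReal (‖m₂.val.det‖ ^ Fintype.card a * (‖m₁.val.det‖ ^ Fintype.card b)⁻¹) *
        haarGL K (a ⊕ b) (twistedSet c 1 1) := by
  have hm1 : ∀ γ : Matrix b a K, MatLe c γ →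
      MatLe 1 ((1 : GL b K).val * γ * ((1 : GL a K)⁻¹).val) := fun γ hγ => by
    simp only [inv_one, Units.val_one, Matrix.one_mul, Matrix.mul_one]
    exact hγ.mono hc
  have hd : ∀ (m₁ : GL a K) (m₂ : GL b K), haarGL K (a ⊕ b)
      ((upperChart K a b).toGL '' twistedCell c m₁ m₂) =
      cellMeasure K a b (twistedCell c m₁ m₂) := fun m₁ m₂ =>
    (upperChart K a b).haarGL_image_eq measurableSet_twistedCell
      (fun p hp => (mem_intGL_iff_det.1 hp.1).2) (fun p hp => (mem_intGL_iff_det.1 hp.2.1).2)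
  rw [twistedSet_eq hm, twistedSet_eq hm1, hd, hd]
  exact cellMeasure_twistedCell

theorem measurableSet_twistedSet
    (hm : ∀ γ : Matrix b a K, MatLe c γ → MatLe 1 (m₂.val * γ * (m₁⁻¹).val)) :
    MeasurableSet (twistedSet c m₁ m₂) := by
  rw [twistedSet_eq hm]
  exact (upperChart K a b).measurableEmbedding.measurableSet_image.2 measurableSet_twistedCell

end CellVolumes

/-! ### The matrix coefficient of π_w on the Levi subgroup. -/

section Coefficient

variable {K : Type*} [NontriviallyNormedField K] [IsNormalizedLocalField K]
  [MeasurableSpace K] [BorelSpace K]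
  {t s : ℕ} {nA : Fin t → ℕ} {nB : Fin s → ℕ} {r : ℕ}

theorem twistedSet_one_eq_iwahoriAB (hr : 1 ≤ r) :
    twistedSet (rad K r) 1 1 = iwahoriAB (K := K) nA nB r := by
  ext k
  constructor
  · rintro ⟨hk, D, hD, hc⟩
    refine ⟨hk, fun x y => mem_pPow_iff_rad.2 ?_⟩
    simp only [inv_one, Units.val_one, Matrix.one_mul, Matrix.mul_one] at hc
    have h1 : MatLe 1 D.val := by
      rw [hD]; exact fun i j => (mem_intGL_iff.1 hk).1 _ _
    have h2 := MatLe.mul_left (rad_pos K r).le h1 hc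
    rw [gl_mul_inv_cancel_left] at h2
    exact h2 x y
  · rintro ⟨hk, hc⟩
    have hc' : MatLe (rad K r) k.val.toBlocks₂₁ := fun x y => hc x y
    have h1 := (norm_det_blocks_eq_one hk (rad_pos K r).le (rad_lt_one K hr) hc').2
    have h2 : glOfDet k.val.toBlocks₂₂ (norm_pos_iff.1 (by rw [h1]; exact one_pos)) ∈
        intGL K _ :=
      mem_intGL_iff_det.2 ⟨fun i j => (mem_intGL_iff.1 hk).1 _ _, h1⟩
    refine ⟨hk, glOfDet k.val.toBlocks₂₂ (norm_pos_iff.1 (by rw [h1]; exact one_pos)), rfl, ?_⟩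
    simp only [inv_one, Units.val_one, Matrix.one_mul, Matrix.mul_one]
    exact MatLe.mul_left (rad_pos K r).le (mem_intGL_iff.1 h2).2 hc'

variable {VA VB PA PB PW : Type*} [AddCommGroup VA] [Module ℂ VA] [AddCommGroup VB] [Module ℂ VB]
  [AddCommGroup PA] [Module ℂ PA] [AddCommGroup PB] [Module ℂ PB] [AddCommGroup PW] [Module ℂ PW]
  {σA : Representation ℂ (∀ j, GL (Fin (nA j)) K) VA}
  {σB : Representation ℂ (∀ j, GL (Fin (nB j)) K) VB}
  {πA : Representation ℂ (GL (BlockIdx nA) K) PA} {πB : Representation ℂ (GL (BlockIdx nB) K) PB}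
  {πW : Representation ℂ (GL (BlockIdx nA ⊕ BlockIdx nB) K) PW}
  {qA : (normalizedInd (blockParabolic nA (· < ·)) σA).IntertwiningMap πA}
  {qB : (normalizedInd (blockParabolic nB (· > ·)) σB).IntertwiningMap πB}
  {qW : (normalizedInd maxParabolic (extTensor₂ πA πB)).IntertwiningMap πW}
  {fW : inducedSpace (mixedParabolic nA nB) (extTensor₂ σA σB)}
  {FW : inducedSpace (maxParabolic (K := K)) (extTensor₂ πA πB)}
  {KA : Subgroup (∀ j, GL (Fin (nA j)) K)} {KB : Subgroup (∀ j, GL (Fin (nB j)) K)}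
  {KW : Subgroup ((∀ j, GL (Fin (nA j)) K) × (∀ j, GL (Fin (nB j)) K))}
  {KW' : Subgroup (GL (BlockIdx nA) K × GL (BlockIdx nB) K)}
  {vA : VA} {vB : VB}
  {fA : inducedSpace (blockParabolic nA (· < ·)) σA}
  {fB : inducedSpace (blockParabolic nB (· > ·)) σB}
  {lA : smoothDual πA} {lB : smoothDual πB} {lW : smoothDual πW}
  {FW' : inducedSpace maxParabolic (extTensor₂ (contragredient πA) (contragredient πB))}
  {P : Set (GL (BlockIdx nA ⊕ BlockIdx nB) K)}

theorem intertwining_apply {G V W : Type*} [Group G] [AddCommGroup V] [Module ℂ V] [AddCommGroup W]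
    [Module ℂ W] {ρ : Representation ℂ G V} {π : Representation ℂ G W} (q : ρ.IntertwiningMap π)
    (g : G) (v : V) : q (ρ g v) = π g (q v) :=
  LinearMap.congr_fun (q.isIntertwining' g) v

theorem smoothDual_apply_of_fixed {G V : Type*} [Group G] [TopologicalSpace G]
    [IsTopologicalGroup G] [AddCommGroup V] [Module ℂ V] {ρ : Representation ℂ G V}
    {l : smoothDual ρ} {i : G} (h : contragredient ρ i l = l) (v : V) : l.1 (ρ i v) = l.1 v := by
  have h1 : l.1 (ρ i⁻¹ (ρ i v)) = l.1 (ρ i v) :=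
    LinearMap.congr_fun (congrArg Subtype.val h) (ρ i v)
  rw [← h1, ← Module.End.mul_apply, ← map_mul, inv_mul_cancel, map_one, Module.End.one_apply]

theorem pairing₂_tmul (x : PA) (y : PB) (l : smoothDual πA) (m : smoothDual πB) :
    pairing₂ πA πB (x ⊗ₜ y) (l ⊗ₜ m) = l.1 x * m.1 y := by
  rw [pairing₂, TensorProduct.map_tmul, TensorProduct.dualDistrib_apply]
  rfl

theorem pairing₂_smul_left (z : ℂ) (x : PA ⊗[ℂ] PB) (y : smoothDual πA ⊗[ℂ] smoothDual πB) :
    pairing₂ πA πB (z • x) y = z * pairing₂ πA πB x y := by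
  rw [pairing₂, map_smul, smul_eq_mul, pairing₂]

theorem pairing₂_zero_left (y : smoothDual πA ⊗[ℂ] smoothDual πB) :
    pairing₂ πA πB 0 y = 0 := by
  rw [pairing₂, map_zero]

variable (hfW : IsTestVector (mixedParabolic nA nB) (extTensor₂ σA σB) KW (iwahoriW nA nB r)
  (vA ⊗ₜ[ℂ] vB) fW) (hFW : IsTransitImage qA qB fW FW)
  (hfA : IsTestVector (blockParabolic nA (· < ·)) σA KA (iwahori nA (· < ·) r) vA fA)
  (hfB : IsTestVector (blockParabolic nB (· > ·)) σB KB (iwahori nB (· > ·) r) vB fB)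
  (hlW : IsDualImage _ _ _ (pairing₂ πA πB) (haarGL K _) (intGL K _) qW lW FW')
  (hFW' : IsDualTestVector _ _ KW' P (iwahoriWT nA nB r) (lA ⊗ₜ[ℂ] lB) lW FW')

include hfW hFW in
theorem coeffW_mul_iwahoriW {i : GL (BlockIdx nA ⊕ BlockIdx nB) K} (hi : i ∈ iwahoriW nA nB r)
    (g : GL (BlockIdx nA ⊕ BlockIdx nB) K) :
    lW.1 (πW (g * i) (qW FW)) = lW.1 (πW g (qW FW)) := by
  have : normalizedInd maxParabolic (extTensor₂ πA πB) i FW = FW :=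
    Subtype.ext (funext fun x => hFW.apply_mul_iwahoriW hfW hi x)
  rw [map_mul, Module.End.mul_apply, ← intertwining_apply, this]

include hFW' in
theorem coeffW_iwahoriWT_mul {i : GL (BlockIdx nA ⊕ BlockIdx nB) K} (hi : i ∈ iwahoriWT nA nB r)
    (g : GL (BlockIdx nA ⊕ BlockIdx nB) K) :
    lW.1 (πW (i * g) (qW FW)) = lW.1 (πW g (qW FW)) := by
  rw [map_mul, Module.End.mul_apply, smoothDual_apply_of_fixed (hFW'.fixed i hi)]

include hfW hFW hfA hfB hlW hFW' in
/-- The matrix coefficient of `π_w` on the Levi subgroup. -/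
theorem coeffW_diagEmb (hr : 1 ≤ r) {m₁ : GL (BlockIdx nA) K} {m₂ : GL (BlockIdx nB) K}
    (hm : ∀ γ : Matrix (BlockIdx nB) (BlockIdx nA) K, MatLe (rad K r) γ →
      MatLe 1 (m₂.val * γ * (m₁⁻¹).val)) :
    lW.1 (πW (diagEmb (m₁, m₂)) (qW FW)) =
      ((haarGL K _).real (iwahoriAB (K := K) nA nB r) : ℂ) *
        ((Real.sqrt (maxParabolic.modulus (m₁, m₂)))⁻¹ : ℝ) *
        (lA.1 (πA m₁ (qA fA)) * lB.1 (πB m₂ (qB fB))) := by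
  set m := diagEmb (m₁, m₂) with hmdef
  set E := twistedSet (rad K r) m₁ m₂ with hE
  have hEm : MeasurableSet E := measurableSet_twistedSet hm
  have hEsub : E ⊆ (intGL K (BlockIdx nA ⊕ BlockIdx nB) : Set _) := fun k hk => hk.1
  have hF1 := hFW.apply_one hfW hfA hfB hr
  set κ : ℂ := ((Real.sqrt (maxParabolic.modulus (m₁, m₂)) : ℝ) : ℂ) *
    (lA.1 (πA m₁ (qA fA)) * lB.1 (πB m₂ (qB fB))) with hκ
  -- On `E` the Levi part of `k` acts on both vectors and cancels in the pairing, and the unipotent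
  -- parts are absorbed, so the integrand is constant. Off `E` the function `FW` vanishes at `k *
  -- m`.
  have hval : ∀ k ∈ (intGL K (BlockIdx nA ⊕ BlockIdx nB) : Set _),
      pairing₂ πA πB (FW.1 (k * m)) (FW'.1 k) = E.indicator (fun _ => κ) k := by
    intro k hk
    by_cases hkE : k ∈ E
    · rw [Set.indicator_of_mem hkE]
      rw [hE, twistedSet_eq hm] at hkE
      obtain ⟨⟨⟨A, D⟩, B, C⟩, ⟨hA, hD, hB, hC⟩, rfl⟩ := hkE
      have hγ := matLe_one_of_twisted hm hC
      rw [toGL_upperChart]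
      simp only at hA hD hB hC hγ ⊢
      set γ := (D⁻¹).val * C with hγdef
      have e1 : upperU (B * (D⁻¹).val) * diagEmb (A, D) * lowerU γ * m =
          upperU (B * (D⁻¹).val) * (diagEmb (A * m₁, D * m₂) *
            lowerU ((m₂⁻¹).val * γ * m₁.val)) := by
        rw [mul_assoc, mul_assoc, mul_right_inj,
          show (A * m₁, D * m₂) = (A, D) * (m₁, m₂) from rfl, map_mul, mul_assoc, mul_right_inj]
        apply Units.ext
        rw [Units.val_mul, Units.val_mul, hmdef, diagEmb_val, lowerU_val, lowerU_val,
          Matrix.fromBlocks_multiply, Matrix.fromBlocks_multiply, Matrix.mul_assoc (m₂⁻¹).val,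
          gl_mul_inv_cancel_left]
        simp
      have hup : ∀ B' : Matrix (BlockIdx nA) (BlockIdx nB) K,
          upperU B' ∈ (maxParabolic (K := K)).unip := fun B' => ⟨B', rfl⟩
      have h1 : FW.1 (upperU (B * (D⁻¹).val) * diagEmb (A, D) * lowerU γ * m) =
          ((Real.sqrt (maxParabolic.modulus (A * m₁, D * m₂)) : ℝ) : ℂ) •
            (πA (A * m₁) (qA fA) ⊗ₜ[ℂ] πB (D * m₂) (qB fB)) := by
        rw [e1, inducedSpace.apply_unip_mul FW (hup _)]
        change FW.1 (maxParabolic.levi (A * m₁, D * m₂) * _) = _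
        rw [inducedSpace.apply_levi_mul, ← one_mul (lowerU _),
          hFW.apply_mul_iwahoriW hfW (lowerU_mem_iwahoriW hC), hF1]
        rfl
      have h2 : FW'.1 (upperU (B * (D⁻¹).val) * diagEmb (A, D) * lowerU γ) =
          ((Real.sqrt (maxParabolic.modulus (A, D)) : ℝ) : ℂ) •
            (contragredient πA A lA ⊗ₜ[ℂ] contragredient πB D lB) := by
        rw [mul_assoc, inducedSpace.apply_unip_mul FW' (hup _)]
        change FW'.1 (maxParabolic.levi (A, D) * _) = _
        rw [inducedSpace.apply_levi_mul, ← one_mul (lowerU _), ← map_one (maxParabolic.levi),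
          hFW'.value 1 (one_mem _) _ (lowerU_mem_iwahoriWT hγ), map_one]
        rfl
      have hAD : maxParabolic.modulus (A, D) = 1 := by
        simp [maxParabolic, (mem_intGL_iff_det.1 hA).2, (mem_intGL_iff_det.1 hD).2]
      have hmm : maxParabolic.modulus (A * m₁, D * m₂) = maxParabolic.modulus (m₁, m₂) := by
        refine maxParabolic_modulus_eq ?_ ?_ <;>
        simp [Matrix.det_mul, (mem_intGL_iff_det.1 hA).2, (mem_intGL_iff_det.1 hD).2]
      have hlA : (contragredient πA A lA).1 (πA (A * m₁) (qA fA)) = lA.1 (πA m₁ (qA fA)) := by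
        change lA.1 (πA A⁻¹ (πA (A * m₁) (qA fA))) = _
        rw [← Module.End.mul_apply, ← map_mul, inv_mul_cancel_left]
      have hlB : (contragredient πB D lB).1 (πB (D * m₂) (qB fB)) = lB.1 (πB m₂ (qB fB)) := by
        change lB.1 (πB D⁻¹ (πB (D * m₂) (qB fB))) = _
        rw [← Module.End.mul_apply, ← map_mul, inv_mul_cancel_left]
      rw [h1, h2, hAD, Real.sqrt_one, Complex.ofReal_one, one_smul, pairing₂_smul_left,
        pairing₂_tmul, hmm, hlA, hlB]
    · rw [Set.indicator_of_notMem hkE]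
      by_contra hne
      have hF : FW.1 (k * m) ≠ 0 := fun h0 => hne (by rw [h0, pairing₂_zero_left])
      obtain ⟨D, hD, hc⟩ := hFW.exists_of_ne_zero hfW hr hF
      have hkm : (k * m).val = Matrix.fromBlocks (k.val.toBlocks₁₁ * m₁.val)
          (k.val.toBlocks₁₂ * m₂.val) (k.val.toBlocks₂₁ * m₁.val) (k.val.toBlocks₂₂ * m₂.val) := by
        rw [Units.val_mul, hmdef, diagEmb_val]
        conv_lhs => rw [gl_eq_of_fromBlocks (g := k)]
        rw [Matrix.fromBlocks_multiply]
        simp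
      rw [hkm, Matrix.toBlocks_fromBlocks₂₂] at hD
      rw [hkm, Matrix.toBlocks_fromBlocks₂₁] at hc
      refine hkE ⟨hk, D * m₂⁻¹, ?_, ?_⟩
      · rw [Units.val_mul, hD, gl_mul_inv_cancel_right]
      · have : (D * m₂⁻¹)⁻¹ = m₂ * D⁻¹ := by group
        rw [this, Units.val_mul, Matrix.mul_assoc m₂.val, gl_inv_mul_cancel_left,
          Matrix.mul_assoc]
        exact hc
  have h1 : lW.1 (πW m (qW FW)) = ∫ k in (intGL K (BlockIdx nA ⊕ BlockIdx nB) : Set _),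
      pairing₂ πA πB (FW.1 (k * m)) (FW'.1 k) ∂(haarGL K _) := by
    rw [← intertwining_apply]
    exact hlW _
  rw [h1, setIntegral_congr_fun measurableSet_intGL hval, setIntegral_indicator hEm,
    Set.inter_eq_self_of_subset_right hEsub, setIntegral_const, Measure.real, hE,
    haarGL_twistedSet (rad_le_one K r) hm, twistedSet_one_eq_iwahoriAB hr, hκ, ENNReal.toReal_mul,
    ENNReal.toReal_ofReal (by positivity)]
  have hmod : ‖m₂.val.det‖ ^ Fintype.card (BlockIdx nA) *
      (‖m₁.val.det‖ ^ Fintype.card (BlockIdx nB))⁻¹ = (maxParabolic.modulus (m₁, m₂))⁻¹ := by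
    simp only [maxParabolic, zpow_natCast, zpow_neg, mul_inv, inv_inv]
    ring
  have hpos := maxParabolic_modulus_pos (m₁, m₂)
  rw [hmod, Complex.real_smul]
  have hsq : Real.sqrt (maxParabolic.modulus (m₁, m₂)) * Real.sqrt (maxParabolic.modulus (m₁, m₂)) =
      maxParabolic.modulus (m₁, m₂) := Real.mul_self_sqrt hpos.le
  have hs0 := (Real.sqrt_pos.2 hpos).ne'
  -- The volume of `E` contributes the inverse modulus and normalized induction its square root.
  have hinv : (maxParabolic.modulus (m₁, m₂))⁻¹ * Real.sqrt (maxParabolic.modulus (m₁, m₂)) =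
      (Real.sqrt (maxParabolic.modulus (m₁, m₂)))⁻¹ := by
    rw [← hsq, mul_inv, mul_assoc, Real.sqrt_mul_self (Real.sqrt_nonneg _), inv_mul_cancel₀ hs0,
      mul_one]
  rw [← hinv, Measure.real]
  push_cast
  ring

end Coefficient

end LocalZeta
end

noncomputable section
namespace LocalZeta

/-! ### Averaging over compact subgroups. -/

section Average

variable {G : Type*} [Group G] [TopologicalSpace G] [IsTopologicalGroup G]
  {V : Type*} [AddCommGroup V] [Module ℂ V] {ρ : Representation ℂ G V}

/-- Averaging a smooth vector over a compact subgroup. -/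
theorem exists_average (hρ : IsSmooth ρ) (H : Subgroup G) (hH : IsCompact (H : Set G)) (w : V) :
    ∃ y : V, (∀ k ∈ H, ρ k y = y) ∧
      ∀ (φ : V →ₗ[ℂ] ℂ) (z : ℂ), (∀ k ∈ H, φ (ρ k w) = z) → φ y = z := by
  classical
  obtain ⟨U, hU⟩ := hρ w
  -- Smoothness makes the orbit of `w` finite, so the average is a finite sum over the orbit and no
  -- measure is needed.
  have hfin : ((fun g => ρ g w) '' (H : Set G)).Finite :=
    finite_image_of_right_invariant hH _ U fun u hu g => by
      rw [map_mul, Module.End.mul_apply, hU u hu]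
  set O := hfin.toFinset with hO
  have hmem : ∀ v, v ∈ O ↔ ∃ k ∈ H, ρ k w = v := fun v => by simp [hO]
  have hne : O.Nonempty := ⟨w, (hmem w).2 ⟨1, one_mem _, by simp⟩⟩
  have hcard : (O.card : ℂ) ≠ 0 := Nat.cast_ne_zero.2 hne.card_pos.ne'
  refine ⟨(O.card : ℂ)⁻¹ • ∑ v ∈ O, v, fun k hk => ?_, fun φ z h => ?_⟩
  · rw [map_smul, map_sum]
    congr 1
    refine Finset.sum_bij (fun v _ => ρ k v) (fun v hv => ?_) (fun v _ v' _ h => ?_)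
      (fun v hv => ?_) fun v _ => rfl
    · obtain ⟨k', hk', rfl⟩ := (hmem v).1 hv
      exact (hmem _).2 ⟨k * k', mul_mem hk hk', by rw [map_mul]; rfl⟩
    · have := congrArg (ρ k⁻¹) h
      simpa [← Module.End.mul_apply, ← map_mul] using this
    · obtain ⟨k', hk', rfl⟩ := (hmem v).1 hv
      refine ⟨ρ (k⁻¹ * k') w, (hmem _).2 ⟨_, mul_mem (inv_mem hk) hk', rfl⟩, ?_⟩
      rw [← Module.End.mul_apply, ← map_mul, mul_inv_cancel_left]
  · rw [map_smul, map_sum, Finset.sum_congr rfl (g := fun _ => z), Finset.sum_const, nsmul_eq_mul,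
      smul_eq_mul, inv_mul_cancel_left₀ hcard]
    intro v hv
    obtain ⟨k, hk, rfl⟩ := (hmem v).1 hv
    exact h k hk

end Average

/-! ### Exponential bounds for matrix coefficients along the torus. -/

section Torus

variable {K : Type*} [NontriviallyNormedField K] [IsNormalizedLocalField K]
variable {ι : Type*} [Fintype ι] [DecidableEq ι] {ϖ : Kˣ} {c : ℝ}

/-- Conjugation multiplies the entry (i, j) by ϖ^(m i - m j), a nonnegative power wherever the entry
differs from that of the identity. -/
theorem conj_diagPow_mem (h1 : ‖(ϖ : K)‖ < 1) (hc0 : 0 ≤ c) (hc : c < 1) {k : GL ι K}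
    (hk : MatLe c (k.val - 1)) {m : ι → ℤ}
    (hm : ∀ i j, k.val i j ≠ (1 : Matrix ι ι K) i j → m j ≤ m i) :
    diagPow ϖ m * k * (diagPow ϖ m)⁻¹ ∈ congrGL K ι hc0 := by
  refine mem_congrGL_of_lt hc0 hc fun i j => ?_
  have e : (diagPow ϖ m * k * (diagPow ϖ m)⁻¹).val - 1 =
      (diagPow ϖ m).val * (k.val - 1) * ((diagPow ϖ m)⁻¹).val := by
    rw [mul_sub, sub_mul, mul_one, ← Units.val_mul, ← Units.val_mul, ← Units.val_mul]; simp
  rw [e, diagPow_val, diagPow_inv_val, Matrix.mul_diagonal, Matrix.diagonal_mul]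
  by_cases h : k.val i j = (1 : Matrix ι ι K) i j
  · rw [Matrix.sub_apply, h, sub_self, mul_zero, zero_mul, norm_zero]
    exact hc0
  · have h2 : ‖(ϖ : K)‖ ^ (m i - m j) ≤ 1 := by
      obtain ⟨k, hk⟩ := Int.eq_ofNat_of_zero_le (sub_nonneg.2 (hm i j h))
      rw [hk, zpow_natCast]
      exact pow_le_one₀ (norm_nonneg _) h1.le
    have h3 : ‖(ϖ : K) ^ m i * (k.val - 1) i j * (ϖ : K) ^ (-m j)‖ =
        ‖(ϖ : K)‖ ^ (m i - m j) * ‖(k.val - 1) i j‖ := by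
      rw [norm_mul, norm_mul, norm_zpow, norm_zpow, show m i - m j = m i + -m j from
        sub_eq_add_neg _ _, zpow_add₀ (norm_pos_iff.2 ϖ.ne_zero).ne']
      ring
    rw [h3]
    calc _ ≤ 1 * c := mul_le_mul h2 (hk i j) (norm_nonneg _) zero_le_one
      _ = c := one_mul c

/-- Factor `k` as L D U for the ordering by `b`. The torus element of `m` contracts L to the left,
that of `ε` contracts U to the right, and D commutes with the latter because `ε` is constant on
blocks. -/
theorem diagPow_mul_congr_mul (h1 : ‖(ϖ : K)‖ < 1) (hc0 : 0 ≤ c) (hc : c < 1) {k : GL ι K}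
    (hk : k ∈ congrGL K ι hc0) {b m ε : ι → ℤ} (hm : ∀ i j, b i < b j → m i ≤ m j)
    (hε : ∀ i j, b i < b j → ε i ≤ ε j) (hε' : ∀ i j, b i = b j → ε i = ε j) :
    ∃ k₁ ∈ congrGL K ι hc0, ∃ k₂ ∈ congrGL K ι hc0,
      diagPow ϖ m * k * diagPow ϖ ε = k₁ * diagPow ϖ (m + ε) * k₂ := by
  obtain ⟨L, D, U, hkv, hL, hD, hU, hL1, hD1, hU1⟩ := exists_ldu hc0 hc _ rfl b k.val hk.2
  obtain ⟨L, rfl, hLi⟩ := exists_gl_of_sub_one hc0 hc hL1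
  obtain ⟨D, rfl, hDi⟩ := exists_gl_of_sub_one hc0 hc hD1
  obtain ⟨U, rfl, hUi⟩ := exists_gl_of_sub_one hc0 hc hU1
  have hk' : k = L * D * U := Units.ext hkv
  have hLm : diagPow ϖ m * L * (diagPow ϖ m)⁻¹ ∈ congrGL K ι hc0 :=
    conj_diagPow_mem h1 hc0 hc hL1 fun i j h => by
      by_contra h'
      exact h (hL i j fun hb => h' (hm j i hb))
  have hneg : diagPow ϖ (-ε) = (diagPow ϖ ε : GL ι K)⁻¹ := by
    apply Units.ext
    rw [diagPow_val, diagPow_inv_val]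
    rfl
  have hUm : diagPow ϖ (-ε) * U * (diagPow ϖ (-ε))⁻¹ ∈ congrGL K ι hc0 :=
    conj_diagPow_mem h1 hc0 hc hU1 fun i j h => by
      by_contra h'
      exact h (hU i j fun hb => h' (neg_le_neg (hε i j hb)))
  have hcomm : D * diagPow ϖ ε = diagPow ϖ ε * D := by
    apply Units.ext
    refine Matrix.ext fun i j => ?_
    rw [Units.val_mul, Units.val_mul, diagPow_val, Matrix.mul_diagonal, Matrix.diagonal_mul]
    by_cases hb : b i = b j
    · rw [hε' i j hb, mul_comm]
    · rw [hD i j hb, zero_mul, mul_zero]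
  refine ⟨_, hLm, D * (diagPow ϖ (-ε) * U * (diagPow ϖ (-ε))⁻¹),
    mul_mem ⟨hDi, hD1⟩ hUm, ?_⟩
  rw [hk', diagPow_add, hneg]
  calc diagPow ϖ m * (L * D * U) * diagPow ϖ ε =
      diagPow ϖ m * L * (D * diagPow ϖ ε) * ((diagPow ϖ ε)⁻¹ * U * diagPow ϖ ε) := by group
    _ = _ := by rw [hcomm]; group

variable {V : Type*} [AddCommGroup V] [Module ℂ V] {ρ : Representation ℂ (GL ι K) V}

/-- Induction on the size of the exponent. The fixed vectors of the congruence subgroup have a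
finite basis `x`. Peeling a vector of signs `ε` off `μ` replaces a basis vector by the average of
its translate under the torus element of `ε`, again a fixed vector. Finitely many such averages
occur, so their coordinates are bounded by `T` and each step costs at most the factor 1 + T. -/
theorem norm_coeff_diagPow_le (hρ : IsAdmissible ρ) (h1 : ‖(ϖ : K)‖ < 1) (hc0 : 0 < c)
    (hc : c < 1) (l : V →ₗ[ℂ] ℂ) (hl : ∀ k ∈ congrGL K ι hc0.le, ∀ x, l (ρ k x) = l x) {v : V}
    (hv : ∀ k ∈ congrGL K ι hc0.le, ρ k v = v) :
    ∃ C M : ℝ, 0 ≤ C ∧ 1 ≤ M ∧ ∀ (m : ℕ) (μ : ι → ℤ), (∀ i, |μ i| ≤ m) →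
      ‖l (ρ (diagPow ϖ μ) v)‖ ≤ C * M ^ m := by
  classical
  let V' := Representation.invariants (ρ.comp (openCongrGL K ι hc0 : Subgroup (GL ι K)).subtype)
  have hV' : ∀ x : V, x ∈ V' ↔ ∀ k ∈ congrGL K ι hc0.le, ρ k x = x := fun x =>
    ⟨fun h k hk => h ⟨k, hk⟩, fun h k => h k.1 k.2⟩
  have hfd : FiniteDimensional ℂ V' := hρ.2 (openCongrGL K ι hc0)
  let x := Module.finBasis ℂ V'
  choose y hy hyφ using fun (ε : ι → SignType) (i : Fin (Module.finrank ℂ V')) =>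
    exists_average hρ.1 (congrGL K ι hc0.le) (isCompact_congrGL hc0)
      (ρ (diagPow ϖ fun i => (ε i : ℤ)) (x i).1)
  let y' : (ι → SignType) → Fin (Module.finrank ℂ V') → V' := fun ε i =>
    ⟨y ε i, (hV' _).2 (hy ε i)⟩
  set T : ℝ := ∑ p : (ι → SignType) × Fin (Module.finrank ℂ V'), ∑ j, ‖x.repr (y' p.1 p.2) j‖
    with hT
  have hT0 : 0 ≤ T := Finset.sum_nonneg fun _ _ => Finset.sum_nonneg fun _ _ => norm_nonneg _
  set A : ℝ := ∑ i, ‖l (x i).1‖ with hA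
  have hA0 : 0 ≤ A := Finset.sum_nonneg fun _ _ => norm_nonneg _
  have key : ∀ (m : ℕ) (μ : ι → ℤ), (∀ i, |μ i| ≤ m) → ∀ i,
      ‖l (ρ (diagPow ϖ μ) (x i).1)‖ ≤ A * (1 + T) ^ m := by
    intro m
    induction m with
    | zero =>
      intro μ hμ i
      have h0 : diagPow ϖ μ = (1 : GL ι K) := by
        apply Units.ext
        rw [diagPow_val, Units.val_one, ← Matrix.diagonal_one]
        congr 1
        funext i
        have : μ i = 0 := by simpa using hμ i
        rw [this, zpow_zero]
      rw [h0, map_one, pow_zero, mul_one, Module.End.one_apply]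
      exact Finset.single_le_sum (f := fun i => ‖l (x i).1‖) (fun _ _ => norm_nonneg _)
        (Finset.mem_univ i)
    | succ m ih =>
      intro μ hμ i
      -- Subtracting the signs lowers every nonzero |μ i| by one, and both `ε` and `μ - ε` stay
      -- monotone for the order given by `μ`, as `diagPow_mul_congr_mul` demands.
      let ε : ι → SignType := fun i => SignType.sign (μ i)
      let μ' : ι → ℤ := fun i => μ i - (ε i : ℤ)
      have hsign : ∀ z : ℤ, (z < 0 ∧ (SignType.sign z : ℤ) = -1) ∨
          (z = 0 ∧ (SignType.sign z : ℤ) = 0) ∨ (0 < z ∧ (SignType.sign z : ℤ) = 1) := by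
        intro z
        rcases lt_trichotomy z 0 with h | h | h
        · exact Or.inl ⟨h, by simp [sign_neg h]⟩
        · exact Or.inr (Or.inl ⟨h, by simp [h]⟩)
        · exact Or.inr (Or.inr ⟨h, by simp [sign_pos h]⟩)
      have hμ' : ∀ i, |μ' i| ≤ m := by
        intro i
        have h2 := abs_le.1 (hμ i)
        push_cast at h2
        rw [abs_le]
        rcases hsign (μ i) with h | h | h <;> constructor <;> simp only [μ', ε, h.2] <;> omega
      have hmono : ∀ i j, μ i < μ j → μ' i ≤ μ' j := by
        intro i j h
        rcases hsign (μ i) with h' | h' | h' <;> rcases hsign (μ j) with h'' | h'' | h'' <;>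
        simp only [μ', ε, h'.2, h''.2] <;> omega
      have hmono' : ∀ i j, μ i < μ j → (ε i : ℤ) ≤ (ε j : ℤ) := by
        intro i j h
        rcases hsign (μ i) with h' | h' | h' <;> rcases hsign (μ j) with h'' | h'' | h'' <;>
        simp only [ε, h'.2, h''.2] <;> omega
      have hsum : (μ' + fun i => (ε i : ℤ)) = μ := by
        funext i
        simp [μ']
      -- Every translate entering the average gives the same value: the congruence factors produced
      -- on the left and right are absorbed by `l` and by the basis vector.
      have e1 : (l ∘ₗ ρ (diagPow ϖ μ')) (y ε i) = l (ρ (diagPow ϖ μ) (x i).1) := by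
        refine hyφ ε i _ _ fun k hk => ?_
        obtain ⟨k₁, hk₁, k₂, hk₂, e⟩ := diagPow_mul_congr_mul h1 hc0.le hc hk hmono hmono'
          (fun i j h => by simp only [ε, h])
        rw [LinearMap.comp_apply, ← Module.End.mul_apply, ← Module.End.mul_apply, ← map_mul,
          ← map_mul, e, hsum, map_mul, map_mul, Module.End.mul_apply,
          Module.End.mul_apply, hl _ hk₁, (hV' _).1 (x i).2 _ hk₂]
      have e2 : y ε i = ∑ j, x.repr (y' ε i) j • (x j).1 := by
        have := congrArg (fun z : V' => z.1) (x.sum_repr (y' ε i))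
        simp only [Submodule.coe_sum, Submodule.coe_smul] at this
        exact this.symm
      rw [← e1, e2, map_sum]
      refine (norm_sum_le _ _).trans ?_
      have h3 : ∀ j, ‖(l ∘ₗ ρ (diagPow ϖ μ')) (x.repr (y' ε i) j • (x j).1)‖ ≤
          ‖x.repr (y' ε i) j‖ * (A * (1 + T) ^ m) := by
        intro j
        rw [map_smul, norm_smul]
        exact mul_le_mul_of_nonneg_left (ih μ' hμ' j) (norm_nonneg _)
      refine (Finset.sum_le_sum fun j _ => h3 j).trans ?_
      rw [← Finset.sum_mul]
      have h4 : ∑ j, ‖x.repr (y' ε i) j‖ ≤ 1 + T := by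
        have := Finset.single_le_sum
          (f := fun p : (ι → SignType) × Fin (Module.finrank ℂ V') =>
            ∑ j, ‖x.repr (y' p.1 p.2) j‖)
          (fun _ _ => Finset.sum_nonneg fun _ _ => norm_nonneg _) (Finset.mem_univ (ε, i))
        linarith
      calc _ ≤ (1 + T) * (A * (1 + T) ^ m) :=
            mul_le_mul_of_nonneg_right h4 (by positivity)
        _ = A * (1 + T) ^ (m + 1) := by ring
  let v' : V' := ⟨v, (hV' v).2 hv⟩
  refine ⟨∑ j, ‖x.repr v' j‖ * A, 1 + T, by positivity, by linarith, fun m μ hμ => ?_⟩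
  have e2 : v = ∑ j, x.repr v' j • (x j).1 := by
    have := congrArg (fun z : V' => z.1) (x.sum_repr v')
    simp only [Submodule.coe_sum, Submodule.coe_smul] at this
    exact this.symm
  have e3 : l (ρ (diagPow ϖ μ) v) = ∑ j, x.repr v' j * l (ρ (diagPow ϖ μ) (x j).1) := by
    conv_lhs => rw [e2]
    simp only [map_sum, map_smul, smul_eq_mul]
  rw [e3, Finset.sum_mul]
  refine (norm_sum_le _ _).trans (Finset.sum_le_sum fun j _ => ?_)
  rw [norm_mul, mul_assoc]
  exact mul_le_mul_of_nonneg_left (key m μ hμ j) (norm_nonneg _)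

end Torus

end LocalZeta
end

noncomputable section
namespace LocalZeta

/-! ### Functions of moderate growth. -/

section Growth

variable {X Y I : Type*} {E : Type*} [NormedAddCommGroup E]

/-- `f` is bounded by `C * R ^ N` at all points of size at most `R`. -/
def HasGrowth (P : X → ℝ → Prop) (f : X → E) : Prop :=
  ∃ (C : ℝ) (N : ℕ), 0 ≤ C ∧ ∀ x R, 1 ≤ R → P x R → ‖f x‖ ≤ C * R ^ N

variable {P : X → ℝ → Prop}

theorem HasGrowth.const (z : E) : HasGrowth P fun _ => z :=
  ⟨‖z‖, 0, norm_nonneg _, fun x R _ _ => by simp⟩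

theorem HasGrowth.of_le {E' : Type*} [NormedAddCommGroup E'] {f : X → E} {f' : X → E'}
    (h : HasGrowth P f') (hf : ∀ x R, 1 ≤ R → P x R → ‖f x‖ ≤ ‖f' x‖) : HasGrowth P f := by
  obtain ⟨C, N, hC, h⟩ := h
  exact ⟨C, N, hC, fun x R hR hx => (hf x R hR hx).trans (h x R hR hx)⟩

theorem HasGrowth.comp {Q : Y → ℝ → Prop} {f : X → E} (h : HasGrowth P f) {φ : Y → X}
    (hφ : ∀ y R, 1 ≤ R → Q y R → P (φ y) R) : HasGrowth Q fun y => f (φ y) := by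
  obtain ⟨C, N, hC, h⟩ := h
  exact ⟨C, N, hC, fun y R hR hy => h _ R hR (hφ y R hR hy)⟩

theorem HasGrowth.mul {f g : X → ℂ} (hf : HasGrowth P f) (hg : HasGrowth P g) :
    HasGrowth P fun x => f x * g x := by
  obtain ⟨C, N, hC, hf⟩ := hf
  obtain ⟨C', N', hC', hg⟩ := hg
  refine ⟨C * C', N + N', mul_nonneg hC hC', fun x R hR hx => ?_⟩
  rw [norm_mul]
  calc _ ≤ (C * R ^ N) * (C' * R ^ N') :=
        mul_le_mul (hf x R hR hx) (hg x R hR hx) (norm_nonneg _) (by positivity)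
    _ = _ := by ring

theorem HasGrowth.add {f g : X → E} (hf : HasGrowth P f) (hg : HasGrowth P g) :
    HasGrowth P fun x => f x + g x := by
  obtain ⟨C, N, hC, hf⟩ := hf
  obtain ⟨C', N', hC', hg⟩ := hg
  refine ⟨C + C', N + N', add_nonneg hC hC', fun x R hR hx => (norm_add_le _ _).trans ?_⟩
  have h1 : R ^ N ≤ R ^ (N + N') := pow_le_pow_right₀ hR (by omega)
  have h2 : R ^ N' ≤ R ^ (N + N') := pow_le_pow_right₀ hR (by omega)
  calc _ ≤ C * R ^ N + C' * R ^ N' := add_le_add (hf x R hR hx) (hg x R hR hx)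
    _ ≤ C * R ^ (N + N') + C' * R ^ (N + N') := by gcongr
    _ = _ := by ring

theorem HasGrowth.prod {S : Finset I} {f : I → X → ℂ} (h : ∀ i ∈ S, HasGrowth P (f i)) :
    HasGrowth P fun x => ∏ i ∈ S, f i x := by
  classical
  induction S using Finset.induction_on with
  | empty => simpa using HasGrowth.const (P := P) (1 : ℂ)
  | insert i S hi ih =>
    simp only [Finset.prod_insert hi]
    exact (h i (Finset.mem_insert_self _ _)).mul
      (ih fun j hj => h j (Finset.mem_insert_of_mem hj))

theorem HasGrowth.uniform {S : Set I} (hS : S.Finite) {f : I → X → E}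
    (h : ∀ i ∈ S, HasGrowth P (f i)) :
    HasGrowth (fun (p : I × X) R => p.1 ∈ S ∧ P p.2 R) fun p => f p.1 p.2 := by
  induction S, hS using Set.Finite.induction_on with
  | empty => exact ⟨0, 0, le_rfl, fun x R _ hx => hx.1.elim⟩
  | @insert i S hi hS ih =>
    obtain ⟨C, N, hC, h1⟩ := ih fun j hj => h j (Set.mem_insert_of_mem _ hj)
    obtain ⟨C', N', hC', h2⟩ := h i (Set.mem_insert _ _)
    refine ⟨C + C', N + N', add_nonneg hC hC', ?_⟩
    rintro ⟨j, x⟩ R hR ⟨hj, hx⟩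
    have h3 : R ^ N ≤ R ^ (N + N') := pow_le_pow_right₀ hR (by omega)
    have h4 : R ^ N' ≤ R ^ (N + N') := pow_le_pow_right₀ hR (by omega)
    have h0 : (0 : ℝ) ≤ R ^ (N + N') := by positivity
    rcases hj with rfl | hj
    · exact (h2 x R hR hx).trans (by nlinarith [mul_le_mul_of_nonneg_left h4 hC', mul_nonneg hC h0])
    · exact (h1 (j, x) R hR ⟨hj, hx⟩).trans
        (by nlinarith [mul_le_mul_of_nonneg_left h3 hC, mul_nonneg hC' h0])

end Growth

/-! ### Moderate growth of coefficients of admissible representations. -/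

section Coefficients

variable {K : Type*} [NontriviallyNormedField K] [IsNormalizedLocalField K]
variable {ι : Type*} [Fintype ι] [DecidableEq ι]

/-- The entries of `g` and of its inverse are bounded by `R`. -/
def GLSize (g : GL ι K) (R : ℝ) : Prop := MatLe R g.val ∧ MatLe R (g⁻¹).val

theorem GLSize.intGL_mul {g k : GL ι K} {R : ℝ} (hR : 0 ≤ R) (h : GLSize g R)
    (hk : k ∈ intGL K ι) : GLSize (k * g) R := by
  obtain ⟨h1, h2⟩ := mem_intGL_iff.1 hk
  refine ⟨?_, ?_⟩
  · rw [Units.val_mul]; exact h1.mul_left hR h.1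
  · rw [mul_inv_rev, Units.val_mul]; exact h.2.mul_right hR h2

theorem GLSize.mul_intGL {g k : GL ι K} {R : ℝ} (hR : 0 ≤ R) (h : GLSize g R)
    (hk : k ∈ intGL K ι) : GLSize (g * k) R := by
  obtain ⟨h1, h2⟩ := mem_intGL_iff.1 hk
  refine ⟨?_, ?_⟩
  · rw [Units.val_mul]; exact h.1.mul_right hR h1
  · rw [mul_inv_rev, Units.val_mul]; exact h2.mul_left hR h.2

theorem pow_le_of_GLSize_diagPow {ϖ : Kˣ} {μ : ι → ℤ} {R : ℝ} (hR : 1 ≤ R)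
    (h : GLSize (diagPow ϖ μ) R) :
    (‖(ϖ : K)‖⁻¹) ^ (Finset.univ.sup fun i => (μ i).natAbs) ≤ R := by
  rcases isEmpty_or_nonempty ι with hι | hι
  · simpa using hR
  obtain ⟨i, -, hi⟩ := Finset.exists_mem_eq_sup Finset.univ Finset.univ_nonempty
    fun i => (μ i).natAbs
  rw [hi]
  have h1 := h.1 i i
  have h2 := h.2 i i
  rw [diagPow_val, Matrix.diagonal_apply_eq, norm_zpow] at h1
  rw [diagPow_inv_val, Matrix.diagonal_apply_eq, norm_zpow] at h2
  rcases Int.natAbs_eq (μ i) with e | e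
  · rw [e, zpow_neg, zpow_natCast] at h2
    rwa [inv_pow]
  · rw [e, zpow_neg, zpow_natCast] at h1
    rwa [inv_pow]

variable {V : Type*} [AddCommGroup V] [Module ℂ V] {ρ : Representation ℂ (GL ι K) V}

/-- Matrix coefficients of admissible representations have moderate growth. -/
theorem hasGrowth_coeff (hρ : IsAdmissible ρ) (l : V →ₗ[ℂ] ℂ)
    (hl : ∃ U : OpenSubgroup (GL ι K), ∀ u ∈ U, ∀ x, l (ρ u x) = l x) (v : V) :
    HasGrowth GLSize fun g : GL ι K => l (ρ g v) := by
  obtain ⟨U, hU⟩ := hρ.1 v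
  obtain ⟨U', hU'⟩ := hl
  obtain ⟨c, hc0, hc1, hcU⟩ := exists_congrGL_le (U ⊓ U')
  obtain ⟨ϖ₀, -, h0, h1, hmax⟩ := exists_uniformizer K
  obtain ⟨ϖ, rfl⟩ : ∃ ϖ : Kˣ, (ϖ : K) = ϖ₀ := ⟨Units.mk0 ϖ₀ (norm_pos_iff.1 h0), rfl⟩
  -- The two integral factors of the Cartan decomposition move `l` and `v` through finite sets only,
  -- so bounds on the torus can be made uniform in them.
  have hS₁ : ((fun g => l ∘ₗ ρ g⁻¹) '' (intGL K ι : Set (GL ι K))).Finite :=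
    finite_image_of_right_invariant isCompact_intGL _ U' fun u hu g => by
      refine LinearMap.ext fun x => ?_
      rw [mul_inv_rev, map_mul]
      exact hU' _ (inv_mem hu) _
  have hS₂ : ((fun g => ρ g v) '' (intGL K ι : Set (GL ι K))).Finite :=
    finite_image_of_right_invariant isCompact_intGL _ U fun u hu g => by
      rw [map_mul, Module.End.mul_apply, hU u hu]
  have key := HasGrowth.uniform (hS₁.prod hS₂)
    (f := fun (p : (V →ₗ[ℂ] ℂ) × V) (g : (Set.range (diagPow (ι := ι) ϖ))) => p.1 (ρ g.1 p.2))
    (P := fun g R => GLSize g.1 R) (by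
      rintro ⟨l', v'⟩ ⟨⟨k₁, hk₁, rfl⟩, ⟨k₂, hk₂, rfl⟩⟩
      obtain ⟨C, M, hC, hM, h⟩ := norm_coeff_diagPow_le hρ h1 hc0 hc1 (l ∘ₗ ρ k₁⁻¹)
        (fun k hk x => by
          have e : k₁⁻¹ * k = (k₁⁻¹ * k * k₁⁻¹⁻¹) * k₁⁻¹ := by group
          rw [LinearMap.comp_apply, ← Module.End.mul_apply, ← map_mul, e, map_mul,
            Module.End.mul_apply, hU' _ (hcU (conj_mem_congrGL hc0.le hk (inv_mem hk₁))).2]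
          rfl) (v := ρ k₂ v) (fun k hk => by
          have e : k * k₂ = k₂ * (k₂⁻¹ * k * k₂⁻¹⁻¹) := by group
          rw [← Module.End.mul_apply, ← map_mul, e, map_mul,
            Module.End.mul_apply, hU _ (hcU (conj_mem_congrGL hc0.le hk (inv_mem hk₂))).1])
      -- Since ‖ϖ‖⁻¹ to the largest exponent is at most R, comparing `M` with a power of ‖ϖ‖⁻¹ turns
      -- the exponential bound into a power of R.
      obtain ⟨N, hN⟩ := pow_unbounded_of_one_lt M ((one_lt_inv₀ h0).2 h1)
      refine ⟨C, N, hC, ?_⟩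
      rintro ⟨_, μ, rfl⟩ R hR hg
      refine (h (Finset.univ.sup fun i => (μ i).natAbs) μ fun i => ?_).trans
        (mul_le_mul_of_nonneg_left ?_ hC)
      · rw [← Int.natCast_natAbs]
        exact_mod_cast Finset.le_sup (f := fun i => (μ i).natAbs) (Finset.mem_univ i)
      · calc M ^ (Finset.univ.sup fun i => (μ i).natAbs)
            ≤ ((‖(ϖ : K)‖⁻¹) ^ N) ^ (Finset.univ.sup fun i => (μ i).natAbs) :=
              pow_le_pow_left₀ (by linarith) hN.le _
          _ = ((‖(ϖ : K)‖⁻¹) ^ (Finset.univ.sup fun i => (μ i).natAbs)) ^ N := by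
              rw [← pow_mul, ← pow_mul, mul_comm]
          _ ≤ R ^ N := pow_le_pow_left₀ (by positivity) (pow_le_of_GLSize_diagPow hR hg) _)
  obtain ⟨C, N, hC, key⟩ := key
  refine ⟨C, N, hC, fun g R hR hg => ?_⟩
  obtain ⟨k₁, hk₁, k₂, hk₂, μ, rfl⟩ := exists_cartan h1 hmax g
  have hR0 : 0 ≤ R := by linarith
  have hsize : GLSize (diagPow ϖ μ) R := by
    have := (hg.intGL_mul hR0 (inv_mem hk₁)).mul_intGL hR0 (inv_mem hk₂)
    have e : k₁⁻¹ * (k₁ * diagPow ϖ μ * k₂) * k₂⁻¹ = diagPow ϖ μ := by group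
    rwa [e] at this
  have := key ((l ∘ₗ ρ k₁⁻¹⁻¹, ρ k₂ v), ⟨_, μ, rfl⟩) R hR
    ⟨⟨⟨k₁⁻¹, inv_mem hk₁, rfl⟩, ⟨k₂, hk₂, rfl⟩⟩, hsize⟩
  change ‖l (ρ (k₁ * diagPow ϖ μ * k₂) v)‖ ≤ _
  rw [map_mul, map_mul, Module.End.mul_apply, Module.End.mul_apply]
  rwa [inv_inv] at this

/-- The one-dimensional representation `χ ∘ det`. -/
def detRep (χ : MulChar K ℂ) (ι : Type*) [Fintype ι] [DecidableEq ι] :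
    Representation ℂ (GL ι K) ℂ where
  toFun g := χ g.val.det • LinearMap.id
  map_one' := by ext; simp
  map_mul' g h := by ext; simp [mul_comm]

theorem mulChar_det_eq_one {χ : MulChar K ℂ} {c : ℕ} (hχ : IsTrivialOnUnits K χ c) {g : GL ι K}
    (hg : g ∈ congrGL K ι (rad_pos K c).le) : χ g.val.det = 1 := by
  have := mulChar_det_add hχ (one_mem (intGL K ι)) hg.2
  rw [Units.val_one, add_sub_cancel, Matrix.det_one, map_one] at this
  exact this

theorem isAdmissible_detRep {χ : MulChar K ℂ} {c : ℕ} (hχ : IsTrivialOnUnits K χ c) :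
    IsAdmissible (detRep χ ι) := by
  refine ⟨fun v => ⟨openCongrGL K ι (rad_pos K c), fun u hu => ?_⟩, fun U => inferInstance⟩
  change χ u.val.det • v = v
  rw [mulChar_det_eq_one hχ hu, one_smul]

/-- χ ∘ det is the coefficient of a one-dimensional admissible representation, so the general bound
covers characters that are not unitary. -/
theorem hasGrowth_mulChar_det {χ : MulChar K ℂ} {c : ℕ} (hχ : IsTrivialOnUnits K χ c) :
    HasGrowth GLSize fun g : GL ι K => χ g.val.det := by
  refine (hasGrowth_coeff (isAdmissible_detRep hχ) LinearMap.id
    ⟨openCongrGL K ι (rad_pos K c), fun u hu x => ?_⟩ 1).of_le fun g R _ _ => ?_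
  · change χ u.val.det • x = x
    rw [mulChar_det_eq_one hχ hu, one_smul]
  · change _ ≤ ‖χ g.val.det • (1 : ℂ)‖
    rw [smul_eq_mul, mul_one]

end Coefficients

end LocalZeta
end

noncomputable section
namespace LocalZeta

/-! ### Finiteness of the volume of GL_d(𝒪). -/

section Volume

variable {K : Type*} [NontriviallyNormedField K] [IsNormalizedLocalField K]
  [MeasurableSpace K] [BorelSpace K] {ι : Type*} [Fintype ι] [DecidableEq ι]

theorem haarGL_eq_haarMatrix {s : Set (GL ι K)} (hs : MeasurableSet s)
    (h : ∀ g ∈ s, ‖g.val.det‖ = 1) : haarGL K ι s = haarMatrix K ι ι (Units.val '' s) := by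
  rw [haarGL_apply s hs, ← setLIntegral_one]
  refine setLIntegral_congr_fun (measurableEmbedding_val.measurableSet_image.2 hs) ?_
  rintro _ ⟨g, hg, rfl⟩
  simp [glDensity, h g hg]

theorem haarGL_intGL_lt_top : haarGL K ι (intGL K ι : Set (GL ι K)) < ⊤ := by
  rw [haarGL_eq_haarMatrix measurableSet_intGL fun g hg => (mem_intGL_iff_det.1 hg).2]
  refine lt_of_le_of_lt (measure_mono ?_) ((haarMatrix_matLe_one (K := K) (ι := ι) (κ := ι)).trans_lt
    ENNReal.one_lt_top)
  rintro _ ⟨g, hg, rfl⟩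
  exact (mem_intGL_iff_det.1 hg).1

end Volume

/-! ### From the Levi factors to induced representations: growth. -/

section Levi

variable {K : Type*} [NontriviallyNormedField K] [IsNormalizedLocalField K]
variable {t : ℕ} {n : Fin t → ℕ} {R : Fin t → Fin t → Prop}
variable {α : Type*} [LinearOrder α] {f : Fin t → α}

theorem unip_blockTriangular (hR : ∀ i j, R i j ↔ f i < f j) {u : GL (BlockIdx n) K}
    (hu : u ∈ (blockParabolic (K := K) n R).unip) :
    u.val.BlockTriangular (fun x : BlockIdx n => f x.1) := fun x y h => by
  rw [hu x y fun h' => lt_asymm h ((hR _ _).1 h'), Matrix.one_apply_ne]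
  rintro rfl
  exact lt_irrefl _ h

theorem mul_apply_eq_left {ι : Type*} [Fintype ι] [DecidableEq ι] {P Q : Matrix ι ι K} {x y : ι}
    (h : ∀ z, P x z = 0 ∨ Q z y = (1 : Matrix ι ι K) z y) : (P * Q) x y = P x y := by
  conv_rhs => rw [← mul_one P]
  rw [Matrix.mul_apply, Matrix.mul_apply]
  refine Finset.sum_congr rfl fun z _ => ?_
  rcases h z with h | h <;> simp [h]

theorem mul_apply_eq_right {ι : Type*} [Fintype ι] [DecidableEq ι] {P Q : Matrix ι ι K} {x y : ι}
    (h : ∀ z, P x z = (1 : Matrix ι ι K) x z ∨ Q z y = 0) : (P * Q) x y = Q x y := by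
  conv_rhs => rw [← one_mul Q]
  rw [Matrix.mul_apply, Matrix.mul_apply]
  refine Finset.sum_congr rfl fun z _ => ?_
  rcases h z with h | h <;> simp [h]

theorem unip_inv_apply (hf : Function.Injective f) (hR : ∀ i j, R i j ↔ f i < f j)
    {u : GL (BlockIdx n) K} (hu : u ∈ (blockParabolic (K := K) n R).unip) {x y : BlockIdx n}
    (hxy : x.1 = y.1) : (u⁻¹).val x y = (1 : Matrix (BlockIdx n) (BlockIdx n) K) x y := by
  have hT' := blockTriangular_gl_inv (unip_blockTriangular hR hu)
  rw [← Units.val_one (α := Matrix (BlockIdx n) (BlockIdx n) K), ← mul_inv_cancel u,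
    Units.val_mul]
  refine (mul_apply_eq_right fun z => ?_).symm
  by_cases h : R x.1 z.1
  · exact Or.inr (hT' (by simpa only [← hxy] using (hR _ _).1 h))
  · exact Or.inl (hu x z h)

/-- All components of `l` have entries, and inverses with entries, bounded by `R`. -/
def LeviSize (l : ∀ j, GL (Fin (n j)) K) (c : ℝ) : Prop := ∀ j, GLSize (l j) c

/-- The diagonal blocks of the product and of its inverse are those of `l` and of its inverse. -/
theorem LeviSize.of_levi_mul (hf : Function.Injective f) (hR : ∀ i j, R i j ↔ f i < f j)
    {l : ∀ j, GL (Fin (n j)) K} {u : GL (BlockIdx n) K}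
    (hu : u ∈ (blockParabolic (K := K) n R).unip) {c : ℝ} (h : GLSize (blockLevi n l * u) c) :
    LeviSize l c := by
  refine fun j => ⟨fun x y => ?_, fun x y => ?_⟩
  · have h1 := h.1 ⟨j, x⟩ ⟨j, y⟩
    rw [Units.val_mul, mul_apply_eq_left, blockLevi_val, Matrix.blockDiagonal'_apply_eq] at h1
    · exact h1
    · intro z
      by_cases hz : j = z.1
      · exact Or.inr (hu _ _ fun h => (((hR _ _).1 h).ne' (congrArg f hz)))
      · exact Or.inl (Matrix.blockDiagonal'_apply_ne _ _ _ hz)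
  · have h1 := h.2 ⟨j, x⟩ ⟨j, y⟩
    rw [mul_inv_rev, ← map_inv, Units.val_mul, mul_apply_eq_right, blockLevi_val,
      Matrix.blockDiagonal'_apply_eq] at h1
    · exact h1
    · intro z
      by_cases hz : z.1 = j
      · exact Or.inl (unip_inv_apply hf hR hu hz.symm)
      · exact Or.inr (Matrix.blockDiagonal'_apply_ne _ _ _ hz)

theorem hasGrowth_norm_det_zpow {ι : Type*} [Fintype ι] [DecidableEq ι] (z : ℤ) :
    HasGrowth GLSize fun g : GL ι K => ((‖g.val.det‖ ^ z : ℝ) : ℂ) := by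
  have key : ∀ (m : ℕ) (g : GL ι K) (c : ℝ), 1 ≤ c → MatLe c g.val →
      ‖g.val.det‖ ^ m ≤ c ^ (Fintype.card ι * m) := fun m g c hc h => by
    rw [pow_mul]
    exact pow_le_pow_left₀ (norm_nonneg _) (h.norm_det_le (by linarith)) _
  obtain ⟨m, rfl | rfl⟩ := z.eq_nat_or_neg
  · refine ⟨1, Fintype.card ι * m, zero_le_one, fun g c hc h => ?_⟩
    rw [Complex.norm_real, zpow_natCast, norm_pow, norm_norm, one_mul]
    exact key m g c hc h.1
  · refine ⟨1, Fintype.card ι * m, zero_le_one, fun g c hc h => ?_⟩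
    have e : ‖g.val.det‖⁻¹ = ‖(g⁻¹).val.det‖ := by
      rw [← norm_inv]
      congr 1
      refine inv_eq_of_mul_eq_one_right ?_
      rw [← Matrix.det_mul, ← Units.val_mul, mul_inv_cancel, Units.val_one, Matrix.det_one]
    rw [Complex.norm_real, zpow_neg, zpow_natCast, ← inv_pow, e, norm_pow, norm_norm, one_mul]
    exact key m g⁻¹ c hc h.2

/-- The inequality √x ≤ 1 + x reduces the claim to integral powers of determinants. -/
theorem hasGrowth_sqrt_modulus (R : Fin t → Fin t → Prop) :
    HasGrowth LeviSize fun l : ∀ j, GL (Fin (n j)) K =>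
      ((Real.sqrt ((blockParabolic n R).modulus l) : ℝ) : ℂ) := by
  have h1 : HasGrowth LeviSize fun l : ∀ j, GL (Fin (n j)) K =>
      (1 : ℂ) + (((blockParabolic n R).modulus l : ℝ) : ℂ) := by
    refine (HasGrowth.const 1).add ?_
    simp only [blockParabolic, Complex.ofReal_prod]
    exact HasGrowth.prod fun k _ => (hasGrowth_norm_det_zpow _).comp
      (φ := fun l : ∀ j, GL (Fin (n j)) K => l k) fun l c hc hl => hl k
  refine h1.of_le fun l c hc hl => ?_
  have hpos := (blockParabolic_modulus_pos R l).le
  have h2 : Real.sqrt ((blockParabolic n R).modulus l) ≤ 1 + (blockParabolic n R).modulus l :=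
    Real.sqrt_le_iff.2 ⟨by linarith, by nlinarith⟩
  rw [← Complex.ofReal_one, ← Complex.ofReal_add, Complex.norm_real, Complex.norm_real,
    Real.norm_of_nonneg (Real.sqrt_nonneg _), Real.norm_of_nonneg (by linarith)]
  exact h2

variable {V : Fin t → Type*} [∀ j, AddCommGroup (V j)] [∀ j, Module ℂ (V j)]
  {σ : ∀ j, Representation ℂ (GL (Fin (n j)) K) (V j)}

theorem smoothDual_apply_eq {G W : Type*} [Group G] [TopologicalSpace G] [AddCommGroup W]
    [Module ℂ W] {ρ : Representation ℂ G W} (l : smoothDual ρ) :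
    ∃ U : OpenSubgroup G, ∀ u ∈ U, ∀ x, l.1 (ρ u x) = l.1 x := by
  obtain ⟨U, hU⟩ := l.2
  refine ⟨U, fun u hu x => ?_⟩
  have : l.1 (ρ u⁻¹⁻¹ x) = l.1 x := LinearMap.congr_fun (hU u⁻¹ (inv_mem hu)) x
  rwa [inv_inv] at this

theorem hasGrowth_piPairing (hσ : ∀ j, IsAdmissible (σ j)) (v : ∀ j, V j)
    (y : ⨂[ℂ] j, smoothDual (σ j)) :
    HasGrowth LeviSize fun l => piPairing σ (extTensor σ l (PiTensorProduct.tprod ℂ v)) y := by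
  induction y using PiTensorProduct.induction_on with
  | smul_tprod z m =>
    have h : HasGrowth LeviSize fun l : ∀ j, GL (Fin (n j)) K =>
        z * ∏ j, (m j).1 (σ j (l j) (v j)) :=
      (HasGrowth.const z).mul (HasGrowth.prod fun j _ =>
        (hasGrowth_coeff (hσ j) (m j).1 (smoothDual_apply_eq (m j)) (v j)).comp
          (φ := fun l : ∀ j, GL (Fin (n j)) K => l j) fun l c hc hl => hl j)
    refine h.of_le fun l c hc hl => le_of_eq (congrArg _ ?_)
    rw [← piPairing_tprod, ← extTensor_tprod]
    simp [piPairing]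
  | add y y' h h' =>
    refine (h.add h').of_le fun l c hc hl => le_of_eq (congrArg _ ?_)
    simp [piPairing]

variable [MeasurableSpace K] [BorelSpace K]

/-- Matrix coefficients of quotients of induced representations at test vectors have moderate
growth. -/
theorem hasGrowth_induced (hf : Function.Injective f) (hR : ∀ i j, R i j ↔ f i < f j)
    (hσ : ∀ j, IsAdmissible (σ j)) {v : ∀ j, V j} {r : ℕ}
    {KL : Subgroup (∀ j, GL (Fin (n j)) K)}
    {F : inducedSpace (blockParabolic n R) (extTensor σ)}
    (hF : IsTestVector _ _ KL (iwahori n R r) (PiTensorProduct.tprod ℂ v) F)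
    {E : Type*} [AddCommGroup E] [Module ℂ E] {π : Representation ℂ (GL (BlockIdx n) K) E}
    {q : (normalizedInd (blockParabolic n R) (extTensor σ)).IntertwiningMap π}
    {l : smoothDual π}
    {F' : inducedSpace (blockParabolic n R) (extTensor fun j => contragredient (σ j))}
    (hl : IsDualImage _ _ _ (piPairing σ) (haarGL K _) (intGL K _) q l F') :
    HasGrowth GLSize fun g : GL (BlockIdx n) K => l.1 (π g (q F)) := by
  obtain ⟨U, hU⟩ := F'.2.2.2
  -- The coefficient is an integral over the integral group of pairings of `F (k g)` with `F' k`.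
  -- Only finitely many values of `F'` occur there, so a bound for each one suffices; admissibility
  -- of `π` itself plays no role.
  have hS : (F'.1 '' (intGL K (BlockIdx n) : Set _)).Finite :=
    finite_image_of_right_invariant isCompact_intGL _ U hU
  obtain ⟨C, N, hC, key⟩ := HasGrowth.uniform hS (P := GLSize)
    (f := fun y (g : GL (BlockIdx n) K) => piPairing σ (F.1 g) y) (by
      intro y _
      obtain ⟨C, N, hC, h⟩ := (hasGrowth_sqrt_modulus R).mul (hasGrowth_piPairing hσ v y)
      refine ⟨C, N, hC, fun g c hc hg => ?_⟩
      beta_reduce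
      by_cases h0 : F.1 g = 0
      · rw [h0]
        simp only [piPairing, map_zero, norm_zero]
        positivity
      · have h1 : g ∈ Function.support F.1 := h0
        rw [hF.support] at h1
        obtain ⟨p, ⟨m, u, hu, rfl⟩, i, hi, rfl⟩ := h1
        -- On the support of `F` the Iwahori factor is integral, so the size of `g` bounds that of
        -- the parabolic factor and hence of its Levi part.
        have h2 : GLSize (blockLevi n m * u) c := by
          have := hg.mul_intGL (by linarith) (inv_mem hi.1)
          rwa [mul_inv_cancel_right] at this
        rw [hF.apply_of_mem one_mem_iwahori m hu hi]
        have := h m c hc (LeviSize.of_levi_mul hf hR hu h2)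
        simpa [piPairing] using this)
  refine ⟨C * (haarGL K (BlockIdx n)).real (intGL K (BlockIdx n) : Set _), N, by positivity,
    fun g c hc hg => ?_⟩
  have hfin : haarGL K (BlockIdx n) (intGL K (BlockIdx n) : Set _) < ⊤ :=
    haarGL_intGL_lt_top
  have h1 : l.1 (π g (q F)) = ∫ k in (intGL K (BlockIdx n) : Set _),
      piPairing σ (F.1 (k * g)) (F'.1 k) ∂(haarGL K _) := by
    rw [← intertwining_apply]
    exact hl _
  change ‖l.1 (π g (q F))‖ ≤ _
  rw [h1]
  refine (norm_setIntegral_le_of_norm_le_const hfin fun k hk =>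
    key (F'.1 k, k * g) c hc ⟨⟨k, hk, rfl⟩, hg.intGL_mul (by linarith) hk⟩).trans_eq ?_
  ring

end Levi

end LocalZeta
end

noncomputable section
namespace LocalZeta

theorem continuous_of_right_invariant {G X : Type*} [Group G] [TopologicalSpace G]
    [IsTopologicalGroup G] [TopologicalSpace X] (F : G → X) (U : OpenSubgroup G)
    (h : ∀ u ∈ U, ∀ g, F (g * u) = F g) : Continuous F := by
  refine continuous_iff_continuousAt.2 fun x => ?_
  refine (continuousAt_const (y := F x)).congr ?_
  have hU : (fun y => x⁻¹ * y) ⁻¹' (U : Set G) ∈ nhds x :=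
    (U.isOpen.preimage (by fun_prop)).mem_nhds (by simp)
  filter_upwards [hU] with y hy
  have := h _ hy x
  rw [mul_inv_cancel_left] at this
  exact this.symm

/-! ### Absolute convergence from growth and bounded support. -/

section Convergence

variable {K : Type*} [NontriviallyNormedField K] [IsNormalizedLocalField K]
variable {ι : Type*} [Fintype ι] [DecidableEq ι]

theorem continuous_mulChar_det {χ : MulChar K ℂ} {c : ℕ} (hχ : IsTrivialOnUnits K χ c) :
    Continuous fun g : GL ι K => χ g.val.det :=
  continuous_of_right_invariant _ (openCongrGL K ι (rad_pos K c)) fun u hu g => by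
    rw [Units.val_mul, Matrix.det_mul, map_mul, mulChar_det_eq_one hχ hu, mul_one]

theorem continuous_absDet (z : ℂ) : Continuous fun g : GL ι K => absDet g z := by
  have h1 : Continuous fun g : GL ι K => ((‖g.val.det‖ : ℝ) : ℂ) :=
    Complex.continuous_ofReal.comp (Units.continuous_val.matrix_det.norm)
  refine h1.cpow continuous_const fun g => ?_
  rw [Complex.ofReal_mem_slitPlane]
  exact norm_det_pos g

theorem norm_absDet (g : GL ι K) (z : ℂ) : ‖absDet g z‖ = ‖g.val.det‖ ^ z.re :=
  Complex.norm_cpow_eq_rpow_re_of_pos (norm_det_pos g) z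

variable [MeasurableSpace K] [BorelSpace K]

/-- Against additive measure the integrand is |det|^(τ - d) on a compact set, which is bounded as
soon as τ ≥ d. -/
theorem integrable_det_rpow {Q τ : ℝ} (hQ : 1 ≤ Q) (hτ : Fintype.card ι ≤ τ) :
    Integrable (fun g : GL ι K =>
      {g : GL ι K | MatLe Q g.val}.indicator (fun g => ‖g.val.det‖ ^ τ) g) (haarGL K ι) := by
  have hQ0 : 0 < Q := by linarith
  have hm : MeasurableSet {M : Matrix ι ι K | MatLe Q M} := measurableSet_matLe Q
  have hmeas : Measurable fun M : Matrix ι ι K => ‖M.det‖ ^ τ :=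
    measurable_matrix_det.norm.pow_const τ
  refine ⟨((hmeas.comp measurable_val_gl).indicator
    (measurable_val_gl hm)).aestronglyMeasurable, ?_⟩
  rw [hasFiniteIntegral_iff_enorm]
  have hdet : MeasurableSet {M : Matrix ι ι K | M.det ≠ 0} :=
    (measurable_matrix_det (measurableSet_singleton 0)).compl
  rw [lintegral_haarGL _ (({M : Matrix ι ι K | MatLe Q M} ∩ {M | M.det ≠ 0}).indicator
    fun M => ENNReal.ofReal (‖M.det‖ ^ τ))]
  · calc _ ≤ ∫⁻ M, ({M : Matrix ι ι K | MatLe Q M}).indicator (fun _ => ENNReal.ofReal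
          ((Q ^ Fintype.card ι) ^ (τ - Fintype.card ι))) M ∂(haarMatrix K ι ι) := by
          refine lintegral_mono fun M => ?_
          by_cases hM : M ∈ {M : Matrix ι ι K | MatLe Q M} ∩ {M | M.det ≠ 0}
          · rw [Set.indicator_of_mem hM, Set.indicator_of_mem hM.1, glDensity,
              ← ENNReal.ofReal_mul (by positivity)]
            refine ENNReal.ofReal_le_ofReal ?_
            have h0 : 0 < ‖M.det‖ := norm_pos_iff.2 hM.2
            rw [← Real.rpow_natCast, ← Real.rpow_neg h0.le, ← Real.rpow_add h0,
              show -(Fintype.card ι : ℝ) + τ = τ - Fintype.card ι by ring]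
            exact Real.rpow_le_rpow h0.le (MatLe.norm_det_le hQ0.le hM.1) (by linarith)
          · rw [Set.indicator_of_notMem hM, mul_zero]
            exact zero_le
      _ < ⊤ := by
          rw [lintegral_indicator_const hm]
          exact ENNReal.mul_lt_top ENNReal.ofReal_lt_top (isCompact_matLe Q).measure_lt_top
  · intro g
    by_cases hg : MatLe Q g.val
    · rw [Set.indicator_of_mem (by exact ⟨hg, (norm_pos_iff.1 (norm_det_pos g))⟩),
        Set.indicator_of_mem (by exact hg), Real.enorm_of_nonneg (by positivity)]
    · rw [Set.indicator_of_notMem (fun h => hg h.1), Set.indicator_of_notMem (by exact hg),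
        enorm_zero]
  · intro M hM
    exact Set.indicator_of_notMem (fun h => h.2 hM) _
  · exact hmeas.ennreal_ofReal.indicator (hm.inter hdet)

/-- Absolute convergence from moderate growth and bounded support. -/
theorem exists_iteratedConverges {I : Set (GL ι K)} (hI : MeasurableSet I)
    (hIK : I ⊆ (intGL K ι : Set _)) (F : ℂ → GL ι K → GL ι K → ℂ)
    (hF : ∀ z, Continuous fun p : GL ι K × GL ι K => F z p.1 p.2) {Q C : ℝ} {N : ℕ} (hQ : 1 ≤ Q)
    (hC : 0 ≤ C) (hF0 : ∀ z X Y, ¬ MatLe Q Y.val → F z X Y = 0)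
    (hbound : ∀ z, ∀ X ∈ I, ∀ Y R, 1 ≤ R → GLSize Y R →
      ‖F z X Y‖ ≤ C * R ^ N * ‖Y.val.det‖ ^ (z.re + Fintype.card ι / 2)) :
    ∃ s₀ : ℝ, ∀ z : ℂ, s₀ < z.re → IteratedConverges I (F z) := by
  -- This abscissa makes `τ` at least the dimension after `N` powers of |det| have been spent on the
  -- growth bound.
  refine ⟨N + Fintype.card ι, fun z hz => ?_⟩
  set n := Fintype.card ι with hn
  set τ : ℝ := z.re + n / 2 - N with hτ
  have hn0 : (0 : ℝ) ≤ n := Nat.cast_nonneg _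
  have hQ0 : 0 < Q := by linarith
  have hfin : IsFiniteMeasure ((haarGL K ι).restrict I) :=
    ⟨by rw [Measure.restrict_apply_univ]; exact (measure_mono hIK).trans_lt haarGL_intGL_lt_top⟩
  have hint := ((integrable_const (1 : ℝ) (μ := (haarGL K ι).restrict I)).mul_prod
    (integrable_det_rpow (K := K) (ι := ι) (τ := τ) hQ (by rw [hτ]; linarith))).const_mul
      (C * (Q ^ (n + 1)) ^ N)
  refine hint.mono' (hF z).aestronglyMeasurable ?_
  rw [show ((haarGL K ι).restrict I).prod (haarGL K ι) =
    ((haarGL K ι).prod (haarGL K ι)).restrict (I ×ˢ Set.univ) by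
      rw [← Measure.prod_restrict, Measure.restrict_univ]]
  refine ae_restrict_of_forall_mem (hI.prod MeasurableSet.univ) ?_
  rintro ⟨X, Y⟩ ⟨hX, -⟩
  by_cases hY : MatLe Q Y.val
  · have h0 := norm_det_pos Y
    have hd : ‖Y.val.det‖ ≤ Q ^ n := hY.norm_det_le hQ0.le
    have hd' : 1 ≤ Q ^ n * ‖Y.val.det‖⁻¹ := by
      rw [← div_eq_mul_inv, one_le_div h0]; exact hd
    have hQR : Q ≤ Q ^ (n + 1) * ‖Y.val.det‖⁻¹ := by
      rw [pow_succ', mul_assoc]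
      exact le_mul_of_one_le_right hQ0.le hd'
    -- On the bounded support the adjugate formula controls the inverse, so the size of `Y` is at
    -- most a constant times |det Y|⁻¹.
    have hsize : GLSize Y (Q ^ (n + 1) * ‖Y.val.det‖⁻¹) :=
      ⟨hY.mono hQR, (matLe_inv_of_det hQ hY).mono (mul_le_mul_of_nonneg_right
        (pow_le_pow_right₀ hQ (by omega)) (by positivity))⟩
    refine (hbound z X hX Y _ (hQ.trans hQR) hsize).trans_eq ?_
    have e : (‖Y.val.det‖⁻¹) ^ N * ‖Y.val.det‖ ^ (z.re + n / 2) = ‖Y.val.det‖ ^ τ := by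
      rw [hτ, Real.rpow_sub h0, Real.rpow_natCast, inv_pow]
      field_simp
    rw [Set.indicator_of_mem (by exact hY), one_mul, ← e, mul_pow]
    ring
  · rw [hF0 z X Y hY, Set.indicator_of_notMem (by exact hY)]
    simp

end Convergence

end LocalZeta
end

noncomputable section
namespace LocalZeta

/-! ### The Iwahori groups in terms of matrix entries. -/

section Iwahori

variable {K : Type*} [NontriviallyNormedField K] [IsNormalizedLocalField K]
variable {t : ℕ} {n : Fin t → ℕ} {r : ℕ}

theorem norm_mul_sub_le {ι : Type*} [Fintype ι] {P Q : Matrix ι ι K} {x y : ι} {c : ℝ}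
    (hc : 0 ≤ c) (h : ∀ z, P x z = 0 ∨ ‖P x z‖ ≤ 1 ∧ ‖Q z y‖ ≤ c) : ‖(P * Q) x y‖ ≤ c := by
  rw [Matrix.mul_apply]
  refine norm_sum_le_of_le _ hc fun z _ => ?_
  rcases h z with h | ⟨h, h'⟩
  · rw [h, zero_mul, norm_zero]
    exact hc
  · rw [norm_mul]
    exact (mul_le_mul h h' (norm_nonneg _) zero_le_one).trans_eq (one_mul c)

/-- The block diagonal part of a matrix. -/
def diagBlocks (M : Matrix (BlockIdx n) (BlockIdx n) K) (j : Fin t) :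
    Matrix (Fin (n j)) (Fin (n j)) K :=
  fun x y => M ⟨j, x⟩ ⟨j, y⟩

theorem det_eq_of_blockTriangular {M : Matrix (BlockIdx n) (BlockIdx n) K}
    (h : M.BlockTriangular fun x : BlockIdx n => x.1) : M.det = ∏ j, (diagBlocks M j).det := by
  rw [h.det_fintype]
  refine Finset.prod_congr rfl fun j _ => ?_
  let φ : Fin (n j) ≃ {x : BlockIdx n // x.1 = j} :=
    { toFun := fun x => ⟨⟨j, x⟩, rfl⟩
      invFun := fun x => x.2 ▸ x.1.2
      left_inv := fun x => rfl
      right_inv := by rintro ⟨⟨_, x⟩, rfl⟩; rfl }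
  rw [← Matrix.det_submatrix_equiv_self φ]
  rfl

/-- Erasing the small lower blocks keeps the norm of the determinant equal to 1. The determinant is
then the product over the diagonal blocks, each factor of norm at most 1, so all have norm 1. -/
theorem exists_levi_of_lower_small {c : ℝ} (hc0 : 0 ≤ c) (hc : c < 1) {g : GL (BlockIdx n) K}
    (hg : g ∈ intGL K (BlockIdx n)) (hlow : ∀ x y : BlockIdx n, y.1 < x.1 → ‖g.val x y‖ ≤ c) :
    ∃ k ∈ intLevi n, ∀ j, (k j).val = diagBlocks g.val j := by
  classical
  obtain ⟨h1, hdet⟩ := mem_intGL_iff_det.1 hg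
  let T : Matrix (BlockIdx n) (BlockIdx n) K := fun x y => if y.1 < x.1 then 0 else g.val x y
  have hT1 : MatLe 1 T := fun x y => by
    by_cases h : y.1 < x.1
    · simp [T, h]
    · simpa [T, h] using h1 x y
  have hTg : MatLe c (T - g.val) := fun x y => by
    rw [Matrix.sub_apply]
    by_cases h : y.1 < x.1
    · simpa [T, h] using hlow x y h
    · simpa [T, h] using hc0
  have hTdet : ‖T.det‖ = 1 := by
    have h2 : ‖T.det - g.val.det‖ < 1 := (norm_det_sub_det_le hc0 hT1 h1 hTg).trans_lt hc
    refine le_antisymm (by simpa using hT1.norm_det_le zero_le_one) ?_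
    by_contra h3
    have h4 := IsUltrametricDist.norm_add_le_max T.det (-(T.det - g.val.det))
    rw [← sub_eq_add_neg, sub_sub_cancel, hdet, norm_neg] at h4
    exact absurd h4 (not_le.2 (max_lt (not_le.1 h3) h2))
  have hTT : T.BlockTriangular fun x : BlockIdx n => x.1 := fun x y h => by
    have h' : y.1 < x.1 := h
    simp [T, h']
  have hblk : ∀ j, diagBlocks T j = diagBlocks g.val j := fun j => by
    refine Matrix.ext fun x y => ?_
    simp [diagBlocks, T]
  rw [det_eq_of_blockTriangular hTT, norm_prod] at hTdet
  have hle : ∀ j, MatLe 1 (diagBlocks g.val j) := fun j x y => h1 _ _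
  have hone : ∀ j, ‖(diagBlocks g.val j).det‖ = 1 := by
    simp only [hblk] at hTdet
    have hle' : ∀ j, ‖(diagBlocks g.val j).det‖ ≤ 1 := fun j => by
      simpa using (hle j).norm_det_le zero_le_one
    intro j
    refine le_antisymm (hle' j) ?_
    rw [← hTdet, ← Finset.mul_prod_erase _ _ (Finset.mem_univ j)]
    exact mul_le_of_le_one_right (norm_nonneg _)
      (Finset.prod_le_one (fun _ _ => norm_nonneg _) fun i _ => hle' i)
  refine ⟨fun j => glOfDet (diagBlocks g.val j) (norm_pos_iff.1 (by rw [hone j]; exact one_pos)),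
    mem_intLevi.2 fun j => mem_intGL_iff_det.2 ⟨hle j, hone j⟩, fun j => rfl⟩

/-- The description by entries gives measurability and the comparison with the diagonal blocks of
𝔊_w. -/
theorem mem_iwahori₀_iff (hr : 1 ≤ r) {g : GL (BlockIdx n) K} : g ∈ iwahori₀ n (· < ·) r ↔
    g ∈ intGL K (BlockIdx n) ∧ ∀ x y : BlockIdx n, y.1 < x.1 → ‖g.val x y‖ ≤ rad K r := by
  constructor
  · rintro ⟨k, hk, u, hu, rfl⟩
    have hk' := blockLevi_mem_intGL.2 hk
    refine ⟨mul_mem hk' hu.1, fun x y hxy => ?_⟩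
    rw [Units.val_mul]
    refine norm_mul_sub_le (rad_pos K r).le fun z => ?_
    by_cases hz : x.1 = z.1
    · refine Or.inr ⟨(mem_intGL_iff_det.1 hk').1 x z, ?_⟩
      have := hu.2 z y (by rw [← hz]; exact lt_asymm hxy)
      rw [Matrix.one_apply_ne (fun h => by rw [← h, ← hz] at hxy; exact lt_irrefl _ hxy),
        sub_zero] at this
      exact this
    · exact Or.inl (Matrix.blockDiagonal'_apply_ne _ _ _ hz)
  · rintro ⟨hg, hlow⟩
    obtain ⟨k, hk, hkg⟩ := exists_levi_of_lower_small (rad_pos K r).le (rad_lt_one K hr) hg hlow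
    have hk' := blockLevi_mem_intGL.2 (inv_mem hk)
    refine ⟨k, hk, blockLevi n k⁻¹ * g, ⟨mul_mem hk' hg, fun x y hxy => ?_⟩, by simp⟩
    have e : (blockLevi n k⁻¹ * g).val - 1 = (blockLevi n k⁻¹).val *
        (g.val - (blockLevi n k).val) := by
      rw [mul_sub, ← Units.val_mul, ← Units.val_mul, ← map_mul, inv_mul_cancel, map_one,
        Units.val_one]
    rw [← Matrix.sub_apply, e]
    refine norm_mul_sub_le (rad_pos K r).le fun z => ?_
    by_cases hz : x.1 = z.1
    · refine Or.inr ⟨(mem_intGL_iff_det.1 hk').1 x z, ?_⟩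
      rw [Matrix.sub_apply]
      rcases (not_lt.1 hxy).lt_or_eq with h | h
      · rw [blockLevi_val, Matrix.blockDiagonal'_apply_ne _ _ _ (by rw [← hz]; exact h.ne'),
          sub_zero]
        exact hlow z y (hz ▸ h)
      · obtain ⟨j, z⟩ := z
        obtain ⟨j', y⟩ := y
        obtain rfl : j' = j := h.trans hz
        rw [blockLevi_val, Matrix.blockDiagonal'_apply_eq, hkg]
        simp only [diagBlocks, sub_self, norm_zero]
        exact (rad_pos K r).le
    · exact Or.inl (Matrix.blockDiagonal'_apply_ne _ _ _ hz)

theorem iwahori₀_subset_intGL (hr : 1 ≤ r) :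
    iwahori₀ n (· < ·) r ⊆ (intGL K (BlockIdx n) : Set (GL (BlockIdx n) K)) :=
  fun _ hg => ((mem_iwahori₀_iff hr).1 hg).1

theorem mem_frakX_of_mem_iwahori₀ {g : GL (BlockIdx n) K} (hg : g ∈ iwahori₀ n (· < ·) r) :
    g.val ∈ frakX n r :=
  ⟨1, ⟨1, one_mem _, 1, one_mem_iwahori, by simp⟩, g, hg, by rw [one_mul]⟩

variable [MeasurableSpace K] [BorelSpace K]

theorem measurableSet_iwahori₀ (hr : 1 ≤ r) :
    MeasurableSet (iwahori₀ n (· < ·) r : Set (GL (BlockIdx n) K)) := by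
  have : (iwahori₀ n (· < ·) r : Set (GL (BlockIdx n) K)) = (intGL K (BlockIdx n) : Set _) ∩
      ⋂ x : BlockIdx n, ⋂ y : BlockIdx n, ⋂ _ : y.1 < x.1,
        {g : GL (BlockIdx n) K | ‖g.val x y‖ ≤ rad K r} := by
    refine Set.ext fun g => ?_
    rw [mem_iwahori₀_iff hr]
    simp
  rw [this]
  refine measurableSet_intGL.inter (MeasurableSet.iInter fun x => MeasurableSet.iInter fun y =>
    MeasurableSet.iInter fun _ => (isClosed_le ?_ continuous_const).measurableSet)
  exact ((Units.continuous_val).matrix_elem x y).norm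

end Iwahori

/-! ### A convergence criterion common to 𝓘_a and 𝓘_b. -/

section Convergence

variable {K : Type*} [NontriviallyNormedField K] [IsNormalizedLocalField K]
  [MeasurableSpace K] [BorelSpace K]
variable {ι : Type*} [Fintype ι] [DecidableEq ι]

/-- The two integrals differ in the argument of the coefficient, `Y⁻¹ * X` for one and `X⁻¹ * Y` for
the other. The map `w` covers both, since multiplying by an integral element does not change sizes.
-/
theorem exists_iteratedConverges_coeff {I : Set (GL ι K)} (hI : MeasurableSet I)
    (hIK : I ⊆ (intGL K ι : Set _)) {u v c : GL ι K → ℂ} {Φ : Matrix ι ι K → ℂ}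
    (hu : Continuous u) (hv : Continuous v) (hc : Continuous c) (hΦ : Continuous Φ)
    (hvg : HasGrowth GLSize v) (hcg : HasGrowth GLSize c) {B Q : ℝ} (hB : ∀ M, ‖Φ M‖ ≤ B)
    (hQ : 1 ≤ Q) (hΦ0 : ∀ M, ¬ MatLe Q M → Φ M = 0) {w : GL ι K → GL ι K → GL ι K}
    (hw : Continuous fun p : GL ι K × GL ι K => w p.1 p.2)
    (hwg : ∀ X ∈ intGL K ι, ∀ Y R, 1 ≤ R → GLSize Y R → GLSize (w X Y) R) :
    ∃ s₀ : ℝ, ∀ z : ℂ, s₀ < z.re → IteratedConverges I fun X Y =>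
      u X * v Y * Φ Y.val * absDet Y (z + Fintype.card ι / 2) * c (w X Y) := by
  obtain ⟨D, hD⟩ := (isCompact_intGL (K := K) (ι := ι)).exists_bound_of_continuousOn hu.continuousOn
  obtain ⟨C, N, hC, hvc⟩ := hvg.mul (HasGrowth.const (1 : ℂ))
  obtain ⟨C', N', hC', hcc⟩ := hcg
  have hD0 : 0 ≤ D := (norm_nonneg _).trans (hD 1 (one_mem _))
  have hB0 : 0 ≤ B := (norm_nonneg _).trans (hB 0)
  refine exists_iteratedConverges (Q := Q) (C := D * B * C * C') (N := N + N') hI hIK _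
    (fun z => ?_) hQ (by positivity) (fun z X Y hY => ?_) fun z X hX Y R hR hY => ?_
  · exact (((((hu.comp continuous_fst).mul (hv.comp continuous_snd)).mul
      (hΦ.comp (Units.continuous_val.comp continuous_snd))).mul
      ((continuous_absDet _).comp continuous_snd)).mul (hc.comp hw))
  · rw [hΦ0 _ hY]
    simp
  · rw [norm_mul, norm_mul, norm_mul, norm_mul, norm_absDet]
    have e : (z + (Fintype.card ι : ℂ) / 2).re = z.re + Fintype.card ι / 2 := by
      simp
    rw [e]
    have hR0 : 0 ≤ R := by linarith
    have h1 := hvc Y R hR hY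
    simp only [mul_one] at h1
    have h2 := hcc _ R hR (hwg X (hIK hX) Y R hR hY)
    have h3 := hD X (hIK hX)
    have h4 := hB Y.val
    calc ‖u X‖ * ‖v Y‖ * ‖Φ Y.val‖ * ‖Y.val.det‖ ^ (z.re + Fintype.card ι / 2) * ‖c (w X Y)‖
        = (‖u X‖ * ‖v Y‖ * ‖Φ Y.val‖ * ‖c (w X Y)‖) *
          ‖Y.val.det‖ ^ (z.re + Fintype.card ι / 2) := by ring
      _ ≤ (D * (C * R ^ N) * B * (C' * R ^ N')) * ‖Y.val.det‖ ^ (z.re + Fintype.card ι / 2) := by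
          gcongr
      _ = _ := by ring

end Convergence

end LocalZeta
end

noncomputable section
namespace LocalZeta

/-! ### Levels of the functions μ and ν. -/

section Level

variable {K : Type*} [NontriviallyNormedField K] [IsNormalizedLocalField K]
  {t : ℕ} {n : Fin t → ℕ} {V : Fin t → Type*} [∀ j, AddCommGroup (V j)]
  [∀ j, Module ℂ (V j)] {σ : ∀ j, Representation ℂ (GL (Fin (n j)) K) (V j)} {c d r : ℕ}
  {W : Fin t → Type*} [∀ j, AddCommGroup (W j)] [∀ j, Module ℂ (W j)]
  (T : ∀ j, TypeVectors (σ j) c (W j)) {χ₁ χ₂ : MulChar K ℂ}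

/-- The coarse level `r` accommodates the conductor of χ₂ and serves only to show continuity. -/
theorem isLevelFun_muA (hc : 1 ≤ c) (hd : 1 ≤ d) (hr : c + d ≤ r)
    (hχ₂ : IsTrivialOnUnits K χ₂ d) : IsLevelFun n r r (muA χ₂ T r) :=
  ((isLevelFun_muA' T hc (by omega)).mono (by omega)).mulChar (by omega) (by omega)
    ((isTrivialOnUnits_inv hd hχ₂).mono (by omega))

theorem isLevelFun_muB (hc : 1 ≤ c) (hd : 1 ≤ d) (hr : d + c ≤ r)
    (hχ₁ : IsTrivialOnUnits K χ₁ d) : IsLevelFun n r r (muB χ₁ T r) :=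
  ((isLevelFun_muB' T hc (by omega)).mono (by omega)).mulChar (by omega) (by omega)
    (hχ₁.mono (by omega))

/-- Here the precise level `c` matters: it bounds the denominators in the support of the Fourier
transform, which the level `r` has to absorb. -/
theorem isLevelFun_twist_muA (hc : 1 ≤ c) (hr : c + d ≤ r) (hχ₁ : IsTrivialOnUnits K χ₁ c) :
    IsLevelFun n r c (twist χ₁ χ₂ (muA χ₂ T r)) := by
  rw [twist_muA T χ₁ χ₂ (by omega)]
  exact (isLevelFun_muA' T hc (by omega)).mulChar (by omega) hc (isTrivialOnUnits_inv hc hχ₁)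

theorem isLevelFun_twist_muB (hc : 1 ≤ c) (hr : d + c ≤ r) (hχ₂ : IsTrivialOnUnits K χ₂ c) :
    IsLevelFun n r c (twist χ₁ χ₂ (muB χ₁ T r)) := by
  rw [twist_muB T χ₁ χ₂ (by omega)]
  exact (isLevelFun_muB' T hc (by omega)).mulChar (by omega) hc hχ₂

end Level

/-! ### Continuity of matrix coefficients. -/

section Coefficient

variable {K : Type*} [NontriviallyNormedField K] [IsNormalizedLocalField K]
  {t : ℕ} {n : Fin t → ℕ} {R : Fin t → Fin t → Prop} {V E : Type*} [AddCommGroup V] [Module ℂ V]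
  [AddCommGroup E] [Module ℂ E] {G L : Type*} [Group L] [Group G] [TopologicalSpace G]
  [IsTopologicalGroup G] {D : ParabolicDatum L G} {ρ : Representation ℂ L V}
  {π : Representation ℂ G E}

theorem contragredient_apply_apply (l : smoothDual π) (g h : G) (x : E) :
    (contragredient π h l).1 (π g x) = l.1 (π (h⁻¹ * g) x) := by
  rw [map_mul]
  rfl

theorem continuous_coeff_of_smooth (l : smoothDual π) {x : E}
    (hx : ∃ U : OpenSubgroup G, ∀ u ∈ U, π u x = x) : Continuous fun g => l.1 (π g x) := by
  obtain ⟨U, hU⟩ := hx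
  refine continuous_of_right_invariant _ U fun u hu g => ?_
  rw [map_mul, Module.End.mul_apply, hU u hu]

theorem smooth_image (q : (normalizedInd D ρ).IntertwiningMap π) (F : inducedSpace D ρ) :
    ∃ U : OpenSubgroup G, ∀ u ∈ U, π u (q F) = q F := by
  obtain ⟨U, hU⟩ := F.2.2.2
  refine ⟨U, fun u hu => ?_⟩
  rw [← intertwining_apply]
  congr 1
  exact Subtype.ext (funext fun g => hU u hu g)

end Coefficient

/-! ### Convergence of 𝓘_a and 𝓘_b. -/

section Convergence

variable {K : Type*} [NontriviallyNormedField K] [IsNormalizedLocalField K]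
  [MeasurableSpace K] [BorelSpace K] {e : AddChar K Circle}
  {t : ℕ} {n : Fin t → ℕ} {V : Fin t → Type*} [∀ j, AddCommGroup (V j)]
  [∀ j, Module ℂ (V j)] {σ : ∀ j, Representation ℂ (GL (Fin (n j)) K) (V j)} {c d r : ℕ}
  {W : Fin t → Type*} [∀ j, AddCommGroup (W j)] [∀ j, Module ℂ (W j)]
  {T : ∀ j, TypeVectors (σ j) c (W j)} {χ₁ χ₂ : MulChar K ℂ}
  {R : Fin t → Fin t → Prop} {α : Type*} [LinearOrder α] {f : Fin t → α}
  {E : Type*} [AddCommGroup E] [Module ℂ E] {π : Representation ℂ (GL (BlockIdx n) K) E}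
  {F : inducedSpace (blockParabolic n R) (extTensor σ)}
  {q : (normalizedInd (blockParabolic n R) (extTensor σ)).IntertwiningMap π}
  {l : smoothDual π}
  {F' : inducedSpace (blockParabolic n R) (extTensor fun j => contragredient (σ j))}
  {KL : Subgroup (∀ j, GL (Fin (n j)) K)}

theorem one_le_inv_rad (K : Type*) [NontriviallyNormedField K] [IsNormalizedLocalField K] (c : ℕ) :
    1 ≤ (rad K c)⁻¹ := (one_le_inv₀ (rad_pos K c)).2 (rad_le_one K c)

theorem exists_iteratedConverges_integrandA (he : IsUnramifiedAddChar K e) (hc : 1 ≤ c)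
    (hd : 1 ≤ d) (hr : c + d ≤ r) (hχ₁ : IsTrivialOnUnits K χ₁ c) (hχ₂ : IsTrivialOnUnits K χ₂ d)
    (hf : Function.Injective f) (hR : ∀ i j, R i j ↔ f i < f j)
    (hσ : ∀ j, IsAdmissible (σ j)) (hF : IsTestVector _ _ KL (iwahori n R r) (vec₀ T) F)
    (hl : IsDualImage _ _ _ (piPairing σ) (haarGL K _) (intGL K _) q l F') :
    ∃ s₀ : ℝ, ∀ z : ℂ, s₀ < z.re → IteratedConverges (iwahori₀ n (· < ·) r)
      (integrandA χ₁ χ₂ (muA χ₂ T r) (PhiDiag e χ₁ χ₂ r (muA χ₂ T r))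
        (fun A₁ A₂ => (contragredient π A₂ l).1 (π A₁ (q F))) z) := by
  have hlev := isLevelFun_twist_muA T hc hr hχ₁ (χ₂ := χ₂)
  rw [PhiDiag_eq_fourier (by omega) χ₁ χ₂ hlev]
  have hχ₁' := isTrivialOnUnits_inv hc hχ₁
  obtain ⟨s₀, h⟩ := exists_iteratedConverges_coeff
    (measurableSet_iwahori₀ (K := K) (n := n) (r := r) (by omega))
    (iwahori₀_subset_intGL (by omega))
    (u := fun X => muA χ₂ T r X.val * χ₂ X.val.det) (v := fun Y => χ₁⁻¹ Y.val.det)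
    (c := fun g => l.1 (π g (q F))) (w := fun X Y => Y⁻¹ * X)
    (((isLevelFun_muA T hc hd hr hχ₂).continuous.comp Units.continuous_val).mul
      (continuous_mulChar_det hχ₂))
    (continuous_mulChar_det hχ₁') (continuous_coeff_of_smooth l (smooth_image q F))
    (continuous_fourier he (by omega) hlev) (hasGrowth_mulChar_det hχ₁')
    (hasGrowth_induced hf hR hσ hF hl) (norm_fourier_le _) (one_le_inv_rad K c)
    (fun M hM => fourier_eq_zero he hlev hM) (by fun_prop)
    (fun X hX Y R hR hY => GLSize.mul_intGL (by linarith) ⟨hY.2, by rw [inv_inv]; exact hY.1⟩ hX)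
  refine ⟨s₀, fun z hz => ?_⟩
  have := h z hz
  simp only [IteratedConverges, integrandA, contragredient_apply_apply] at this ⊢
  exact this

theorem exists_iteratedConverges_integrandB (he : IsUnramifiedAddChar K e) (hc : 1 ≤ c)
    (hd : 1 ≤ d) (hr : d + c ≤ r) (hχ₁ : IsTrivialOnUnits K χ₁ d) (hχ₂ : IsTrivialOnUnits K χ₂ c)
    (hf : Function.Injective f) (hR : ∀ i j, R i j ↔ f i < f j)
    (hσ : ∀ j, IsAdmissible (σ j)) (hF : IsTestVector _ _ KL (iwahori n R r) (vec₀ T) F)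
    (hl : IsDualImage _ _ _ (piPairing σ) (haarGL K _) (intGL K _) q l F') :
    ∃ s₀ : ℝ, ∀ z : ℂ, s₀ < z.re → IteratedConverges (iwahori₀ n (· < ·) r)
      (integrandB χ₁ χ₂ (muB χ₁ T r) (PhiDiag e χ₁ χ₂ r (muB χ₁ T r))
        (fun D₁ D₂ => (contragredient π D₂ l).1 (π D₁ (q F))) z) := by
  have hlev := isLevelFun_twist_muB T hc hr hχ₂ (χ₁ := χ₁)
  rw [PhiDiag_eq_fourier (by omega) χ₁ χ₂ hlev]
  have hχ₁' := isTrivialOnUnits_inv hd hχ₁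
  obtain ⟨s₀, h⟩ := exists_iteratedConverges_coeff
    (measurableSet_iwahori₀ (K := K) (n := n) (r := r) (by omega))
    (iwahori₀_subset_intGL (by omega))
    (u := fun X => muB χ₁ T r X.val * χ₁⁻¹ X.val.det) (v := fun Y => χ₂ Y.val.det)
    (c := fun g => l.1 (π g (q F))) (w := fun X Y => X⁻¹ * Y)
    (((isLevelFun_muB T hc hd hr hχ₁).continuous.comp Units.continuous_val).mul
      (continuous_mulChar_det hχ₁'))
    (continuous_mulChar_det hχ₂) (continuous_coeff_of_smooth l (smooth_image q F))
    (continuous_fourier he (by omega) hlev) (hasGrowth_mulChar_det hχ₂)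
    (hasGrowth_induced hf hR hσ hF hl) (norm_fourier_le _) (one_le_inv_rad K c)
    (fun M hM => fourier_eq_zero he hlev hM) (by fun_prop)
    (fun X hX Y R hR hY => GLSize.intGL_mul (by linarith) hY (inv_mem hX))
  refine ⟨s₀, fun z hz => (h z hz).congr (Filter.Eventually.of_forall fun p => ?_)⟩
  simp only [integrandB, contragredient_apply_apply]
  ring

end Convergence

end LocalZeta
end

noncomputable section
namespace LocalZeta

theorem fromCols_mul_swapMatrix {K : Type*} [NontriviallyNormedField K] {a b : Type*} [Fintype a]
    [DecidableEq a] [Fintype b] [DecidableEq b] (M N : Matrix (a ⊕ b) (a ⊕ b) K) :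
    Matrix.fromCols M N * swapMatrix K a b =
      Matrix.fromCols
        (Matrix.fromBlocks M.toBlocks₁₁ N.toBlocks₁₂ M.toBlocks₂₁ N.toBlocks₂₂)
        (Matrix.fromBlocks N.toBlocks₁₁ M.toBlocks₁₂ N.toBlocks₂₁ M.toBlocks₂₂) := by
  rw [swapMatrix, Matrix.fromCols_mul_fromBlocks]
  conv_lhs => rw [← Matrix.fromBlocks_toBlocks M, ← Matrix.fromBlocks_toBlocks N]
  simp only [Matrix.fromBlocks_multiply, Matrix.fromBlocks_add, Matrix.mul_one, Matrix.mul_zero,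
    add_zero, zero_add]

/-! ### The group 𝔊_w: support of Φ₁ and volume. -/

section GroupG

variable {K : Type*} [NontriviallyNormedField K] [IsNormalizedLocalField K]
  {t s : ℕ} {nA : Fin t → ℕ} {nB : Fin s → ℕ} {r : ℕ}

theorem exists_iwahori₀_add (hr : 1 ≤ r) {D : GL (BlockIdx nB) K}
    (hD : D ∈ iwahori₀ nB (· < ·) r) {Y : Matrix (BlockIdx nB) (BlockIdx nB) K}
    (hY : MatLe (rad K r) Y) : ∃ D' ∈ iwahori₀ (K := K) nB (· < ·) r, D'.val = D.val + Y := by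
  have h0 := (rad_pos K r).le
  have hl := rad_lt_one K hr
  obtain ⟨hDi, hDl⟩ := (mem_iwahori₀_iff hr).1 hD
  have h1 : MatLe (rad K r) (1 + (D⁻¹).val * Y - 1) := by
    rw [add_sub_cancel_left]
    exact MatLe.mul_left h0 (mem_intGL_iff.1 hDi).2 hY
  obtain ⟨h, hh, hi⟩ := exists_gl_of_sub_one h0 hl h1
  have e : (D * h).val = D.val + Y := by
    rw [Units.val_mul, hh, Matrix.mul_add, Matrix.mul_one, gl_mul_inv_cancel_left]
  refine ⟨D * h, (mem_iwahori₀_iff hr).2 ⟨mul_mem hDi hi, fun x y hxy => ?_⟩, e⟩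
  rw [e]
  exact (IsUltrametricDist.norm_add_le_max _ _).trans (max_le (hDl x y hxy) (hY x y))

theorem neg_mem_groupG {g : GL (BlockIdx nA ⊕ BlockIdx nB) K} (hg : g ∈ groupG nA nB r) :
    -g ∈ groupG nA nB r := by
  obtain ⟨h1, h2, h3, h4, h5⟩ := hg
  have hneg : ∀ {x : K}, x ∈ pPow K r → -x ∈ pPow K r := fun {x} hx => by
    rw [mem_pPow_iff_rad, norm_neg]; exact hx
  refine ⟨?_, fun x y h => hneg (h2 x y h), fun x y h => hneg (h3 x y h),
    fun x y => hneg (h4 x y), fun x y => hneg (h5 x y)⟩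
  have := mul_mem TypeVectors.neg_one_mem_intGL h1
  rwa [neg_one_mul] at this

theorem exists_of_mem_groupG (hr : 1 ≤ r) {g : GL (BlockIdx nA ⊕ BlockIdx nB) K}
    (hg : g ∈ groupG nA nB r) : ∃ A ∈ iwahori₀ (K := K) nA (· < ·) r,
      ∃ D ∈ iwahori₀ (K := K) nB (· < ·) r, ∃ B C, MatLe (rad K r) B ∧ MatLe (rad K r) C ∧
        g.val = Matrix.fromBlocks A.val B C D.val := by
  obtain ⟨h1, h2, h3, h4, h5⟩ := hg
  have hC : MatLe (rad K r) g.val.toBlocks₂₁ := fun x y => h4 x y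
  obtain ⟨d1, d2⟩ := norm_det_blocks_eq_one h1 (rad_pos K r).le (rad_lt_one K hr) hC
  have hi := (mem_intGL_iff.1 h1).1
  refine ⟨glOfDet g.val.toBlocks₁₁ (norm_pos_iff.1 (by rw [d1]; exact one_pos)),
    (mem_iwahori₀_iff hr).2 ⟨mem_intGL_iff_det.2 ⟨fun x y => hi _ _, d1⟩, h2⟩,
    glOfDet g.val.toBlocks₂₂ (norm_pos_iff.1 (by rw [d2]; exact one_pos)),
    (mem_iwahori₀_iff hr).2 ⟨mem_intGL_iff_det.2 ⟨fun x y => hi _ _, d2⟩, h3⟩,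
    g.val.toBlocks₁₂, g.val.toBlocks₂₁, h5, hC, gl_eq_of_fromBlocks⟩

theorem exists_groupG_iff (hr : 1 ≤ r) {A : GL (BlockIdx nA) K} {D : GL (BlockIdx nB) K}
    {B : Matrix (BlockIdx nA) (BlockIdx nB) K} {C : Matrix (BlockIdx nB) (BlockIdx nA) K} :
    (∃ g ∈ groupG (K := K) nA nB r, g.val = Matrix.fromBlocks A.val B C D.val) ↔
      (A ∈ iwahori₀ nA (· < ·) r ∧ D ∈ iwahori₀ nB (· < ·) r) ∧
        MatLe (rad K r) B ∧ MatLe (rad K r) C := by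
  constructor
  · rintro ⟨g, hg, e⟩
    obtain ⟨A', hA, D', hD, B', C', hB, hC, e'⟩ := exists_of_mem_groupG hr hg
    obtain ⟨e1, rfl, rfl, e2⟩ := Matrix.fromBlocks_inj.1 (e.symm.trans e')
    rw [Units.ext e1, Units.ext e2]
    exact ⟨⟨hA, hD⟩, hB, hC⟩
  · rintro ⟨⟨hA, hD⟩, hB, hC⟩
    have h0 := (rad_pos K r).le
    obtain ⟨hAi, hAl⟩ := (mem_iwahori₀_iff hr).1 hA
    obtain ⟨hDi, hDl⟩ := (mem_iwahori₀_iff hr).1 hD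
    have h1 : MatLe (rad K r)
        (Matrix.fromBlocks 1 ((A⁻¹).val * B) ((D⁻¹).val * C) 1 - 1) := by
      rw [← Matrix.fromBlocks_one, sub_eq_add_neg, Matrix.fromBlocks_neg, Matrix.fromBlocks_add,
        matLe_fromBlocks_iff]
      simp only [add_neg_cancel, neg_zero, add_zero]
      exact ⟨MatLe.zero h0, MatLe.mul_left h0 (mem_intGL_iff.1 hAi).2 hB,
        MatLe.mul_left h0 (mem_intGL_iff.1 hDi).2 hC, MatLe.zero h0⟩
    obtain ⟨h, hh, hi⟩ := exists_gl_of_sub_one h0 (rad_lt_one K hr) h1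
    have e : (diagEmb (A, D) * h).val = Matrix.fromBlocks A.val B C D.val := by
      rw [Units.val_mul, hh, diagEmb_val, Matrix.fromBlocks_multiply]
      simp
    refine ⟨diagEmb (A, D) * h, ⟨mul_mem (diagEmb_mem_intGL.2 ⟨hAi, hDi⟩) hi, ?_⟩, e⟩
    rw [e]
    exact ⟨hAl, hDl, hC, hB⟩

-- 𝔊_w is stable under -1 and the functions μ are sign equivariant, so the sign leaves the argument
-- as a constant factor.
open Classical in
theorem Phi₁_fromBlocks (hr : 1 ≤ r) {μa : Matrix (BlockIdx nA) (BlockIdx nA) K → ℂ}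
    {μb : Matrix (BlockIdx nB) (BlockIdx nB) K → ℂ} (ha : IsSignEquivariant μa)
    (hb : IsSignEquivariant μb) (ε : ℤˣ) (A : GL (BlockIdx nA) K) (D : GL (BlockIdx nB) K)
    (B : Matrix (BlockIdx nA) (BlockIdx nB) K) (C : Matrix (BlockIdx nB) (BlockIdx nA) K) :
    Phi₁ r μa μb ((ε : ℤ) • Matrix.fromBlocks A.val B C D.val) =
      if (A ∈ iwahori₀ nA (· < ·) r ∧ D ∈ iwahori₀ nB (· < ·) r) ∧
        MatLe (rad K r) B ∧ MatLe (rad K r) C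
      then μa ((ε : ℤ) • 1) * μb ((ε : ℤ) • 1) * (μa A.val * μb D.val) else 0 := by
  have hiff : (∃ g ∈ groupG (K := K) nA nB r,
      g.val = (ε : ℤ) • Matrix.fromBlocks A.val B C D.val) ↔
      ∃ g ∈ groupG (K := K) nA nB r, g.val = Matrix.fromBlocks A.val B C D.val := by
    rcases Int.units_eq_one_or ε with rfl | rfl
    · simp
    · constructor
      · rintro ⟨g, hg, e⟩
        exact ⟨-g, neg_mem_groupG hg, by rw [Units.val_neg, e]; simp⟩
      · rintro ⟨g, hg, e⟩
        exact ⟨-g, neg_mem_groupG hg, by rw [Units.val_neg, e]; simp⟩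
  rw [Phi₁]
  simp only [hiff, exists_groupG_iff hr]
  split_ifs with h
  · obtain ⟨⟨hA, hD⟩, hB, hC⟩ := h
    have e : (ε : ℤ) • Matrix.fromBlocks A.val B C D.val = Matrix.fromBlocks ((ε : ℤ) • A.val)
        ((ε : ℤ) • B) ((ε : ℤ) • C) ((ε : ℤ) • D.val) := by
      rw [Matrix.fromBlocks_smul]
    have hX : ∀ {t : ℕ} {n : Fin t → ℕ} {X : Matrix (BlockIdx n) (BlockIdx n) K},
        X ∈ frakX n r → (ε : ℤ) • X ∈ frakX n r := by
      intro t n X hX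
      rcases Int.units_eq_one_or ε with rfl | rfl
      · simpa using hX
      · simpa using neg_mem_frakX hr hX
    have hint : ∀ {κ κ' : Type} {Y : Matrix κ κ' K}, MatLe (rad K r) Y →
        ∀ x y, ((ε : ℤ) • Y) x y ∈ pPow K 0 := by
      intro κ κ' Y hY x y
      rw [mem_pPow_zero_iff]
      refine le_trans ?_ (rad_le_one K r)
      rcases Int.units_eq_one_or ε with rfl | rfl
      · simpa using hY x y
      · simpa using hY x y
    rw [e, blockExtend, if_pos, Matrix.toBlocks_fromBlocks₁₁, Matrix.toBlocks_fromBlocks₂₂, ha, hb]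
    · ring
    · exact ⟨hX (mem_frakX_of_mem_iwahori₀ hA), hX (mem_frakX_of_mem_iwahori₀ hD),
        hint hB, hint hC⟩
  · rfl

variable [MeasurableSpace K] [BorelSpace K]

/-- In the chart the lower right block is shifted by C A⁻¹ B, which is 𝔭^r-small and therefore
absorbed by the Iwahori group of the second factor. -/
theorem groupG_eq_image (hr : 1 ≤ r) : groupG (K := K) nA nB r =
    (lowerChart K (BlockIdx nA) (BlockIdx nB)).toGL ''
      ((iwahori₀ nA (· < ·) r ×ˢ iwahori₀ nB (· < ·) r) ×ˢ
        ({B | MatLe (rad K r) B} ×ˢ {C | MatLe (rad K r) C})) := by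
  have h0 := (rad_pos K r).le
  have hsmall : ∀ {A : GL (BlockIdx nA) K} {B : Matrix (BlockIdx nA) (BlockIdx nB) K}
      {C : Matrix (BlockIdx nB) (BlockIdx nA) K}, A ∈ iwahori₀ nA (· < ·) r →
      MatLe (rad K r) B → MatLe (rad K r) C → MatLe (rad K r) (C * (A⁻¹).val * B) := by
    intro A B C hA hB hC
    exact MatLe.mul_left h0 ((hC.mono (rad_le_one K r)).mul_right zero_le_one
      (mem_intGL_iff.1 (iwahori₀_subset_intGL hr hA)).2) hB
  refine Set.Subset.antisymm (fun g hg => ?_) ?_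
  · obtain ⟨A, hA, D, hD, B, C, hB, hC, e⟩ := exists_of_mem_groupG hr hg
    obtain ⟨D', hD', e'⟩ := exists_iwahori₀_add hr hD (hsmall hA hB hC).neg
    refine ⟨((A, D'), (B, C)), ⟨⟨hA, hD'⟩, hB, hC⟩, Units.ext ?_⟩
    rw [toGL_lowerChart_val, e, e']
    simp
  · rintro _ ⟨⟨⟨A, D'⟩, B, C⟩, ⟨⟨hA, hD'⟩, hB, hC⟩, rfl⟩
    obtain ⟨D, hD, e⟩ := exists_iwahori₀_add hr hD' (hsmall hA hB hC)
    obtain ⟨g, hg, e'⟩ := (exists_groupG_iff hr).2 ⟨⟨hA, hD⟩, hB, hC⟩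
    have : (lowerChart K (BlockIdx nA) (BlockIdx nB)).toGL ((A, D'), (B, C)) = g := by
      apply Units.ext
      rw [toGL_lowerChart_val, e', e]
    rw [this]
    exact hg

theorem haarGL_real_groupG (hr : 1 ≤ r) : (haarGL K _).real (groupG (K := K) nA nB r) =
    (haarGL K _).real (iwahori₀ (K := K) nA (· < ·) r) *
      (haarGL K _).real (iwahori₀ (K := K) nB (· < ·) r) *
      ((haarMatrix K (BlockIdx nA) (BlockIdx nB)).real {B | MatLe (rad K r) B} *
        (haarMatrix K (BlockIdx nB) (BlockIdx nA)).real {C | MatLe (rad K r) C}) := by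
  rw [Measure.real, groupG_eq_image hr, CellChart.haarGL_image_eq, cellMeasure, Measure.prod_prod,
    Measure.prod_prod, Measure.prod_prod]
  · simp [ENNReal.toReal_mul, Measure.real]
  · exact ((measurableSet_iwahori₀ hr).prod (measurableSet_iwahori₀ hr)).prod
      ((measurableSet_matLe _).prod (measurableSet_matLe _))
  · exact fun p hp => (mem_intGL_iff_det.1 (iwahori₀_subset_intGL hr hp.1.1)).2
  · exact fun p hp => (mem_intGL_iff_det.1 (iwahori₀_subset_intGL hr hp.1.2)).2

theorem haarMatrix_real_matLe_ne_zero {ι κ : Type*} [Fintype ι] [Fintype κ] :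
    (haarMatrix K ι κ).real {B | MatLe (rad K r) B} ≠ 0 := by
  classical
  refine (ENNReal.toReal_pos ?_ (isCompact_matLe _).measure_lt_top.ne).ne'
  exact ((isOpen_matLe (rad_pos K r)).measure_pos _ ⟨0, MatLe.zero (rad_pos K r).le⟩).ne'

end GroupG

end LocalZeta
end

noncomputable section
namespace LocalZeta

/-! ### Bookkeeping of powers of determinants. -/

section AbsDet

variable {K : Type*} [NontriviallyNormedField K] [IsNormalizedLocalField K]
variable {ι : Type*} [Fintype ι] [DecidableEq ι]

theorem absDet_mul (g h : GL ι K) (z : ℂ) : absDet (g * h) z = absDet g z * absDet h z := by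
  rw [absDet, Units.val_mul, Matrix.det_mul, norm_mul, Complex.ofReal_mul,
    Complex.mul_cpow_ofReal_nonneg (norm_nonneg _) (norm_nonneg _), absDet, absDet]

theorem absDet_ne_zero (g : GL ι K) : ((‖g.val.det‖ : ℝ) : ℂ) ≠ 0 :=
  Complex.ofReal_ne_zero.2 (norm_det_pos g).ne'

theorem absDet_add (g : GL ι K) (z w : ℂ) : absDet g (z + w) = absDet g z * absDet g w :=
  Complex.cpow_add _ _ (absDet_ne_zero g)

theorem ofReal_exp_cpow (u : ℝ) (z : ℂ) : ((Real.exp u : ℝ) : ℂ) ^ z = Complex.exp (u * z) := by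
  rw [Complex.cpow_def_of_ne_zero (Complex.ofReal_ne_zero.2 (Real.exp_pos u).ne'),
    ← Complex.ofReal_log (Real.exp_pos u).le, Real.log_exp]

/-- The exponents of the determinants that come from the modulus character and the density of the
Haar measure on the big cells. -/
theorem cpow_cells {x y : ℝ} (hx : 0 < x) (hy : 0 < y) (a b : ℕ) (s : ℂ) :
    (((x ^ b)⁻¹ : ℝ) : ℂ) * (((y ^ a)⁻¹ : ℝ) : ℂ) *
      (((y : ℂ) ^ ((a + b : ℂ) / 2 + s)) * ((x : ℂ) ^ ((a + b : ℂ) / 2 + s))) *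
      (((Real.sqrt ((x⁻¹) ^ (b : ℤ) * y ^ (-(a : ℤ))))⁻¹ : ℝ) : ℂ) =
    (x : ℂ) ^ (s + a / 2) * (y : ℂ) ^ (s + b / 2) := by
  -- In exponential coordinates the identity becomes linear in the exponents.
  obtain ⟨u, rfl⟩ : ∃ u, Real.exp u = x := ⟨_, Real.exp_log hx⟩
  obtain ⟨v, rfl⟩ : ∃ v, Real.exp v = y := ⟨_, Real.exp_log hy⟩
  have h1 : (Real.exp u)⁻¹ ^ (b : ℤ) * Real.exp v ^ (-(a : ℤ)) =
      Real.exp (-(b * u + a * v)) := by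
    rw [zpow_neg, zpow_natCast, zpow_natCast, ← Real.exp_neg, ← Real.exp_nat_mul,
      ← Real.exp_nat_mul, ← Real.exp_neg, ← Real.exp_add]
    congr 1
    ring
  have h2 : (Real.exp u ^ b)⁻¹ = Real.exp (-(b * u)) := by
    rw [← Real.exp_nat_mul, ← Real.exp_neg]
  have h3 : (Real.exp v ^ a)⁻¹ = Real.exp (-(a * v)) := by
    rw [← Real.exp_nat_mul, ← Real.exp_neg]
  rw [h1, h2, h3, ← Real.exp_half, ← Real.exp_neg]
  simp only [ofReal_exp_cpow]
  rw [Complex.ofReal_exp, Complex.ofReal_exp, Complex.ofReal_exp, ← Complex.exp_add,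
    ← Complex.exp_add, ← Complex.exp_add, ← Complex.exp_add, ← Complex.exp_add]
  congr 1
  push_cast
  ring

end AbsDet

/-! ### The zeta integrand in the variables X and Z = X g. -/

section Kernel

variable {K : Type*} [NontriviallyNormedField K] [IsNormalizedLocalField K]
variable {a b : Type*} [Fintype a] [DecidableEq a] [Fintype b] [DecidableEq b]

/-- The integrand of the zeta integral in the variables `X` and `Z = X g`. -/
def zetaKernel (χ₁ χ₂ : MulChar K ℂ) (Φ : Matrix (a ⊕ b) ((a ⊕ b) ⊕ (a ⊕ b)) K → ℂ)
    (coeff : GL (a ⊕ b) K → ℂ) (s : ℂ) (X Z : GL (a ⊕ b) K) : ℂ :=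
  χ₂ Z.val.det * χ₁⁻¹ X.val.det *
    (absDet Z (Fintype.card (a ⊕ b) / 2 + s) * absDet X (Fintype.card (a ⊕ b) / 2 + s)) *
    Φ (Matrix.fromCols Z.val X.val * swapMatrix K a b) * coeff (X⁻¹ * Z)

/-- The exponent n + 2 s of |det X| splits in two halves, one of which joins |det g| to form a power
of |det Z|; χ₂(det X) joins χ₂(det g) in the same way. -/
theorem section_eq_zetaKernel (χ₁ χ₂ : MulChar K ℂ)
    (Φ : Matrix (a ⊕ b) ((a ⊕ b) ⊕ (a ⊕ b)) K → ℂ) (coeff : GL (a ⊕ b) K → ℂ) (s : ℂ)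
    (X g : GL (a ⊕ b) K) :
    sectionFactor χ₂ s g * sectionIntegrand χ₁ χ₂ Φ s g X * coeff g =
      zetaKernel χ₁ χ₂ Φ coeff s X (X * g) := by
  rw [sectionFactor, sectionIntegrand, zetaKernel, inv_mul_cancel_left, absDet_mul,
    show (Fintype.card (a ⊕ b) + 2 * s : ℂ) = (Fintype.card (a ⊕ b) / 2 + s) +
      (Fintype.card (a ⊕ b) / 2 + s) by ring, absDet_add X, Units.val_mul, Matrix.det_mul, map_mul]
  ring

variable [MeasurableSpace K] [BorelSpace K]

theorem det_chart (c : CellChart K a b) (p : CellGL K a b) :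
    (c.toGL p).val.det = p.1.1.val.det * p.1.2.val.det := by
  rw [c.toGL_val]
  exact c.det_eq _ (c.mem_image _ (Matrix.GeneralLinearGroup.det_ne_zero p.1.1)
    (Matrix.GeneralLinearGroup.det_ne_zero p.1.2))

theorem absDet_chart (c : CellChart K a b) (p : CellGL K a b) (z : ℂ) :
    absDet (c.toGL p) z = absDet p.1.1 z * absDet p.1.2 z := by
  rw [absDet, det_chart, norm_mul, Complex.ofReal_mul,
    Complex.mul_cpow_ofReal_nonneg (norm_nonneg _) (norm_nonneg _), absDet, absDet]

end Kernel

/-! ### The zeta integrand on the product of the two cells. -/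

section Cells

variable {K : Type*} [NontriviallyNormedField K] [IsNormalizedLocalField K]
  [MeasurableSpace K] [BorelSpace K]
  {t s : ℕ} {nA : Fin t → ℕ} {nB : Fin s → ℕ} {cA cB r : ℕ} {e : AddChar K Circle}
  {χ₁ χ₂ : MulChar K ℂ} {μa : Matrix (BlockIdx nA) (BlockIdx nA) K → ℂ}
  {μb : Matrix (BlockIdx nB) (BlockIdx nB) K → ℂ}
  {coeff : GL (BlockIdx nA ⊕ BlockIdx nB) K → ℂ} {ca : GL (BlockIdx nA) K → ℂ}
  {cb : GL (BlockIdx nB) K → ℂ} {v : ℂ}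

/-- After the permutation of columns, Φ₁ sees A₁, D₂ and the blocks B₂, C₁, while Φ₂ sees A₂ and D₁
shifted by B₂ D₂⁻¹ C₂ and C₁ A₁⁻¹ B₁. On the support these shifts are integral, so the Fourier
transforms do not notice them. -/
theorem PhiW_swap (he : IsUnramifiedAddChar K e) (hr : 1 ≤ r)
    (hμa : IsSignEquivariant μa) (hμb : IsSignEquivariant μb)
    (hνa : IsLevelFun nA r cA (twist χ₁ χ₂ μa)) (hνb : IsLevelFun nB r cB (twist χ₁ χ₂ μb))
    (ε : ℤˣ) (dimτ : ℕ) (p q : CellGL K (BlockIdx nA) (BlockIdx nB)) :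
    PhiW ε e χ₁ χ₂ r dimτ μa μb (Matrix.fromCols ((lowerChart K (BlockIdx nA) (BlockIdx nB)).toGL q).val
      ((upperChart K (BlockIdx nA) (BlockIdx nB)).toGL p).val *
        swapMatrix K (BlockIdx nA) (BlockIdx nB)) =
    (dimτ : ℂ) ^ 2 / ((haarGL K _).real (groupG (K := K) nA nB r) : ℂ) *
      (μa ((ε : ℤ) • 1) * μb ((ε : ℤ) • 1)) *
      ((iwahori₀ nA (· < ·) r).indicator (fun A => μa A.val) q.1.1 *
        (iwahori₀ nB (· < ·) r).indicator (fun D => μb D.val) p.1.2) *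
      (fourier e (twist χ₁ χ₂ μa) p.1.1.val * fourier e (twist χ₁ χ₂ μb) q.1.2.val) *
      (({B | MatLe (rad K r) B}.indicator 1 p.2.1 * {C | MatLe 1 C}.indicator 1 p.2.2) *
        ({B | MatLe 1 B}.indicator 1 q.2.1 * {C | MatLe (rad K r) C}.indicator 1 q.2.2)) := by
  classical
  obtain ⟨⟨A₂, D₂⟩, B₂, C₂⟩ := p
  obtain ⟨⟨A₁, D₁⟩, B₁, C₁⟩ := q
  rw [fromCols_mul_swapMatrix, toGL_lowerChart_val, toGL_upperChart_val, PhiW,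
    Matrix.toCols₁_fromCols, Matrix.toCols₂_fromCols]
  simp only [Matrix.toBlocks_fromBlocks₁₁, Matrix.toBlocks_fromBlocks₁₂,
    Matrix.toBlocks_fromBlocks₂₁, Matrix.toBlocks_fromBlocks₂₂]
  rw [Phi₁_fromBlocks hr hμa hμb, Phi₂, fourier_blockExtend he hr hνa.eq_zero hνb.eq_zero]
  by_cases h : (A₁ ∈ iwahori₀ nA (· < ·) r ∧ D₂ ∈ iwahori₀ nB (· < ·) r) ∧
    MatLe (rad K r) B₂ ∧ MatLe (rad K r) C₁
  · obtain ⟨⟨hA, hD⟩, hB, hC⟩ := h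
    rw [if_pos ⟨⟨hA, hD⟩, hB, hC⟩, Set.indicator_of_mem hA, Set.indicator_of_mem hD,
      Set.indicator_of_mem (show B₂ ∈ {B | MatLe (rad K r) B} from hB),
      Set.indicator_of_mem (show C₁ ∈ {C | MatLe (rad K r) C} from hC)]
    by_cases h' : MatLe 1 C₂ ∧ MatLe 1 B₁
    · obtain ⟨hC', hB'⟩ := h'
      have hA' := (mem_intGL_iff.1 (iwahori₀_subset_intGL hr hA)).2
      have hD' := (mem_intGL_iff.1 (iwahori₀_subset_intGL hr hD)).2
      have hrl := rad_le_one K r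
      rw [fourier_add he hr hνa _ _ (((hB.mono hrl).mul_right zero_le_one hD').mul_right
          zero_le_one hC'),
        fourier_add he hr hνb _ _ (((hC.mono hrl).mul_right zero_le_one hA').mul_right
          zero_le_one hB')]
      simp only [Pi.one_apply]
      ring
    · have hz : ({C | MatLe 1 C} : Set (Matrix (BlockIdx nB) (BlockIdx nA) K)).indicator
            (1 : Matrix (BlockIdx nB) (BlockIdx nA) K → ℂ) C₂ *
          ({B | MatLe 1 B} : Set (Matrix (BlockIdx nA) (BlockIdx nB) K)).indicator
            (1 : Matrix (BlockIdx nA) (BlockIdx nB) K → ℂ) B₁ = 0 := by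
        rcases not_and_or.1 h' with h' | h'
        · rw [Set.indicator_of_notMem (show C₂ ∉ {C | MatLe 1 C} from h'), zero_mul]
        · rw [Set.indicator_of_notMem (show B₁ ∉ {B | MatLe 1 B} from h'), mul_zero]
      simp only [hz, Pi.one_apply, one_mul, mul_one, mul_zero]
  · rw [if_neg h]
    rcases not_and_or.1 h with h | h <;> rcases not_and_or.1 h with h | h
    · rw [Set.indicator_of_notMem h]; ring
    · rw [Set.indicator_of_notMem (s := iwahori₀ nB (· < ·) r) h]; ring
    · rw [Set.indicator_of_notMem (s := {B | MatLe (rad K r) B}) h]; ring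
    · rw [Set.indicator_of_notMem (s := {C | MatLe (rad K r) C}) (a := C₁) h]; ring

/-- The integrand of the zeta integral on the product of two big cells. -/
theorem zetaKernel_cells (he : IsUnramifiedAddChar K e) (hcA : 1 ≤ cA) (hr : cA + cB ≤ r)
    (hμa : IsSignEquivariant μa) (hμb : IsSignEquivariant μb)
    (hνa : IsLevelFun nA r cA (twist χ₁ χ₂ μa)) (hνb : IsLevelFun nB r cB (twist χ₁ χ₂ μb))
    (hR : ∀ i ∈ iwahoriW nA nB r, ∀ g, coeff (g * i) = coeff g)
    (hL : ∀ i ∈ iwahoriWT nA nB r, ∀ g, coeff (i * g) = coeff g)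
    (hdiag : ∀ (m₁ : GL (BlockIdx nA) K) (m₂ : GL (BlockIdx nB) K),
      (∀ γ : Matrix (BlockIdx nB) (BlockIdx nA) K, MatLe (rad K r) γ →
        MatLe 1 (m₂.val * γ * (m₁⁻¹).val)) →
      coeff (diagEmb (m₁, m₂)) =
        v * ((Real.sqrt (maxParabolic.modulus (m₁, m₂)))⁻¹ : ℝ) * (ca m₁ * cb m₂))
    (ε : ℤˣ) (dimτ : ℕ) (z : ℂ) (p q : CellGL K (BlockIdx nA) (BlockIdx nB)) :
    ((cellDensity p : ℝ) : ℂ) * ((cellDensity q : ℝ) : ℂ) *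
      zetaKernel χ₁ χ₂ (PhiW ε e χ₁ χ₂ r dimτ μa μb) coeff z
        ((upperChart K (BlockIdx nA) (BlockIdx nB)).toGL p) ((lowerChart K (BlockIdx nA) (BlockIdx nB)).toGL q) =
    (dimτ : ℂ) ^ 2 / ((haarGL K _).real (groupG (K := K) nA nB r) : ℂ) *
      (μa ((ε : ℤ) • 1) * μb ((ε : ℤ) • 1)) * v *
      ((iwahori₀ nA (· < ·) r).indicator (fun A => integrandA χ₁ χ₂ μa
          (PhiDiag e χ₁ χ₂ r μa) (fun A₁ A₂ => ca (A₂⁻¹ * A₁)) z A p.1.1) q.1.1 *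
        (iwahori₀ nB (· < ·) r).indicator (fun D => integrandB χ₁ χ₂ μb
          (PhiDiag e χ₁ χ₂ r μb) (fun D₁ D₂ => cb (D₂⁻¹ * D₁)) z D q.1.2) p.1.2) *
      (({B | MatLe (rad K r) B}.indicator 1 p.2.1 * {C | MatLe 1 C}.indicator 1 p.2.2) *
        ({B | MatLe 1 B}.indicator 1 q.2.1 * {C | MatLe (rad K r) C}.indicator 1 q.2.2)) := by
  classical
  have hr1 : 1 ≤ r := by omega
  rw [zetaKernel, PhiW_swap he hr1 hμa hμb hνa hνb, PhiDiag_eq_fourier hr1 χ₁ χ₂ hνa,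
    PhiDiag_eq_fourier hr1 χ₁ χ₂ hνb]
  obtain ⟨⟨A₂, D₂⟩, B₂, C₂⟩ := p
  obtain ⟨⟨A₁, D₁⟩, B₁, C₁⟩ := q
  simp only
  by_cases hA : A₁ ∈ iwahori₀ nA (· < ·) r
  swap
  · rw [Set.indicator_of_notMem hA, Set.indicator_of_notMem hA]; ring
  by_cases hD : D₂ ∈ iwahori₀ nB (· < ·) r
  swap
  · rw [Set.indicator_of_notMem hD, Set.indicator_of_notMem hD]; ring
  by_cases hB₂ : B₂ ∈ {B | MatLe (rad K r) B}
  swap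
  · rw [Set.indicator_of_notMem hB₂]; ring
  by_cases hC₁ : C₁ ∈ {C | MatLe (rad K r) C}
  swap
  · rw [Set.indicator_of_notMem hC₁]; ring
  by_cases hC₂ : C₂ ∈ {C | MatLe 1 C}
  swap
  · rw [Set.indicator_of_notMem hC₂]; ring
  by_cases hB₁ : B₁ ∈ {B | MatLe 1 B}
  swap
  · rw [Set.indicator_of_notMem hB₁]; ring
  rw [Set.indicator_of_mem hA, Set.indicator_of_mem hA, Set.indicator_of_mem hD,
    Set.indicator_of_mem hD, integrandA, integrandB]
  -- The coefficient can be reduced to the Levi subgroup only for bounded denominators; outside that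
  -- range the Fourier transform makes both sides zero.
  by_cases hA₂ : MatLe (rad K cA)⁻¹ A₂.val
  swap
  · rw [fourier_eq_zero he hνa hA₂]; ring
  by_cases hD₁ : MatLe (rad K cB)⁻¹ D₁.val
  swap
  · rw [fourier_eq_zero he hνb hD₁]; ring
  have hAi := iwahori₀_subset_intGL hr1 hA
  have hDi := iwahori₀_subset_intGL hr1 hD
  have hA' := (mem_intGL_iff.1 hAi).2
  have hD' := (mem_intGL_iff.1 hDi).2
  have h0 := (rad_pos K r).le
  have hcoeff : coeff (((upperChart K (BlockIdx nA) (BlockIdx nB)).toGL ((A₂, D₂), (B₂, C₂)))⁻¹ *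
      (lowerChart K (BlockIdx nA) (BlockIdx nB)).toGL ((A₁, D₁), (B₁, C₁))) =
      v * ((Real.sqrt (maxParabolic.modulus (A₂⁻¹ * A₁, D₂⁻¹ * D₁)))⁻¹ : ℝ) *
        (ca (A₂⁻¹ * A₁) * cb (D₂⁻¹ * D₁)) := by
    rw [toGL_upperChart, toGL_lowerChart, coeff_cells hcA hr hR hL hAi hDi hA₂ hD₁
      (MatLe.mul_left zero_le_one hA' hB₁) (MatLe.mul_right h0 hC₁ hA')
      (MatLe.mul_right h0 hB₂ hD') (MatLe.mul_left zero_le_one hD' hC₂)]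
    -- The full condition r ≥ c_a + c_b enters here: γ in 𝔭^r must absorb the denominators of `D₁`
    -- on the left and of `A₂` on the right at once.
    refine hdiag _ _ fun γ hγ => ?_
    have e1 : (D₂⁻¹ * D₁).val * γ * ((A₂⁻¹ * A₁)⁻¹).val =
        (D₂⁻¹).val * (D₁.val * γ * ((A₁⁻¹).val * A₂.val)) := by
      rw [mul_inv_rev, inv_inv, Units.val_mul, Units.val_mul, Matrix.mul_assoc, Matrix.mul_assoc,
        Matrix.mul_assoc]
    rw [e1]
    refine MatLe.mul_left zero_le_one hD' ?_
    have hrA := rad_pos K cA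
    have hrB := rad_pos K cB
    refine (MatLe.mul (by positivity) (by positivity) (MatLe.mul (by positivity) h0 hD₁ hγ)
      (MatLe.mul_left (by positivity) hA' hA₂)).mono ?_
    have h1 : rad K r ≤ rad K cA * rad K cB := by
      rw [← rad_add]; exact rad_anti K hr
    calc (rad K cB)⁻¹ * rad K r * (rad K cA)⁻¹ = rad K r / (rad K cA * rad K cB) := by
          field_simp
      _ ≤ 1 := (div_le_one (by positivity)).2 h1
  have hdA := (mem_intGL_iff_det.1 hAi).2
  have hdD := (mem_intGL_iff_det.1 hDi).2
  have hinv : ∀ {ι : Type} [Fintype ι] [DecidableEq ι] (g : GL ι K),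
      ‖(g⁻¹).val.det‖ = ‖g.val.det‖⁻¹ := by
    intro ι _ _ g
    rw [← norm_inv]
    congr 1
    refine (inv_eq_of_mul_eq_one_right ?_).symm
    rw [← Matrix.det_mul, ← Units.val_mul, mul_inv_cancel, Units.val_one, Matrix.det_one]
  have hmod : maxParabolic.modulus (A₂⁻¹ * A₁, D₂⁻¹ * D₁) =
      (‖A₂.val.det‖⁻¹) ^ (Fintype.card (BlockIdx nB) : ℤ) *
        ‖D₁.val.det‖ ^ (-(Fintype.card (BlockIdx nA) : ℤ)) := by
    simp only [maxParabolic, Units.val_mul, Matrix.det_mul, norm_mul, hdA, hdD, hinv, mul_one,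
      inv_one, one_mul]
  have hone : ∀ {ι : Type} [Fintype ι] [DecidableEq ι] (g : GL ι K) (w : ℂ),
      ‖g.val.det‖ = 1 → absDet g w = 1 := by
    intro ι _ _ g w h
    rw [absDet, h, Complex.ofReal_one, Complex.one_cpow]
  -- `A₁` and `D₂` have unit determinants, so only |det A₂| and |det D₁| survive in the densities,
  -- the modulus and the powers; `hpow` balances exactly these.
  have hδ₂ : ((cellDensity ((A₂, D₂), (B₂, C₂)) : ℝ) : ℂ) =
      (((‖A₂.val.det‖ ^ Fintype.card (BlockIdx nB))⁻¹ : ℝ) : ℂ) := by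
    simp [cellDensity, hdD]
  have hδ₁ : ((cellDensity ((A₁, D₁), (B₁, C₁)) : ℝ) : ℂ) =
      (((‖D₁.val.det‖ ^ Fintype.card (BlockIdx nA))⁻¹ : ℝ) : ℂ) := by
    simp [cellDensity, hdA]
  have hpow := cpow_cells (norm_det_pos A₂) (norm_det_pos D₁) (Fintype.card (BlockIdx nA))
    (Fintype.card (BlockIdx nB)) z
  rw [hcoeff, hδ₁, hδ₂, det_chart, det_chart, absDet_chart, absDet_chart, map_mul, map_mul, hmod]
  simp only [hone A₁ _ hdA, hone D₂ _ hdD, one_mul, mul_one, Fintype.card_sum, Nat.cast_add]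
  rw [← absDet, ← absDet, ← absDet, ← absDet] at hpow
  linear_combination (χ₂ A₁.val.det * χ₂ D₁.val.det * (χ₁⁻¹ A₂.val.det * χ₁⁻¹ D₂.val.det) *
    ((dimτ : ℂ) ^ 2 / ((haarGL K _).real (groupG (K := K) nA nB r) : ℂ) *
      (μa ((ε : ℤ) • 1) * μb ((ε : ℤ) • 1)) * (μa A₁.val * μb D₂.val) *
      (fourier e (twist χ₁ χ₂ μa) A₂.val * fourier e (twist χ₁ χ₂ μb) D₁.val)) *
      v * (ca (A₂⁻¹ * A₁) * cb (D₂⁻¹ * D₁)) *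
      (({B | MatLe (rad K r) B}.indicator 1 B₂ * {C | MatLe 1 C}.indicator 1 C₂) *
        ({B | MatLe 1 B}.indicator 1 B₁ * {C | MatLe (rad K r) C}.indicator 1 C₁))) * hpow

end Cells

end LocalZeta
end

noncomputable section
namespace LocalZeta

/-! ### Integrability of products in separate variables. -/

section Products

variable {α β : Type*} [MeasurableSpace α] [MeasurableSpace β] {μ : Measure α} {ν : Measure β}
  [SFinite μ] [SFinite ν] {f : α → ℂ} {g : β → ℂ}

/-- Almost every slice is integrable, and some such slice has a nonzero factor `f x`, which can be
divided out. -/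
theorem right_integrable_of_integrable_prod_mul
    (h : Integrable (fun p : α × β => f p.1 * g p.2) (μ.prod ν)) (hf : ¬ f =ᵐ[μ] 0) :
    Integrable g ν := by
  have h1 := h.prod_right_ae
  by_contra hg
  refine hf ?_
  filter_upwards [h1] with x hx
  by_contra hne
  exact hg ((integrable_const_mul_iff (isUnit_iff_ne_zero.2 hne) g).1 hx)

theorem left_integrable_of_integrable_prod_mul
    (h : Integrable (fun p : α × β => f p.1 * g p.2) (μ.prod ν)) (hg : ¬ g =ᵐ[ν] 0) :
    Integrable f μ := by
  refine right_integrable_of_integrable_prod_mul (μ := ν) (ν := μ) (f := g) (g := f) ?_ hg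
  refine (h.swap).congr (Filter.Eventually.of_forall fun p => ?_)
  simp only [Function.comp, Prod.fst_swap, Prod.snd_swap, mul_comm]

theorem integrable_or_ae_zero_of_integrable_mul {γ : Type*} [MeasurableSpace γ] {ρ : Measure γ}
    [SFinite ρ] {h : γ → ℂ} {k : ℂ} (hk : k ≠ 0) (hh : ∫ y, h y ∂ρ ≠ 0)
    (H : Integrable (fun x : (α × β) × γ => k * (f x.1.1 * g x.1.2) * h x.2)
      ((μ.prod ν).prod ρ)) :
    (Integrable f μ ∧ Integrable g ν) ∨ f =ᵐ[μ] 0 ∨ g =ᵐ[ν] 0 := by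
  have h0 : ¬ h =ᵐ[ρ] 0 := fun h0 => hh (integral_eq_zero_of_ae h0)
  have h1 := left_integrable_of_integrable_prod_mul
    (f := fun p : α × β => k * (f p.1 * g p.2)) H h0
  have h2 := (integrable_const_mul_iff (isUnit_iff_ne_zero.2 hk) _).1 h1
  by_cases hf : f =ᵐ[μ] 0
  · exact Or.inr (Or.inl hf)
  by_cases hg : g =ᵐ[ν] 0
  · exact Or.inr (Or.inr hg)
  exact Or.inl ⟨left_integrable_of_integrable_prod_mul h2 hg,
    right_integrable_of_integrable_prod_mul h2 hf⟩

/-- Integrability of the product does not give that of both factors, since a factor vanishing almost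
everywhere hides divergence of the other. In that case the factor that vanishes makes both sides
zero, whatever value is assigned to the other one. -/
theorem mul_integral_mul_integral_eq {γ : Type*} [MeasurableSpace γ] {ρ : Measure γ}
    [SFinite ρ] {h : γ → ℂ} {k I J : ℂ} (hh : ∫ y, h y ∂ρ ≠ 0)
    (H : Integrable (fun x : (α × β) × γ => k * (f x.1.1 * g x.1.2) * h x.2)
      ((μ.prod ν).prod ρ)) (hI : Integrable f μ → I = ∫ x, f x ∂μ)
    (hJ : Integrable g ν → J = ∫ x, g x ∂ν) :
    k * ((∫ x, f x ∂μ) * ∫ x, g x ∂ν) = k * (I * J) := by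
  by_cases hk : k = 0
  · rw [hk, zero_mul, zero_mul]
  congr 1
  rcases integrable_or_ae_zero_of_integrable_mul hk hh H with ⟨hf, hg⟩ | hf | hg
  · rw [hI hf, hJ hg]
  · rw [hI ((integrable_zero _ _ _).congr hf.symm), integral_eq_zero_of_ae hf, zero_mul, zero_mul]
  · rw [hJ ((integrable_zero _ _ _).congr hg.symm), integral_eq_zero_of_ae hg, mul_zero, mul_zero]

end Products

/-! ### Iterated integrals as integrals over the product. -/

section Iterated

variable {K : Type*} [NontriviallyNormedField K] [IsNormalizedLocalField K]
  [MeasurableSpace K] [BorelSpace K] {ι : Type*} [Fintype ι] [DecidableEq ι]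
  {I : Set (GL ι K)} {F : GL ι K → GL ι K → ℂ}

theorem indicator_prod_univ (I : Set (GL ι K)) (F : GL ι K → GL ι K → ℂ) :
    (fun p : GL ι K × GL ι K => I.indicator (fun A => F A p.2) p.1) =
      (I ×ˢ Set.univ).indicator fun p => F p.1 p.2 := by
  classical
  funext p
  simp only [Set.indicator_apply, Set.mem_prod, Set.mem_univ, and_true]

theorem restrict_prod_haarGL (I : Set (GL ι K)) : ((haarGL K ι).restrict I).prod (haarGL K ι) =
    ((haarGL K ι).prod (haarGL K ι)).restrict (I ×ˢ Set.univ) := by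
  rw [← Measure.prod_restrict, Measure.restrict_univ]

theorem integrable_indicator_iff_iteratedConverges (hI : MeasurableSet I) :
    Integrable (fun p : GL ι K × GL ι K => I.indicator (fun A => F A p.2) p.1)
      ((haarGL K ι).prod (haarGL K ι)) ↔ IteratedConverges I F := by
  rw [indicator_prod_univ, integrable_indicator_iff (hI.prod MeasurableSet.univ), IntegrableOn,
    IteratedConverges, restrict_prod_haarGL]

theorem integrable_indicator_swap_iff_iteratedConverges (hI : MeasurableSet I) :
    Integrable (fun p : GL ι K × GL ι K => I.indicator (fun A => F A p.1) p.2)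
      ((haarGL K ι).prod (haarGL K ι)) ↔ IteratedConverges I F := by
  rw [← integrable_indicator_iff_iteratedConverges hI, ← integrable_swap_iff]
  rfl

theorem iteratedIntegral_eq (hI : MeasurableSet I) (h : IteratedConverges I F) :
    iteratedIntegral I F = ∫ p : GL ι K × GL ι K, I.indicator (fun A => F A p.2) p.1
      ∂((haarGL K ι).prod (haarGL K ι)) := by
  rw [indicator_prod_univ, integral_indicator (hI.prod MeasurableSet.univ),
    ← restrict_prod_haarGL, integral_prod _ h, iteratedIntegral]

theorem iteratedIntegral_eq_swap (hI : MeasurableSet I) (h : IteratedConverges I F) :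
    iteratedIntegral I F = ∫ p : GL ι K × GL ι K, I.indicator (fun A => F A p.1) p.2
      ∂((haarGL K ι).prod (haarGL K ι)) := by
  rw [iteratedIntegral_eq hI h, ← integral_prod_swap]
  rfl

end Iterated

/-! ### The substitution Z = X g. -/

section Shear

variable {K : Type*} [NontriviallyNormedField K] [IsNormalizedLocalField K]
  [MeasurableSpace K] [BorelSpace K]
  {a b : Type*} [Fintype a] [DecidableEq a] [Fintype b] [DecidableEq b]
  {χ₁ χ₂ : MulChar K ℂ} {Φ : Matrix (a ⊕ b) ((a ⊕ b) ⊕ (a ⊕ b)) K → ℂ}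
  {coeff : GL (a ⊕ b) K → ℂ} {s : ℂ}

theorem measurePreserving_shearMulRight : MeasurePreserving
    (MeasurableEquiv.shearMulRight (GL (a ⊕ b) K))
    ((haarGL K (a ⊕ b)).prod (haarGL K (a ⊕ b))) ((haarGL K (a ⊕ b)).prod (haarGL K (a ⊕ b))) :=
  measurePreserving_prod_mul _ _

/-- The map (X, g) ↦ (X, X g) preserves the product measure by left invariance, so the pair (X, Z)
can be integrated independently. -/
theorem zetaConverges_iff : ZetaConverges χ₁ χ₂ Φ coeff s ↔
    Integrable (fun p : GL (a ⊕ b) K × GL (a ⊕ b) K => zetaKernel χ₁ χ₂ Φ coeff s p.1 p.2)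
      ((haarGL K (a ⊕ b)).prod (haarGL K (a ⊕ b))) := by
  rw [ZetaConverges, ← integrable_swap_iff,
    ← (measurePreserving_shearMulRight (K := K) (a := a) (b := b)).integrable_comp_emb
      (MeasurableEquiv.measurableEmbedding _)
      (g := fun p => zetaKernel χ₁ χ₂ Φ coeff s p.1 p.2)]
  refine Eq.to_iff (congrArg (fun f => Integrable f _) ?_)
  funext p
  exact section_eq_zetaKernel χ₁ χ₂ Φ coeff s p.1 p.2

theorem zetaIntegral_eq (h : ZetaConverges χ₁ χ₂ Φ coeff s) : zetaIntegral χ₁ χ₂ Φ coeff s =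
    ∫ p : GL (a ⊕ b) K × GL (a ⊕ b) K, zetaKernel χ₁ χ₂ Φ coeff s p.1 p.2
      ∂((haarGL K (a ⊕ b)).prod (haarGL K (a ⊕ b))) := by
  rw [← (measurePreserving_shearMulRight (K := K) (a := a) (b := b)).integral_comp',
    ← integral_prod_swap]
  have e : ∀ p : GL (a ⊕ b) K × GL (a ⊕ b) K, zetaKernel χ₁ χ₂ Φ coeff s
      (MeasurableEquiv.shearMulRight (GL (a ⊕ b) K) p.swap).1
      (MeasurableEquiv.shearMulRight (GL (a ⊕ b) K) p.swap).2 =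
      sectionFactor χ₂ s p.1 * sectionIntegrand χ₁ χ₂ Φ s p.1 p.2 * coeff p.1 := fun p =>
    (section_eq_zetaKernel _ _ _ _ _ _ _).symm
  simp only [e]
  rw [integral_prod _ h, zetaIntegral]
  refine integral_congr_ae (Filter.Eventually.of_forall fun g => ?_)
  simp only [sectionPlus]
  rw [← integral_const_mul, ← integral_mul_const]

end Shear

/-! ### Change of variables to the two cells. -/

section Charts

variable {K : Type*} [NontriviallyNormedField K] [IsNormalizedLocalField K]
  [MeasurableSpace K] [BorelSpace K]
  {a b : Type*} [Fintype a] [DecidableEq a] [Fintype b] [DecidableEq b]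
  (c d : CellChart K a b) {F : GL (a ⊕ b) K × GL (a ⊕ b) K → ℂ}

theorem restrict_prod_eq_map : ((haarGL K (a ⊕ b)).prod (haarGL K (a ⊕ b))).restrict
      ((Units.val ⁻¹' c.image) ×ˢ (Units.val ⁻¹' d.image)) =
    (((cellMeasure K a b).prod (cellMeasure K a b)).withDensity fun p =>
      ((cellDensity p.1 * cellDensity p.2 : NNReal) : ENNReal)).map
        (Prod.map c.toGL d.toGL) := by
  have hm : Measurable fun p : CellGL K a b => (cellDensity p : ENNReal) :=
    measurable_cellDensity.coe_nnreal_ennreal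
  rw [← Measure.prod_restrict, c.restrict_eq_map, d.restrict_eq_map,
    Measure.map_prod_map _ _ c.measurableEmbedding.measurable d.measurableEmbedding.measurable,
    prod_withDensity hm hm]
  simp only [ENNReal.coe_mul]

theorem measurable_density_mul : Measurable fun p : CellGL K a b × CellGL K a b =>
    cellDensity p.1 * cellDensity p.2 :=
  (measurable_cellDensity.comp measurable_fst).mul (measurable_cellDensity.comp measurable_snd)

theorem integrable_charts (hF : ∀ p, F p ≠ 0 → p.1.val ∈ c.image ∧ p.2.val ∈ d.image) :
    Integrable F ((haarGL K (a ⊕ b)).prod (haarGL K (a ⊕ b))) ↔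
      Integrable (fun p : CellGL K a b × CellGL K a b => ((cellDensity p.1 : ℝ) : ℂ) *
        ((cellDensity p.2 : ℝ) : ℂ) * F (c.toGL p.1, d.toGL p.2))
        ((cellMeasure K a b).prod (cellMeasure K a b)) := by
  rw [← integrableOn_iff_integrable_of_support_subset
    (s := (Units.val ⁻¹' c.image) ×ˢ (Units.val ⁻¹' d.image)) (fun p hp => hF p hp),
    IntegrableOn, restrict_prod_eq_map,
    (c.measurableEmbedding.prodMap d.measurableEmbedding).integrable_map_iff,
    integrable_withDensity_iff_integrable_smul measurable_density_mul]
  refine Eq.to_iff (congrArg (fun f => Integrable f _) ?_)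
  funext p
  simp [NNReal.smul_def, Prod.map]

theorem integral_charts (hF : ∀ p, F p ≠ 0 → p.1.val ∈ c.image ∧ p.2.val ∈ d.image) :
    ∫ p, F p ∂((haarGL K (a ⊕ b)).prod (haarGL K (a ⊕ b))) =
      ∫ p : CellGL K a b × CellGL K a b, ((cellDensity p.1 : ℝ) : ℂ) *
        ((cellDensity p.2 : ℝ) : ℂ) * F (c.toGL p.1, d.toGL p.2)
        ∂((cellMeasure K a b).prod (cellMeasure K a b)) := by
  rw [← setIntegral_eq_integral_of_forall_compl_eq_zero
    (s := (Units.val ⁻¹' c.image) ×ˢ (Units.val ⁻¹' d.image))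
      (fun p hp => by by_contra h; exact hp (hF p h)), restrict_prod_eq_map,
    (c.measurableEmbedding.prodMap d.measurableEmbedding).integral_map,
    integral_withDensity_eq_integral_smul measurable_density_mul]
  refine integral_congr_ae (Filter.Eventually.of_forall fun p => ?_)
  simp [NNReal.smul_def, Prod.map]

variable (K a b) in
/-- Rearrangement of the coordinates on the product of two cells. -/
def cellRearrange : CellGL K a b × CellGL K a b ≃ᵐ
    ((GL a K × GL a K) × (GL b K × GL b K)) ×
      ((Matrix a b K × Matrix b a K) × (Matrix a b K × Matrix b a K)) :=
  (prodProdCommEquiv _ _ _ _).trans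
    ((prodProdCommEquiv _ _ _ _).prodCongr (MeasurableEquiv.refl _))

theorem measurePreserving_cellRearrange : MeasurePreserving (cellRearrange K a b)
    ((cellMeasure K a b).prod (cellMeasure K a b))
    ((((haarGL K a).prod (haarGL K a)).prod ((haarGL K b).prod (haarGL K b))).prod
      (((haarMatrix K a b).prod (haarMatrix K b a)).prod
        ((haarMatrix K a b).prod (haarMatrix K b a)))) :=
  ((measurePreserving_prodProdComm _ _ _ _).prod (MeasurePreserving.id _)).comp
    (measurePreserving_prodProdComm _ _ _ _)

end Charts

/-! ### The integrand is supported on the two cells. -/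

section Support

variable {K : Type*} [NontriviallyNormedField K] [IsNormalizedLocalField K]
  [MeasurableSpace K] [BorelSpace K]
  {t s : ℕ} {nA : Fin t → ℕ} {nB : Fin s → ℕ} {cA cB r : ℕ} {e : AddChar K Circle}
  {χ₁ χ₂ : MulChar K ℂ} {μa : Matrix (BlockIdx nA) (BlockIdx nA) K → ℂ}
  {μb : Matrix (BlockIdx nB) (BlockIdx nB) K → ℂ}
  {coeff : GL (BlockIdx nA ⊕ BlockIdx nB) K → ℂ}

theorem det_ne_zero_of_Phi₁_ne_zero (hr : 1 ≤ r) (ε : ℤˣ)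
    {X : Matrix (BlockIdx nA ⊕ BlockIdx nB) (BlockIdx nA ⊕ BlockIdx nB) K}
    (h : Phi₁ r μa μb ((ε : ℤ) • X) ≠ 0) :
    X.toBlocks₁₁.det ≠ 0 ∧ X.toBlocks₂₂.det ≠ 0 := by
  have h1 : ∃ g ∈ groupG (K := K) nA nB r, g.val = X := by
    by_contra hne
    refine h (if_neg ?_)
    rintro ⟨g, hg, e'⟩
    refine hne ?_
    rcases Int.units_eq_one_or ε with rfl | rfl
    · exact ⟨g, hg, by rw [e']; simp⟩
    · exact ⟨-g, neg_mem_groupG hg, by rw [Units.val_neg, e']; simp⟩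
  obtain ⟨g, hg, rfl⟩ := h1
  obtain ⟨A, hA, D, hD, B, C, -, -, e'⟩ := exists_of_mem_groupG hr hg
  rw [e', Matrix.toBlocks_fromBlocks₁₁, Matrix.toBlocks_fromBlocks₂₂]
  exact ⟨Matrix.GeneralLinearGroup.det_ne_zero A, Matrix.GeneralLinearGroup.det_ne_zero D⟩

/-- Φ₁ reads the upper left block of Z and the lower right block of X, and elements of 𝔊_w have
invertible diagonal blocks. No statement about null complements of the cells is needed. -/
theorem mem_image_of_zetaKernel_ne_zero (hr : 1 ≤ r) (ε : ℤˣ) (dimτ : ℕ) (z : ℂ)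
    (p : GL (BlockIdx nA ⊕ BlockIdx nB) K × GL (BlockIdx nA ⊕ BlockIdx nB) K)
    (h : zetaKernel χ₁ χ₂ (PhiW ε e χ₁ χ₂ r dimτ μa μb) coeff z p.1 p.2 ≠ 0) :
    p.1.val ∈ (upperChart K (BlockIdx nA) (BlockIdx nB)).image ∧
      p.2.val ∈ (lowerChart K (BlockIdx nA) (BlockIdx nB)).image := by
  have h1 : Phi₁ r μa μb ((ε : ℤ) • (Matrix.fromCols p.2.val p.1.val *
      swapMatrix K (BlockIdx nA) (BlockIdx nB)).toCols₁) ≠ 0 := by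
    intro h0
    refine h ?_
    rw [zetaKernel, PhiW, h0]
    ring
  rw [fromCols_mul_swapMatrix, Matrix.toCols₁_fromCols] at h1
  have h2 := det_ne_zero_of_Phi₁_ne_zero hr ε h1
  rw [Matrix.toBlocks_fromBlocks₁₁, Matrix.toBlocks_fromBlocks₂₂] at h2
  exact ⟨h2.2, h2.1⟩

end Support

end LocalZeta
end

noncomputable section
namespace LocalZeta

/-! ### Factorization of the zeta integral. -/

section Final

variable {K : Type*} [NontriviallyNormedField K] [IsNormalizedLocalField K]
  [MeasurableSpace K] [BorelSpace K]
  {t s : ℕ} {nA : Fin t → ℕ} {nB : Fin s → ℕ} {cA cB r : ℕ} {e : AddChar K Circle}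
  {χ₁ χ₂ : MulChar K ℂ} {μa : Matrix (BlockIdx nA) (BlockIdx nA) K → ℂ}
  {μb : Matrix (BlockIdx nB) (BlockIdx nB) K → ℂ}
  {coeff : GL (BlockIdx nA ⊕ BlockIdx nB) K → ℂ} {ca : GL (BlockIdx nA) K → ℂ}
  {cb : GL (BlockIdx nB) K → ℂ} {v : ℂ}

variable (K nA nB) in
/-- The indicator function of the off-diagonal blocks of the two cells. -/
def offDiagIndicator (r : ℕ) (x : (Matrix (BlockIdx nA) (BlockIdx nB) K ×
    Matrix (BlockIdx nB) (BlockIdx nA) K) × (Matrix (BlockIdx nA) (BlockIdx nB) K ×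
      Matrix (BlockIdx nB) (BlockIdx nA) K)) : ℂ :=
  ({B | MatLe (rad K r) B}.indicator 1 x.1.1 * {C | MatLe 1 C}.indicator 1 x.1.2) *
    ({B | MatLe 1 B}.indicator 1 x.2.1 * {C | MatLe (rad K r) C}.indicator 1 x.2.2)

/-- The integrand of the zeta integral in the rearranged coordinates of the two cells. -/
def cellProduct (r : ℕ) (κ : ℂ) (f : GL (BlockIdx nA) K × GL (BlockIdx nA) K → ℂ)
    (g : GL (BlockIdx nB) K × GL (BlockIdx nB) K → ℂ) (x : ((GL (BlockIdx nA) K × GL (BlockIdx nA) K) ×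
          (GL (BlockIdx nB) K × GL (BlockIdx nB) K)) × ((Matrix (BlockIdx nA) (BlockIdx nB) K ×
            Matrix (BlockIdx nB) (BlockIdx nA) K) × (Matrix (BlockIdx nA) (BlockIdx nB) K ×
            Matrix (BlockIdx nB) (BlockIdx nA) K))) : ℂ :=
  κ * (f x.1.1 * g x.1.2) * offDiagIndicator K nA nB r x.2

theorem integral_indicator_matLe {ι κ : Type*} [Fintype ι] [Fintype κ] [DecidableEq ι]
    [DecidableEq κ] (ρ : ℝ) :
    ∫ B, ({B | MatLe ρ B} : Set (Matrix ι κ K)).indicator (1 : Matrix ι κ K → ℂ) B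
      ∂(haarMatrix K ι κ) = ((haarMatrix K ι κ).real {B | MatLe ρ B} : ℂ) := by
  rw [integral_indicator (measurableSet_matLe ρ)]
  simp
theorem integrable_indicator_matLe {ι κ : Type*} [Fintype ι] [Fintype κ] [DecidableEq ι]
    [DecidableEq κ] (ρ : ℝ) :
    Integrable (({B | MatLe ρ B} : Set (Matrix ι κ K)).indicator (1 : Matrix ι κ K → ℂ))
      (haarMatrix K ι κ) :=
  (integrable_indicator_iff (measurableSet_matLe ρ)).2
    (integrableOn_const (isCompact_matLe _).measure_lt_top.ne)

theorem integrable_offDiagIndicator : Integrable (offDiagIndicator K nA nB r)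
    (((haarMatrix K (BlockIdx nA) (BlockIdx nB)).prod
      (haarMatrix K (BlockIdx nB) (BlockIdx nA))).prod
      ((haarMatrix K (BlockIdx nA) (BlockIdx nB)).prod
        (haarMatrix K (BlockIdx nB) (BlockIdx nA)))) :=
  ((integrable_indicator_matLe _).mul_prod (integrable_indicator_matLe _)).mul_prod
    ((integrable_indicator_matLe _).mul_prod (integrable_indicator_matLe _))

theorem integral_offDiagIndicator : ∫ x, offDiagIndicator K nA nB r x
    ∂(((haarMatrix K (BlockIdx nA) (BlockIdx nB)).prod
      (haarMatrix K (BlockIdx nB) (BlockIdx nA))).prod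
      ((haarMatrix K (BlockIdx nA) (BlockIdx nB)).prod
        (haarMatrix K (BlockIdx nB) (BlockIdx nA)))) =
    ((haarMatrix K (BlockIdx nA) (BlockIdx nB)).real {B | MatLe (rad K r) B} : ℂ) *
      ((haarMatrix K (BlockIdx nB) (BlockIdx nA)).real {C | MatLe (rad K r) C} : ℂ) := by
  unfold offDiagIndicator
  rw [integral_prod_mul
    (f := fun y : Matrix (BlockIdx nA) (BlockIdx nB) K × Matrix (BlockIdx nB) (BlockIdx nA) K =>
      ({B | MatLe (rad K r) B}.indicator 1 y.1 * {C | MatLe 1 C}.indicator 1 y.2 : ℂ))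
    (g := fun y : Matrix (BlockIdx nA) (BlockIdx nB) K × Matrix (BlockIdx nB) (BlockIdx nA) K =>
      ({B | MatLe 1 B}.indicator 1 y.1 * {C | MatLe (rad K r) C}.indicator 1 y.2 : ℂ)),
    integral_prod_mul, integral_prod_mul]
  simp only [integral_indicator_matLe]
  simp [Measure.real, haarMatrix_matLe_one]

/-- The zeta integral in the coordinates of the two big cells. -/
theorem zeta_cells (he : IsUnramifiedAddChar K e) (hcA : 1 ≤ cA) (hr : cA + cB ≤ r)
    (hμa : IsSignEquivariant μa) (hμb : IsSignEquivariant μb)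
    (hνa : IsLevelFun nA r cA (twist χ₁ χ₂ μa)) (hνb : IsLevelFun nB r cB (twist χ₁ χ₂ μb))
    (hR : ∀ i ∈ iwahoriW nA nB r, ∀ g, coeff (g * i) = coeff g)
    (hL : ∀ i ∈ iwahoriWT nA nB r, ∀ g, coeff (i * g) = coeff g)
    (hdiag : ∀ (m₁ : GL (BlockIdx nA) K) (m₂ : GL (BlockIdx nB) K),
      (∀ γ : Matrix (BlockIdx nB) (BlockIdx nA) K, MatLe (rad K r) γ →
        MatLe 1 (m₂.val * γ * (m₁⁻¹).val)) →
      coeff (diagEmb (m₁, m₂)) =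
        v * ((Real.sqrt (maxParabolic.modulus (m₁, m₂)))⁻¹ : ℝ) * (ca m₁ * cb m₂))
    (ε : ℤˣ) (dimτ : ℕ) (z : ℂ) {κ : ℂ}
    (hκ : κ = (dimτ : ℂ) ^ 2 / ((haarGL K _).real (groupG (K := K) nA nB r) : ℂ) *
      (μa ((ε : ℤ) • 1) * μb ((ε : ℤ) • 1)) * v)
    {f : GL (BlockIdx nA) K × GL (BlockIdx nA) K → ℂ}
    (hf : f = fun p => (iwahori₀ nA (· < ·) r).indicator (fun A => integrandA χ₁ χ₂ μa
      (PhiDiag e χ₁ χ₂ r μa) (fun A₁ A₂ => ca (A₂⁻¹ * A₁)) z A p.1) p.2)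
    {g : GL (BlockIdx nB) K × GL (BlockIdx nB) K → ℂ}
    (hg : g = fun p => (iwahori₀ nB (· < ·) r).indicator (fun D => integrandB χ₁ χ₂ μb
      (PhiDiag e χ₁ χ₂ r μb) (fun D₁ D₂ => cb (D₂⁻¹ * D₁)) z D p.2) p.1) :
    (ZetaConverges χ₁ χ₂ (PhiW ε e χ₁ χ₂ r dimτ μa μb) coeff z ↔
      Integrable (cellProduct r κ f g)
        ((((haarGL K _).prod (haarGL K _)).prod ((haarGL K _).prod (haarGL K _))).prod
          (((haarMatrix K _ _).prod (haarMatrix K _ _)).prod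
            ((haarMatrix K _ _).prod (haarMatrix K _ _))))) ∧
    (ZetaConverges χ₁ χ₂ (PhiW ε e χ₁ χ₂ r dimτ μa μb) coeff z →
      zetaIntegral χ₁ χ₂ (PhiW ε e χ₁ χ₂ r dimτ μa μb) coeff z =
        κ * ((∫ p, f p ∂((haarGL K _).prod (haarGL K _))) *
          ∫ p, g p ∂((haarGL K _).prod (haarGL K _))) *
          (((haarMatrix K (BlockIdx nA) (BlockIdx nB)).real {B | MatLe (rad K r) B} : ℂ) *
            ((haarMatrix K (BlockIdx nB) (BlockIdx nA)).real {C | MatLe (rad K r) C} : ℂ))) := by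
  have hF := mem_image_of_zetaKernel_ne_zero (e := e) (χ₁ := χ₁) (χ₂ := χ₂) (μa := μa) (μb := μb)
    (coeff := coeff) (show 1 ≤ r by omega) ε dimτ z
  have hpt : ∀ p : CellGL K (BlockIdx nA) (BlockIdx nB) × CellGL K (BlockIdx nA) (BlockIdx nB),
      ((cellDensity p.1 : ℝ) : ℂ) * ((cellDensity p.2 : ℝ) : ℂ) *
        zetaKernel χ₁ χ₂ (PhiW ε e χ₁ χ₂ r dimτ μa μb) coeff z
          ((upperChart K (BlockIdx nA) (BlockIdx nB)).toGL p.1)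
          ((lowerChart K (BlockIdx nA) (BlockIdx nB)).toGL p.2) =
      cellProduct r κ f g (cellRearrange K (BlockIdx nA) (BlockIdx nB) p) := by
    intro p
    rw [hκ, hf, hg]
    exact zetaKernel_cells he hcA hr hμa hμb hνa hνb hR hL hdiag ε dimτ z p.1 p.2
  refine ⟨?_, fun h => ?_⟩
  · rw [zetaConverges_iff, integrable_charts _ _ hF]
    simp only [hpt]
    exact (measurePreserving_cellRearrange (K := K) (a := BlockIdx nA)
      (b := BlockIdx nB)).integrable_comp_emb (MeasurableEquiv.measurableEmbedding _)
      (g := cellProduct r κ f g)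
  · rw [zetaIntegral_eq h, integral_charts _ _ hF]
    simp only [hpt]
    rw [(measurePreserving_cellRearrange (K := K) (a := BlockIdx nA) (b := BlockIdx nB)).integral_comp'
      (g := cellProduct r κ f g)]
    simp only [cellProduct]
    rw [integral_prod_mul (f := fun y : (GL (BlockIdx nA) K × GL (BlockIdx nA) K) ×
          (GL (BlockIdx nB) K × GL (BlockIdx nB) K) => κ * (f y.1 * g y.2)),
      integral_const_mul, integral_prod_mul, integral_offDiagIndicator]

/-- The factorization of the zeta integral. -/
theorem zeta_factorization (he : IsUnramifiedAddChar K e) (hcA : 1 ≤ cA) (hr : cA + cB ≤ r)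
    (hμa : IsSignEquivariant μa) (hμb : IsSignEquivariant μb)
    (hνa : IsLevelFun nA r cA (twist χ₁ χ₂ μa)) (hνb : IsLevelFun nB r cB (twist χ₁ χ₂ μb))
    (hR : ∀ i ∈ iwahoriW nA nB r, ∀ g, coeff (g * i) = coeff g)
    (hL : ∀ i ∈ iwahoriWT nA nB r, ∀ g, coeff (i * g) = coeff g)
    (hdiag : ∀ (m₁ : GL (BlockIdx nA) K) (m₂ : GL (BlockIdx nB) K),
      (∀ γ : Matrix (BlockIdx nB) (BlockIdx nA) K, MatLe (rad K r) γ →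
        MatLe 1 (m₂.val * γ * (m₁⁻¹).val)) →
      coeff (diagEmb (m₁, m₂)) =
        v * ((Real.sqrt (maxParabolic.modulus (m₁, m₂)))⁻¹ : ℝ) * (ca m₁ * cb m₂))
    (ε : ℤˣ) (dimτ : ℕ) (z : ℂ)
    {FA : GL (BlockIdx nA) K → GL (BlockIdx nA) K → ℂ}
    (hFA : FA = integrandA χ₁ χ₂ μa (PhiDiag e χ₁ χ₂ r μa) (fun A₁ A₂ => ca (A₂⁻¹ * A₁)) z)
    {FB : GL (BlockIdx nB) K → GL (BlockIdx nB) K → ℂ}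
    (hFB : FB = integrandB χ₁ χ₂ μb (PhiDiag e χ₁ χ₂ r μb) (fun D₁ D₂ => cb (D₂⁻¹ * D₁)) z) :
    (IteratedConverges (iwahori₀ nA (· < ·) r) FA → IteratedConverges (iwahori₀ nB (· < ·) r) FB →
      ZetaConverges χ₁ χ₂ (PhiW ε e χ₁ χ₂ r dimτ μa μb) coeff z) ∧
    (ZetaConverges χ₁ χ₂ (PhiW ε e χ₁ χ₂ r dimτ μa μb) coeff z →
      zetaIntegral χ₁ χ₂ (PhiW ε e χ₁ χ₂ r dimτ μa μb) coeff z =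
        μa ((ε : ℤ) • 1) * μb ((ε : ℤ) • 1) * ((dimτ : ℂ) ^ 2 * v /
          (((haarGL K _).real (iwahori₀ (K := K) nA (· < ·) r) : ℂ) *
            ((haarGL K _).real (iwahori₀ (K := K) nB (· < ·) r) : ℂ))) *
          iteratedIntegral (iwahori₀ nA (· < ·) r) FA *
          iteratedIntegral (iwahori₀ nB (· < ·) r) FB) := by
  have hr1 : 1 ≤ r := by omega
  have hIA : MeasurableSet (iwahori₀ (K := K) nA (· < ·) r) := measurableSet_iwahori₀ hr1
  have hIB : MeasurableSet (iwahori₀ (K := K) nB (· < ·) r) := measurableSet_iwahori₀ hr1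
  have hA := integrable_indicator_swap_iff_iteratedConverges (F := FA) hIA
  have hB := integrable_indicator_iff_iteratedConverges (F := FB) hIB
  have hA' := iteratedIntegral_eq_swap (F := FA) hIA
  have hB' := iteratedIntegral_eq (F := FB) hIB
  obtain ⟨f, hf⟩ : ∃ f : GL (BlockIdx nA) K × GL (BlockIdx nA) K → ℂ, f = fun p =>
    (iwahori₀ nA (· < ·) r).indicator (fun A => FA A p.1) p.2 := ⟨_, rfl⟩
  obtain ⟨g, hg⟩ : ∃ g : GL (BlockIdx nB) K × GL (BlockIdx nB) K → ℂ, g = fun p =>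
    (iwahori₀ nB (· < ·) r).indicator (fun D => FB D p.2) p.1 := ⟨_, rfl⟩
  have hfp := congrFun hf
  have hgp := congrFun hg
  rw [← hf] at hA
  rw [← hg] at hB
  simp only [← hfp] at hA'
  simp only [← hgp] at hB'
  obtain ⟨h1, h2⟩ := zeta_cells he hcA hr hμa hμb hνa hνb hR hL hdiag ε dimτ z rfl
    (hf.trans (by rw [hFA])) (hg.trans (by rw [hFB]))
  clear hf hg hfp hgp hFA hFB
  refine ⟨fun hA₁ hB₁ => h1.2 ?_, fun h => ?_⟩
  · exact (((hA.2 hA₁).mul_prod (hB.2 hB₁)).const_mul _).mul_prod integrable_offDiagIndicator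
  have hvB : ((haarMatrix K (BlockIdx nA) (BlockIdx nB)).real {B | MatLe (rad K r) B} : ℂ) ≠ 0 :=
    Complex.ofReal_ne_zero.2 haarMatrix_real_matLe_ne_zero
  have hvC : ((haarMatrix K (BlockIdx nB) (BlockIdx nA)).real {C | MatLe (rad K r) C} : ℂ) ≠ 0 :=
    Complex.ofReal_ne_zero.2 haarMatrix_real_matLe_ne_zero
  -- Only convergence of Z_w is assumed at this point, so the integrals over the products become
  -- iterated ones through the degenerate-case argument; the off-diagonal factor has nonzero
  -- integral.
  rw [h2 h, mul_integral_mul_integral_eq (h := offDiagIndicator K nA nB r)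
    (by rw [integral_offDiagIndicator]; exact mul_ne_zero hvB hvC) (h1.1 h)
    (fun h => hA' (hA.1 h)) (fun h => hB' (hB.1 h))]
  -- Vol(𝔊_w) contains the same two off-diagonal volumes as the integral, and they cancel.
  have hG : ((haarGL K _).real (groupG (K := K) nA nB r) : ℂ) = _ :=
    congrArg Complex.ofReal (haarGL_real_groupG hr1)
  simp only [Complex.ofReal_mul] at hG
  rw [hG, ← mul_div_mul_right ((dimτ : ℂ) ^ 2 * v) _ (mul_ne_zero hvB hvC)]
  ring

end Final

end LocalZeta
end

/-! ### The main theorem. -/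

theorem mainTheorem3
    {K : Type*} [NontriviallyNormedField K] [IsNormalizedLocalField K]
    [MeasurableSpace K] [BorelSpace K]
    (e : AddChar K Circle) (he : IsUnramifiedAddChar K e)
    {t s : ℕ} (nA : Fin t → ℕ) (nB : Fin s → ℕ)
    -- the representations `σ_{w,j}` of the factors of the Levi subgroup
    {VA : Fin t → Type*} [∀ j, AddCommGroup (VA j)] [∀ j, Module ℂ (VA j)]
    {VB : Fin s → Type*} [∀ j, AddCommGroup (VB j)] [∀ j, Module ℂ (VB j)]
    (σA : ∀ j, Representation ℂ (GL (Fin (nA j)) K) (VA j))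
    (σB : ∀ j, Representation ℂ (GL (Fin (nB j)) K) (VB j))
    (hσA : ∀ j, IsAdmissible (σA j)) (hσB : ∀ j, IsAdmissible (σB j))
    (hσA' : ∀ j, (σA j).IsIrreducible) (hσB' : ∀ j, (σB j).IsIrreducible)
    -- the irreducible quotients `π_a`, `π_b`, `π_w` of the induced representations
    {PA PB PW : Type*} [AddCommGroup PA] [Module ℂ PA] [AddCommGroup PB] [Module ℂ PB]
    [AddCommGroup PW] [Module ℂ PW]
    (πA : Representation ℂ (GL (BlockIdx nA) K) PA)
    (πB : Representation ℂ (GL (BlockIdx nB) K) PB)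
    (πW : Representation ℂ (GL (BlockIdx nA ⊕ BlockIdx nB) K) PW)
    (hπA : πA.IsIrreducible) (hπB : πB.IsIrreducible) (hπW : πW.IsIrreducible)
    (qA : (normalizedInd (blockParabolic nA (· < ·)) (extTensor σA)).IntertwiningMap πA)
    (qB : (normalizedInd (blockParabolic nB (· > ·)) (extTensor σB)).IntertwiningMap πB)
    (qW : (normalizedInd maxParabolic (extTensor₂ πA πB)).IntertwiningMap πW)
    (hqA : Function.Surjective qA) (hqB : Function.Surjective qB) (hqW : Function.Surjective qW)
    -- the characters, the types with their vectors, and the level `r`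
    (χ₁ χ₂ : MulChar K ℂ) (cA cB r : ℕ) (hcA : 1 ≤ cA) (hcB : 1 ≤ cB)
    (hχ₁ : IsTrivialOnUnits K χ₁ cA) (hχ₂ : IsTrivialOnUnits K χ₂ cB)
    {WA : Fin t → Type*} [∀ j, AddCommGroup (WA j)] [∀ j, Module ℂ (WA j)]
    {WB : Fin s → Type*} [∀ j, AddCommGroup (WB j)] [∀ j, Module ℂ (WB j)]
    (TA : ∀ j, TypeVectors (σA j) cA (WA j)) (TB : ∀ j, TypeVectors (σB j) cB (WB j))
    (hr : cA + cB ≤ r)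
    -- the test vectors in the induced representations
    (fA : inducedSpace (blockParabolic nA (· < ·)) (extTensor σA))
    (hfA : IsTestVector _ _ (intLevi nA) (iwahori nA (· < ·) r) (vec₀ TA) fA)
    (fB : inducedSpace (blockParabolic nB (· > ·)) (extTensor σB))
    (hfB : IsTestVector _ _ (intLevi nB) (iwahori nB (· > ·) r) (vec₀ TB) fB)
    (fW : inducedSpace (mixedParabolic nA nB) (extTensor₂ (extTensor σA) (extTensor σB)))
    (hfW : IsTestVector _ _ ((intLevi nA).prod (intLevi nB)) (iwahoriW nA nB r)
      (vec₀ TA ⊗ₜ[ℂ] vec₀ TB) fW)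
    (FW : inducedSpace maxParabolic (extTensor₂ πA πB)) (hFW : IsTransitImage qA qB fW FW)
    -- the test vectors in the contragredients, with their images in induced representations
    (lA : smoothDual πA) (fA' : inducedSpace (blockParabolic nA (· < ·))
      (extTensor fun j => contragredient (σA j)))
    (hlA : IsDualImage _ _ _ (piPairing σA) (haarGL K _) (intGL K _) qA lA fA')
    (hfA' : IsDualTestVector _ _ (intLevi nA) (blockParabolic nA (· < ·)).carrier
      (iwahori nA (· > ·) r) (dualVec₀ TA) lA fA')
    (lB : smoothDual πB) (fB' : inducedSpace (blockParabolic nB (· > ·))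
      (extTensor fun j => contragredient (σB j)))
    (hlB : IsDualImage _ _ _ (piPairing σB) (haarGL K _) (intGL K _) qB lB fB')
    (hfB' : IsDualTestVector _ _ (intLevi nB) (blockParabolic nB (· > ·)).carrier
      (iwahori nB (· < ·) r) (dualVec₀ TB) lB fB')
    (lW : smoothDual πW)
    (FW' : inducedSpace maxParabolic (extTensor₂ (contragredient πA) (contragredient πB)))
    (hlW : IsDualImage _ _ _ (pairing₂ πA πB) (haarGL K _) (intGL K _) qW lW FW')
    (hFW' : IsDualTestVector _ _
      (((intLevi nA).map (blockLevi nA)).prod ((intLevi nB).map (blockLevi nB)))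
      (mixedParabolic nA nB).carrier (iwahoriWT nA nB r) (lA ⊗ₜ[ℂ] lB) lW FW')
    (ε : ℤˣ) :
    let μa := muA χ₂ TA r
    let μb := muB χ₁ TB r
    let dimτ := Module.finrank ℂ ((⨂[ℂ] j, WA j) ⊗[ℂ] (⨂[ℂ] j, WB j))
    let Φ := PhiW ε e χ₁ χ₂ r dimτ μa μb
    let coeffW : GL (BlockIdx nA ⊕ BlockIdx nB) K → ℂ := fun g => lW.1 (πW g (qW FW))
    let coeffA : GL (BlockIdx nA) K → GL (BlockIdx nA) K → ℂ :=
      fun A₁ A₂ => (contragredient πA A₂ lA).1 (πA A₁ (qA fA))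
    let coeffB : GL (BlockIdx nB) K → GL (BlockIdx nB) K → ℂ :=
      fun D₁ D₂ => (contragredient πB D₂ lB).1 (πB D₁ (qB fB))
    let IA : Set (GL (BlockIdx nA) K) := iwahori₀ nA (· < ·) r
    let IB : Set (GL (BlockIdx nB) K) := iwahori₀ nB (· < ·) r
    let FA : ℂ → GL (BlockIdx nA) K → GL (BlockIdx nA) K → ℂ :=
      integrandA χ₁ χ₂ μa (PhiDiag e χ₁ χ₂ r μa) coeffA
    let FB : ℂ → GL (BlockIdx nB) K → GL (BlockIdx nB) K → ℂ :=
      integrandB χ₁ χ₂ μb (PhiDiag e χ₁ χ₂ r μb) coeffB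
    (∃ s₀ : ℝ, ∀ z : ℂ, s₀ < z.re → ZetaConverges χ₁ χ₂ Φ coeffW z ∧
        IteratedConverges IA (FA z) ∧ IteratedConverges IB (FB z)) ∧
      ∀ z : ℂ, ZetaConverges χ₁ χ₂ Φ coeffW z →
        zetaIntegral χ₁ χ₂ Φ coeffW z =
          μa ((ε : ℤ) • 1) * μb ((ε : ℤ) • 1) *
            ((dimτ : ℂ) ^ 2 * ((haarGL K _).real (iwahoriAB (K := K) nA nB r) : ℂ) /
              (((haarGL K _).real IA : ℂ) * ((haarGL K _).real IB : ℂ))) *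
            iteratedIntegral IA (FA z) * iteratedIntegral IB (FB z) := by
  intro μa μb dimτ Φ coeffW coeffA coeffB IA IB FA FB
  have hr1 : 1 ≤ r := by omega
  have hr' : cB + cA ≤ r := by omega
  -- The block order is encoded by an injective map to a linear order: the identity for P_a, and the
  -- order-reversing `OrderDual.toDual` for the opposite parabolic P_b^op.
  obtain ⟨sA, hA⟩ := exists_iteratedConverges_integrandA (R := (· < ·)) (f := id) he hcA hcB hr
    hχ₁ hχ₂ Function.injective_id (fun _ _ => Iff.rfl) hσA hfA hlA
  obtain ⟨sB, hB⟩ := exists_iteratedConverges_integrandB (R := (· > ·)) (f := OrderDual.toDual) he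
    hcB hcA hr hχ₁ hχ₂ OrderDual.toDual.injective (fun _ _ => Iff.rfl) hσB hfB hlB
  -- The constant `v` is the volume of I⁰_{a,b,r}, which enters through the coefficient of π_w on
  -- the Levi subgroup.
  have key := fun z : ℂ => zeta_factorization (coeff := coeffW)
    (ca := fun m => lA.1 (πA m (qA fA))) (cb := fun m => lB.1 (πB m (qB fB)))
    (v := ((haarGL K _).real (iwahoriAB (K := K) nA nB r) : ℂ)) he hcA hr
    ((isSignEquivariant_muA' TA hcA (by omega)).mulChar χ₂⁻¹)
    ((isSignEquivariant_muB' TB hcB (by omega)).mulChar χ₁)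
    (isLevelFun_twist_muA TA hcA hr hχ₁) (isLevelFun_twist_muB TB hcB hr hχ₂)
    (fun i hi g => coeffW_mul_iwahoriW hfW hFW hi g)
    (fun i hi g => coeffW_iwahoriWT_mul hFW' hi g)
    (fun m₁ m₂ hm => coeffW_diagEmb hfW hFW hfA hfB hlW hFW' hr1 hm) ε dimτ z
    (FA := FA z) (by simp only [FA, coeffA, contragredient_apply_apply]; rfl)
    (FB := FB z) (by simp only [FB, coeffB, contragredient_apply_apply]; rfl)
  refine ⟨⟨max sA sB, fun z hz => ?_⟩, fun z => (key z).2⟩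
  have h1 := hA z (lt_of_le_of_lt (le_max_left _ _) hz)
  have h2 := hB z (lt_of_le_of_lt (le_max_right _ _) hz)
  exact ⟨(key z).1 h1 h2, h1, h2⟩
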